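/- Let $\ell,\lambda_1,\lambda_2>0$, $q\neq 0$, $\rho\neq 0$ with $|\rho q|\le \tfrac12$, and $c_1,c_2\in C^0([0,\ell];\mathbb R)$. Consider the plant $$\partial_t u=-\lambda_1\partial_x u+c_1 v,\quad \partial_t v=\lambda_2\partial_x v+c_2u,\quad u(0,t)=q\,v(0,t),\quad v(\ell,t)=\rho u(\ell,t)+U^p(t),$$ and the observer $$\partial_t \hat u=-\lambda_1\partial_x \hat u+c_1 \hat v+p_1(x)\tilde v(0,t),\quad \partial_t \hat v=\lambda_2\partial_x \hat v+c_2\hat u+p_2(x)\tilde v(0,t),\quad \hat u(0,t)=q\,v(0,t),\quad \hat v(\ell,t)=\rho \hat u(\ell,t)+U^p(t),$$ where $\tilde v=v-\hat v$ and $0\le x\le\ell$, $t\ge 0$. **Kernels.** On the triangle $0\le\xi\le x\le\ell$ let $K,L,P$ be continuous $2\times2$ kernels satisfying the following equations, the left-hand sides being understood as derivatives along characteristics. For $K=(K^{uu},K^{uv};K^{vu},K^{vv})$: $\lambda_1(\partial_x+\partial_\xi)K^{uu}=-c_2(\xi)K^{uv}$, $(\lambda_1\partial_x-\lambda_2\partial_\xi)K^{uv}=-c_1(\xi)K^{uu}$,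 $(\lambda_2\partial_x-\lambda_1\partial_\xi)K^{vu}=c_2(\xi)K^{vv}$, $\lambda_2(\partial_x+\partial_\xi)K^{vv}=c_1(\xi)K^{vu}$, with $K^{uu}(x,0)=\frac{\lambda_2}{q\lambda_1}K^{uv}(x,0)$, $K^{uv}(x,x)=\frac{c_1(x)}{\lambda_1+\lambda_2}$, $K^{vv}(x,0)=\frac{q\lambda_1}{\lambda_2}K^{vu}(x,0)$, $K^{vu}(x,x)=-\frac{c_2(x)}{\lambda_1+\lambda_2}$. For $L=(L^{\alpha\alpha},L^{\alpha\beta};L^{\beta\alpha},L^{\beta\beta})$: $\lambda_1(\partial_x+\partial_\xi)L^{\alpha\alpha}=c_1(x)L^{\beta\alpha}$, $(\lambda_1\partial_x-\lambda_2\partial_\xi)L^{\alpha\beta}=c_1(x)L^{\beta\beta}$, $(\lambda_2\partial_x-\lambda_1\partial_\xi)L^{\beta\alpha}=-c_2(x)L^{\alpha\alpha}$, $\lambda_2(\partial_x+\partial_\xi)L^{\beta\beta}=-c_2(x)L^{\alpha\beta}$, with $L^{\alpha\alpha}(x,0)=\frac{\lambda_2}{q\lambda_1}L^{\alpha\beta}(x,0)$,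 $L^{\alpha\beta}(x,x)=\frac{c_1(x)}{\lambda_1+\lambda_2}$, $L^{\beta\beta}(x,0)=\frac{q\lambda_1}{\lambda_2}L^{\beta\alpha}(x,0)$, $L^{\beta\alpha}(x,x)=-\frac{c_2(x)}{\lambda_1+\lambda_2}$. For $P=(P^{\alpha\alpha},P^{\alpha\beta};P^{\beta\alpha},P^{\beta\beta})$: the same four differential equations as for $L$, with $P^{\alpha\alpha}(\ell,\xi)=\frac1\rho P^{\beta\alpha}(\ell,\xi)$, $P^{\alpha\beta}(x,x)=-\frac{c_1(x)}{\lambda_1+\lambda_2}$, $P^{\beta\beta}(\ell,\xi)=\rho P^{\alpha\beta}(\ell,\xi)$, $P^{\beta\alpha}(x,x)=\frac{c_2(x)}{\lambda_1+\lambda_2}$. **Gains.** Put $p_1(x)=-\lambda_2P^{\alpha\beta}(x,0)$, $p_2(x)=-\lambda_2P^{\beta\beta}(x,0)$, $\bar p_1(x)=p_1(x)-\int_0^x(K^{uu}(x,\xi)p_1(\xi)+K^{uv}(x,\xi)p_2(\xi))d\xi$, $\bar p_2(x)=p_2(x)-\int_0^x(K^{vu}(x,\xi)p_1(\xi)+K^{vv}(x,\xi)p_2(\xi))d\xi$,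 $N^u=K^{vu}(\ell,\cdot)-\rho K^{uu}(\ell,\cdot)$, $N^v=K^{vv}(\ell,\cdot)-\rho K^{uv}(\ell,\cdot)$, $N^\alpha=L^{\beta\alpha}(\ell,\cdot)-\rho L^{\alpha\alpha}(\ell,\cdot)$, $N^\beta=L^{\beta\beta}(\ell,\cdot)-\rho L^{\alpha\beta}(\ell,\cdot)$, and assume $N^\alpha,N^\beta\in H^1(0,\ell)$. Let $\hat\alpha=\hat u-\int_0^x(K^{uu}\hat u+K^{uv}\hat v)d\xi$, $\hat\beta=\hat v-\int_0^x(K^{vu}\hat u+K^{vv}\hat v)d\xi$, $\tilde\beta(0,t)=\tilde v(0,t)$, and $U(t)=\int_0^\ell (N^u\hat u+N^v\hat v)(\xi,t)\,d\xi$. **Parameters.** Let $\epsilon_0=5\max\{\lambda_1^2\int_0^\ell|\partial_\xi N^\alpha|^2,\ \lambda_2^2\int_0^\ell|\partial_\xi N^\beta|^2\}$, $\epsilon_1=5(\lambda_1N^\alpha(\ell)-\rho\lambda_2N^\beta(\ell))^2$, $\epsilon_2=5\big(\int_0^\ell(N^\alpha\bar p_1+N^\beta\bar p_2)d\xi+q\lambda_1N^\alpha(0)\big)^2$,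 $\epsilon_3=5(\lambda_2N^\beta(\ell))^2$. Let $\eta,\theta>0$, $\sigma\in(0,1)$, $\kappa_i=\theta\epsilon_i/(1-\sigma)$ for $i=0,1,2$, $a=1+\epsilon_3+\eta$, $0<\mu<\frac{2\lambda_1\lambda_2}{\ell(\lambda_1+\lambda_2)}\ln\frac1{2|q\rho|}$ (so that such a $\mu$ exists only if $|\rho q|<\frac12$), $0<\delta<\mu$, $r=\min\{\frac1{\lambda_1}e^{-\mu\ell/\lambda_1},\frac{2q^2}{\lambda_2}\}$, $$C>\max\Big\{\frac{\kappa_0}{(\mu-\delta)r},\ \frac{\kappa_1}{1-4\rho^2q^2e^{\mu(\ell/\lambda_1+\ell/\lambda_2)}}\Big\},\qquad D=2Cq^2,\qquad \theta_m=2De^{\mu\ell/\lambda_2},$$ $$0<h\le\tau:=\frac1a\ln\Big(1+\frac{a\theta\sigma}{(a\theta+\theta_m)(1-\sigma)}\Big).$$ **Periodic event-triggering.** Let $t_0=0$ and $t_{k+1}=\inf\{t>t_k:\ t=nh,\ n\in\mathbb N,\ \Gamma^p(t)>0\}$ (with $\inf\emptyset=\infty$), where $\Gamma^p(t)=\big(e^{ah}(\theta_m+a\theta)-\theta_m\big)d(t)^2+a\,m(t)$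 and, up to the decision taken at $t_{k+1}$, $d(t)=U(t_k)-U(t)$. The applied input is $U^p(t)=U(t_k)$ for $t\in[t_k,t_{k+1})$. The variable $m$ is continuous, $m(0)=m^0<0$, and for almost every $t>0$ $$\dot m=-\eta m+\theta_m (U^p-U)^2-\kappa_0\|(\hat\alpha,\hat\beta)(\cdot,t)\|_{L^2}^2-\kappa_1\hat\alpha(\ell,t)^2-\kappa_2\tilde\beta(0,t)^2 .$$ Solutions are weak solutions that are continuous in time with values in $L^2(0,\ell)$ and have boundary values in $L^2_{loc}([0,\infty))$. **Theorem (PETC convergence).** Kernels $K,L,P$ as above exist. For all kernels and parameters as above: 1. for all $u^0,v^0,\hat u^0,\hat v^0\in L^2(0,\ell)$ and all $m^0<0$ the closed-loop system has a unique solution $(u,v,\hat u,\hat v)\in C^0([0,\infty);L^2((0,\ell);\mathbb R^4))$; 2. the states converge to $0$ globally exponentially in the spatial $L^2$ norm: there are $M,\nu>0$, independent of the initial data and of $m^0$, such that for all $t\ge0$ $$\|(u,v,\hat u,\hat v)(\cdot,t)\|_{L^2}^2\le M e^{-\nu t}\big(\|(u^0,v^0,\hat u^0,\hat v^0)\|_{L^2}^2+|m^0|\big).$$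 -/

import Mathlib

open MeasureTheory Set
open scoped ENNReal

noncomputable section

namespace PETC

/-- The Hilbert space `L²((0,ℓ); ℝ)`. -/
abbrev L2 (ℓ : ℝ) := Lp ℝ 2 (volume.restrict (Ioo (0 : ℝ) ℓ))

/-- Data of the `2 × 2` linear hyperbolic plant
`∂ₜ u = -λ₁ ∂ₓ u + c₁ v`, `∂ₜ v = λ₂ ∂ₓ v + c₂ u` on `(0,ℓ)`,
`u(0,t) = q v(0,t)`, `v(ℓ,t) = ρ u(ℓ,t) + U(t)`. -/
structure Plant where
  ℓ : ℝ
  lam1 : ℝ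
  lam2 : ℝ
  q : ℝ
  rho : ℝ
  c1 : ℝ → ℝ
  c2 : ℝ → ℝ

/-- Standing assumptions on the plant. -/
structure Plant.Admissible (S : Plant) : Prop where
  ℓ_pos : 0 < S.ℓ
  lam1_pos : 0 < S.lam1
  lam2_pos : 0 < S.lam2
  q_ne : S.q ≠ 0
  rho_ne : S.rho ≠ 0
  c1_cont : ContinuousOn S.c1 (Icc 0 S.ℓ)
  c2_cont : ContinuousOn S.c2 (Icc 0 S.ℓ)

/-! ### Backstepping kernels -/

/-- A `2 × 2` matrix of kernels `k i j (x, ξ)`. -/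
structure Kernels where
  k11 : ℝ → ℝ → ℝ
  k12 : ℝ → ℝ → ℝ
  k21 : ℝ → ℝ → ℝ
  k22 : ℝ → ℝ → ℝ

/-- The closed triangle `0 ≤ ξ ≤ x ≤ ℓ`, points being `(x, ξ)`. -/
def triangle (ℓ : ℝ) : Set (ℝ × ℝ) := {p | 0 ≤ p.2 ∧ p.2 ≤ p.1 ∧ p.1 ≤ ℓ}

/-- All four kernels are continuous on the closed triangle. -/
structure Kernels.Cont (k : Kernels) (ℓ : ℝ) : Prop where
  c11 : ContinuousOn (Function.uncurry k.k11) (triangle ℓ)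
  c12 : ContinuousOn (Function.uncurry k.k12) (triangle ℓ)
  c21 : ContinuousOn (Function.uncurry k.k21) (triangle ℓ)
  c22 : ContinuousOn (Function.uncurry k.k22) (triangle ℓ)

/-- `a ∂ₓ F + b ∂_ξ F = g` in the open triangle `0 < ξ < x < ℓ`, the left side being the derivative
of `F` along the characteristic direction `(a, b)` (for merely continuous coefficients the kernels
need not have separate partial derivatives; for a differentiable `F` it is the usual equation). -/
def CharEq (ℓ a b : ℝ) (F g : ℝ → ℝ → ℝ) : Prop :=
  ∀ x ξ : ℝ, 0 < ξ → ξ < x → x < ℓ →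
    HasDerivAt (fun s : ℝ => F (x + a * s) (ξ + b * s)) (g x ξ) 0

/-- `P = (P^{αα}, P^{αβ}; P^{βα}, P^{ββ})`: kernels of the observer error transformation. -/
structure IsObserverKernel (S : Plant) (P : Kernels) : Prop where
  cont : P.Cont S.ℓ
  eq11 : CharEq S.ℓ S.lam1 S.lam1 P.k11 (fun x ξ => S.c1 x * P.k21 x ξ)
  eq12 : CharEq S.ℓ S.lam1 (-S.lam2) P.k12 (fun x ξ => S.c1 x * P.k22 x ξ)
  eq21 : CharEq S.ℓ S.lam2 (-S.lam1) P.k21 (fun x ξ => -S.c2 x * P.k11 x ξ)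
  eq22 : CharEq S.ℓ S.lam2 S.lam2 P.k22 (fun x ξ => -S.c2 x * P.k12 x ξ)
  bc11 : ∀ ξ ∈ Icc 0 S.ℓ, P.k11 S.ℓ ξ = 1 / S.rho * P.k21 S.ℓ ξ
  bc12 : ∀ x ∈ Icc 0 S.ℓ, P.k12 x x = -(S.c1 x / (S.lam1 + S.lam2))
  bc22 : ∀ ξ ∈ Icc 0 S.ℓ, P.k22 S.ℓ ξ = S.rho * P.k12 S.ℓ ξ
  bc21 : ∀ x ∈ Icc 0 S.ℓ, P.k21 x x = S.c2 x / (S.lam1 + S.lam2)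

/-- `K = (K^{uu}, K^{uv}; K^{vu}, K^{vv})`: kernels of the control transformation. -/
structure IsControlKernel (S : Plant) (K : Kernels) : Prop where
  cont : K.Cont S.ℓ
  eq11 : CharEq S.ℓ S.lam1 S.lam1 K.k11 (fun x ξ => -S.c2 ξ * K.k12 x ξ)
  eq12 : CharEq S.ℓ S.lam1 (-S.lam2) K.k12 (fun x ξ => -S.c1 ξ * K.k11 x ξ)
  eq21 : CharEq S.ℓ S.lam2 (-S.lam1) K.k21 (fun x ξ => S.c2 ξ * K.k22 x ξ)
  eq22 : CharEq S.ℓ S.lam2 S.lam2 K.k22 (fun x ξ => S.c1 ξ * K.k21 x ξ)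
  bc11 : ∀ x ∈ Icc 0 S.ℓ, K.k11 x 0 = S.lam2 / (S.q * S.lam1) * K.k12 x 0
  bc12 : ∀ x ∈ Icc 0 S.ℓ, K.k12 x x = S.c1 x / (S.lam1 + S.lam2)
  bc22 : ∀ x ∈ Icc 0 S.ℓ, K.k22 x 0 = S.q * S.lam1 / S.lam2 * K.k21 x 0
  bc21 : ∀ x ∈ Icc 0 S.ℓ, K.k21 x x = -(S.c2 x / (S.lam1 + S.lam2))

/-- `L = (L^{αα}, L^{αβ}; L^{βα}, L^{ββ})`: kernels of the inverse control transformation. -/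
structure IsInverseKernel (S : Plant) (L : Kernels) : Prop where
  cont : L.Cont S.ℓ
  eq11 : CharEq S.ℓ S.lam1 S.lam1 L.k11 (fun x ξ => S.c1 x * L.k21 x ξ)
  eq12 : CharEq S.ℓ S.lam1 (-S.lam2) L.k12 (fun x ξ => S.c1 x * L.k22 x ξ)
  eq21 : CharEq S.ℓ S.lam2 (-S.lam1) L.k21 (fun x ξ => -S.c2 x * L.k11 x ξ)
  eq22 : CharEq S.ℓ S.lam2 S.lam2 L.k22 (fun x ξ => -S.c2 x * L.k12 x ξ)
  bc11 : ∀ x ∈ Icc 0 S.ℓ, L.k11 x 0 = S.lam2 / (S.q * S.lam1) * L.k12 x 0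
  bc12 : ∀ x ∈ Icc 0 S.ℓ, L.k12 x x = S.c1 x / (S.lam1 + S.lam2)
  bc22 : ∀ x ∈ Icc 0 S.ℓ, L.k22 x 0 = S.q * S.lam1 / S.lam2 * L.k21 x 0
  bc21 : ∀ x ∈ Icc 0 S.ℓ, L.k21 x x = -(S.c2 x / (S.lam1 + S.lam2))

/-! ### Gains -/

/-- Output injection gain `p₁(x) = -λ₂ P^{αβ}(x,0)`. -/
def p1 (S : Plant) (P : Kernels) (x : ℝ) : ℝ := -S.lam2 * P.k12 x 0

/-- Output injection gain `p₂(x) = -λ₂ P^{ββ}(x,0)`. -/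
def p2 (S : Plant) (P : Kernels) (x : ℝ) : ℝ := -S.lam2 * P.k22 x 0

def pbar1 (S : Plant) (K P : Kernels) (x : ℝ) : ℝ :=
  p1 S P x - (∫ ξ in (0 : ℝ)..x, K.k11 x ξ * p1 S P ξ) - ∫ ξ in (0 : ℝ)..x, K.k12 x ξ * p2 S P ξ

def pbar2 (S : Plant) (K P : Kernels) (x : ℝ) : ℝ :=
  p2 S P x - (∫ ξ in (0 : ℝ)..x, K.k21 x ξ * p1 S P ξ) - ∫ ξ in (0 : ℝ)..x, K.k22 x ξ * p2 S P ξ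

def Nu (S : Plant) (K : Kernels) (ξ : ℝ) : ℝ := K.k21 S.ℓ ξ - S.rho * K.k11 S.ℓ ξ

def Nv (S : Plant) (K : Kernels) (ξ : ℝ) : ℝ := K.k22 S.ℓ ξ - S.rho * K.k12 S.ℓ ξ

def Nalpha (S : Plant) (L : Kernels) (ξ : ℝ) : ℝ := L.k21 S.ℓ ξ - S.rho * L.k11 S.ℓ ξ

def Nbeta (S : Plant) (L : Kernels) (ξ : ℝ) : ℝ := L.k22 S.ℓ ξ - S.rho * L.k12 S.ℓ ξ

/-- `f ∈ H¹(0,ℓ)`: `f` is, on `[0,ℓ]`, a primitive of a square-integrable function (which is then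
almost everywhere its derivative). -/
def MemH1 (ℓ : ℝ) (f : ℝ → ℝ) : Prop :=
  ∃ g : ℝ → ℝ, MemLp g 2 (volume.restrict (Ioo (0 : ℝ) ℓ)) ∧
    ∀ x ∈ Icc 0 ℓ, f x = f 0 + ∫ s in (0 : ℝ)..x, g s

/-! ### Event-trigger parameters -/

def eps0 (S : Plant) (L : Kernels) : ℝ :=
  5 * max (S.lam1 ^ 2 * ∫ ξ in Ioo (0 : ℝ) S.ℓ, (deriv (Nalpha S L) ξ) ^ 2)
    (S.lam2 ^ 2 * ∫ ξ in Ioo (0 : ℝ) S.ℓ, (deriv (Nbeta S L) ξ) ^ 2)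

def eps1 (S : Plant) (L : Kernels) : ℝ :=
  5 * (S.lam1 * Nalpha S L S.ℓ - S.rho * S.lam2 * Nbeta S L S.ℓ) ^ 2

def eps2 (S : Plant) (K L P : Kernels) : ℝ :=
  5 * ((∫ ξ in Ioo (0 : ℝ) S.ℓ, (Nalpha S L ξ * pbar1 S K P ξ + Nbeta S L ξ * pbar2 S K P ξ))
    + S.q * S.lam1 * Nalpha S L 0) ^ 2

def eps3 (S : Plant) (L : Kernels) : ℝ := 5 * (S.lam2 * Nbeta S L S.ℓ) ^ 2

/-- The free design parameters `η, θ, σ` and the auxiliary constants `μ, δ, C`. -/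
structure Design where
  eta : ℝ
  theta : ℝ
  sigma : ℝ
  mu : ℝ
  delta : ℝ
  C : ℝ

/-- `κ = θ ε / (1 - σ)`, that is `θ ε = (1 - σ) κ`. -/
def Design.kappa (G : Design) (eps : ℝ) : ℝ := G.theta * eps / (1 - G.sigma)

/-- `a = 1 + ε₃ + η`. -/
def Design.a (G : Design) (S : Plant) (L : Kernels) : ℝ := 1 + eps3 S L + G.eta

def Design.r (G : Design) (S : Plant) : ℝ :=
  min (1 / S.lam1 * Real.exp (-(G.mu * (S.ℓ / S.lam1)))) (2 * S.q ^ 2 / S.lam2)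

/-- `θ_m = 2 D e^{μ ℓ / λ₂}` with `D = 2 C q²`. -/
def Design.thetam (G : Design) (S : Plant) : ℝ :=
  2 * (2 * G.C * S.q ^ 2) * Real.exp (G.mu * (S.ℓ / S.lam2))

/-- The admissible choices of the parameters. -/
structure Design.Admissible (G : Design) (S : Plant) (L : Kernels) : Prop where
  eta_pos : 0 < G.eta
  theta_pos : 0 < G.theta
  sigma_mem : G.sigma ∈ Ioo (0 : ℝ) 1
  mu_pos : 0 < G.mu
  mu_lt : G.mu < 2 * S.lam1 * S.lam2 / (S.ℓ * (S.lam1 + S.lam2))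
    * Real.log (1 / (2 * |S.q * S.rho|))
  delta_mem : G.delta ∈ Ioo 0 G.mu
  C_gt : max (G.kappa (eps0 S L) / ((G.mu - G.delta) * G.r S))
    (G.kappa (eps1 S L) /
      (1 - 4 * S.rho ^ 2 * S.q ^ 2 * Real.exp (G.mu * (S.ℓ / S.lam1 + S.ℓ / S.lam2)))) < G.C

/-- The bound on the sampling period (the minimal dwell time). -/
def Design.tau (G : Design) (S : Plant) (L : Kernels) : ℝ :=
  1 / G.a S L * Real.log (1 + G.a S L * G.theta * G.sigma /
    ((G.a S L * G.theta + G.thetam S) * (1 - G.sigma)))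

/-- The periodic event-triggering function, as a function of the values of `d` and `m`. -/
def Design.gammaP (G : Design) (S : Plant) (L : Kernels) (h d m : ℝ) : ℝ :=
  (Real.exp (G.a S L * h) * (G.thetam S + G.a S L * G.theta) - G.thetam S) * d ^ 2 + G.a S L * m

/-! ### The closed loop -/

/-- A trajectory `t ↦ (u, v, û, v̂)(·,t)` (only `t ≥ 0` matters). -/
structure Trajectory (ℓ : ℝ) where
  u : ℝ → L2 ℓ
  v : ℝ → L2 ℓ
  uh : ℝ → L2 ℓ
  vh : ℝ → L2 ℓ

/-- `(u, v, û, v̂) ∈ C⁰([0,∞); L²((0,ℓ); ℝ⁴))`. -/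
structure Trajectory.Cont {ℓ : ℝ} (z : Trajectory ℓ) : Prop where
  u : ContinuousOn z.u (Ici 0)
  v : ContinuousOn z.v (Ici 0)
  uh : ContinuousOn z.uh (Ici 0)
  vh : ContinuousOn z.vh (Ici 0)

/-- The norm of `(u, v, û, v̂)(·,t)` in `L²((0,ℓ); ℝ⁴)`. -/
def Trajectory.norm {ℓ : ℝ} (z : Trajectory ℓ) (t : ℝ) : ℝ :=
  Real.sqrt (‖z.u t‖ ^ 2 + ‖z.v t‖ ^ 2 + ‖z.uh t‖ ^ 2 + ‖z.vh t‖ ^ 2)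

/-- Boundary values at `x = 0` and `x = ℓ` of the four states. -/
structure Traces where
  u0 : ℝ → ℝ
  uL : ℝ → ℝ
  v0 : ℝ → ℝ
  vL : ℝ → ℝ
  uh0 : ℝ → ℝ
  uhL : ℝ → ℝ
  vh0 : ℝ → ℝ
  vhL : ℝ → ℝ

/-- `f ∈ L²_loc([0,∞))`. -/
def L2loc (f : ℝ → ℝ) : Prop := ∀ T : ℝ, MemLp f 2 (volume.restrict (Ioo 0 T))

structure Traces.Admissible (b : Traces) : Prop where
  u0 : L2loc b.u0
  uL : L2loc b.uL
  v0 : L2loc b.v0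
  vL : L2loc b.vL
  uh0 : L2loc b.uh0
  uhL : L2loc b.uhL
  vh0 : L2loc b.vh0
  vhL : L2loc b.vhL

/-- `w` is a weak solution of `∂ₜ w = -c ∂ₓ w + f` on `(0,ℓ) × (0,∞)` with boundary values
`w(0,t) = w0 t`, `w(ℓ,t) = wL t`: the equation is tested against `C¹` functions on `[0,ℓ]`,
integrated by parts in `x` and integrated in time. -/
def WeakTransport {ℓ : ℝ} (c : ℝ) (w : ℝ → L2 ℓ) (f : ℝ → ℝ → ℝ) (w0 wL : ℝ → ℝ) : Prop :=
  ∀ ψ : ℝ → ℝ, ContDiff ℝ 1 ψ → ∀ t : ℝ, 0 ≤ t →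
    ∫ x in Ioo (0 : ℝ) ℓ, w t x * ψ x =
      (∫ x in Ioo (0 : ℝ) ℓ, w 0 x * ψ x) +
      ∫ s in (0 : ℝ)..t,
        (c * (w0 s * ψ 0 - wL s * ψ ℓ) +
          ∫ x in Ioo (0 : ℝ) ℓ, (c * w s x * deriv ψ x + f s x * ψ x))

/-- The plant and the observer with the input `inp` applied to both of them. -/
structure PlantObserver (S : Plant) (P : Kernels) (inp : ℝ → ℝ) (z : Trajectory S.ℓ)
    (b : Traces) : Prop where
  cont : z.Cont
  traces : b.Admissible
  eq_u : WeakTransport S.lam1 z.u (fun t x => S.c1 x * z.v t x) b.u0 b.uL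
  eq_v : WeakTransport (-S.lam2) z.v (fun t x => S.c2 x * z.u t x) b.v0 b.vL
  eq_uh : WeakTransport S.lam1 z.uh
    (fun t x => S.c1 x * z.vh t x + p1 S P x * (b.v0 t - b.vh0 t)) b.uh0 b.uhL
  eq_vh : WeakTransport (-S.lam2) z.vh
    (fun t x => S.c2 x * z.uh t x + p2 S P x * (b.v0 t - b.vh0 t)) b.vh0 b.vhL
  bc_u : ∀ᵐ t ∂(volume.restrict (Ioi (0 : ℝ))), b.u0 t = S.q * b.v0 t
  bc_v : ∀ᵐ t ∂(volume.restrict (Ioi (0 : ℝ))), b.vL t = S.rho * b.uL t + inp t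
  bc_uh : ∀ᵐ t ∂(volume.restrict (Ioi (0 : ℝ))), b.uh0 t = S.q * b.v0 t
  bc_vh : ∀ᵐ t ∂(volume.restrict (Ioi (0 : ℝ))), b.vhL t = S.rho * b.uhL t + inp t

/-- The continuous-time feedback `U(t) = ∫ N^u û + ∫ N^v v̂`. -/
def feedback (S : Plant) (K : Kernels) (z : Trajectory S.ℓ) (t : ℝ) : ℝ :=
  (∫ ξ in Ioo (0 : ℝ) S.ℓ, Nu S K ξ * z.uh t ξ) + ∫ ξ in Ioo (0 : ℝ) S.ℓ, Nv S K ξ * z.vh t ξ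

def alphaHat {S : Plant} (K : Kernels) (z : Trajectory S.ℓ) (x t : ℝ) : ℝ :=
  z.uh t x - (∫ ξ in (0 : ℝ)..x, K.k11 x ξ * z.uh t ξ) - ∫ ξ in (0 : ℝ)..x, K.k12 x ξ * z.vh t ξ

def betaHat {S : Plant} (K : Kernels) (z : Trajectory S.ℓ) (x t : ℝ) : ℝ :=
  z.vh t x - (∫ ξ in (0 : ℝ)..x, K.k21 x ξ * z.uh t ξ) - ∫ ξ in (0 : ℝ)..x, K.k22 x ξ * z.vh t ξ

/-- `‖(α̂(·,t), β̂(·,t))‖²`. -/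
def hatNormSq {S : Plant} (K : Kernels) (z : Trajectory S.ℓ) (t : ℝ) : ℝ :=
  (∫ x in Ioo (0 : ℝ) S.ℓ, alphaHat K z x t ^ 2) + ∫ x in Ioo (0 : ℝ) S.ℓ, betaHat K z x t ^ 2

/-- The boundary value `α̂(ℓ,t)`. -/
def alphaHatL {S : Plant} (K : Kernels) (z : Trajectory S.ℓ) (b : Traces) (t : ℝ) : ℝ :=
  b.uhL t - (∫ ξ in Ioo (0 : ℝ) S.ℓ, K.k11 S.ℓ ξ * z.uh t ξ)
    - ∫ ξ in Ioo (0 : ℝ) S.ℓ, K.k12 S.ℓ ξ * z.vh t ξ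

/-- The boundary value `β̃(0,t)`; the Volterra transformation between the observer errors and
`(α̃, β̃)` is the identity at `x = 0`, so it is `ṽ(0,t) = v(0,t) - v̂(0,t)`. -/
def betaTilde0 (b : Traces) (t : ℝ) : ℝ := b.v0 t - b.vh0 t

/-- Event times, sampled at the multiples of `h`; `inf ∅ = ∞` (no further event). Between `tk k`
and the next event, `d(t) = U(tk k) - U(t)`; this is also the value of `d` that decides at
`t = n h` whether an event takes place. -/
structure EventTimes (U m : ℝ → ℝ) (gamma : ℝ → ℝ → ℝ) (h : ℝ) (tk : ℕ → ℝ≥0∞) : Prop where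
  zero : tk 0 = 0
  succ : ∀ k, tk (k + 1) = sInf {s : ℝ≥0∞ | ∃ n : ℕ, s = ENNReal.ofReal (n * h) ∧ tk k < s ∧
    0 < gamma (U (tk k).toReal - U (n * h)) (m (n * h))}

/-- `inp` is the zero-order hold `inp(t) = U(tk k)` for `t ∈ [tk k, tk (k+1))`. -/
def ZeroOrderHold (U : ℝ → ℝ) (tk : ℕ → ℝ≥0∞) (inp : ℝ → ℝ) : Prop :=
  ∀ (k : ℕ) (t : ℝ), 0 ≤ t → tk k ≤ ENNReal.ofReal t → ENNReal.ofReal t < tk (k + 1) →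
    inp t = U (tk k).toReal

/-- The dynamic variable `m`, continuous with `m(0) = m₀` and
`m' = -η m + θ_m d² - κ₀ ‖(α̂,β̂)‖² - κ₁ α̂(ℓ,t)² - κ₂ β̃(0,t)²` almost everywhere, in integrated
form. -/
structure DynamicVariable (S : Plant) (K L P : Kernels) (G : Design) (m₀ : ℝ)
    (z : Trajectory S.ℓ) (b : Traces) (inp m : ℝ → ℝ) : Prop where
  cont : ContinuousOn m (Ici 0)
  eq : ∀ t : ℝ, 0 ≤ t → m t = m₀ + ∫ s in (0 : ℝ)..t,
    (-G.eta * m s + G.thetam S * (inp s - feedback S K z s) ^ 2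
      - G.kappa (eps0 S L) * hatNormSq K z s
      - G.kappa (eps1 S L) * alphaHatL K z b s ^ 2
      - G.kappa (eps2 S K L P) * betaTilde0 b s ^ 2)

/-- `z = (u, v, û, v̂)` solves the closed loop under periodic event-triggered control with sampling
period `h`, initial data `(u₀, v₀, û₀, v̂₀)` and `m(0) = m₀`. -/
def IsSolution (S : Plant) (K L P : Kernels) (G : Design) (h m₀ : ℝ)
    (u₀ v₀ uh₀ vh₀ : L2 S.ℓ) (z : Trajectory S.ℓ) : Prop :=
  z.u 0 = u₀ ∧ z.v 0 = v₀ ∧ z.uh 0 = uh₀ ∧ z.vh 0 = vh₀ ∧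
  ∃ (b : Traces) (m inp : ℝ → ℝ) (tk : ℕ → ℝ≥0∞),
    PlantObserver S P inp z b ∧
    DynamicVariable S K L P G m₀ z b inp m ∧
    EventTimes (feedback S K z) m (G.gammaP S L h) h tk ∧
    ZeroOrderHold (feedback S K z) tk inp

end PETC

end

open MeasureTheory Set
open scoped ENNReal

noncomputable section

namespace PETC

/-! Backstepping removes the in-domain coupling. What remains is a delay system for two scalar
signals, and all estimates are made there. The operators 1 - K and 1 + L are mutually inverse on L²,
and so are 1 - Q and 1 - P, where Q is an auxiliary kernel (`exists_observerInverse`) with boundary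
conditions on x = ℓ like those of P. In both cases the kernel of the product minus the identity is
constant along characteristics and is annihilated by the boundary conditions (`KerEq.comp_eq_zero`).
The kernels themselves come from a Picard iteration (`exists_goursat`). Such an operator maps weak
solutions to weak solutions (`KerEq.weakTransport`), because its adjoint sends C¹ test functions to
C¹ test functions. A weak solution without sources is a travelling profile
(`TransportBalance.eq_prof`).

Consequently (1 - K)(u,v) consists of the profiles of signals A, B with A(t) = q B(t - ℓ/λ₂) and
B(t) = ρ A(t - ℓ/λ₁) + U^p(t) - N(t), where N(t) = ∫(N^u u + N^v v) is the feedback functional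
evaluated on the plant state. For the image of the observer error under 1 - Q the relations are A =
0 and B(t) = ρ A(t - ℓ/λ₁), so the error vanishes identically after the finite time T = ℓ/λ₁ + ℓ/λ₂.
This splits the convergence proof. Up to a sampling instant past T, a Grönwall bound linear in the
data suffices (`exists_growth`, `exists_loop_growth`). After T the observer equals the plant and
β̃(0,t) = 0.

Two facts give decay after T. First, let d = U^p - U, let s be the time since the last sample, and
let g(s) = (e^{a(h-s)} - 1)/a. Then m + θ_m g d² decays at rate η. At a sample, either d = 0 or the
negated trigger condition makes this quantity nonpositive, and h ≤ τ is what makes θ_m g ε_i ≤ κ_i.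
Hence the positive part of m decays (`hold_decay`); m is not shown to stay negative, and this is not
needed. Secondly, a functional V with affine weights satisfies V' ≤ -e‖(α̂,β̂)‖² + θ_m d² - κ₁
α̂(ℓ)² with e > κ₀ (`PlantObserver.exists_lyapunov`). In V - m the terms in d² and α̂(ℓ)² cancel,
which yields exponential decay of V (`lyapunov_decay`).

For well-posedness with a given input, the boundary value at x = ℓ solves a Volterra equation of the
second kind, treated on successive short intervals (`exists_rightInflow`). The feedback and m at
time nh depend only on the input before nh (`PlantObserver.causal_outputs`). The sequence of held
values is therefore a fixed point of a strictly causal map (`exists_fixedPoint_of_causal`), and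
uniqueness follows one sampling interval after another. -/

/-! ### The triangle and continuous extensions -/

/-- The retraction of the plane onto the triangle. -/
def projTri (ℓ : ℝ) (p : ℝ × ℝ) : ℝ × ℝ :=
  (max (max 0 (min p.2 ℓ)) (min p.1 ℓ), max 0 (min p.2 ℓ))

lemma projTri_mem {ℓ : ℝ} (hℓ : 0 ≤ ℓ) (p : ℝ × ℝ) : projTri ℓ p ∈ triangle ℓ := by
  refine ⟨le_max_left _ _, le_max_left _ _, ?_⟩
  simp [projTri, hℓ]

lemma projTri_eq {ℓ : ℝ} {p : ℝ × ℝ} (hp : p ∈ triangle ℓ) : projTri ℓ p = p := by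
  obtain ⟨h0, h1, h2⟩ := hp
  have e2 : max 0 (min p.2 ℓ) = p.2 := by
    rw [min_eq_left (h1.trans h2), max_eq_right h0]
  ext
  · simp only [projTri, e2]; rw [min_eq_left h2, max_eq_right h1]
  · simp only [projTri, e2]

lemma continuous_projTri (ℓ : ℝ) : Continuous (projTri ℓ) := by
  unfold projTri; fun_prop

/-- Continuous extension of a kernel from the triangle to the plane. -/
def extendTri (ℓ : ℝ) (k : ℝ → ℝ → ℝ) (x ξ : ℝ) : ℝ :=
  k (projTri ℓ (x, ξ)).1 (projTri ℓ (x, ξ)).2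

lemma extendTri_eq {ℓ x ξ : ℝ} (k : ℝ → ℝ → ℝ) (hp : (x, ξ) ∈ triangle ℓ) :
    extendTri ℓ k x ξ = k x ξ := by
  simp [extendTri, projTri_eq hp]

lemma continuous_extendTri {ℓ : ℝ} (hℓ : 0 ≤ ℓ) {k : ℝ → ℝ → ℝ}
    (hk : ContinuousOn (Function.uncurry k) (triangle ℓ)) :
    Continuous (Function.uncurry (extendTri ℓ k)) :=
  hk.comp_continuous (continuous_projTri ℓ) (fun p => projTri_mem hℓ p)

lemma isCompact_triangle (ℓ : ℝ) : IsCompact (triangle ℓ) := by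
  refine (isCompact_Icc.prod isCompact_Icc :
    IsCompact (Icc (0 : ℝ) ℓ ×ˢ Icc (0 : ℝ) ℓ)).of_isClosed_subset ?_ ?_
  · have : triangle ℓ = {p : ℝ × ℝ | 0 ≤ p.2} ∩ ({p | p.2 ≤ p.1} ∩ {p | p.1 ≤ ℓ}) := rfl
    rw [this]
    exact (isClosed_le continuous_const continuous_snd).inter
      ((isClosed_le continuous_snd continuous_fst).inter
        (isClosed_le continuous_fst continuous_const))
  · rintro p ⟨h0, h1, h2⟩
    exact ⟨⟨h0.trans h1, h2⟩, ⟨h0, h1.trans h2⟩⟩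

/-- A kernel continuous on the triangle is bounded there. -/
lemma exists_bound_triangle {ℓ : ℝ} {k : ℝ → ℝ → ℝ}
    (hk : ContinuousOn (Function.uncurry k) (triangle ℓ)) :
    ∃ M : ℝ, 0 ≤ M ∧ ∀ p ∈ triangle ℓ, |k p.1 p.2| ≤ M := by
  obtain ⟨M, hM⟩ := (isCompact_triangle ℓ).exists_bound_of_continuousOn hk
  exact ⟨max M 0, le_max_right _ _, fun p hp => (hM p hp).trans (le_max_left _ _)⟩

/-- The open triangle. -/
def openTriangle (ℓ : ℝ) : Set (ℝ × ℝ) := {p | 0 < p.2 ∧ p.2 < p.1 ∧ p.1 < ℓ}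

lemma openTriangle_subset (ℓ : ℝ) : openTriangle ℓ ⊆ triangle ℓ :=
  fun _ hp => ⟨hp.1.le, hp.2.1.le, hp.2.2.le⟩

/-- Moving a point linearly towards the interior point (2ℓ/3, ℓ/3) enters the open triangle at once.
The kernel equations are posed only in the open triangle, so identities between continuous kernels
reach the closed triangle through this density. -/
lemma triangle_subset_closure {ℓ : ℝ} (hℓ : 0 < ℓ) : triangle ℓ ⊆ closure (openTriangle ℓ) := by
  intro p hp
  obtain ⟨h0, h1, h2⟩ := hp
  let γ : ℝ → ℝ × ℝ := fun s =>
    ((1 - s) * p.1 + s * (2 * ℓ / 3), (1 - s) * p.2 + s * (ℓ / 3))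
  have hγ : Continuous γ := by fun_prop
  have h : Filter.Tendsto γ (nhdsWithin 0 (Ioo 0 1)) (nhds p) := by
    have : Filter.Tendsto γ (nhds 0) (nhds (γ 0)) := hγ.tendsto 0
    have e : γ 0 = p := by simp [γ]
    rw [e] at this
    exact this.mono_left nhdsWithin_le_nhds
  have hne : (nhdsWithin (0 : ℝ) (Ioo 0 1)).NeBot := by
    rw [← mem_closure_iff_nhdsWithin_neBot, closure_Ioo (by norm_num)]
    simp
  refine mem_closure_of_tendsto h ?_
  filter_upwards [self_mem_nhdsWithin] with s hs
  obtain ⟨hs0, hs1⟩ := hs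
  refine ⟨?_, ?_, ?_⟩ <;> simp only [γ] <;> nlinarith

lemma eqOn_triangle {ℓ : ℝ} (hℓ : 0 < ℓ) {f g : ℝ → ℝ → ℝ}
    (hf : ContinuousOn (Function.uncurry f) (triangle ℓ))
    (hg : ContinuousOn (Function.uncurry g) (triangle ℓ))
    (h : ∀ x ξ, 0 < ξ → ξ < x → x < ℓ → f x ξ = g x ξ) {x ξ : ℝ} (hp : (x, ξ) ∈ triangle ℓ) :
    f x ξ = g x ξ := by
  have : EqOn (Function.uncurry f) (Function.uncurry g) (openTriangle ℓ) :=
    fun p hp => h p.1 p.2 hp.1 hp.2.1 hp.2.2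
  exact this.of_subset_closure hf hg (openTriangle_subset ℓ) (triangle_subset_closure hℓ) hp

/-! ### Integration along characteristics -/

/-- Integration of `g` along the characteristic direction `(a, b)`, starting from the values of `k₀`
on the line `τ₁ x + τ₂ ξ = 0`. -/
def charInt (τ₁ τ₂ a b : ℝ) (k₀ g : ℝ → ℝ → ℝ) (x ξ : ℝ) : ℝ :=
  k₀ (x - a * (τ₁ * x + τ₂ * ξ)) (ξ - b * (τ₁ * x + τ₂ * ξ)) +
    ∫ s in (0 : ℝ)..(τ₁ * x + τ₂ * ξ),
      g (x - a * (τ₁ * x + τ₂ * ξ) + a * s) (ξ - b * (τ₁ * x + τ₂ * ξ) + b * s)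

lemma continuous_charInt (τ₁ τ₂ a b : ℝ) {k₀ g : ℝ → ℝ → ℝ}
    (hk : Continuous (Function.uncurry k₀)) (hg : Continuous (Function.uncurry g)) :
    Continuous (Function.uncurry (charInt τ₁ τ₂ a b k₀ g)) := by
  have h1 : Continuous fun p : ℝ × ℝ => k₀ (p.1 - a * (τ₁ * p.1 + τ₂ * p.2))
      (p.2 - b * (τ₁ * p.1 + τ₂ * p.2)) :=
    hk.comp (f := fun p : ℝ × ℝ => (p.1 - a * (τ₁ * p.1 + τ₂ * p.2),
      p.2 - b * (τ₁ * p.1 + τ₂ * p.2))) (by fun_prop)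
  have h2 : Continuous fun p : ℝ × ℝ => ∫ s in (0 : ℝ)..(τ₁ * p.1 + τ₂ * p.2),
      g (p.1 - a * (τ₁ * p.1 + τ₂ * p.2) + a * s) (p.2 - b * (τ₁ * p.1 + τ₂ * p.2) + b * s) := by
    apply intervalIntegral.continuous_parametric_intervalIntegral_of_continuous
    · exact hg.comp (f := fun q : (ℝ × ℝ) × ℝ =>
        (q.1.1 - a * (τ₁ * q.1.1 + τ₂ * q.1.2) + a * q.2,
          q.1.2 - b * (τ₁ * q.1.1 + τ₂ * q.1.2) + b * q.2)) (by fun_prop)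
    · fun_prop
  exact h1.add h2

/-- By τ₁ a + τ₂ b = 1, a displacement by s along (a, b) lengthens the travel time by s and leaves
the foot fixed. Only the upper limit of the integral moves, so neither `k₀` nor `g` has to be
differentiable. -/
lemma hasDerivAt_charInt {τ₁ τ₂ a b : ℝ} (h : τ₁ * a + τ₂ * b = 1) (k₀ : ℝ → ℝ → ℝ)
    {g : ℝ → ℝ → ℝ} (hg : Continuous (Function.uncurry g)) (x ξ s : ℝ) :
    HasDerivAt (fun s : ℝ => charInt τ₁ τ₂ a b k₀ g (x + a * s) (ξ + b * s))
      (g (x + a * s) (ξ + b * s)) s := by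
  set T := τ₁ * x + τ₂ * ξ with hT
  have hTs : ∀ s, τ₁ * (x + a * s) + τ₂ * (ξ + b * s) = T + s := by
    intro s; rw [hT]; linear_combination s * h
  have e : (fun s : ℝ => charInt τ₁ τ₂ a b k₀ g (x + a * s) (ξ + b * s)) =
      fun s => k₀ (x - a * T) (ξ - b * T) +
        ∫ r in (0 : ℝ)..(T + s), g (x - a * T + a * r) (ξ - b * T + b * r) := by
    funext s
    unfold charInt
    rw [hTs]
    have e1 : x + a * s - a * (T + s) = x - a * T := by ring
    have e2 : ξ + b * s - b * (T + s) = ξ - b * T := by ring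
    rw [e1, e2]
  rw [e]
  have hc : Continuous fun r : ℝ => g (x - a * T + a * r) (ξ - b * T + b * r) :=
    hg.comp (f := fun r : ℝ => (x - a * T + a * r, ξ - b * T + b * r)) (by fun_prop)
  have h1 := (hc.integral_hasStrictDerivAt 0 (T + s)).hasDerivAt
  have h2 : HasDerivAt (fun s : ℝ => T + s) 1 s := (hasDerivAt_id s).const_add T
  have h3 := (h1.comp s h2).const_add (k₀ (x - a * T) (ξ - b * T))
  refine h3.congr_deriv ?_
  rw [mul_one]
  congr 1 <;> ring

/-- Geometric conditions under which every point of the triangle is reached from its foot on the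
line `τ₁ x + τ₂ ξ = 0` inside the triangle. -/
structure CharDir (ℓ τ₁ τ₂ a b : ℝ) : Prop where
  norm : τ₁ * a + τ₂ * b = 1
  nonneg : ∀ x ξ, (x, ξ) ∈ triangle ℓ → 0 ≤ τ₁ * x + τ₂ * ξ
  foot : ∀ x ξ, (x, ξ) ∈ triangle ℓ →
    (x - a * (τ₁ * x + τ₂ * ξ), ξ - b * (τ₁ * x + τ₂ * ξ)) ∈ triangle ℓ

/-- Characteristics parallel to the diagonal start on the side ξ = 0, at travel time ξ/a. -/
lemma charDir_diag {ℓ a : ℝ} (ha : 0 < a) : CharDir ℓ 0 (1 / a) a a where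
  norm := by field_simp; ring
  nonneg := fun x ξ h => by
    have h0 : 0 ≤ ξ := h.1
    rw [zero_mul, zero_add]
    exact mul_nonneg (by positivity) h0
  foot := fun x ξ h => by
    obtain ⟨h0, h1, h2⟩ := h
    simp only at h0 h1 h2
    have e : a * (0 * x + 1 / a * ξ) = ξ := by field_simp; ring
    rw [e]
    exact ⟨by simp, by simpa using h1, by simp; linarith⟩

/-- Characteristics of negative slope start on the diagonal, at travel time (x - ξ)/(b + d). -/
lemma charDir_anti {ℓ b d : ℝ} (hb : 0 < b) (hd : 0 < d) :
    CharDir ℓ (1 / (b + d)) (-(1 / (b + d))) b (-d) where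
  norm := by field_simp; try ring
  nonneg := fun x ξ h => by
    have h1 := h.2.1
    simp only at h1
    have : 1 / (b + d) * x + -(1 / (b + d)) * ξ = (x - ξ) / (b + d) := by ring
    rw [this]
    exact div_nonneg (by linarith) (by positivity)
  foot := fun x ξ h => by
    obtain ⟨h0, h1, h2⟩ := h
    simp only at h0 h1 h2
    have e : 1 / (b + d) * x + -(1 / (b + d)) * ξ = (x - ξ) / (b + d) := by ring
    have e1 : x - b * ((x - ξ) / (b + d)) = (d * x + b * ξ) / (b + d) := by field_simp; ring
    have e2 : ξ - -d * ((x - ξ) / (b + d)) = (d * x + b * ξ) / (b + d) := by field_simp; ring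
    rw [e, e1, e2]
    refine ⟨?_, le_refl _, ?_⟩
    · have : 0 ≤ x := h0.trans h1
      simp only
      positivity
    · simp only
      rw [div_le_iff₀ (by positivity)]
      nlinarith

/-- By convexity: the point on the segment is (1 - θ)·foot + θ·(x, ξ), with θ the fraction of the
travel time elapsed. -/
lemma CharDir.segment_mem {ℓ τ₁ τ₂ a b : ℝ} (h : CharDir ℓ τ₁ τ₂ a b) {x ξ s : ℝ}
    (hp : (x, ξ) ∈ triangle ℓ) (hs : s ∈ Icc 0 (τ₁ * x + τ₂ * ξ)) :
    (x - a * (τ₁ * x + τ₂ * ξ) + a * s, ξ - b * (τ₁ * x + τ₂ * ξ) + b * s) ∈ triangle ℓ := by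
  set T := τ₁ * x + τ₂ * ξ with hT
  have hf := h.foot x ξ hp
  rw [← hT] at hf
  rcases eq_or_lt_of_le (h.nonneg x ξ hp) with h0 | h0
  · rw [← hT] at h0
    have : s = 0 := le_antisymm (h0 ▸ hs.2) hs.1
    subst this; simpa using hf
  · rw [← hT] at h0
    obtain ⟨θ, rfl⟩ : ∃ θ, s = θ * T := ⟨s / T, by field_simp⟩
    have hθ0 : 0 ≤ θ := by
      by_contra hc; push Not at hc; nlinarith [hs.1]
    have hθ1 : θ ≤ 1 := by
      by_contra hc; push Not at hc; nlinarith [hs.2]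
    obtain ⟨f0, f1, f2⟩ := hf
    obtain ⟨p0, p1, p2⟩ := hp
    simp only at f0 f1 f2 p0 p1 p2
    refine ⟨?_, ?_, ?_⟩ <;> simp only <;> nlinarith

lemma CharDir.segment_mem_open {ℓ τ₁ τ₂ a b : ℝ} (h : CharDir ℓ τ₁ τ₂ a b) {x ξ s : ℝ}
    (hp : (x, ξ) ∈ openTriangle ℓ) (hs : s ∈ Ioo 0 (τ₁ * x + τ₂ * ξ)) :
    (x - a * (τ₁ * x + τ₂ * ξ) + a * s, ξ - b * (τ₁ * x + τ₂ * ξ) + b * s) ∈ openTriangle ℓ := by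
  have hf := h.foot x ξ (openTriangle_subset ℓ hp)
  set T := τ₁ * x + τ₂ * ξ with hT
  have h0 : 0 < T := hs.1.trans hs.2
  obtain ⟨θ, rfl⟩ : ∃ θ, s = θ * T := ⟨s / T, by field_simp⟩
  have hθ0 : 0 < θ := by
    by_contra hc; push Not at hc; nlinarith [hs.1]
  have hθ1 : θ < 1 := by
    by_contra hc; push Not at hc; nlinarith [hs.2]
  obtain ⟨f0, f1, f2⟩ := hf
  obtain ⟨p0, p1, p2⟩ := hp
  simp only at f0 f1 f2 p0 p1 p2
  refine ⟨?_, ?_, ?_⟩ <;> simp only <;> nlinarith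

/-- A kernel satisfying a characteristic equation is recovered by integration. -/
lemma CharDir.eq_charInt {ℓ τ₁ τ₂ a b : ℝ} (h : CharDir ℓ τ₁ τ₂ a b) (hℓ : 0 < ℓ)
    {k g : ℝ → ℝ → ℝ} (hk : ContinuousOn (Function.uncurry k) (triangle ℓ))
    (hg : ContinuousOn (Function.uncurry g) (triangle ℓ)) (he : CharEq ℓ a b k g) {x ξ : ℝ}
    (hp : (x, ξ) ∈ triangle ℓ) :
    charInt τ₁ τ₂ a b (extendTri ℓ k) (extendTri ℓ g) x ξ = k x ξ := by
  -- Both sides are continuous up to the boundary, so it suffices to integrate the equation for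
  -- points of the open triangle. Their characteristic segments stay in the open triangle except
  -- possibly at the foot.
  refine eqOn_triangle hℓ
    (continuous_charInt _ _ _ _ (continuous_extendTri hℓ.le hk)
      (continuous_extendTri hℓ.le hg)).continuousOn hk ?_ hp
  clear hp x ξ
  intro x ξ h0 h1 h2
  have hpo : (x, ξ) ∈ openTriangle ℓ := ⟨h0, h1, h2⟩
  have hp : (x, ξ) ∈ triangle ℓ := openTriangle_subset ℓ hpo
  unfold charInt
  set T := τ₁ * x + τ₂ * ξ with hT
  have hT0 : 0 ≤ T := h.nonneg x ξ hp
  rw [extendTri_eq _ (h.foot x ξ hp)]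
  have hcg : Continuous fun s : ℝ => extendTri ℓ g (x - a * T + a * s) (ξ - b * T + b * s) :=
    (continuous_extendTri hℓ.le hg).comp
      (f := fun s : ℝ => (x - a * T + a * s, ξ - b * T + b * s)) (by fun_prop)
  have key := intervalIntegral.integral_eq_sub_of_hasDerivAt_of_le
    (f := fun s => k (x - a * T + a * s) (ξ - b * T + b * s))
    (f' := fun s => extendTri ℓ g (x - a * T + a * s) (ξ - b * T + b * s)) hT0 ?_ ?_
    (hcg.intervalIntegrable _ _)
  · rw [key]
    simp [← hT]
  · exact hk.comp (f := fun s : ℝ => (x - a * T + a * s, ξ - b * T + b * s)) (by fun_prop)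
      (fun s hs => h.segment_mem hp hs)
  · intro s hs
    have hm := h.segment_mem_open hpo hs
    rw [extendTri_eq _ (openTriangle_subset ℓ hm)]
    have := he _ _ hm.1 hm.2.1 hm.2.2
    have h3 : HasDerivAt (fun r : ℝ => r - s) 1 s := (hasDerivAt_id s).sub_const s
    have h4 := HasDerivAt.comp (h := fun r : ℝ => r - s) s (by simpa using this) h3
    rw [mul_one] at h4
    refine h4.congr_of_eventuallyEq (Filter.Eventually.of_forall fun r => ?_)
    simp only [Function.comp]
    congr 1 <;> ring

/-- A kernel with a continuous characteristic derivative on the triangle extends to the plane with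
the same property. -/
lemma CharDir.exists_extension {ℓ τ₁ τ₂ a b : ℝ} (h : CharDir ℓ τ₁ τ₂ a b) (hℓ : 0 < ℓ)
    {k g : ℝ → ℝ → ℝ} (hk : ContinuousOn (Function.uncurry k) (triangle ℓ))
    (hg : ContinuousOn (Function.uncurry g) (triangle ℓ)) (he : CharEq ℓ a b k g) :
    ∃ k' g' : ℝ → ℝ → ℝ, Continuous (Function.uncurry k') ∧ Continuous (Function.uncurry g') ∧
      (∀ x ξ, (x, ξ) ∈ triangle ℓ → k' x ξ = k x ξ) ∧
      (∀ x ξ, (x, ξ) ∈ triangle ℓ → g' x ξ = g x ξ) ∧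
      ∀ x ξ s, HasDerivAt (fun s : ℝ => k' (x + a * s) (ξ + b * s)) (g' (x + a * s) (ξ + b * s)) s :=
  ⟨charInt τ₁ τ₂ a b (extendTri ℓ k) (extendTri ℓ g), extendTri ℓ g,
    continuous_charInt _ _ _ _ (continuous_extendTri hℓ.le hk) (continuous_extendTri hℓ.le hg),
    continuous_extendTri hℓ.le hg, fun _ _ hp => h.eq_charInt hℓ hk hg he hp,
    fun _ _ hp => extendTri_eq g hp,
    fun x ξ s => hasDerivAt_charInt h.norm _ (continuous_extendTri hℓ.le hg) x ξ s⟩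

/-! ### Goursat problems -/

/-- Along the characteristic x increases at rate a > 0, so integrating e^{ωx} gains a factor 1/(aω).
The value at the foot passes through without gain, because x is no larger there. This asymmetry
decides which family of components is iterated below. -/
lemma CharDir.abs_charInt_sub_le {ℓ τ₁ τ₂ a b : ℝ} (h : CharDir ℓ τ₁ τ₂ a b) (ha : 0 < a)
    {k k' g g' : ℝ → ℝ → ℝ} (hg : Continuous (Function.uncurry g))
    (hg' : Continuous (Function.uncurry g')) {ω A B : ℝ} (hω : 0 < ω) (hA : 0 ≤ A) (hB : 0 ≤ B)
    (hkk : ∀ x ξ, (x, ξ) ∈ triangle ℓ → τ₁ * x + τ₂ * ξ = 0 →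
      |k x ξ - k' x ξ| ≤ A * Real.exp (ω * x))
    (hgg : ∀ x ξ, (x, ξ) ∈ triangle ℓ → |g x ξ - g' x ξ| ≤ B * Real.exp (ω * x)) {x ξ : ℝ}
    (hp : (x, ξ) ∈ triangle ℓ) :
    |charInt τ₁ τ₂ a b k g x ξ - charInt τ₁ τ₂ a b k' g' x ξ| ≤
      (A + B / (a * ω)) * Real.exp (ω * x) := by
  unfold charInt
  set T := τ₁ * x + τ₂ * ξ with hT
  have hT0 : 0 ≤ T := h.nonneg x ξ hp
  have hc : ∀ {g : ℝ → ℝ → ℝ}, Continuous (Function.uncurry g) →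
      Continuous fun s : ℝ => g (x - a * T + a * s) (ξ - b * T + b * s) := fun hg =>
    hg.comp (f := fun s : ℝ => (x - a * T + a * s, ξ - b * T + b * s)) (by fun_prop)
  have h1 := hkk _ _ (h.foot x ξ hp) (by
    rw [← hT]; linear_combination -hT - T * h.norm)
  rw [← hT] at h1
  have h2 : |(∫ s in (0 : ℝ)..T, g (x - a * T + a * s) (ξ - b * T + b * s)) -
      ∫ s in (0 : ℝ)..T, g' (x - a * T + a * s) (ξ - b * T + b * s)| ≤
      ∫ s in (0 : ℝ)..T, B * Real.exp (ω * (x - a * T + a * s)) := by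
    rw [← intervalIntegral.integral_sub ((hc hg).intervalIntegrable _ _)
      ((hc hg').intervalIntegrable _ _)]
    refine (intervalIntegral.abs_integral_le_integral_abs hT0).trans ?_
    refine intervalIntegral.integral_mono_on hT0
      (((hc hg).sub (hc hg')).abs.intervalIntegrable _ _)
      (Continuous.intervalIntegrable (by fun_prop) _ _) ?_
    intro s hs
    exact hgg _ _ (h.segment_mem hp hs)
  have h3 : ∫ s in (0 : ℝ)..T, B * Real.exp (ω * (x - a * T + a * s)) =
      B / (a * ω) * (Real.exp (ω * x) - Real.exp (ω * (x - a * T))) := by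
    have hd : ∀ s ∈ uIcc 0 T, HasDerivAt
        (fun s => B / (a * ω) * Real.exp (ω * (x - a * T + a * s)))
        (B * Real.exp (ω * (x - a * T + a * s))) s := by
      intro s _
      have : HasDerivAt (fun s : ℝ => ω * (x - a * T + a * s)) (ω * (a * 1)) s :=
        (((hasDerivAt_id s).const_mul a).const_add _).const_mul ω
      refine (this.exp.const_mul (B / (a * ω))).congr_deriv ?_
      field_simp
    rw [intervalIntegral.integral_eq_sub_of_hasDerivAt hd
      (Continuous.intervalIntegrable (by fun_prop) _ _)]
    simp only [mul_zero, add_zero, sub_add_cancel]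
    ring
  have h4 : Real.exp (ω * (x - a * T)) ≤ Real.exp (ω * x) := by
    apply Real.exp_le_exp.2
    have : 0 ≤ a * T := by positivity
    nlinarith
  have h5 : 0 ≤ B / (a * ω) * Real.exp (ω * (x - a * T)) := by positivity
  rw [h3] at h2
  have h6 : A * Real.exp (ω * (x - a * T)) ≤ A * Real.exp (ω * x) := by gcongr
  rw [abs_le] at *
  constructor <;> nlinarith [h1.1, h1.2, h2.1, h2.2]

instance compactSpace_triangle (ℓ : ℝ) : CompactSpace (triangle ℓ) :=
  isCompact_iff_compactSpace.1 (isCompact_triangle ℓ)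

/-- The first family of components in a Goursat problem, as a function of the second. -/
def goursatF (a : Fin 2 → ℝ) (f : Fin 2 → Fin 2 → ℝ → ℝ → ℝ) (r : Fin 2 → Fin 2 → ℝ)
    (G : Fin 2 → ℝ → ℝ → ℝ) (i : Fin 2) : ℝ → ℝ → ℝ :=
  charInt 0 (1 / a i) (a i) (a i) (fun x ξ => ∑ j, r i j * G j x ξ)
    (fun x ξ => ∑ j, f i j x ξ * G j x ξ)

/-- The second family of components, after one Picard iteration. -/
def goursatG (a b d : Fin 2 → ℝ) (f g : Fin 2 → Fin 2 → ℝ → ℝ → ℝ) (r : Fin 2 → Fin 2 → ℝ)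
    (φ : Fin 2 → ℝ → ℝ) (G : Fin 2 → ℝ → ℝ → ℝ) (i : Fin 2) : ℝ → ℝ → ℝ :=
  charInt (1 / (b i + d i)) (-(1 / (b i + d i))) (b i) (-d i) (fun x _ => φ i x)
    (fun x ξ => ∑ j, g i j x ξ * goursatF a f r G j x ξ)

lemma continuous_sum_mul {f G : Fin 2 → ℝ → ℝ → ℝ}
    (hf : ∀ j, Continuous (Function.uncurry (f j)))
    (hG : ∀ j, Continuous (Function.uncurry (G j))) :
    Continuous (Function.uncurry fun x ξ => ∑ j, f j x ξ * G j x ξ) :=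
  continuous_finsetSum _ fun j _ => (hf j).mul (hG j)

lemma continuous_goursatF (a : Fin 2 → ℝ) {f : Fin 2 → Fin 2 → ℝ → ℝ → ℝ}
    (hf : ∀ i j, Continuous (Function.uncurry (f i j))) (r : Fin 2 → Fin 2 → ℝ)
    {G : Fin 2 → ℝ → ℝ → ℝ} (hG : ∀ j, Continuous (Function.uncurry (G j))) (i : Fin 2) :
    Continuous (Function.uncurry (goursatF a f r G i)) :=
  continuous_charInt _ _ _ _ (continuous_finsetSum _ fun j _ => continuous_const.mul (hG j))
    (continuous_sum_mul (hf i) hG)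

lemma continuous_goursatG (a b d : Fin 2 → ℝ) {f g : Fin 2 → Fin 2 → ℝ → ℝ → ℝ}
    (hf : ∀ i j, Continuous (Function.uncurry (f i j)))
    (hg : ∀ i j, Continuous (Function.uncurry (g i j))) (r : Fin 2 → Fin 2 → ℝ)
    {φ : Fin 2 → ℝ → ℝ} (hφ : ∀ i, Continuous (φ i))
    {G : Fin 2 → ℝ → ℝ → ℝ} (hG : ∀ j, Continuous (Function.uncurry (G j))) (i : Fin 2) :
    Continuous (Function.uncurry (goursatG a b d f g r φ G i)) :=
  continuous_charInt _ _ _ _ ((hφ i).comp continuous_fst)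
    (continuous_sum_mul (hg i) fun j => continuous_goursatF a hf r hG j)

lemma abs_sum_mul_sub_le {f G G' : Fin 2 → ℝ} {M δ : ℝ} (hM : ∀ j, |f j| ≤ M)
    (hδ : ∀ j, |G j - G' j| ≤ δ) :
    |(∑ j, f j * G j) - ∑ j, f j * G' j| ≤ 2 * M * δ := by
  rw [← Finset.sum_sub_distrib]
  refine (Finset.abs_sum_le_sum_abs _ _).trans ?_
  have : ∀ j ∈ Finset.univ, |f j * G j - f j * G' j| ≤ M * δ := by
    intro j _
    rw [← mul_sub, abs_mul]
    exact mul_le_mul (hM j) (hδ j) (abs_nonneg _) ((abs_nonneg _).trans (hM j))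
  refine (Finset.sum_le_sum this).trans ?_
  simp; linarith

/-- The first family sees G through its boundary data and gains nothing, whence the factor 2M +
2M/α. The second has fixed data on the diagonal and gains 1/(αω). The iteration on the second family
alone is thus contracting for large ω, however large the reflection coefficients `r`. -/
lemma abs_goursatG_sub_le {ℓ : ℝ} {a b d : Fin 2 → ℝ} (ha : ∀ i, 0 < a i) (hb : ∀ i, 0 < b i)
    (hd : ∀ i, 0 < d i) {f g : Fin 2 → Fin 2 → ℝ → ℝ → ℝ}
    (hf : ∀ i j, Continuous (Function.uncurry (f i j)))
    (hg : ∀ i j, Continuous (Function.uncurry (g i j))) (r : Fin 2 → Fin 2 → ℝ)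
    (φ : Fin 2 → ℝ → ℝ) {M α : ℝ} (hM : 0 ≤ M) (hα : 0 < α) (haα : ∀ i, α ≤ a i)
    (hbα : ∀ i, α ≤ b i)
    (hfM : ∀ i j x ξ, (x, ξ) ∈ triangle ℓ → |f i j x ξ| ≤ M)
    (hgM : ∀ i j x ξ, (x, ξ) ∈ triangle ℓ → |g i j x ξ| ≤ M) (hrM : ∀ i j, |r i j| ≤ M)
    {G G' : Fin 2 → ℝ → ℝ → ℝ} (hG : ∀ j, Continuous (Function.uncurry (G j)))
    (hG' : ∀ j, Continuous (Function.uncurry (G' j))) {ω δ : ℝ} (hω : 1 ≤ ω) (hδ : 0 ≤ δ)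
    (hGG : ∀ j x ξ, (x, ξ) ∈ triangle ℓ → |G j x ξ - G' j x ξ| ≤ δ * Real.exp (ω * x))
    (i : Fin 2) {x ξ : ℝ} (hp : (x, ξ) ∈ triangle ℓ) :
    |goursatG a b d f g r φ G i x ξ - goursatG a b d f g r φ G' i x ξ| ≤
      2 * M * (2 * M + 2 * M / α) * δ / (α * ω) * Real.exp (ω * x) := by
  have hω0 : 0 < ω := by linarith
  have hF : ∀ j x ξ, (x, ξ) ∈ triangle ℓ →
      |goursatF a f r G j x ξ - goursatF a f r G' j x ξ| ≤
        ((2 * M + 2 * M / α) * δ) * Real.exp (ω * x) := by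
    intro j x ξ hp
    refine ((charDir_diag (ha j)).abs_charInt_sub_le (A := 2 * M * δ) (B := 2 * M * δ) (ha j)
      (continuous_sum_mul (hf j) hG) (continuous_sum_mul (hf j) hG') hω0 (by positivity)
      (by positivity) ?_ ?_ hp).trans ?_
    · intro x ξ hq _
      refine (abs_sum_mul_sub_le (hrM j) (fun k => hGG k x ξ hq)).trans (le_of_eq (by ring))
    · intro x ξ hq
      exact (abs_sum_mul_sub_le (fun k => hfM j k x ξ hq) (fun k => hGG k x ξ hq)).trans
        (le_of_eq (by ring))
    · gcongr
      have : 2 * M * δ / (a j * ω) ≤ 2 * M * δ / (α * 1) := by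
        have := (ha j).le
        gcongr
        exact haα j
      calc 2 * M * δ + 2 * M * δ / (a j * ω) ≤ 2 * M * δ + 2 * M * δ / (α * 1) := by linarith
        _ = (2 * M + 2 * M / α) * δ := by ring
  refine ((charDir_anti (hb i) (hd i)).abs_charInt_sub_le (A := 0)
    (B := 2 * M * ((2 * M + 2 * M / α) * δ)) (hb i)
    (continuous_sum_mul (hg i) fun j => continuous_goursatF a hf r hG j)
    (continuous_sum_mul (hg i) fun j => continuous_goursatF a hf r hG' j) hω0 le_rfl
    (by positivity) ?_ ?_ hp).trans ?_
  · intro x ξ _ _; simp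
  · intro x ξ hq
    exact (abs_sum_mul_sub_le (fun k => hgM i k x ξ hq) (fun k => hF k x ξ hq)).trans
      (le_of_eq (by ring))
  · gcongr
    rw [zero_add]
    have : 2 * M * ((2 * M + 2 * M / α) * δ) / (b i * ω) ≤
        2 * M * ((2 * M + 2 * M / α) * δ) / (α * ω) := by
      gcongr
      exact hbα i
    exact this.trans (le_of_eq (by ring))

/-- Well-posedness of Goursat problems on the triangle: two components propagate along the diagonal
direction, starting from the side `ξ = 0`, and two propagate from the diagonal. -/
theorem exists_goursat {ℓ : ℝ} (hℓ : 0 < ℓ) {a b d : Fin 2 → ℝ} (ha : ∀ i, 0 < a i)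
    (hb : ∀ i, 0 < b i) (hd : ∀ i, 0 < d i) {f g : Fin 2 → Fin 2 → ℝ → ℝ → ℝ}
    (hf : ∀ i j, ContinuousOn (Function.uncurry (f i j)) (triangle ℓ))
    (hg : ∀ i j, ContinuousOn (Function.uncurry (g i j)) (triangle ℓ)) (r : Fin 2 → Fin 2 → ℝ)
    {φ : Fin 2 → ℝ → ℝ} (hφ : ∀ i, ContinuousOn (φ i) (Icc 0 ℓ)) :
    ∃ F G : Fin 2 → ℝ → ℝ → ℝ, (∀ i, Continuous (Function.uncurry (F i))) ∧
      (∀ i, Continuous (Function.uncurry (G i))) ∧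
      (∀ i, CharEq ℓ (a i) (a i) (F i) fun x ξ => ∑ j, f i j x ξ * G j x ξ) ∧
      (∀ i, CharEq ℓ (b i) (-d i) (G i) fun x ξ => ∑ j, g i j x ξ * F j x ξ) ∧
      (∀ i, ∀ x ∈ Icc 0 ℓ, F i x 0 = ∑ j, r i j * G j x 0) ∧
      ∀ i, ∀ x ∈ Icc 0 ℓ, G i x x = φ i x := by
  set f' : Fin 2 → Fin 2 → ℝ → ℝ → ℝ := fun i j => extendTri ℓ (f i j) with hf'
  set g' : Fin 2 → Fin 2 → ℝ → ℝ → ℝ := fun i j => extendTri ℓ (g i j) with hg'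
  set φ' : Fin 2 → ℝ → ℝ := fun i x => φ i (max 0 (min x ℓ)) with hφ'
  have hcf : ∀ i j, Continuous (Function.uncurry (f' i j)) := fun i j =>
    continuous_extendTri hℓ.le (hf i j)
  have hcg : ∀ i j, Continuous (Function.uncurry (g' i j)) := fun i j =>
    continuous_extendTri hℓ.le (hg i j)
  have hcφ : ∀ i, Continuous (φ' i) := fun i =>
    (hφ i).comp_continuous (by fun_prop) (fun x => ⟨le_max_left _ _, by simp [hℓ.le]⟩)
  obtain ⟨M, hM, hfM, hgM, hrM⟩ : ∃ M : ℝ, 0 ≤ M ∧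
      (∀ i j x ξ, (x, ξ) ∈ triangle ℓ → |f' i j x ξ| ≤ M) ∧
      (∀ i j x ξ, (x, ξ) ∈ triangle ℓ → |g' i j x ξ| ≤ M) ∧ (∀ i j, |r i j| ≤ M) := by
    choose Mf hMf0 hMf using fun i j => exists_bound_triangle (hf i j)
    choose Mg hMg0 hMg using fun i j => exists_bound_triangle (hg i j)
    have hs : ∀ (u : Fin 2 → Fin 2 → ℝ), (∀ i j, 0 ≤ u i j) → ∀ i j, u i j ≤ ∑ i, ∑ j, u i j := by
      intro u hu i j
      refine (Finset.single_le_sum (f := fun j => u i j) (fun j _ => hu i j)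
        (Finset.mem_univ j)).trans ?_
      exact Finset.single_le_sum (f := fun i => ∑ j, u i j)
        (fun i _ => Finset.sum_nonneg fun j _ => hu i j) (Finset.mem_univ i)
    have n1 : 0 ≤ ∑ i, ∑ j, Mf i j :=
      Finset.sum_nonneg fun i _ => Finset.sum_nonneg fun j _ => hMf0 i j
    have n2 : 0 ≤ ∑ i, ∑ j, Mg i j :=
      Finset.sum_nonneg fun i _ => Finset.sum_nonneg fun j _ => hMg0 i j
    have n3 : 0 ≤ ∑ i, ∑ j, |r i j| :=
      Finset.sum_nonneg fun i _ => Finset.sum_nonneg fun j _ => abs_nonneg _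
    refine ⟨(∑ i, ∑ j, Mf i j) + (∑ i, ∑ j, Mg i j) + ∑ i, ∑ j, |r i j|, by positivity,
      fun i j x ξ hp => ?_, fun i j x ξ hp => ?_, fun i j => ?_⟩
    · rw [hf']; simp only [extendTri_eq _ hp]
      have := hMf i j _ hp
      have h2 := hs Mf hMf0 i j
      linarith
    · rw [hg']; simp only [extendTri_eq _ hp]
      have := hMg i j _ hp
      have h2 := hs Mg hMg0 i j
      linarith
    · have := hs (fun i j => |r i j|) (fun i j => abs_nonneg _) i j
      linarith
  obtain ⟨α, hα, haα, hbα⟩ : ∃ α : ℝ, 0 < α ∧ (∀ i, α ≤ a i) ∧ ∀ i, α ≤ b i := by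
    refine ⟨min (min (a 0) (a 1)) (min (b 0) (b 1)), by simp [ha, hb], ?_, ?_⟩ <;>
      intro i <;> fin_cases i <;> simp
  set c := 2 * M * (2 * M + 2 * M / α) / α with hc
  have hc0 : 0 ≤ c := by positivity
  -- The Lipschitz constant in the norm weighted by e^{-ωx} is c/ω; this ω makes it at most 1/2.
  set ω := 1 + 2 * c with hω
  have hω1 : 1 ≤ ω := by linarith
  -- The unknown is H = e^{-ωx} G on the triangle, so the plain supremum norm of H is the weighted
  -- norm of G. The retraction onto the triangle makes the kernel continuous on the whole plane.
  let lift : C(triangle ℓ, Fin 2 → ℝ) → Fin 2 → ℝ → ℝ → ℝ := fun H j x ξ =>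
    Real.exp (ω * x) * H ⟨projTri ℓ (x, ξ), projTri_mem hℓ.le _⟩ j
  have hlift : ∀ H j, Continuous (Function.uncurry (lift H j)) := by
    intro H j
    have h1 : Continuous fun p : ℝ × ℝ =>
        (⟨projTri ℓ p, projTri_mem hℓ.le _⟩ : triangle ℓ) :=
      (continuous_projTri ℓ).subtype_mk _
    have h2 : Continuous fun p : ℝ × ℝ => H ⟨projTri ℓ p, projTri_mem hℓ.le _⟩ j :=
      (continuous_apply j).comp (H.continuous.comp h1)
    have h3 : Continuous fun p : ℝ × ℝ => Real.exp (ω * p.1) := by fun_prop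
    exact h3.mul h2
  let T : C(triangle ℓ, Fin 2 → ℝ) → C(triangle ℓ, Fin 2 → ℝ) := fun H =>
    ⟨fun p i => Real.exp (-(ω * p.1.1)) * goursatG a b d f' g' r φ' (lift H) i p.1.1 p.1.2, by
      refine continuous_pi fun i => Continuous.mul (by fun_prop) ?_
      exact (continuous_goursatG a b d hcf hcg r hcφ (hlift H) i).comp continuous_subtype_val⟩
  have hT : ContractingWith (1 / 2) T := by
    refine ⟨by norm_num, LipschitzWith.of_dist_le_mul fun H H' => ?_⟩
    rw [ContinuousMap.dist_le (by positivity)]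
    intro p
    rw [dist_pi_le_iff (by positivity)]
    intro i
    have hp : (p.1.1, p.1.2) ∈ triangle ℓ := p.2
    have hGG : ∀ j x ξ, (x, ξ) ∈ triangle ℓ →
        |lift H j x ξ - lift H' j x ξ| ≤ dist H H' * Real.exp (ω * x) := by
      intro j x ξ _
      simp only [lift]
      rw [← mul_sub, abs_mul, abs_of_pos (Real.exp_pos _), mul_comm]
      gcongr
      rw [← Real.dist_eq]
      exact (dist_le_pi_dist _ _ j).trans (ContinuousMap.dist_apply_le_dist _)
    have := abs_goursatG_sub_le ha hb hd hcf hcg r φ' hM hα haα hbα hfM hgM hrM (hlift H)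
      (hlift H') hω1 dist_nonneg hGG i hp
    simp only [T, ContinuousMap.coe_mk]
    rw [Real.dist_eq, ← mul_sub, abs_mul, abs_of_pos (Real.exp_pos _)]
    have h2 : 2 * M * (2 * M + 2 * M / α) * dist H H' / (α * ω) = c / ω * dist H H' := by
      rw [hc]; field_simp
    have h3 : c / ω ≤ 1 / 2 := by
      rw [div_le_iff₀ (by linarith)]; linarith
    have h4 : Real.exp (-(ω * p.1.1)) * Real.exp (ω * p.1.1) = 1 := by
      rw [← Real.exp_add]; simp
    rw [h2] at this
    have hd0 : 0 ≤ dist H H' := dist_nonneg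
    calc Real.exp (-(ω * p.1.1)) * _
        ≤ Real.exp (-(ω * p.1.1)) * (c / ω * dist H H' * Real.exp (ω * p.1.1)) := by gcongr
      _ = c / ω * dist H H' * (Real.exp (-(ω * p.1.1)) * Real.exp (ω * p.1.1)) := by ring
      _ ≤ 1 / 2 * dist H H' := by rw [h4, mul_one]; gcongr
      _ = _ := by norm_num
  have : Nonempty C(triangle ℓ, Fin 2 → ℝ) := ⟨0⟩
  set H := hT.fixedPoint T with hH
  have hfix : T H = H := hT.fixedPoint_isFixedPt
  set F := goursatF a f' r (lift H) with hF
  set G := goursatG a b d f' g' r φ' (lift H) with hG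
  -- The fixed point identifies the lift with G only on the triangle, which is all that the
  -- equations and boundary conditions involve.
  have hGH : ∀ j x ξ, (x, ξ) ∈ triangle ℓ → lift H j x ξ = G j x ξ := by
    intro j x ξ hp
    have h1 : T H ⟨(x, ξ), hp⟩ j = H ⟨(x, ξ), hp⟩ j := by rw [hfix]
    simp only [T, ContinuousMap.coe_mk] at h1
    simp only [lift]
    have e : (⟨projTri ℓ (x, ξ), projTri_mem hℓ.le _⟩ : triangle ℓ) = ⟨(x, ξ), hp⟩ :=
      Subtype.ext (projTri_eq hp)
    rw [e, ← h1, ← mul_assoc, ← Real.exp_add]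
    simp [hG]
  refine ⟨F, G, continuous_goursatF a hcf r (hlift H),
    continuous_goursatG a b d hcf hcg r hcφ (hlift H), ?_, ?_, ?_, ?_⟩
  · intro i x ξ h0 h1 h2
    have hp : (x, ξ) ∈ triangle ℓ := ⟨h0.le, h1.le, h2.le⟩
    have := hasDerivAt_charInt (charDir_diag (ℓ := ℓ) (ha i)).norm
      (fun x ξ => ∑ j, r i j * lift H j x ξ) (continuous_sum_mul (hcf i) (hlift H)) x ξ 0
    refine this.congr_deriv ?_
    simp only [mul_zero, add_zero]
    refine Finset.sum_congr rfl fun j _ => ?_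
    rw [hGH j x ξ hp, hf']
    simp only [extendTri_eq _ hp]
  · intro i x ξ h0 h1 h2
    have hp : (x, ξ) ∈ triangle ℓ := ⟨h0.le, h1.le, h2.le⟩
    have := hasDerivAt_charInt (charDir_anti (ℓ := ℓ) (hb i) (hd i)).norm
      (fun x _ => φ' i x) (continuous_sum_mul (hcg i) fun j =>
        continuous_goursatF a hcf r (hlift H) j) x ξ 0
    refine this.congr_deriv ?_
    simp only [mul_zero, add_zero]
    refine Finset.sum_congr rfl fun j _ => ?_
    rw [hg']
    simp only [extendTri_eq _ hp, hF]
  · intro i x hx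
    have hp : (x, (0 : ℝ)) ∈ triangle ℓ := ⟨le_rfl, hx.1, hx.2⟩
    rw [hF]
    simp only [goursatF, charInt]
    simp only [zero_mul, mul_zero, add_zero, intervalIntegral.integral_same, sub_zero]
    exact Finset.sum_congr rfl fun j _ => by rw [hGH j x 0 hp]
  · intro i x hx
    rw [hG]
    simp only [goursatG, charInt]
    have e : 1 / (b i + d i) * x + -(1 / (b i + d i)) * x = 0 := by ring
    rw [e]
    simp only [mul_zero, intervalIntegral.integral_same, sub_zero, add_zero, hφ']
    rw [min_eq_left hx.2, max_eq_right hx.1]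

/-! ### Goursat problems with conditions on the side x = ℓ. -/

/-- Reflection of a kernel in the line `x + ξ = ℓ`. -/
def reflectTri (ℓ : ℝ) (k : ℝ → ℝ → ℝ) (x ξ : ℝ) : ℝ := k (ℓ - ξ) (ℓ - x)

lemma reflectTri_mem {ℓ x ξ : ℝ} (hp : (x, ξ) ∈ triangle ℓ) : (ℓ - ξ, ℓ - x) ∈ triangle ℓ := by
  obtain ⟨h0, h1, h2⟩ := hp
  simp only at h0 h1 h2
  refine ⟨?_, ?_, ?_⟩ <;> simp only <;> linarith

lemma continuousOn_reflectTri {ℓ : ℝ} {k : ℝ → ℝ → ℝ}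
    (hk : ContinuousOn (Function.uncurry k) (triangle ℓ)) :
    ContinuousOn (Function.uncurry (reflectTri ℓ k)) (triangle ℓ) :=
  hk.comp (f := fun p : ℝ × ℝ => (ℓ - p.2, ℓ - p.1)) (by fun_prop) fun _ hp => reflectTri_mem hp

lemma continuous_reflectTri (ℓ : ℝ) {k : ℝ → ℝ → ℝ} (hk : Continuous (Function.uncurry k)) :
    Continuous (Function.uncurry (reflectTri ℓ k)) :=
  hk.comp (f := fun p : ℝ × ℝ => (ℓ - p.2, ℓ - p.1)) (by fun_prop)

/-- The reflection (x, ξ) ↦ (ℓ - ξ, ℓ - x) keeps the diagonal, exchanges the sides ξ = 0 and x = ℓ,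
and turns the direction (a, b) into (-b, -a). -/
lemma CharEq.reflect {ℓ a b : ℝ} {F g : ℝ → ℝ → ℝ} (h : CharEq ℓ a b F g) :
    CharEq ℓ (-b) (-a) (reflectTri ℓ F) (reflectTri ℓ g) := by
  intro x ξ h0 h1 h2
  have := h (ℓ - ξ) (ℓ - x) (by linarith) (by linarith) (by linarith)
  refine this.congr_of_eventuallyEq (Filter.Eventually.of_forall fun s => ?_)
  simp only [reflectTri]
  congr 1 <;> ring

lemma CharEq.reverse {ℓ a b : ℝ} {F g : ℝ → ℝ → ℝ} (h : CharEq ℓ a b F g) :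
    CharEq ℓ (-a) (-b) F (fun x ξ => -g x ξ) := by
  intro x ξ h0 h1 h2
  have := HasDerivAt.comp (h := fun s : ℝ => -s) 0 (by simpa using h x ξ h0 h1 h2)
    (hasDerivAt_neg 0)
  refine (this.congr_of_eventuallyEq (Filter.Eventually.of_forall fun s => ?_)).congr_deriv ?_
  · simp
  · ring

lemma CharEq.congr {ℓ a b : ℝ} {F g g' : ℝ → ℝ → ℝ} (h : CharEq ℓ a b F g)
    (hg : ∀ x ξ, g x ξ = g' x ξ) : CharEq ℓ a b F g' :=
  fun x ξ h0 h1 h2 => (h x ξ h0 h1 h2).congr_deriv (hg x ξ)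

/-- The Goursat problem with the boundary condition on the side `x = ℓ`. -/
theorem exists_goursat_right {ℓ : ℝ} (hℓ : 0 < ℓ) {a b d : Fin 2 → ℝ} (ha : ∀ i, 0 < a i)
    (hb : ∀ i, 0 < b i) (hd : ∀ i, 0 < d i) {f g : Fin 2 → Fin 2 → ℝ → ℝ → ℝ}
    (hf : ∀ i j, ContinuousOn (Function.uncurry (f i j)) (triangle ℓ))
    (hg : ∀ i j, ContinuousOn (Function.uncurry (g i j)) (triangle ℓ)) (r : Fin 2 → Fin 2 → ℝ)
    {φ : Fin 2 → ℝ → ℝ} (hφ : ∀ i, ContinuousOn (φ i) (Icc 0 ℓ)) :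
    ∃ F G : Fin 2 → ℝ → ℝ → ℝ, (∀ i, Continuous (Function.uncurry (F i))) ∧
      (∀ i, Continuous (Function.uncurry (G i))) ∧
      (∀ i, CharEq ℓ (a i) (a i) (F i) fun x ξ => ∑ j, f i j x ξ * G j x ξ) ∧
      (∀ i, CharEq ℓ (b i) (-d i) (G i) fun x ξ => ∑ j, g i j x ξ * F j x ξ) ∧
      (∀ i, ∀ ξ ∈ Icc 0 ℓ, F i ℓ ξ = ∑ j, r i j * G j ℓ ξ) ∧
      ∀ i, ∀ x ∈ Icc 0 ℓ, G i x x = φ i x := by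
  -- The reflection interchanges the two speeds of the second family, so `hd` and `hb` trade places.
  -- It reverses the diagonal direction, which is undone by the sign in front of `f`.
  obtain ⟨F, G, hF, hG, eF, eG, bF, bG⟩ := exists_goursat hℓ ha hd hb
    (f := fun i j x ξ => -reflectTri ℓ (f i j) x ξ) (g := fun i j => reflectTri ℓ (g i j))
    (fun i j => (continuousOn_reflectTri (hf i j)).neg)
    (fun i j => continuousOn_reflectTri (hg i j)) r (φ := fun i x => φ i (ℓ - x))
    (fun i => (hφ i).comp (by fun_prop)
      fun x hx => ⟨by linarith [hx.2], by linarith [hx.1]⟩)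
  refine ⟨fun i => reflectTri ℓ (F i), fun i => reflectTri ℓ (G i),
    fun i => continuous_reflectTri ℓ (hF i), fun i => continuous_reflectTri ℓ (hG i), ?_, ?_,
    ?_, ?_⟩
  · intro i
    have := (eF i).reflect.reverse
    rw [neg_neg] at this
    refine this.congr fun x ξ => ?_
    simp [reflectTri]
  · intro i
    have := (eG i).reflect
    rw [neg_neg] at this
    refine this.congr fun x ξ => ?_
    simp [reflectTri]
  · intro i ξ hξ
    have := bF i (ℓ - ξ) ⟨by linarith [hξ.2], by linarith [hξ.1]⟩
    simpa [reflectTri] using this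
  · intro i x hx
    have := bG i (ℓ - x) ⟨by linarith [hx.2], by linarith [hx.1]⟩
    simpa [reflectTri] using this

/-! ### The kernel systems of the plant and their solvability. -/

/-- The equations shared by kernels of transformations from the plant to pure transport. -/
structure CtrlEq (S : Plant) (K : Kernels) : Prop where
  cont : K.Cont S.ℓ
  eq11 : CharEq S.ℓ S.lam1 S.lam1 K.k11 (fun x ξ => -S.c2 ξ * K.k12 x ξ)
  eq12 : CharEq S.ℓ S.lam1 (-S.lam2) K.k12 (fun x ξ => -S.c1 ξ * K.k11 x ξ)
  eq21 : CharEq S.ℓ S.lam2 (-S.lam1) K.k21 (fun x ξ => S.c2 ξ * K.k22 x ξ)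
  eq22 : CharEq S.ℓ S.lam2 S.lam2 K.k22 (fun x ξ => S.c1 ξ * K.k21 x ξ)
  bc12 : ∀ x ∈ Icc 0 S.ℓ, K.k12 x x = S.c1 x / (S.lam1 + S.lam2)
  bc21 : ∀ x ∈ Icc 0 S.ℓ, K.k21 x x = -(S.c2 x / (S.lam1 + S.lam2))

/-- The equations shared by kernels of transformations from pure transport to the plant. -/
structure InvEq (S : Plant) (L : Kernels) : Prop where
  cont : L.Cont S.ℓ
  eq11 : CharEq S.ℓ S.lam1 S.lam1 L.k11 (fun x ξ => S.c1 x * L.k21 x ξ)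
  eq12 : CharEq S.ℓ S.lam1 (-S.lam2) L.k12 (fun x ξ => S.c1 x * L.k22 x ξ)
  eq21 : CharEq S.ℓ S.lam2 (-S.lam1) L.k21 (fun x ξ => -S.c2 x * L.k11 x ξ)
  eq22 : CharEq S.ℓ S.lam2 S.lam2 L.k22 (fun x ξ => -S.c2 x * L.k12 x ξ)
  bc12 : ∀ x ∈ Icc 0 S.ℓ, L.k12 x x = S.c1 x / (S.lam1 + S.lam2)
  bc21 : ∀ x ∈ Icc 0 S.ℓ, L.k21 x x = -(S.c2 x / (S.lam1 + S.lam2))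

lemma IsControlKernel.ctrlEq {S : Plant} {K : Kernels} (h : IsControlKernel S K) : CtrlEq S K :=
  ⟨h.cont, h.eq11, h.eq12, h.eq21, h.eq22, h.bc12, h.bc21⟩

lemma IsInverseKernel.invEq {S : Plant} {L : Kernels} (h : IsInverseKernel S L) : InvEq S L :=
  ⟨h.cont, h.eq11, h.eq12, h.eq21, h.eq22, h.bc12, h.bc21⟩

/-- The opposite of a matrix of kernels. -/
def Kernels.opp (P : Kernels) : Kernels where
  k11 x ξ := -P.k11 x ξ
  k12 x ξ := -P.k12 x ξ
  k21 x ξ := -P.k21 x ξ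
  k22 x ξ := -P.k22 x ξ

lemma CharEq.opp {ℓ a b : ℝ} {F g : ℝ → ℝ → ℝ} (h : CharEq ℓ a b F g) :
    CharEq ℓ a b (fun x ξ => -F x ξ) (fun x ξ => -g x ξ) :=
  fun x ξ h0 h1 h2 => (h x ξ h0 h1 h2).neg

/-- The error transformation is 1 - P whereas the inverse control transformation is 1 + L. Hence -P
satisfies the same equations and diagonal conditions as L and differs only in the conditions on a
side of the triangle. -/
lemma IsObserverKernel.invEq {S : Plant} {P : Kernels} (h : IsObserverKernel S P) :
    InvEq S P.opp where
  cont := ⟨h.cont.c11.neg, h.cont.c12.neg, h.cont.c21.neg, h.cont.c22.neg⟩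
  eq11 := h.eq11.opp.congr fun x ξ => by simp [Kernels.opp]
  eq12 := h.eq12.opp.congr fun x ξ => by simp [Kernels.opp]
  eq21 := h.eq21.opp.congr fun x ξ => by simp [Kernels.opp]
  eq22 := h.eq22.opp.congr fun x ξ => by simp [Kernels.opp]
  bc12 := fun x hx => by simp [Kernels.opp, h.bc12 x hx]
  bc21 := fun x hx => by simp [Kernels.opp, h.bc21 x hx]

lemma Plant.Admissible.continuousOn_c1_fst {S : Plant} (hS : S.Admissible) :
    ContinuousOn (Function.uncurry fun x (_ : ℝ) => S.c1 x) (triangle S.ℓ) :=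
  hS.c1_cont.comp continuousOn_fst fun _ hp => ⟨hp.1.trans hp.2.1, hp.2.2⟩

lemma Plant.Admissible.continuousOn_c1_snd {S : Plant} (hS : S.Admissible) :
    ContinuousOn (Function.uncurry fun (_ : ℝ) ξ => S.c1 ξ) (triangle S.ℓ) :=
  hS.c1_cont.comp continuousOn_snd fun _ hp => ⟨hp.1, hp.2.1.trans hp.2.2⟩

lemma Plant.Admissible.continuousOn_c2_fst {S : Plant} (hS : S.Admissible) :
    ContinuousOn (Function.uncurry fun x (_ : ℝ) => S.c2 x) (triangle S.ℓ) :=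
  hS.c2_cont.comp continuousOn_fst fun _ hp => ⟨hp.1.trans hp.2.1, hp.2.2⟩

lemma Plant.Admissible.continuousOn_c2_snd {S : Plant} (hS : S.Admissible) :
    ContinuousOn (Function.uncurry fun (_ : ℝ) ξ => S.c2 ξ) (triangle S.ℓ) :=
  hS.c2_cont.comp continuousOn_snd fun _ hp => ⟨hp.1, hp.2.1.trans hp.2.2⟩

lemma forall_fin_two_of {p : Fin 2 → Prop} (h0 : p 0) (h1 : p 1) : ∀ i, p i :=
  Fin.forall_fin_two.2 ⟨h0, h1⟩

lemma continuousOn_zero_kernel (ℓ : ℝ) :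
    ContinuousOn (Function.uncurry fun _ _ : ℝ => (0 : ℝ)) (triangle ℓ) := continuousOn_const

/-- The entries 11 and 22 travel parallel to the diagonal and form the first Goursat family. The
entries 12 and 21 carry data on the diagonal and form the second. The conditions on ξ = 0 couple
entries of the same row. -/
lemma exists_controlKernel {S : Plant} (hS : S.Admissible) : ∃ K, IsControlKernel S K := by
  have z := continuousOn_zero_kernel S.ℓ
  have h1 := hS.lam1_pos
  have h2 := hS.lam2_pos
  obtain ⟨F, G, hF, hG, eF, eG, bF, bG⟩ := exists_goursat hS.ℓ_pos
    (a := ![S.lam1, S.lam2]) (b := ![S.lam1, S.lam2]) (d := ![S.lam2, S.lam1])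
    (forall_fin_two_of h1 h2) (forall_fin_two_of h1 h2) (forall_fin_two_of h2 h1)
    (f := ![![fun _ ξ => -S.c2 ξ, fun _ _ => 0],
      ![fun _ _ => 0, fun _ ξ => S.c1 ξ]]) (g := ![![fun _ ξ => -S.c1 ξ, fun _ _ => 0],
      ![fun _ _ => 0, fun _ ξ => S.c2 ξ]])
    (forall_fin_two_of (forall_fin_two_of hS.continuousOn_c2_snd.neg z)
      (forall_fin_two_of z hS.continuousOn_c1_snd))
    (forall_fin_two_of (forall_fin_two_of hS.continuousOn_c1_snd.neg z)
      (forall_fin_two_of z hS.continuousOn_c2_snd))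
    ![![S.lam2 / (S.q * S.lam1), 0],
      ![0, S.q * S.lam1 / S.lam2]]
    (φ := ![fun x => S.c1 x / (S.lam1 + S.lam2), fun x => -(S.c2 x / (S.lam1 + S.lam2))])
    (forall_fin_two_of (hS.c1_cont.div_const _) (hS.c2_cont.div_const _).neg)
  refine ⟨⟨F 0, G 0, G 1, F 1⟩, ⟨⟨(hF 0).continuousOn, (hG 0).continuousOn, (hG 1).continuousOn, (hF 1).continuousOn⟩,
    (eF 0).congr fun x ξ => by simp, (eG 0).congr fun x ξ => by simp,
    (eG 1).congr fun x ξ => by simp, (eF 1).congr fun x ξ => by simp,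
    fun x hx => by simpa using bF 0 x hx, fun x hx => by simpa using bG 0 x hx,
    fun x hx => by simpa using bF 1 x hx, fun x hx => by simpa using bG 1 x hx⟩⟩

lemma exists_inverseKernel {S : Plant} (hS : S.Admissible) : ∃ L, IsInverseKernel S L := by
  have z := continuousOn_zero_kernel S.ℓ
  have h1 := hS.lam1_pos
  have h2 := hS.lam2_pos
  obtain ⟨F, G, hF, hG, eF, eG, bF, bG⟩ := exists_goursat hS.ℓ_pos
    (a := ![S.lam1, S.lam2]) (b := ![S.lam1, S.lam2]) (d := ![S.lam2, S.lam1])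
    (forall_fin_two_of h1 h2) (forall_fin_two_of h1 h2) (forall_fin_two_of h2 h1)
    (f := ![![fun _ _ => 0, fun x _ => S.c1 x],
      ![fun x _ => -S.c2 x, fun _ _ => 0]]) (g := ![![fun _ _ => 0, fun x _ => S.c1 x],
      ![fun x _ => -S.c2 x, fun _ _ => 0]])
    (forall_fin_two_of (forall_fin_two_of z hS.continuousOn_c1_fst)
      (forall_fin_two_of hS.continuousOn_c2_fst.neg z))
    (forall_fin_two_of (forall_fin_two_of z hS.continuousOn_c1_fst)
      (forall_fin_two_of hS.continuousOn_c2_fst.neg z))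
    ![![S.lam2 / (S.q * S.lam1), 0],
      ![0, S.q * S.lam1 / S.lam2]]
    (φ := ![fun x => S.c1 x / (S.lam1 + S.lam2), fun x => -(S.c2 x / (S.lam1 + S.lam2))])
    (forall_fin_two_of (hS.c1_cont.div_const _) (hS.c2_cont.div_const _).neg)
  refine ⟨⟨F 0, G 0, G 1, F 1⟩, ⟨⟨(hF 0).continuousOn, (hG 0).continuousOn, (hG 1).continuousOn, (hF 1).continuousOn⟩,
    (eF 0).congr fun x ξ => by simp, (eG 0).congr fun x ξ => by simp,
    (eG 1).congr fun x ξ => by simp, (eF 1).congr fun x ξ => by simp,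
    fun x hx => by simpa using bF 0 x hx, fun x hx => by simpa using bG 0 x hx,
    fun x hx => by simpa using bF 1 x hx, fun x hx => by simpa using bG 1 x hx⟩⟩

/-- Here the conditions lie on x = ℓ and couple entries of the same column, so the reflection matrix
is antidiagonal. -/
lemma exists_observerKernel {S : Plant} (hS : S.Admissible) : ∃ P, IsObserverKernel S P := by
  have z := continuousOn_zero_kernel S.ℓ
  have h1 := hS.lam1_pos
  have h2 := hS.lam2_pos
  obtain ⟨F, G, hF, hG, eF, eG, bF, bG⟩ := exists_goursat_right hS.ℓ_pos
    (a := ![S.lam1, S.lam2]) (b := ![S.lam1, S.lam2]) (d := ![S.lam2, S.lam1])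
    (forall_fin_two_of h1 h2) (forall_fin_two_of h1 h2) (forall_fin_two_of h2 h1)
    (f := ![![fun _ _ => 0, fun x _ => S.c1 x],
      ![fun x _ => -S.c2 x, fun _ _ => 0]]) (g := ![![fun _ _ => 0, fun x _ => S.c1 x],
      ![fun x _ => -S.c2 x, fun _ _ => 0]])
    (forall_fin_two_of (forall_fin_two_of z hS.continuousOn_c1_fst)
      (forall_fin_two_of hS.continuousOn_c2_fst.neg z))
    (forall_fin_two_of (forall_fin_two_of z hS.continuousOn_c1_fst)
      (forall_fin_two_of hS.continuousOn_c2_fst.neg z))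
    ![![0, 1 / S.rho],
      ![S.rho, 0]]
    (φ := ![fun x => -(S.c1 x / (S.lam1 + S.lam2)), fun x => S.c2 x / (S.lam1 + S.lam2)])
    (forall_fin_two_of (hS.c1_cont.div_const _).neg (hS.c2_cont.div_const _))
  refine ⟨⟨F 0, G 0, G 1, F 1⟩, ⟨⟨(hF 0).continuousOn, (hG 0).continuousOn, (hG 1).continuousOn, (hF 1).continuousOn⟩,
    (eF 0).congr fun x ξ => by simp, (eG 0).congr fun x ξ => by simp,
    (eG 1).congr fun x ξ => by simp, (eF 1).congr fun x ξ => by simp,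
    fun x hx => by simpa using bF 0 x hx, fun x hx => by simpa using bG 0 x hx,
    fun x hx => by simpa using bF 1 x hx, fun x hx => by simpa using bG 1 x hx⟩⟩

/-- Kernels of the transformation of the observer error to pure transport. -/
lemma exists_observerInverse {S : Plant} (hS : S.Admissible) : ∃ Q, CtrlEq S Q ∧
    (∀ ξ ∈ Icc 0 S.ℓ, Q.k21 S.ℓ ξ = S.rho * Q.k11 S.ℓ ξ) ∧
    ∀ ξ ∈ Icc 0 S.ℓ, Q.k22 S.ℓ ξ = S.rho * Q.k12 S.ℓ ξ := by
  have z := continuousOn_zero_kernel S.ℓ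
  have h1 := hS.lam1_pos
  have h2 := hS.lam2_pos
  obtain ⟨F, G, hF, hG, eF, eG, bF, bG⟩ := exists_goursat_right hS.ℓ_pos
    (a := ![S.lam1, S.lam2]) (b := ![S.lam1, S.lam2]) (d := ![S.lam2, S.lam1])
    (forall_fin_two_of h1 h2) (forall_fin_two_of h1 h2) (forall_fin_two_of h2 h1)
    (f := ![![fun _ ξ => -S.c2 ξ, fun _ _ => 0],
      ![fun _ _ => 0, fun _ ξ => S.c1 ξ]]) (g := ![![fun _ ξ => -S.c1 ξ, fun _ _ => 0],
      ![fun _ _ => 0, fun _ ξ => S.c2 ξ]])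
    (forall_fin_two_of (forall_fin_two_of hS.continuousOn_c2_snd.neg z)
      (forall_fin_two_of z hS.continuousOn_c1_snd))
    (forall_fin_two_of (forall_fin_two_of hS.continuousOn_c1_snd.neg z)
      (forall_fin_two_of z hS.continuousOn_c2_snd))
    ![![0, 1 / S.rho],
      ![S.rho, 0]]
    (φ := ![fun x => S.c1 x / (S.lam1 + S.lam2), fun x => -(S.c2 x / (S.lam1 + S.lam2))])
    (forall_fin_two_of (hS.c1_cont.div_const _) (hS.c2_cont.div_const _).neg)
  refine ⟨⟨F 0, G 0, G 1, F 1⟩, ⟨⟨(hF 0).continuousOn, (hG 0).continuousOn, (hG 1).continuousOn, (hF 1).continuousOn⟩,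
    (eF 0).congr fun x ξ => by simp, (eG 0).congr fun x ξ => by simp,
    (eG 1).congr fun x ξ => by simp, (eF 1).congr fun x ξ => by simp,
    fun x hx => by simpa using bG 0 x hx, fun x hx => by simpa using bG 1 x hx⟩,
    fun ξ hξ => ?_, fun ξ hξ => by simpa using bF 1 ξ hξ⟩
  have := bF 0 ξ hξ
  have hρ := hS.rho_ne
  simp at this
  simp only [this]
  field_simp

/-! ### Differentiation under the integral sign with moving limits -/

lemma hasDerivAt_integral_fixed {f f' : ℝ → ℝ → ℝ} (hf : Continuous (Function.uncurry f))
    (hf' : Continuous (Function.uncurry f'))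
    (hd : ∀ σ s, HasDerivAt (fun σ => f σ s) (f' σ s) σ) (A B σ₀ : ℝ) :
    HasDerivAt (fun σ => ∫ s in A..B, f σ s) (∫ s in A..B, f' σ₀ s) σ₀ := by
  have hc : ∀ {f : ℝ → ℝ → ℝ} (σ : ℝ), Continuous (Function.uncurry f) → Continuous (f σ) :=
    fun σ h => h.comp (f := fun s : ℝ => (σ, s)) (by fun_prop)
  obtain ⟨M, hM⟩ := ((isCompact_closedBall σ₀ 1).prod
    (isCompact_uIcc (a := A) (b := B))).exists_bound_of_continuousOn hf'.continuousOn
  refine (intervalIntegral.hasDerivAt_integral_of_dominated_loc_of_deriv_le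
    (F := f) (F' := f') (bound := fun _ => M) (s := Metric.ball σ₀ 1) (Metric.ball_mem_nhds _ one_pos)
    (Filter.Eventually.of_forall fun σ => (hc σ hf).aestronglyMeasurable)
    ((hc σ₀ hf).intervalIntegrable _ _) (hc σ₀ hf').aestronglyMeasurable ?_
    intervalIntegrable_const ?_).2
  · refine Filter.Eventually.of_forall fun s hs σ hσ => ?_
    exact hM (σ, s) ⟨Metric.ball_subset_closedBall hσ, uIoc_subset_uIcc hs⟩
  · exact Filter.Eventually.of_forall fun s _ σ _ => hd σ s

/-- Rescaling the short interval to [0,1] writes the integral as σ times a continuous function of σ,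
whose value at 0 is the derivative. No derivative of `f` enters. -/
lemma hasDerivAt_integral_of_moving_limit {f : ℝ → ℝ → ℝ} (hf : Continuous (Function.uncurry f))
    (B β : ℝ) : HasDerivAt (fun σ => ∫ s in B..(B + β * σ), f σ s) (β * f 0 B) 0 := by
  have e : ∀ σ : ℝ, ∫ s in B..(B + β * σ), f σ s =
      σ * (β * ∫ u in (0 : ℝ)..1, f σ (B + β * σ * u)) := by
    intro σ
    have := intervalIntegral.smul_integral_comp_add_mul (a := 0) (b := 1) (f σ) (β * σ) B
    simp only [mul_zero, add_zero, mul_one, smul_eq_mul] at this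
    rw [← this]; ring
  have hc : Continuous fun σ : ℝ => β * ∫ u in (0 : ℝ)..1, f σ (B + β * σ * u) := by
    refine continuous_const.mul ?_
    apply intervalIntegral.continuous_parametric_intervalIntegral_of_continuous'
    exact hf.comp (f := fun p : ℝ × ℝ => (p.1, B + β * p.1 * p.2)) (by fun_prop)
  rw [hasDerivAt_iff_tendsto_slope]
  have h1 : Filter.Tendsto (fun σ : ℝ => β * ∫ u in (0 : ℝ)..1, f σ (B + β * σ * u))
      (nhdsWithin 0 {0}ᶜ) (nhds (β * f 0 B)) := by
    have := (hc.tendsto 0).mono_left (nhdsWithin_le_nhds (s := {0}ᶜ))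
    simpa using this
  refine h1.congr' ?_
  filter_upwards [self_mem_nhdsWithin] with σ hσ
  rw [slope_def_field, e σ, e 0]
  have : σ ≠ 0 := hσ
  field_simp
  ring

lemma hasDerivAt_integral_moving {f f' : ℝ → ℝ → ℝ} (hf : Continuous (Function.uncurry f))
    (hf' : Continuous (Function.uncurry f'))
    (hd : ∀ σ s, HasDerivAt (fun σ => f σ s) (f' σ s) σ) (A α B β : ℝ) :
    HasDerivAt (fun σ => ∫ s in (A + α * σ)..(B + β * σ), f σ s)
      ((∫ s in A..B, f' 0 s) + β * f 0 B - α * f 0 A) 0 := by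
  have hc : ∀ (σ : ℝ), Continuous (f σ) :=
    fun σ => hf.comp (f := fun s : ℝ => (σ, s)) (by fun_prop)
  have h := ((hasDerivAt_integral_fixed hf hf' hd A B 0).add
    (hasDerivAt_integral_of_moving_limit hf B β)).sub
    (hasDerivAt_integral_of_moving_limit hf A α)
  refine h.congr_of_eventuallyEq (Filter.Eventually.of_forall fun σ => ?_)
  have i := fun a b => (hc σ).intervalIntegrable (μ := volume) a b
  simp only [Pi.add_apply, Pi.sub_apply]
  rw [intervalIntegral.integral_add_adjacent_intervals (i _ _) (i _ _),
    intervalIntegral.integral_interval_sub_left (i _ _) (i _ _)]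

/-! ### Kernels with a characteristic derivative -/

/-- `k` extends continuously to the plane with continuous characteristic derivative `g`. -/
def CharExt (ℓ a b : ℝ) (k g : ℝ → ℝ → ℝ) : Prop :=
  ∃ k' g' : ℝ → ℝ → ℝ, Continuous (Function.uncurry k') ∧ Continuous (Function.uncurry g') ∧
    (∀ x ξ, (x, ξ) ∈ triangle ℓ → k' x ξ = k x ξ) ∧
    (∀ x ξ, (x, ξ) ∈ triangle ℓ → g' x ξ = g x ξ) ∧
    ∀ x ξ s, HasDerivAt (fun s : ℝ => k' (x + a * s) (ξ + b * s)) (g' (x + a * s) (ξ + b * s)) s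

lemma CharExt.reverse {ℓ a b : ℝ} {k g : ℝ → ℝ → ℝ} (h : CharExt ℓ a b k g) :
    CharExt ℓ (-a) (-b) k (fun x ξ => -g x ξ) := by
  obtain ⟨k', g', hk, hg, ek, eg, hd⟩ := h
  refine ⟨k', fun x ξ => -g' x ξ, hk, hg.neg, ek, fun x ξ hp => by simp only [eg x ξ hp], ?_⟩
  intro x ξ s
  have := HasDerivAt.comp (h := fun s : ℝ => -s) s (hd x ξ (-s)) (hasDerivAt_neg s)
  refine (this.congr_of_eventuallyEq (Filter.Eventually.of_forall fun s => ?_)).congr_deriv ?_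
  · simp
  · simp

lemma openTriangle_eventually {ℓ a b x ξ : ℝ} (h0 : 0 < ξ) (h1 : ξ < x) (h2 : x < ℓ) :
    ∀ᶠ σ : ℝ in nhds 0, (x + a * σ, ξ + b * σ) ∈ openTriangle ℓ := by
  have c1 : Continuous fun σ : ℝ => x + a * σ := by fun_prop
  have c2 : Continuous fun σ : ℝ => ξ + b * σ := by fun_prop
  have e1 : ∀ᶠ σ : ℝ in nhds 0, 0 < ξ + b * σ :=
    continuousAt_const.eventually_lt c2.continuousAt (by simpa using h0)
  have e2 : ∀ᶠ σ : ℝ in nhds 0, ξ + b * σ < x + a * σ :=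
    c2.continuousAt.eventually_lt c1.continuousAt (by simpa using h1)
  have e3 : ∀ᶠ σ : ℝ in nhds 0, x + a * σ < ℓ :=
    c1.continuousAt.eventually_lt continuousAt_const (by simpa using h2)
  filter_upwards [e1, e2, e3] with σ u v w using ⟨u, v, w⟩

/-- The characteristic derivative of a composition of kernels. -/
lemma CharExt.charEq_comp {ℓ a b c : ℝ} {k g l m : ℝ → ℝ → ℝ} (hk : CharExt ℓ a b k g)
    (hl : CharExt ℓ b c l m) :
    CharEq ℓ a c (fun x ξ => ∫ s in ξ..x, k x s * l s ξ) (fun x ξ =>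
      (∫ s in ξ..x, (g x s * l s ξ + k x s * m s ξ)) + (a - b) * (k x x * l x ξ)
        - (c - b) * (k x ξ * l ξ ξ)) := by
  obtain ⟨k', g', ck, cg, ek, eg, dk⟩ := hk
  obtain ⟨l', m', cl, cm, el, em, dl⟩ := hl
  intro x ξ h0 h1 h2
  have hcont : ∀ {k : ℝ → ℝ → ℝ}, Continuous (Function.uncurry k) → ∀ p q : ℝ × ℝ → ℝ,
      Continuous p → Continuous q → Continuous fun z => k (p z) (q z) :=
    fun h p q hp hq => h.comp (f := fun z => (p z, q z)) (hp.prodMk hq)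
  -- The integration variable is shifted by bσ. Then k moves along its characteristic (a, b) and l
  -- along (b, c), while the limits x and ξ move with the relative speeds a - b and c - b.
  have key := hasDerivAt_integral_moving
    (f := fun σ s => k' (x + a * σ) (s + b * σ) * l' (s + b * σ) (ξ + c * σ))
    (f' := fun σ s => g' (x + a * σ) (s + b * σ) * l' (s + b * σ) (ξ + c * σ) +
      k' (x + a * σ) (s + b * σ) * m' (s + b * σ) (ξ + c * σ)) ?_ ?_ ?_ ξ (c - b) x (a - b)
  · have t : ∀ {x ξ s : ℝ}, 0 ≤ ξ → x ≤ ℓ → s ∈ Icc ξ x →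
        (x, s) ∈ triangle ℓ ∧ (s, ξ) ∈ triangle ℓ := fun h0 h2 hs =>
      ⟨⟨h0.trans hs.1, hs.2, h2⟩, ⟨h0, hs.1, hs.2.trans h2⟩⟩
    refine (key.congr_of_eventuallyEq ?_).congr_deriv ?_
    · filter_upwards [openTriangle_eventually (a := a) (b := c) h0 h1 h2] with σ hσ
      obtain ⟨u, v, w⟩ := hσ
      simp only at u v w
      have e1 : ξ + (c - b) * σ = ξ + c * σ - b * σ := by ring
      have e2 : x + (a - b) * σ = x + a * σ - b * σ := by ring
      rw [e1, e2, intervalIntegral.integral_comp_add_right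
        (fun s => k' (x + a * σ) s * l' s (ξ + c * σ)), sub_add_cancel, sub_add_cancel]
      refine intervalIntegral.integral_congr fun s hs => ?_
      rw [uIcc_of_le v.le] at hs
      rw [ek _ _ (t u.le w.le hs).1, el _ _ (t u.le w.le hs).2]
    · simp only [mul_zero, add_zero]
      have hx := t h0.le h2.le (right_mem_Icc.2 h1.le)
      have hξ := t h0.le h2.le (left_mem_Icc.2 h1.le)
      rw [ek _ _ hx.1, el _ _ hx.2, ek _ _ hξ.1, el _ _ hξ.2]
      congr 2
      refine intervalIntegral.integral_congr fun s hs => ?_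
      rw [uIcc_of_le h1.le] at hs
      have hs := t h0.le h2.le hs
      rw [ek _ _ hs.1, el _ _ hs.2, eg _ _ hs.1, em _ _ hs.2]
  · exact (hcont ck _ _ (by fun_prop) (by fun_prop)).mul (hcont cl _ _ (by fun_prop) (by fun_prop))
  · exact ((hcont cg _ _ (by fun_prop) (by fun_prop)).mul
      (hcont cl _ _ (by fun_prop) (by fun_prop))).add
      ((hcont ck _ _ (by fun_prop) (by fun_prop)).mul (hcont cm _ _ (by fun_prop) (by fun_prop)))
  · intro σ s
    exact (dk x s σ).mul (dl s ξ σ)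

/-- The adjoint of an integral operator applied to a `C¹` function is `C¹`. -/
lemma CharExt.exists_adjoint {ℓ a b : ℝ} {k g : ℝ → ℝ → ℝ} (hk : CharExt ℓ a b k g) (hb : b ≠ 0)
    {φ : ℝ → ℝ} (hφ : ContDiff ℝ 1 φ) :
    ∃ Ψ : ℝ → ℝ, ContDiff ℝ 1 Ψ ∧ (∀ ξ ∈ Icc 0 ℓ, Ψ ξ = ∫ s in ξ..ℓ, k s ξ * φ s) ∧
      ∀ ξ ∈ Icc 0 ℓ, b * deriv Ψ ξ = (∫ s in ξ..ℓ, (g s ξ * φ s + a * (k s ξ * deriv φ s)))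
        - a * (k ℓ ξ * φ ℓ) - (b - a) * (k ξ ξ * φ ξ) := by
  obtain ⟨k', g', ck, cg, ek, eg, dk⟩ := hk
  have hcont : ∀ {k : ℝ → ℝ → ℝ}, Continuous (Function.uncurry k) → ∀ p q : ℝ × ℝ → ℝ,
      Continuous p → Continuous q → Continuous fun z => k (p z) (q z) :=
    fun h p q hp hq => h.comp (f := fun z => (p z, q z)) (hp.prodMk hq)
  have hφ' : Continuous (deriv φ) := hφ.continuous_deriv le_rfl
  have hφc : Continuous φ := hφ.continuous
  set Ψ : ℝ → ℝ := fun ξ => ∫ s in ξ..ℓ, k' s ξ * φ s with hΨ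
  set R : ℝ → ℝ := fun ξ => (∫ s in ξ..ℓ, (g' s ξ * φ s + a * (k' s ξ * deriv φ s)))
        - a * (k' ℓ ξ * φ ℓ) - (b - a) * (k' ξ ξ * φ ξ) with hR
  have hd : ∀ ξ, HasDerivAt Ψ (R ξ / b) ξ := by
    intro ξ
    -- A derivative of k in ξ alone need not exist. Shifting s by aσ while ξ moves by bσ
    -- differentiates k along its characteristic and puts the remaining derivative on φ.
    have key := hasDerivAt_integral_moving
      (f := fun σ s => k' (s + a * σ) (ξ + b * σ) * φ (s + a * σ))
      (f' := fun σ s => g' (s + a * σ) (ξ + b * σ) * φ (s + a * σ) +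
        k' (s + a * σ) (ξ + b * σ) * (deriv φ (s + a * σ) * a)) ?_ ?_ ?_ ξ (b - a) ℓ (-a)
    · have h1 : HasDerivAt (fun η : ℝ => (η - ξ) / b) (1 / b) ξ :=
        ((hasDerivAt_id ξ).sub_const ξ).div_const b
      have h2 := HasDerivAt.comp (h := fun η : ℝ => (η - ξ) / b) ξ (by simpa using key) h1
      refine (h2.congr_of_eventuallyEq (Filter.Eventually.of_forall fun η => ?_)).congr_deriv ?_
      · simp only [Function.comp]
        have e1 : ξ + (b - a) * ((η - ξ) / b) = η - a * ((η - ξ) / b) := by field_simp; ring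
        have e2 : ξ + b * ((η - ξ) / b) = η := by field_simp; ring
        have e3 : ℓ + -(a * ((η - ξ) / b)) = ℓ - a * ((η - ξ) / b) := by ring
        rw [e1, e2, e3, intervalIntegral.integral_comp_add_right
          (fun s => k' s η * φ s), sub_add_cancel, sub_add_cancel]
      · rw [hR, mul_one_div]
        congr 1
        have : ∀ s, k' s ξ * (deriv φ s * a) = a * (k' s ξ * deriv φ s) := fun s => by ring
        simp only [this]
        ring
    · exact (hcont ck _ _ (by fun_prop) (by fun_prop)).mul
        (hφc.comp (f := fun z : ℝ × ℝ => z.2 + a * z.1) (by fun_prop))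
    · exact ((hcont cg _ _ (by fun_prop) (by fun_prop)).mul
        (hφc.comp (f := fun z : ℝ × ℝ => z.2 + a * z.1) (by fun_prop))).add
        ((hcont ck _ _ (by fun_prop) (by fun_prop)).mul
        ((hφ'.comp (f := fun z : ℝ × ℝ => z.2 + a * z.1) (by fun_prop)).mul continuous_const))
    · intro σ s
      refine (dk s ξ σ).mul ?_
      have h1 : HasDerivAt (fun σ : ℝ => s + a * σ) a σ := by
        simpa using ((hasDerivAt_id σ).const_mul a).const_add s
      exact ((hφ.differentiable one_ne_zero) (s + a * σ)).hasDerivAt.comp σ h1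
  have hRc : Continuous R := by
    have i1 : Continuous fun ξ => ∫ s in ξ..ℓ, (g' s ξ * φ s + a * (k' s ξ * deriv φ s)) := by
      simp only [intervalIntegral.integral_symm ℓ]
      refine Continuous.neg ?_
      exact intervalIntegral.continuous_parametric_intervalIntegral_of_continuous
        (f := fun ξ s => g' s ξ * φ s + a * (k' s ξ * deriv φ s))
        (((hcont cg _ _ (by fun_prop) (by fun_prop)).mul (hφc.comp continuous_snd)).add
          (continuous_const.mul ((hcont ck _ _ (by fun_prop) (by fun_prop)).mul
            (hφ'.comp continuous_snd)))) continuous_id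
    have i2 : Continuous fun ξ => k' ℓ ξ := ck.comp (f := fun ξ : ℝ => (ℓ, ξ)) (by fun_prop)
    have i3 : Continuous fun ξ => k' ξ ξ := ck.comp (f := fun ξ : ℝ => (ξ, ξ)) (by fun_prop)
    exact (i1.sub (continuous_const.mul (i2.mul continuous_const))).sub
      (continuous_const.mul (i3.mul hφc))
  have hderiv : deriv Ψ = fun ξ => R ξ / b := funext fun ξ => (hd ξ).deriv
  have t : ∀ {ξ s : ℝ}, ξ ∈ Icc 0 ℓ → s ∈ uIcc ξ ℓ → (s, ξ) ∈ triangle ℓ := by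
    intro ξ s hξ hs
    rw [uIcc_of_le hξ.2] at hs
    exact ⟨hξ.1, hs.1, hs.2⟩
  refine ⟨Ψ, ?_, ?_, ?_⟩
  · rw [contDiff_one_iff_deriv]
    exact ⟨fun ξ => (hd ξ).differentiableAt, by rw [hderiv]; exact hRc.div_const b⟩
  · intro ξ hξ
    refine intervalIntegral.integral_congr fun s hs => ?_
    rw [ek _ _ (t hξ hs)]
  · intro ξ hξ
    rw [hderiv]
    simp only
    rw [mul_div_cancel₀ _ hb, hR]
    simp only
    rw [ek _ _ (t hξ right_mem_uIcc), ek _ _ (t hξ left_mem_uIcc)]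
    congr 2
    refine intervalIntegral.integral_congr fun s hs => ?_
    rw [ek _ _ (t hξ hs), eg _ _ (t hξ hs)]

/-! ### Kernel equations in matrix form -/

lemma CharExt.continuousOn {ℓ a b : ℝ} {k g : ℝ → ℝ → ℝ} (h : CharExt ℓ a b k g) :
    ContinuousOn (Function.uncurry k) (triangle ℓ) := by
  obtain ⟨k', g', ck, -, ek, -, -⟩ := h
  exact ck.continuousOn.congr fun p hp => (ek p.1 p.2 hp).symm

lemma CharExt.continuousOn_deriv {ℓ a b : ℝ} {k g : ℝ → ℝ → ℝ} (h : CharExt ℓ a b k g) :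
    ContinuousOn (Function.uncurry g) (triangle ℓ) := by
  obtain ⟨k', g', -, cg, -, eg, -⟩ := h
  exact cg.continuousOn.congr fun p hp => (eg p.1 p.2 hp).symm

lemma CharExt.charEq {ℓ a b : ℝ} {k g : ℝ → ℝ → ℝ} (h : CharExt ℓ a b k g) :
    CharEq ℓ a b k g := by
  obtain ⟨k', g', -, -, ek, eg, hd⟩ := h
  intro x ξ h0 h1 h2
  have := hd x ξ 0
  simp only [mul_zero, add_zero] at this
  rw [eg x ξ ⟨h0.le, h1.le, h2.le⟩] at this
  refine this.congr_of_eventuallyEq ?_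
  filter_upwards [openTriangle_eventually (a := a) (b := b) h0 h1 h2] with σ hσ
  rw [ek _ _ (openTriangle_subset ℓ hσ)]

lemma CharExt.congr {ℓ a b : ℝ} {k g k₁ g₁ : ℝ → ℝ → ℝ} (h : CharExt ℓ a b k g)
    (hk : ∀ x ξ, k x ξ = k₁ x ξ) (hg : ∀ x ξ, g x ξ = g₁ x ξ) : CharExt ℓ a b k₁ g₁ := by
  obtain ⟨k', g', ck, cg, ek, eg, hd⟩ := h
  exact ⟨k', g', ck, cg, fun x ξ hp => (ek x ξ hp).trans (hk x ξ),
    fun x ξ hp => (eg x ξ hp).trans (hg x ξ), hd⟩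

lemma CharExt.opp {ℓ a b : ℝ} {k g : ℝ → ℝ → ℝ} (h : CharExt ℓ a b k g) :
    CharExt ℓ a b (fun x ξ => -k x ξ) (fun x ξ => -g x ξ) := by
  obtain ⟨k', g', ck, cg, ek, eg, hd⟩ := h
  exact ⟨fun x ξ => -k' x ξ, fun x ξ => -g' x ξ, ck.neg, cg.neg,
    fun x ξ hp => by simp only [ek x ξ hp], fun x ξ hp => by simp only [eg x ξ hp],
    fun x ξ s => (hd x ξ s).neg⟩

/-- The kernel `k` of a transformation `1 + k` intertwining `-Λ ∂ₓ + σ₁` and `-Λ ∂ₓ + σ₂`. -/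
structure KerEq (ℓ : ℝ) (Λ : Fin 2 → ℝ) (σ₁ σ₂ : Fin 2 → Fin 2 → ℝ → ℝ)
    (k : Fin 2 → Fin 2 → ℝ → ℝ → ℝ) : Prop where
  ext : ∀ i j, CharExt ℓ (Λ i) (Λ j) (k i j)
    (fun x ξ => ∑ m, (σ₂ i m x * k m j x ξ - k i m x ξ * σ₁ m j ξ))
  diag : ∀ i j, ∀ x ∈ Icc 0 ℓ, (Λ i - Λ j) * k i j x x = σ₂ i j x - σ₁ i j x

lemma continuousOn_slice_left {ℓ : ℝ} {k : ℝ → ℝ → ℝ}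
    (hk : ContinuousOn (Function.uncurry k) (triangle ℓ)) {x : ℝ} (hx : x ≤ ℓ) :
    ContinuousOn (fun s => k x s) (Icc 0 x) :=
  hk.comp (f := fun s : ℝ => (x, s)) (by fun_prop) fun _ hs => ⟨hs.1, hs.2, hx⟩

lemma continuousOn_slice_right {ℓ : ℝ} {k : ℝ → ℝ → ℝ}
    (hk : ContinuousOn (Function.uncurry k) (triangle ℓ)) {ξ : ℝ} (hξ : 0 ≤ ξ) :
    ContinuousOn (fun s => k s ξ) (Icc ξ ℓ) :=
  hk.comp (f := fun s : ℝ => (s, ξ)) (by fun_prop) fun _ hs => ⟨hξ, hs.1, hs.2⟩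

lemma intervalIntegrable_kernel_mul {ℓ : ℝ} {k l : ℝ → ℝ → ℝ}
    (hk : ContinuousOn (Function.uncurry k) (triangle ℓ))
    (hl : ContinuousOn (Function.uncurry l) (triangle ℓ)) {x ξ : ℝ} (hp : (x, ξ) ∈ triangle ℓ) :
    IntervalIntegrable (fun s => k x s * l s ξ) volume ξ x := by
  obtain ⟨h0, h1, h2⟩ := hp
  refine ContinuousOn.intervalIntegrable ?_
  rw [uIcc_of_le h1]
  exact ((continuousOn_slice_left hk h2).mono (Icc_subset_Icc_left h0)).mul
    ((continuousOn_slice_right hl h0).mono (Icc_subset_Icc_right h2))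

/-- The kernel of `(1 + k) ∘ (1 + l) - 1`. -/
def compKernel (k l : Fin 2 → Fin 2 → ℝ → ℝ → ℝ) (i j : Fin 2) (x ξ : ℝ) : ℝ :=
  k i j x ξ + l i j x ξ + ∑ m, ∫ s in ξ..x, k i m x s * l m j s ξ

/-- Continuity of the composition of kernels on the triangle. -/
lemma continuousOn_comp_kernel {ℓ : ℝ} (hℓ : 0 ≤ ℓ) {k l : ℝ → ℝ → ℝ}
    (hk : ContinuousOn (Function.uncurry k) (triangle ℓ))
    (hl : ContinuousOn (Function.uncurry l) (triangle ℓ)) :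
    ContinuousOn (Function.uncurry fun x ξ => ∫ s in ξ..x, k x s * l s ξ) (triangle ℓ) := by
  have ck := continuous_extendTri hℓ hk
  have cl := continuous_extendTri hℓ hl
  have h : Continuous fun p : ℝ × ℝ => ∫ s in p.2..p.1,
      extendTri ℓ k p.1 s * extendTri ℓ l s p.2 := by
    have hc : Continuous (Function.uncurry fun (p : ℝ × ℝ) (s : ℝ) =>
        extendTri ℓ k p.1 s * extendTri ℓ l s p.2) :=
      (ck.comp (f := fun z : (ℝ × ℝ) × ℝ => (z.1.1, z.2)) (by fun_prop)).mul
        (cl.comp (f := fun z : (ℝ × ℝ) × ℝ => (z.2, z.1.2)) (by fun_prop))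
    have e : ∀ p : ℝ × ℝ, (∫ s in p.2..p.1, extendTri ℓ k p.1 s * extendTri ℓ l s p.2) =
        (∫ s in (0 : ℝ)..p.1, extendTri ℓ k p.1 s * extendTri ℓ l s p.2) -
          ∫ s in (0 : ℝ)..p.2, extendTri ℓ k p.1 s * extendTri ℓ l s p.2 := by
      intro p
      have hp : Continuous fun s => extendTri ℓ k p.1 s * extendTri ℓ l s p.2 :=
        hc.comp (f := fun s : ℝ => (p, s)) (by fun_prop)
      rw [intervalIntegral.integral_interval_sub_left (hp.intervalIntegrable _ _)
        (hp.intervalIntegrable _ _)]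
    simp only [e]
    exact (intervalIntegral.continuous_parametric_intervalIntegral_of_continuous hc
      continuous_fst).sub
      (intervalIntegral.continuous_parametric_intervalIntegral_of_continuous hc continuous_snd)
  refine h.continuousOn.congr fun p hp => ?_
  obtain ⟨h0, h1, h2⟩ := hp
  refine intervalIntegral.integral_congr fun s hs => ?_
  rw [uIcc_of_le h1] at hs
  have m1 : (p.1, s) ∈ triangle ℓ := ⟨h0.trans hs.1, hs.2, h2⟩
  have m2 : (s, p.2) ∈ triangle ℓ := ⟨h0, hs.1, hs.2.trans h2⟩
  rw [extendTri_eq _ m1, extendTri_eq _ m2]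

/-- The product (1 + k)(1 + l) intertwines pure transport with itself. Under the integral the two
source terms cancel. The terms from the moving limits cancel the local source terms by the diagonal
conditions, the differences of speeds in the former being exactly the factors in the latter. -/
lemma KerEq.charEq_comp {ℓ : ℝ} {Λ : Fin 2 → ℝ} {σ : Fin 2 → Fin 2 → ℝ → ℝ}
    {k l : Fin 2 → Fin 2 → ℝ → ℝ → ℝ} (hk : KerEq ℓ Λ σ 0 k) (hl : KerEq ℓ Λ 0 σ l)
    (i j : Fin 2) : CharEq ℓ (Λ i) (Λ j) (compKernel k l i j) (fun _ _ => 0) := by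
  intro x ξ h0 h1 h2
  have hp : (x, ξ) ∈ triangle ℓ := ⟨h0.le, h1.le, h2.le⟩
  have hx : x ∈ Icc 0 ℓ := ⟨(h0.trans h1).le, h2.le⟩
  have hξ : ξ ∈ Icc 0 ℓ := ⟨h0.le, (h1.trans h2).le⟩
  have d1 := (hk.ext i j).charEq x ξ h0 h1 h2
  have d2 := (hl.ext i j).charEq x ξ h0 h1 h2
  have d3 := HasDerivAt.fun_sum fun (m : Fin 2) (_ : m ∈ Finset.univ) =>
    (hk.ext i m).charEq_comp (hl.ext m j) x ξ h0 h1 h2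
  refine ((d1.add d2).add d3).congr_deriv ?_
  have ii : ∀ m, IntervalIntegrable (fun s =>
      (∑ n, ((0 : Fin 2 → Fin 2 → ℝ → ℝ) i n x * k n m x s - k i n x s * σ n m s)) * l m j s ξ +
        k i m x s * ∑ n, (σ m n s * l n j s ξ - l m n s ξ * (0 : Fin 2 → Fin 2 → ℝ → ℝ) n j ξ))
      volume ξ x := fun m =>
    (intervalIntegrable_kernel_mul (hk.ext i m).continuousOn_deriv (hl.ext m j).continuousOn
      hp).add (intervalIntegrable_kernel_mul (hk.ext i m).continuousOn
        (hl.ext m j).continuousOn_deriv hp)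
  have e0 : ∀ s : ℝ, (∑ m, ((∑ n, ((0 : Fin 2 → Fin 2 → ℝ → ℝ) i n x * k n m x s -
      k i n x s * σ n m s)) * l m j s ξ + k i m x s * ∑ n, (σ m n s * l n j s ξ -
        l m n s ξ * (0 : Fin 2 → Fin 2 → ℝ → ℝ) n j ξ))) = 0 := by
    intro s
    simp only [Fin.sum_univ_two, Pi.zero_apply]
    ring
  have hint := intervalIntegral.integral_finsetSum (s := Finset.univ) fun m _ => ii m
  simp only [e0, intervalIntegral.integral_zero] at hint
  have b1 := fun m => hk.diag i m x hx
  have b2 := fun m => hl.diag m j ξ hξ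
  have q10 := b1 0
  have q11 := b1 1
  have q20 := b2 0
  have q21 := b2 1
  simp only [Fin.sum_univ_two, Pi.zero_apply] at hint q10 q11 q20 q21 ⊢
  linear_combination -hint + l 0 j x ξ * q10 + l 1 j x ξ * q11 + k i 0 x ξ * q20 + k i 1 x ξ * q21

/-- Two intertwining kernels that agree in their boundary conditions are inverse to each other. -/
lemma KerEq.comp_eq_zero {ℓ : ℝ} (hℓ : 0 < ℓ) {Λ : Fin 2 → ℝ} (hΛ0 : 0 < Λ 0) (hΛ1 : Λ 1 < 0)
    {σ : Fin 2 → Fin 2 → ℝ → ℝ} {k l : Fin 2 → Fin 2 → ℝ → ℝ → ℝ} (hk : KerEq ℓ Λ σ 0 k)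
    (hl : KerEq ℓ Λ 0 σ l)
    (hbc : ∀ i j, i ≠ j → ∀ y ∈ Icc 0 ℓ, ∃ ξ, (y + ξ, ξ) ∈ triangle ℓ ∧
      ((∀ i j, i ≠ j → ∀ x ξ, (x, ξ) ∈ triangle ℓ → compKernel k l i j x ξ = 0) →
        compKernel k l i i (y + ξ) ξ = 0)) {i j : Fin 2} {x ξ : ℝ}
    (hp : (x, ξ) ∈ triangle ℓ) : compKernel k l i j x ξ = 0 := by
  have hc : ∀ i j, ContinuousOn (Function.uncurry (compKernel k l i j)) (triangle ℓ) := by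
    intro i j
    refine ((hk.ext i j).continuousOn.add (hl.ext i j).continuousOn).add ?_
    exact continuousOn_finsetSum _ fun m _ =>
      continuousOn_comp_kernel hℓ.le (hk.ext i m).continuousOn (hl.ext m j).continuousOn
  -- An entry with zero characteristic derivative equals its value at the foot of its
  -- characteristic.
  have foot : ∀ {i j : Fin 2} {τ₁ τ₂ a b : ℝ}, CharDir ℓ τ₁ τ₂ a b →
      CharEq ℓ a b (compKernel k l i j) (fun _ _ => 0) → ∀ {x ξ : ℝ}, (x, ξ) ∈ triangle ℓ →
      compKernel k l i j x ξ = compKernel k l i j (x - a * (τ₁ * x + τ₂ * ξ))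
        (ξ - b * (τ₁ * x + τ₂ * ξ)) := by
    intro i j τ₁ τ₂ a b h he x ξ hp
    rw [← h.eq_charInt hℓ (hc i j) continuousOn_const he hp]
    unfold charInt
    rw [extendTri_eq _ (h.foot x ξ hp)]
    simp [extendTri]
  -- On the diagonal the integral part is void, and the conditions for k and l have opposite
  -- right-hand sides; distinct speeds allow division by Λ i - Λ j.
  have hdiag : ∀ i j, i ≠ j → ∀ y ∈ Icc 0 ℓ, compKernel k l i j y y = 0 := by
    intro i j hij y hy
    have h1 := hk.diag i j y hy
    have h2 := hl.diag i j y hy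
    have hne : Λ i - Λ j ≠ 0 := by
      fin_cases i <;> fin_cases j <;> simp at hij ⊢ <;> linarith
    simp only [compKernel, intervalIntegral.integral_same, Finset.sum_const_zero, add_zero]
    have : (Λ i - Λ j) * (k i j y y + l i j y y) = 0 := by
      rw [mul_add, h1, h2]; simp
    exact (mul_eq_zero.1 this).resolve_left hne
  have hanti : ∀ {i j : Fin 2} {b d : ℝ}, i ≠ j → 0 < b → 0 < d →
      CharEq ℓ b (-d) (compKernel k l i j) (fun _ _ => 0) → ∀ x ξ, (x, ξ) ∈ triangle ℓ →
      compKernel k l i j x ξ = 0 := by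
    intro i j b d hij hb hd he x ξ hp
    have hD := charDir_anti (ℓ := ℓ) hb hd
    rw [foot hD he hp]
    have hf := hD.foot x ξ hp
    have e : ξ - -d * (1 / (b + d) * x + -(1 / (b + d)) * ξ) =
        x - b * (1 / (b + d) * x + -(1 / (b + d)) * ξ) := by
      have : b + d ≠ 0 := by positivity
      field_simp; ring
    rw [e] at hf ⊢
    exact hdiag i j hij _ ⟨hf.1, hf.2.2⟩
  have hoff : ∀ i j, i ≠ j → ∀ x ξ, (x, ξ) ∈ triangle ℓ → compKernel k l i j x ξ = 0 := by
    intro i j hij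
    have he := hk.charEq_comp hl i j
    fin_cases i <;> fin_cases j
    · exact absurd rfl hij
    · exact hanti hij hΛ0 (neg_pos.2 hΛ1) (by simpa using he)
    · have := he.reverse
      exact hanti hij (neg_pos.2 hΛ1) hΛ0 (by simpa using this)
    · exact absurd rfl hij
  by_cases hij : i = j
  · subst hij
    have hd : ∀ {x ξ : ℝ}, (x, ξ) ∈ triangle ℓ →
        compKernel k l i i x ξ = compKernel k l i i (x - ξ) 0 := by
      intro x ξ hp
      have he := hk.charEq_comp hl i i
      obtain ⟨a, ha, he⟩ : ∃ a, 0 < a ∧ CharEq ℓ a a (compKernel k l i i) (fun _ _ => 0) := by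
        fin_cases i
        · exact ⟨Λ 0, hΛ0, he⟩
        · exact ⟨-Λ 1, neg_pos.2 hΛ1, by simpa using he.reverse⟩
      rw [foot (charDir_diag ha) he hp]
      have e : a * (0 * x + 1 / a * ξ) = ξ := by field_simp; ring
      rw [e, sub_self]
    -- A diagonal entry depends only on x - ξ. On each such line `hbc` supplies one point where it
    -- vanishes as soon as the off-diagonal entries do. The index i + 1 is the other element of `Fin
    -- 2`.
    obtain ⟨η, hη, h⟩ := hbc i (i + 1) (by fin_cases i <;> simp) (x - ξ)
      ⟨by linarith [hp.2.1], by linarith [hp.2.2, hp.1]⟩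
    have h' := h hoff
    rw [hd hη, add_sub_cancel_right] at h'
    rw [hd hp, h']
  · exact hoff i j hij x ξ hp

/-! ### The kernels of the plant -/

/-- Signed transport speeds. -/
def Plant.spd (S : Plant) : Fin 2 → ℝ := ![S.lam1, -S.lam2]

/-- In-domain coupling coefficients. -/
def Plant.src (S : Plant) : Fin 2 → Fin 2 → ℝ → ℝ := ![![0, S.c1], ![S.c2, 0]]

/-- The matrix of kernels, indexed by `Fin 2`. -/
def Kernels.mat (k : Kernels) : Fin 2 → Fin 2 → ℝ → ℝ → ℝ := ![![k.k11, k.k12], ![k.k21, k.k22]]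

lemma CharDir.charExt {ℓ τ₁ τ₂ a b : ℝ} (h : CharDir ℓ τ₁ τ₂ a b) (hℓ : 0 < ℓ)
    {k g : ℝ → ℝ → ℝ} (hk : ContinuousOn (Function.uncurry k) (triangle ℓ))
    (he : CharEq ℓ a b k g) (hg : ContinuousOn (Function.uncurry g) (triangle ℓ)) :
    CharExt ℓ a b k g := h.exists_extension hℓ hk hg he

/-- The transformation is 1 - K, hence the opposite kernel. In the second row the characteristics
are traversed backwards to match the signed speed -λ₂. -/
lemma CtrlEq.kerEq {S : Plant} (hS : S.Admissible) {K : Kernels} (h : CtrlEq S K) :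
    KerEq S.ℓ S.spd S.src 0 K.opp.mat where
  ext := by
    have hℓ := hS.ℓ_pos
    have h1 := hS.lam1_pos
    have h2 := hS.lam2_pos
    refine forall_fin_two_of (forall_fin_two_of ?_ ?_) (forall_fin_two_of ?_ ?_)
    · refine ((charDir_diag h1).charExt hℓ h.cont.c11 h.eq11
        (hS.continuousOn_c2_snd.neg.mul h.cont.c12)).opp.congr (fun _ _ => rfl) ?_
      intro x ξ
      simp [Kernels.mat, Kernels.opp, Plant.src]; ring
    · refine ((charDir_anti h1 h2).charExt hℓ h.cont.c12 h.eq12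
        (hS.continuousOn_c1_snd.neg.mul h.cont.c11)).opp.congr (fun _ _ => rfl) ?_
      intro x ξ
      simp [Kernels.mat, Kernels.opp, Plant.src]; ring
    · have := ((charDir_anti h2 h1).charExt hℓ h.cont.c21 h.eq21
        (hS.continuousOn_c2_snd.mul h.cont.c22)).reverse.opp
      rw [neg_neg] at this
      refine this.congr (fun _ _ => rfl) ?_
      intro x ξ
      simp [Kernels.mat, Kernels.opp, Plant.src]; ring
    · refine ((charDir_diag h2).charExt hℓ h.cont.c22 h.eq22
        (hS.continuousOn_c1_snd.mul h.cont.c21)).reverse.opp.congr (fun _ _ => rfl) ?_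
      intro x ξ
      simp [Kernels.mat, Kernels.opp, Plant.src]; ring
  diag := by
    have h1 := hS.lam1_pos
    have h2 := hS.lam2_pos
    refine forall_fin_two_of (forall_fin_two_of ?_ ?_) (forall_fin_two_of ?_ ?_) <;> intro x hx <;>
      simp [Kernels.mat, Kernels.opp, Plant.src, Plant.spd, h.bc12 x hx, h.bc21 x hx] <;>
      field_simp
    ring

lemma InvEq.kerEq {S : Plant} (hS : S.Admissible) {L : Kernels} (h : InvEq S L) :
    KerEq S.ℓ S.spd 0 S.src L.mat where
  ext := by
    have hℓ := hS.ℓ_pos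
    have h1 := hS.lam1_pos
    have h2 := hS.lam2_pos
    refine forall_fin_two_of (forall_fin_two_of ?_ ?_) (forall_fin_two_of ?_ ?_)
    · refine ((charDir_diag h1).charExt hℓ h.cont.c11 h.eq11
        (hS.continuousOn_c1_fst.mul h.cont.c21)).congr (fun _ _ => rfl) ?_
      intro x ξ
      simp [Kernels.mat, Plant.src]
    · refine ((charDir_anti h1 h2).charExt hℓ h.cont.c12 h.eq12
        (hS.continuousOn_c1_fst.mul h.cont.c22)).congr (fun _ _ => rfl) ?_
      intro x ξ
      simp [Kernels.mat, Plant.src]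
    · have := ((charDir_anti h2 h1).charExt hℓ h.cont.c21 h.eq21
        (hS.continuousOn_c2_fst.neg.mul h.cont.c11)).reverse
      rw [neg_neg] at this
      refine this.congr (fun _ _ => rfl) ?_
      intro x ξ
      simp [Kernels.mat, Plant.src]
    · refine ((charDir_diag h2).charExt hℓ h.cont.c22 h.eq22
        (hS.continuousOn_c2_fst.neg.mul h.cont.c12)).reverse.congr (fun _ _ => rfl) ?_
      intro x ξ
      simp [Kernels.mat, Plant.src]
  diag := by
    have h1 := hS.lam1_pos
    have h2 := hS.lam2_pos
    refine forall_fin_two_of (forall_fin_two_of ?_ ?_) (forall_fin_two_of ?_ ?_) <;> intro x hx <;>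
      simp [Kernels.mat, Plant.src, Plant.spd, h.bc12 x hx, h.bc21 x hx] <;>
      field_simp
    ring

/-- A column of a product of kernels involves only the same column of the right factor, so
proportionality of two columns at ξ = 0 survives composition. -/
lemma compKernel_col {ℓ : ℝ} {k l : Fin 2 → Fin 2 → ℝ → ℝ → ℝ} {i j : Fin 2} {κ y : ℝ}
    (hy : y ∈ Icc 0 ℓ) (hk : ∀ m, ∀ s ∈ Icc 0 ℓ, k m i s 0 = κ * k m j s 0)
    (hl : ∀ m, ∀ s ∈ Icc 0 ℓ, l m i s 0 = κ * l m j s 0) (n : Fin 2) :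
    compKernel k l n i y 0 = κ * compKernel k l n j y 0 := by
  unfold compKernel
  rw [hk n y hy, hl n y hy, mul_add, mul_add, Finset.mul_sum]
  congr 1
  refine Finset.sum_congr rfl fun m _ => ?_
  rw [← intervalIntegral.integral_const_mul]
  refine intervalIntegral.integral_congr fun s hs => ?_
  rw [uIcc_of_le hy.1] at hs
  rw [hl m s ⟨hs.1, hs.2.trans hy.2⟩]
  ring

/-- A row of a product involves only the same row of the left factor, so proportionality of two rows
at x = ℓ survives composition. -/
lemma compKernel_row {ℓ : ℝ} {k l : Fin 2 → Fin 2 → ℝ → ℝ → ℝ} {i j : Fin 2} {κ y : ℝ}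
    (hy : y ∈ Icc 0 ℓ) (hk : ∀ m, ∀ s ∈ Icc 0 ℓ, k i m ℓ s = κ * k j m ℓ s)
    (hl : ∀ m, ∀ s ∈ Icc 0 ℓ, l i m ℓ s = κ * l j m ℓ s) (n : Fin 2) :
    compKernel k l i n ℓ y = κ * compKernel k l j n ℓ y := by
  unfold compKernel
  rw [hk n y hy, hl n y hy, mul_add, mul_add, Finset.mul_sum]
  congr 1
  refine Finset.sum_congr rfl fun m _ => ?_
  rw [← intervalIntegral.integral_const_mul]
  refine intervalIntegral.integral_congr fun s hs => ?_
  rw [uIcc_of_le hy.2] at hs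
  rw [hk m s ⟨hy.1.trans hs.1, hs.2⟩]
  ring

/-- The side ξ = 0 meets every line x - ξ = y. There K and L satisfy the same proportionality
between columns, so each diagonal entry of the product is a multiple of an off-diagonal one, which
is already zero. Uniqueness of the kernels is never invoked. -/
lemma control_comp_inverse {S : Plant} (hS : S.Admissible) {K L : Kernels}
    (hK : IsControlKernel S K) (hL : IsInverseKernel S L) (i j : Fin 2) {x ξ : ℝ}
    (hp : (x, ξ) ∈ triangle S.ℓ) : compKernel K.opp.mat L.mat i j x ξ = 0 := by
  have h1 := hS.lam1_pos
  have h2 := hS.lam2_pos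
  have hq := hS.q_ne
  refine (hK.ctrlEq.kerEq hS).comp_eq_zero hS.ℓ_pos (by simpa [Plant.spd]) (by simpa [Plant.spd])
    (hL.invEq.kerEq hS) ?_ hp
  intro i j hij y hy
  refine ⟨0, ⟨le_rfl, by simpa using hy.1, by simpa using hy.2⟩, fun h => ?_⟩
  rw [add_zero]
  obtain ⟨κ, hk, hl⟩ : ∃ κ, (∀ m, ∀ s ∈ Icc 0 S.ℓ, K.opp.mat m i s 0 = κ * K.opp.mat m j s 0) ∧
      ∀ m, ∀ s ∈ Icc 0 S.ℓ, L.mat m i s 0 = κ * L.mat m j s 0 := by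
    fin_cases i <;> fin_cases j
    · exact absurd rfl hij
    · refine ⟨S.lam2 / (S.q * S.lam1), forall_fin_two_of ?_ ?_, forall_fin_two_of ?_ ?_⟩ <;>
        intro s hs
      · simp [Kernels.mat, Kernels.opp, hK.bc11 s hs]
      · simp [Kernels.mat, Kernels.opp, hK.bc22 s hs]; field_simp
      · simp [Kernels.mat, hL.bc11 s hs]
      · simp [Kernels.mat, hL.bc22 s hs]; field_simp
    · refine ⟨S.q * S.lam1 / S.lam2, forall_fin_two_of ?_ ?_, forall_fin_two_of ?_ ?_⟩ <;>
        intro s hs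
      · simp [Kernels.mat, Kernels.opp, hK.bc11 s hs]; field_simp
      · simp [Kernels.mat, Kernels.opp, hK.bc22 s hs]
      · simp [Kernels.mat, hL.bc11 s hs]; field_simp
      · simp [Kernels.mat, hL.bc22 s hs]
    · exact absurd rfl hij
  rw [compKernel_col hy hk hl, h i j hij y 0 ⟨le_rfl, hy.1, hy.2⟩, mul_zero]

/-- The same argument on the side x = ℓ, where for both kernels the second row is ρ times the first.
-/
lemma observerInverse_comp {S : Plant} (hS : S.Admissible) {Q P : Kernels}
    (hQ : CtrlEq S Q) (hQ1 : ∀ ξ ∈ Icc 0 S.ℓ, Q.k21 S.ℓ ξ = S.rho * Q.k11 S.ℓ ξ)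
    (hQ2 : ∀ ξ ∈ Icc 0 S.ℓ, Q.k22 S.ℓ ξ = S.rho * Q.k12 S.ℓ ξ) (hP : IsObserverKernel S P)
    (i j : Fin 2) {x ξ : ℝ} (hp : (x, ξ) ∈ triangle S.ℓ) :
    compKernel Q.opp.mat P.opp.mat i j x ξ = 0 := by
  have h1 := hS.lam1_pos
  have h2 := hS.lam2_pos
  have hρ := hS.rho_ne
  refine (hQ.kerEq hS).comp_eq_zero hS.ℓ_pos (by simpa [Plant.spd]) (by simpa [Plant.spd])
    (hP.invEq.kerEq hS) ?_ hp
  intro i j hij y hy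
  have hy' : S.ℓ - y ∈ Icc 0 S.ℓ := ⟨by linarith [hy.2], by linarith [hy.1]⟩
  have hyt : (S.ℓ, S.ℓ - y) ∈ triangle S.ℓ := ⟨hy'.1, hy'.2, le_rfl⟩
  refine ⟨S.ℓ - y, by rwa [add_sub_cancel], fun h => ?_⟩
  rw [add_sub_cancel]
  obtain ⟨κ, hk, hl⟩ : ∃ κ,
      (∀ m, ∀ s ∈ Icc 0 S.ℓ, Q.opp.mat i m S.ℓ s = κ * Q.opp.mat j m S.ℓ s) ∧
      ∀ m, ∀ s ∈ Icc 0 S.ℓ, P.opp.mat i m S.ℓ s = κ * P.opp.mat j m S.ℓ s := by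
    fin_cases i <;> fin_cases j
    · exact absurd rfl hij
    · refine ⟨1 / S.rho, forall_fin_two_of ?_ ?_, forall_fin_two_of ?_ ?_⟩ <;> intro s hs
      · simp [Kernels.mat, Kernels.opp, hQ1 s hs]; field_simp
      · simp [Kernels.mat, Kernels.opp, hQ2 s hs]; field_simp
      · simp [Kernels.mat, Kernels.opp, hP.bc11 s hs]
      · simp [Kernels.mat, Kernels.opp, hP.bc22 s hs]; field_simp
    · refine ⟨S.rho, forall_fin_two_of ?_ ?_, forall_fin_two_of ?_ ?_⟩ <;> intro s hs
      · simp [Kernels.mat, Kernels.opp, hQ1 s hs]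
      · simp [Kernels.mat, Kernels.opp, hQ2 s hs]
      · simp [Kernels.mat, Kernels.opp, hP.bc11 s hs]; field_simp
      · simp [Kernels.mat, Kernels.opp, hP.bc22 s hs]
    · exact absurd rfl hij
  rw [compKernel_row hy' hk hl, h j i (Ne.symm hij) _ _ hyt, mul_zero]

/-! ### Volterra operators on `L²(0,ℓ)` -/

lemma L2.integrable {ℓ : ℝ} (w : L2 ℓ) : Integrable w (volume.restrict (Ioo (0 : ℝ) ℓ)) :=
  (Lp.memLp w).integrable one_le_two

lemma L2.inner_eq {ℓ : ℝ} (v w : L2 ℓ) : inner ℝ v w = ∫ x in Ioo (0 : ℝ) ℓ, w x * v x := by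
  rw [L2.inner_def]
  rfl

lemma L2.norm_sq {ℓ : ℝ} (w : L2 ℓ) : ‖w‖ ^ 2 = ∫ x in Ioo (0 : ℝ) ℓ, w x ^ 2 := by
  rw [← real_inner_self_eq_norm_sq, L2.inner_eq]
  simp only [sq]

lemma L2.integral_mul_eq_inner {ℓ : ℝ} {φ : ℝ → ℝ}
    (hφ : MemLp φ 2 (volume.restrict (Ioo (0 : ℝ) ℓ))) (w : L2 ℓ) :
    ∫ x in Ioo (0 : ℝ) ℓ, w x * φ x = inner ℝ (hφ.toLp φ) w := by
  rw [L2.inner_eq]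
  refine integral_congr_ae ?_
  filter_upwards [hφ.coeFn_toLp] with x hx
  rw [hx]

lemma memLp_two_of_continuousOn {ℓ : ℝ} {φ : ℝ → ℝ} (hφ : ContinuousOn φ (Icc 0 ℓ)) :
    MemLp φ 2 (volume.restrict (Ioo (0 : ℝ) ℓ)) := by
  obtain ⟨C, hC⟩ := isCompact_Icc.exists_bound_of_continuousOn hφ
  refine MemLp.of_bound ((hφ.mono Ioo_subset_Icc_self).aestronglyMeasurable measurableSet_Ioo) C ?_
  filter_upwards [ae_restrict_mem measurableSet_Ioo] with x hx
  exact hC x (Ioo_subset_Icc_self hx)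

lemma integral_mul_sq_le {μ : Measure ℝ} {f g : ℝ → ℝ} (hf : MemLp f 2 μ) (hg : MemLp g 2 μ) :
    (∫ x, f x * g x ∂μ) ^ 2 ≤ (∫ x, f x ^ 2 ∂μ) * ∫ x, g x ^ 2 ∂μ := by
  have key : ∀ u v : Lp ℝ 2 μ, inner ℝ v u = ∫ x, u x * v x ∂μ := fun u v => by
    rw [L2.inner_def]; rfl
  have e : ∀ {a b : ℝ → ℝ} (ha : MemLp a 2 μ) (hb : MemLp b 2 μ),
      inner ℝ (hb.toLp b) (ha.toLp a) = ∫ x, a x * b x ∂μ := by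
    intro a b ha hb
    rw [key]
    refine integral_congr_ae ?_
    filter_upwards [ha.coeFn_toLp, hb.coeFn_toLp] with x h1 h2
    rw [h1, h2]
  have h := real_inner_mul_inner_self_le (hf.toLp f) (hg.toLp g)
  rw [real_inner_comm (hg.toLp g)] at h
  simp only [e, ← sq] at h
  have c : inner ℝ (hf.toLp f) (hg.toLp g) = ∫ x, f x * g x ∂μ := by
    rw [e hg hf]; simp only [mul_comm]
  simpa [e hf hg, c, sq] using h

lemma L2.integral_abs_le {ℓ : ℝ} (hℓ : 0 ≤ ℓ) (w : L2 ℓ) :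
    ∫ x in Ioo (0 : ℝ) ℓ, |w x| ≤ Real.sqrt ℓ * ‖w‖ := by
  have h := integral_mul_sq_le (Lp.memLp w).abs
    (memLp_const (1 : ℝ) : MemLp (fun _ => (1 : ℝ)) 2 (volume.restrict (Ioo (0 : ℝ) ℓ)))
  simp only [Pi.abs_apply, mul_one, sq_abs, one_pow] at h
  rw [← L2.norm_sq] at h
  simp only [integral_const, MeasurableSet.univ, measureReal_restrict_apply, univ_inter,
    Real.volume_real_Ioo, sub_zero, smul_eq_mul, mul_one, max_eq_left hℓ] at h
  refine (Real.abs_le_sqrt h |> le_trans (le_abs_self _)).trans ?_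
  rw [Real.sqrt_mul (sq_nonneg _), Real.sqrt_sq (norm_nonneg _), mul_comm]

/-! ### Scalar Volterra operators and their adjoints. -/

/-- Truncation of a kernel below the diagonal. -/
def lowerKernel (ℓ : ℝ) (k : ℝ → ℝ → ℝ) (x ξ : ℝ) : ℝ := if ξ ≤ x then extendTri ℓ k x ξ else 0

lemma measurable_lowerKernel {ℓ : ℝ} (hℓ : 0 ≤ ℓ) {k : ℝ → ℝ → ℝ}
    (hk : ContinuousOn (Function.uncurry k) (triangle ℓ)) :
    Measurable (Function.uncurry (lowerKernel ℓ k)) :=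
  Measurable.ite (measurableSet_le measurable_snd measurable_fst)
    (continuous_extendTri hℓ hk).measurable measurable_const

lemma abs_lowerKernel_le {ℓ : ℝ} (hℓ : 0 ≤ ℓ) {k : ℝ → ℝ → ℝ} {M : ℝ} (hM0 : 0 ≤ M)
    (hM : ∀ p ∈ triangle ℓ, |k p.1 p.2| ≤ M) (x ξ : ℝ) : |lowerKernel ℓ k x ξ| ≤ M := by
  unfold lowerKernel
  split_ifs
  · exact hM _ (projTri_mem hℓ _)
  · simpa

lemma integral_lowerKernel {ℓ : ℝ} (k : ℝ → ℝ → ℝ) (w : ℝ → ℝ) {x : ℝ} (hx : x ∈ Ioo 0 ℓ) :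
    ∫ ξ in Ioo (0 : ℝ) ℓ, lowerKernel ℓ k x ξ * w ξ = ∫ ξ in (0 : ℝ)..x, k x ξ * w ξ := by
  rw [intervalIntegral.integral_of_le hx.1.le]
  have e : ∀ ξ, lowerKernel ℓ k x ξ * w ξ =
      (Iic x).indicator (fun ξ => extendTri ℓ k x ξ * w ξ) ξ := by
    intro ξ
    by_cases h : ξ ≤ x <;> simp [lowerKernel, indicator, h]
  simp only [e]
  rw [setIntegral_indicator measurableSet_Iic]
  have hs : Ioo (0 : ℝ) ℓ ∩ Iic x = Ioc 0 x := by
    ext ξ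
    exact ⟨fun h => ⟨h.1.1, h.2⟩, fun h => ⟨⟨h.1, h.2.trans_lt hx.2⟩, h.2⟩⟩
  rw [hs]
  refine setIntegral_congr_fun measurableSet_Ioc fun ξ hξ => ?_
  have hp : (x, ξ) ∈ triangle ℓ := ⟨hξ.1.le, hξ.2, hx.2.le⟩
  simp only [extendTri_eq _ hp]

lemma integral_lowerKernel_right {ℓ : ℝ} (k : ℝ → ℝ → ℝ) (φ : ℝ → ℝ) {ξ : ℝ}
    (hξ : ξ ∈ Ioo 0 ℓ) :
    ∫ x in Ioo (0 : ℝ) ℓ, lowerKernel ℓ k x ξ * φ x = ∫ x in ξ..ℓ, k x ξ * φ x := by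
  rw [intervalIntegral.integral_of_le hξ.2.le, ← integral_Ico_eq_integral_Ioc]
  have e : ∀ x, lowerKernel ℓ k x ξ * φ x =
      (Ici ξ).indicator (fun x => extendTri ℓ k x ξ * φ x) x := by
    intro x
    by_cases h : ξ ≤ x <;> simp [lowerKernel, indicator, h]
  simp only [e]
  rw [setIntegral_indicator measurableSet_Ici]
  have hs : Ioo (0 : ℝ) ℓ ∩ Ici ξ = Ico ξ ℓ := by
    ext x
    exact ⟨fun h => ⟨h.2, h.1.2⟩, fun h => ⟨⟨hξ.1.trans_le h.1, h.2⟩, h.1⟩⟩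
  rw [hs]
  refine setIntegral_congr_fun measurableSet_Ico fun x hx => ?_
  have hp : (x, ξ) ∈ triangle ℓ := ⟨hξ.1.le, hx.1, hx.2.le⟩
  simp only [extendTri_eq _ hp]

lemma integrable_lowerKernel_mul {ℓ : ℝ} (hℓ : 0 ≤ ℓ) {k : ℝ → ℝ → ℝ}
    (hk : ContinuousOn (Function.uncurry k) (triangle ℓ)) {w φ : ℝ → ℝ}
    (hw : Integrable w (volume.restrict (Ioo (0 : ℝ) ℓ)))
    (hφ : Integrable φ (volume.restrict (Ioo (0 : ℝ) ℓ))) :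
    Integrable (fun p : ℝ × ℝ => lowerKernel ℓ k p.1 p.2 * (φ p.1 * w p.2))
      ((volume.restrict (Ioo (0 : ℝ) ℓ)).prod (volume.restrict (Ioo (0 : ℝ) ℓ))) := by
  obtain ⟨M, hM0, hM⟩ := exists_bound_triangle hk
  exact (hφ.mul_prod hw).bdd_mul (measurable_lowerKernel hℓ hk).aestronglyMeasurable
    (Filter.Eventually.of_forall fun p => abs_lowerKernel_le hℓ hM0 hM p.1 p.2)

/-- The adjoint of a Volterra operator. -/
lemma integral_volterra_mul {ℓ : ℝ} (hℓ : 0 ≤ ℓ) {k : ℝ → ℝ → ℝ}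
    (hk : ContinuousOn (Function.uncurry k) (triangle ℓ)) {w φ : ℝ → ℝ}
    (hw : Integrable w (volume.restrict (Ioo (0 : ℝ) ℓ)))
    (hφ : Integrable φ (volume.restrict (Ioo (0 : ℝ) ℓ))) :
    ∫ x in Ioo (0 : ℝ) ℓ, (∫ ξ in (0 : ℝ)..x, k x ξ * w ξ) * φ x =
      ∫ ξ in Ioo (0 : ℝ) ℓ, w ξ * ∫ x in ξ..ℓ, k x ξ * φ x := by
  have h := integral_integral_swap
    (f := fun x ξ => lowerKernel ℓ k x ξ * (φ x * w ξ)) (integrable_lowerKernel_mul hℓ hk hw hφ)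
  have e1 : ∫ x in Ioo (0 : ℝ) ℓ, (∫ ξ in (0 : ℝ)..x, k x ξ * w ξ) * φ x =
      ∫ x in Ioo (0 : ℝ) ℓ, ∫ ξ in Ioo (0 : ℝ) ℓ, lowerKernel ℓ k x ξ * (φ x * w ξ) := by
    refine setIntegral_congr_fun measurableSet_Ioo fun x hx => ?_
    rw [← integral_lowerKernel k w hx, ← integral_mul_const]
    congr 1; funext ξ; ring
  have e2 : ∫ ξ in Ioo (0 : ℝ) ℓ, w ξ * ∫ x in ξ..ℓ, k x ξ * φ x =
      ∫ ξ in Ioo (0 : ℝ) ℓ, ∫ x in Ioo (0 : ℝ) ℓ, lowerKernel ℓ k x ξ * (φ x * w ξ) := by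
    refine setIntegral_congr_fun measurableSet_Ioo fun ξ hξ => ?_
    rw [← integral_lowerKernel_right k φ hξ, ← integral_const_mul]
    congr 1; funext x; ring
  rw [e1, e2]
  exact h

lemma memLp_volterra {ℓ : ℝ} (hℓ : 0 ≤ ℓ) {k : ℝ → ℝ → ℝ}
    (hk : ContinuousOn (Function.uncurry k) (triangle ℓ)) {M : ℝ} (hM0 : 0 ≤ M)
    (hM : ∀ p ∈ triangle ℓ, |k p.1 p.2| ≤ M) (w : L2 ℓ) :
    MemLp (fun x => ∫ ξ in (0 : ℝ)..x, k x ξ * w ξ) 2 (volume.restrict (Ioo (0 : ℝ) ℓ)) ∧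
    ∀ᵐ x ∂(volume.restrict (Ioo (0 : ℝ) ℓ)),
      ‖∫ ξ in (0 : ℝ)..x, k x ξ * w ξ‖ ≤ M * (Real.sqrt ℓ * ‖w‖) := by
  have hb : ∀ᵐ x ∂(volume.restrict (Ioo (0 : ℝ) ℓ)),
      ‖∫ ξ in (0 : ℝ)..x, k x ξ * w ξ‖ ≤ M * (Real.sqrt ℓ * ‖w‖) := by
    filter_upwards [ae_restrict_mem measurableSet_Ioo] with x hx
    rw [← integral_lowerKernel k w hx]
    refine (norm_integral_le_integral_norm _).trans ?_
    calc ∫ ξ in Ioo (0 : ℝ) ℓ, ‖lowerKernel ℓ k x ξ * w ξ‖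
        ≤ ∫ ξ in Ioo (0 : ℝ) ℓ, M * |w ξ| := by
          refine integral_mono_of_nonneg (Filter.Eventually.of_forall fun _ => norm_nonneg _)
            ((L2.integrable w).abs.const_mul M) (Filter.Eventually.of_forall fun ξ => ?_)
          simp only [norm_mul, Real.norm_eq_abs]
          exact mul_le_mul_of_nonneg_right (abs_lowerKernel_le hℓ hM0 hM x ξ) (abs_nonneg _)
      _ = M * ∫ ξ in Ioo (0 : ℝ) ℓ, |w ξ| := integral_const_mul _ _
      _ ≤ _ := by gcongr; exact L2.integral_abs_le hℓ w
  refine ⟨MemLp.of_bound ?_ _ hb, hb⟩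
  have h1 : AEStronglyMeasurable (fun p : ℝ × ℝ => lowerKernel ℓ k p.1 p.2 * w p.2)
      ((volume.restrict (Ioo (0 : ℝ) ℓ)).prod (volume.restrict (Ioo (0 : ℝ) ℓ))) :=
    (measurable_lowerKernel hℓ hk).aestronglyMeasurable.mul
      (L2.integrable w).aestronglyMeasurable.comp_snd
  refine h1.integral_prod_right'.congr ?_
  filter_upwards [ae_restrict_mem measurableSet_Ioo] with x hx
  exact integral_lowerKernel k w hx

/-- The norm estimate is stated for every bound M of the kernel, so that on a short interval the
operator can be made a strict contraction; the boundary equation at x = ℓ is solved that way. -/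
lemma exists_volterra {ℓ : ℝ} (hℓ : 0 ≤ ℓ) {k : ℝ → ℝ → ℝ}
    (hk : ContinuousOn (Function.uncurry k) (triangle ℓ)) :
    ∃ T : L2 ℓ →L[ℝ] L2 ℓ, (∀ w : L2 ℓ, T w =ᵐ[volume.restrict (Ioo (0 : ℝ) ℓ)]
      fun x => ∫ ξ in (0 : ℝ)..x, k x ξ * w ξ) ∧
      ∀ M : ℝ, 0 ≤ M → (∀ p ∈ triangle ℓ, |k p.1 p.2| ≤ M) → ‖T‖ ≤ M * ℓ := by
  obtain ⟨M, hM0, hM⟩ := exists_bound_triangle hk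
  have hbound : ∀ {M : ℝ}, 0 ≤ M → (∀ p ∈ triangle ℓ, |k p.1 p.2| ≤ M) → ∀ (w v : L2 ℓ),
      v =ᵐ[volume.restrict (Ioo (0 : ℝ) ℓ)] (fun x => ∫ ξ in (0 : ℝ)..x, k x ξ * w ξ) →
      ‖v‖ ≤ M * ℓ * ‖w‖ := by
    intro M hM0 hM w v hv
    have h : ∀ᵐ x ∂(volume.restrict (Ioo (0 : ℝ) ℓ)), ‖v x‖ ≤ M * (Real.sqrt ℓ * ‖w‖) := by
      filter_upwards [hv, (memLp_volterra hℓ hk hM0 hM w).2] with x h1 h2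
      rwa [h1]
    have hle := Lp.norm_le_of_ae_bound (by positivity) h
    have e : (↑(measureUnivNNReal (volume.restrict (Ioo (0 : ℝ) ℓ))) : ℝ) = ℓ := by
      simp only [measureUnivNNReal, Measure.restrict_apply MeasurableSet.univ, univ_inter,
        Real.volume_Ioo, sub_zero]
      exact ENNReal.toReal_ofReal hℓ
    have e2 : ((2 : ℝ≥0∞).toReal)⁻¹ = 1 / 2 := by norm_num
    rw [e, e2, ← Real.sqrt_eq_rpow] at hle
    refine hle.trans (le_of_eq ?_)
    linear_combination (M * ‖w‖) * Real.mul_self_sqrt hℓ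
  let F : L2 ℓ → L2 ℓ := fun w => (memLp_volterra hℓ hk hM0 hM w).1.toLp _
  have hF : ∀ w, F w =ᵐ[volume.restrict (Ioo (0 : ℝ) ℓ)]
      fun x => ∫ ξ in (0 : ℝ)..x, k x ξ * w ξ := fun w =>
    (memLp_volterra hℓ hk hM0 hM w).1.coeFn_toLp
  have hint : ∀ (w : L2 ℓ) {x : ℝ}, x ∈ Ioo 0 ℓ →
      Integrable (fun ξ => lowerKernel ℓ k x ξ * w ξ) (volume.restrict (Ioo (0 : ℝ) ℓ)) :=
    fun w x _ => (L2.integrable w).bdd_mul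
      ((measurable_lowerKernel hℓ hk).comp measurable_prodMk_left).aestronglyMeasurable
      (Filter.Eventually.of_forall fun ξ => abs_lowerKernel_le hℓ hM0 hM x ξ)
  let T : L2 ℓ →ₗ[ℝ] L2 ℓ :=
    { toFun := F
      map_add' := by
        intro v w
        refine Lp.ext ?_
        filter_upwards [hF (v + w), hF v, hF w, Lp.coeFn_add (F v) (F w),
          ae_restrict_mem measurableSet_Ioo] with x h1 h2 h3 h4 hx
        rw [h1, h4, Pi.add_apply, h2, h3, ← integral_lowerKernel k _ hx,
          ← integral_lowerKernel k _ hx, ← integral_lowerKernel k _ hx,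
          ← integral_add (hint v hx) (hint w hx)]
        refine integral_congr_ae ?_
        filter_upwards [Lp.coeFn_add v w] with ξ h
        rw [h, Pi.add_apply, mul_add]
      map_smul' := by
        intro c w
        refine Lp.ext ?_
        filter_upwards [hF (c • w), hF w, Lp.coeFn_smul c (F w),
          ae_restrict_mem measurableSet_Ioo] with x h1 h2 h4 hx
        rw [h1, RingHom.id_apply, h4, Pi.smul_apply, h2, ← integral_lowerKernel k _ hx,
          ← integral_lowerKernel k _ hx, ← integral_smul]
        refine integral_congr_ae ?_
        filter_upwards [Lp.coeFn_smul c w] with ξ h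
        rw [h, Pi.smul_apply, smul_eq_mul, smul_eq_mul]
        ring }
  refine ⟨T.mkContinuous (M * ℓ) fun w => hbound hM0 hM w (F w) (hF w), hF, ?_⟩
  intro M' hM0' hM'
  exact ContinuousLinearMap.opNorm_le_bound _ (by positivity)
    fun w => hbound hM0' hM' w (F w) (hF w)

open Classical in
/-- The Volterra operator with kernel `k` on `L²(0,ℓ)`. -/
def volterra (ℓ : ℝ) (k : ℝ → ℝ → ℝ) : L2 ℓ →L[ℝ] L2 ℓ :=
  if h : 0 ≤ ℓ ∧ ContinuousOn (Function.uncurry k) (triangle ℓ) then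
    (exists_volterra h.1 h.2).choose else 0

lemma volterra_ae {ℓ : ℝ} (hℓ : 0 ≤ ℓ) {k : ℝ → ℝ → ℝ}
    (hk : ContinuousOn (Function.uncurry k) (triangle ℓ)) (w : L2 ℓ) :
    volterra ℓ k w =ᵐ[volume.restrict (Ioo (0 : ℝ) ℓ)]
      fun x => ∫ ξ in (0 : ℝ)..x, k x ξ * w ξ := by
  unfold volterra
  rw [dif_pos ⟨hℓ, hk⟩]
  exact (exists_volterra hℓ hk).choose_spec.1 w

lemma norm_volterra_le {ℓ : ℝ} (hℓ : 0 ≤ ℓ) {k : ℝ → ℝ → ℝ}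
    (hk : ContinuousOn (Function.uncurry k) (triangle ℓ)) {M : ℝ} (hM0 : 0 ≤ M)
    (hM : ∀ p ∈ triangle ℓ, |k p.1 p.2| ≤ M) : ‖volterra ℓ k‖ ≤ M * ℓ := by
  unfold volterra
  rw [dif_pos ⟨hℓ, hk⟩]
  exact (exists_volterra hℓ hk).choose_spec.2 M hM0 hM

/-- Integral form of Grönwall's inequality. -/
lemma le_mul_exp_of_le_add_integral {y : ℝ → ℝ} {T a K : ℝ} (hy : ContinuousOn y (Icc 0 T))
    (hK : 0 ≤ K) (h : ∀ t ∈ Icc 0 T, y t ≤ a + K * ∫ s in (0 : ℝ)..t, y s) :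
    ∀ t ∈ Icc 0 T, y t ≤ a * Real.exp (K * t) := by
  intro t ht
  have hT : 0 ≤ T := ht.1.trans ht.2
  set u : ℝ → ℝ := fun t => ∫ s in (0 : ℝ)..t, y s with hu
  have hyi : IntervalIntegrable y volume 0 T := by
    refine ContinuousOn.intervalIntegrable ?_
    rwa [uIcc_of_le hT]
  have hud : ∀ s ∈ Ioo 0 T, HasDerivAt u (y s) s := by
    intro s hs
    have hn : Icc 0 T ∈ nhds s := Icc_mem_nhds hs.1 hs.2
    refine intervalIntegral.integral_hasDerivAt_right
      (hyi.mono_set (by rw [uIcc_of_le hs.1.le, uIcc_of_le hT]; exact Icc_subset_Icc_right hs.2.le))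
      ?_ (hy.continuousAt hn)
    exact hy.stronglyMeasurableAtFilter_nhdsWithin measurableSet_Icc s |>.filter_mono
      (by rw [nhdsWithin_eq_nhds.2 hn])
  have huc : ContinuousOn u (Icc 0 T) := by
    have := intervalIntegral.continuousOn_primitive_interval' hyi (left_mem_uIcc)
    rwa [uIcc_of_le hT] at this
  -- The hypothesis says precisely that e^{-Kt}(a + K ∫ y) has nonpositive derivative.
  have hanti : AntitoneOn (fun t => Real.exp (-(K * t)) * (a + K * u t)) (Icc 0 T) := by
    have hd : ∀ s ∈ Ioo 0 T, HasDerivAt (fun t => Real.exp (-(K * t)) * (a + K * u t))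
        (Real.exp (-(K * s)) * (-(K * 1)) * (a + K * u s) + Real.exp (-(K * s)) * (K * y s)) s :=
      fun s hs => (((hasDerivAt_id s).const_mul K).neg.exp).mul (((hud s hs).const_mul K).const_add a)
    refine antitoneOn_of_deriv_nonpos (convex_Icc 0 T) ?_ ?_ ?_
    · exact ContinuousOn.mul (by fun_prop) (continuousOn_const.add (continuousOn_const.mul huc))
    · rw [interior_Icc]
      exact fun s hs => (hd s hs).differentiableAt.differentiableWithinAt
    · rw [interior_Icc]
      intro s hs
      rw [(hd s hs).deriv]
      have h1 := h s ⟨hs.1.le, hs.2.le⟩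
      have h2 := Real.exp_pos (-(K * s))
      have h3 : 0 ≤ K * Real.exp (-(K * s)) := by positivity
      nlinarith
  have h1 := hanti (left_mem_Icc.2 hT) ht ht.1
  simp only [mul_zero, neg_zero, Real.exp_zero, one_mul, hu, intervalIntegral.integral_same,
    add_zero] at h1
  have h2 : Real.exp (-(K * t)) * Real.exp (K * t) = 1 := by rw [← Real.exp_add]; simp
  have h3 := Real.exp_pos (K * t)
  have h4 := h t ht
  calc y t ≤ a + K * u t := h4
    _ = (Real.exp (-(K * t)) * (a + K * u t)) * Real.exp (K * t) := by
        linear_combination -(a + K * u t) * h2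
    _ ≤ a * Real.exp (K * t) := by gcongr

/-! ### Matrix Volterra operators and their inverses. -/

/-- The operator `1 + k` on `L²((0,ℓ); ℝ²)`, for a matrix `k` of Volterra kernels. -/
def onePlus (ℓ : ℝ) (k : Fin 2 → Fin 2 → ℝ → ℝ → ℝ) : (Fin 2 → L2 ℓ) →L[ℝ] (Fin 2 → L2 ℓ) :=
  ContinuousLinearMap.pi fun i => ContinuousLinearMap.proj i +
    ∑ j, (volterra ℓ (k i j)).comp (ContinuousLinearMap.proj j)

lemma onePlus_apply (ℓ : ℝ) (k : Fin 2 → Fin 2 → ℝ → ℝ → ℝ) (w : Fin 2 → L2 ℓ) (i : Fin 2) :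
    onePlus ℓ k w i = w i + ∑ j, volterra ℓ (k i j) (w j) := by
  simp [onePlus]

lemma onePlus_ae {ℓ : ℝ} (hℓ : 0 ≤ ℓ) {k : Fin 2 → Fin 2 → ℝ → ℝ → ℝ}
    (hk : ∀ i j, ContinuousOn (Function.uncurry (k i j)) (triangle ℓ)) (w : Fin 2 → L2 ℓ)
    (i : Fin 2) : onePlus ℓ k w i =ᵐ[volume.restrict (Ioo (0 : ℝ) ℓ)]
      fun x => w i x + ∑ j, ∫ ξ in (0 : ℝ)..x, k i j x ξ * w j ξ := by
  rw [onePlus_apply, Fin.sum_univ_two]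
  filter_upwards [Lp.coeFn_add (w i) (volterra ℓ (k i 0) (w 0) + volterra ℓ (k i 1) (w 1)),
    Lp.coeFn_add (volterra ℓ (k i 0) (w 0)) (volterra ℓ (k i 1) (w 1)),
    volterra_ae hℓ (hk i 0) (w 0), volterra_ae hℓ (hk i 1) (w 1)] with x h1 h2 h3 h4
  rw [h1, Pi.add_apply, h2, Pi.add_apply, h3, h4, Fin.sum_univ_two]

lemma triangle_mono {x ℓ : ℝ} (h : x ≤ ℓ) : triangle x ⊆ triangle ℓ :=
  fun _ hp => ⟨hp.1, hp.2.1, hp.2.2.trans h⟩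

/-- For fixed x this is the adjoint identity on (0, x) with k(x, ·) as the test function, that is,
Fubini on the triangle below x. -/
lemma volterra_comp_ae {ℓ : ℝ} (hℓ : 0 ≤ ℓ) {k l : ℝ → ℝ → ℝ}
    (hk : ContinuousOn (Function.uncurry k) (triangle ℓ))
    (hl : ContinuousOn (Function.uncurry l) (triangle ℓ)) (w : L2 ℓ) :
    volterra ℓ k (volterra ℓ l w) =ᵐ[volume.restrict (Ioo (0 : ℝ) ℓ)]
      fun x => ∫ ξ in (0 : ℝ)..x, (∫ s in ξ..x, k x s * l s ξ) * w ξ := by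
  filter_upwards [volterra_ae hℓ hk (volterra ℓ l w), ae_restrict_mem measurableSet_Ioo] with x hx hm
  rw [hx]
  have hw : Integrable w (volume.restrict (Ioo (0 : ℝ) x)) :=
    (L2.integrable w).mono_measure (Measure.restrict_mono (Ioo_subset_Ioo_right hm.2.le) le_rfl)
  have hkx : ContinuousOn (fun s => k x s) (Icc 0 x) := continuousOn_slice_left hk hm.2.le
  have h := integral_volterra_mul hm.1.le (hl.mono (triangle_mono hm.2.le)) hw
    ((memLp_two_of_continuousOn hkx).integrable one_le_two)
  rw [intervalIntegral.integral_of_le hm.1.le, intervalIntegral.integral_of_le hm.1.le,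
    integral_Ioc_eq_integral_Ioo, integral_Ioc_eq_integral_Ioo]
  have e1 : ∫ s in Ioo 0 x, k x s * volterra ℓ l w s =
      ∫ s in Ioo 0 x, (∫ ξ in (0 : ℝ)..s, l s ξ * w ξ) * k x s := by
    refine integral_congr_ae ?_
    have := ae_mono (Measure.restrict_mono (Ioo_subset_Ioo_right hm.2.le) le_rfl)
      (volterra_ae hℓ hl w)
    filter_upwards [this] with s hs
    rw [hs, mul_comm]
  rw [e1, h]
  congr 1; funext ξ
  rw [mul_comm]
  simp only [mul_comm (l _ _)]

lemma intervalIntegrable_slice_mul {ℓ : ℝ} {k : ℝ → ℝ → ℝ}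
    (hk : ContinuousOn (Function.uncurry k) (triangle ℓ)) (w : L2 ℓ) {x : ℝ} (hx : x ∈ Ioo 0 ℓ) :
    IntervalIntegrable (fun ξ => k x ξ * w ξ) volume 0 x := by
  have hw : IntervalIntegrable w volume 0 x := by
    rw [intervalIntegrable_iff_integrableOn_Ioo_of_le hx.1.le]
    exact (L2.integrable w).mono_measure
      (Measure.restrict_mono (Ioo_subset_Ioo_right hx.2.le) le_rfl)
  refine hw.continuousOn_mul ?_
  rw [uIcc_of_le hx.1.le]
  exact continuousOn_slice_left hk hx.2.le

lemma onePlus_onePlus {ℓ : ℝ} (hℓ : 0 ≤ ℓ) {k l : Fin 2 → Fin 2 → ℝ → ℝ → ℝ}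
    (hk : ∀ i j, ContinuousOn (Function.uncurry (k i j)) (triangle ℓ))
    (hl : ∀ i j, ContinuousOn (Function.uncurry (l i j)) (triangle ℓ))
    (h : ∀ i j x ξ, (x, ξ) ∈ triangle ℓ → compKernel k l i j x ξ = 0) (w : Fin 2 → L2 ℓ) :
    onePlus ℓ k (onePlus ℓ l w) = w := by
  have key : ∀ i j (u : L2 ℓ), volterra ℓ (k i j) u + volterra ℓ (l i j) u +
      (volterra ℓ (k i 0) (volterra ℓ (l 0 j) u) + volterra ℓ (k i 1) (volterra ℓ (l 1 j) u)) =
      0 := by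
    intro i j u
    refine Lp.ext ?_
    filter_upwards [Lp.coeFn_add (volterra ℓ (k i j) u + volterra ℓ (l i j) u)
        (volterra ℓ (k i 0) (volterra ℓ (l 0 j) u) + volterra ℓ (k i 1) (volterra ℓ (l 1 j) u)),
      Lp.coeFn_add (volterra ℓ (k i j) u) (volterra ℓ (l i j) u),
      Lp.coeFn_add (volterra ℓ (k i 0) (volterra ℓ (l 0 j) u))
        (volterra ℓ (k i 1) (volterra ℓ (l 1 j) u)),
      volterra_ae hℓ (hk i j) u, volterra_ae hℓ (hl i j) u,
      volterra_comp_ae hℓ (hk i 0) (hl 0 j) u, volterra_comp_ae hℓ (hk i 1) (hl 1 j) u,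
      Lp.coeFn_zero ℝ 2 (volume.restrict (Ioo (0 : ℝ) ℓ)), ae_restrict_mem measurableSet_Ioo]
      with x h1 h2 h3 h4 h5 h6 h7 h8 hx
    rw [h1, h8, Pi.add_apply, h2, h3, Pi.add_apply, Pi.add_apply, h4, h5, h6, h7]
    have c := fun m => continuousOn_comp_kernel hℓ (hk i m) (hl m j)
    rw [← intervalIntegral.integral_add (intervalIntegrable_slice_mul (hk i j) u hx)
        (intervalIntegrable_slice_mul (hl i j) u hx),
      ← intervalIntegral.integral_add (intervalIntegrable_slice_mul (c 0) u hx)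
        (intervalIntegrable_slice_mul (c 1) u hx),
      ← intervalIntegral.integral_add ((intervalIntegrable_slice_mul (hk i j) u hx).add
        (intervalIntegrable_slice_mul (hl i j) u hx))
        ((intervalIntegrable_slice_mul (c 0) u hx).add (intervalIntegrable_slice_mul (c 1) u hx))]
    have e : ∀ ξ ∈ uIcc 0 x, k i j x ξ * u ξ + l i j x ξ * u ξ +
        ((∫ s in ξ..x, k i 0 x s * l 0 j s ξ) * u ξ + (∫ s in ξ..x, k i 1 x s * l 1 j s ξ) * u ξ) =
        0 := by
      intro ξ hξ
      rw [uIcc_of_le hx.1.le] at hξ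
      have := h i j x ξ ⟨hξ.1, hξ.2, hx.2.le⟩
      simp only [compKernel, Fin.sum_univ_two] at this
      linear_combination u ξ * this
    rw [intervalIntegral.integral_congr e]
    simp
  funext i
  simp only [onePlus_apply, Fin.sum_univ_two, map_add]
  have k0 := key i 0 (w 0)
  have k1 := key i 1 (w 1)
  refine Eq.trans ?_ (by rw [k0, k1, add_zero, add_zero] : w i +
    (volterra ℓ (k i 0) (w 0) + volterra ℓ (l i 0) (w 0) +
      (volterra ℓ (k i 0) (volterra ℓ (l 0 0) (w 0)) +
        volterra ℓ (k i 1) (volterra ℓ (l 1 0) (w 0)))) +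
    (volterra ℓ (k i 1) (w 1) + volterra ℓ (l i 1) (w 1) +
      (volterra ℓ (k i 0) (volterra ℓ (l 0 1) (w 1)) +
        volterra ℓ (k i 1) (volterra ℓ (l 1 1) (w 1)))) = w i)
  abel

/-- In the kernel of the operator, |w₀| + |w₁| is at most a constant times its own primitive, and
Grönwall with zero initial value forces it to vanish. No smallness of the kernel is needed. -/
lemma onePlus_injective {ℓ : ℝ} (hℓ : 0 ≤ ℓ) {k : Fin 2 → Fin 2 → ℝ → ℝ → ℝ}
    (hk : ∀ i j, ContinuousOn (Function.uncurry (k i j)) (triangle ℓ)) {w : Fin 2 → L2 ℓ}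
    (hw : onePlus ℓ k w = 0) : w = 0 := by
  choose Mf hMf0 hMf using fun i j => exists_bound_triangle (hk i j)
  set M := ∑ i, ∑ j, Mf i j with hM
  have hM0 : 0 ≤ M := Finset.sum_nonneg fun i _ => Finset.sum_nonneg fun j _ => hMf0 i j
  have hMle : ∀ i j, Mf i j ≤ M := fun i j =>
    (Finset.single_le_sum (f := fun j => Mf i j) (fun j _ => hMf0 i j) (Finset.mem_univ j)).trans
      (Finset.single_le_sum (f := fun i => ∑ j, Mf i j)
        (fun i _ => Finset.sum_nonneg fun j _ => hMf0 i j) (Finset.mem_univ i))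
  set f : ℝ → ℝ := fun x => |w 0 x| + |w 1 x| with hf
  have hfi : Integrable f (volume.restrict (Ioo (0 : ℝ) ℓ)) :=
    (L2.integrable (w 0)).abs.add (L2.integrable (w 1)).abs
  have hfii : IntervalIntegrable f volume 0 ℓ := by
    rw [intervalIntegrable_iff_integrableOn_Ioo_of_le hℓ]; exact hfi
  have hsub : ∀ {x}, x ∈ Icc 0 ℓ → IntervalIntegrable f volume 0 x := fun hx =>
    hfii.mono_set (by rw [uIcc_of_le hx.1, uIcc_of_le hℓ]; exact Icc_subset_Icc_right hx.2)
  set y : ℝ → ℝ := fun x => ∫ ξ in (0 : ℝ)..x, f ξ with hy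
  have hyc : ContinuousOn y (Icc 0 ℓ) := by
    have := intervalIntegral.continuousOn_primitive_interval' hfii left_mem_uIcc
    rwa [uIcc_of_le hℓ] at this
  have hbound : ∀ᵐ x ∂(volume.restrict (Ioo (0 : ℝ) ℓ)), f x ≤ 2 * M * y x := by
    have hi : ∀ i, ∀ᵐ x ∂(volume.restrict (Ioo (0 : ℝ) ℓ)), |w i x| ≤ M * y x := by
      intro i
      have h0 : onePlus ℓ k w i = 0 := by rw [hw]; rfl
      filter_upwards [onePlus_ae hℓ hk w i, Lp.coeFn_zero ℝ 2 (volume.restrict (Ioo (0 : ℝ) ℓ)),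
        ae_restrict_mem measurableSet_Ioo] with x h1 h2 hx
      rw [h0, h2, Fin.sum_univ_two, Pi.zero_apply] at h1
      have hj : ∀ j, |∫ ξ in (0 : ℝ)..x, k i j x ξ * w j ξ| ≤ ∫ ξ in (0 : ℝ)..x, M * |w j ξ| := by
        intro j
        refine (intervalIntegral.abs_integral_le_integral_abs hx.1.le).trans ?_
        have hwi : IntervalIntegrable (fun ξ => |w j ξ|) volume 0 x := by
          rw [intervalIntegrable_iff_integrableOn_Ioo_of_le hx.1.le]
          exact (L2.integrable (w j)).abs.mono_measure
            (Measure.restrict_mono (Ioo_subset_Ioo_right hx.2.le) le_rfl)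
        refine intervalIntegral.integral_mono_on hx.1.le
          (intervalIntegrable_slice_mul (hk i j) (w j) hx).abs (hwi.const_mul M) ?_
        intro ξ hξ
        rw [abs_mul]
        exact mul_le_mul_of_nonneg_right
          ((hMf i j (x, ξ) ⟨hξ.1, hξ.2, hx.2.le⟩).trans (hMle i j)) (abs_nonneg _)
      have hii : ∀ j, IntervalIntegrable (fun ξ => |w j ξ|) volume 0 x := fun j => by
        rw [intervalIntegrable_iff_integrableOn_Ioo_of_le hx.1.le]
        exact (L2.integrable (w j)).abs.mono_measure
          (Measure.restrict_mono (Ioo_subset_Ioo_right hx.2.le) le_rfl)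
      have e : M * y x = (∫ ξ in (0 : ℝ)..x, M * |w 0 ξ|) + ∫ ξ in (0 : ℝ)..x, M * |w 1 ξ| := by
        rw [hy, hf]
        simp only [intervalIntegral.integral_const_mul]
        rw [intervalIntegral.integral_add (hii 0) (hii 1), mul_add]
      have e2 : w i x = -((∫ ξ in (0 : ℝ)..x, k i 0 x ξ * w 0 ξ) +
          ∫ ξ in (0 : ℝ)..x, k i 1 x ξ * w 1 ξ) := by linarith
      rw [e2, abs_neg, e]
      exact (abs_add_le _ _).trans (add_le_add (hj 0) (hj 1))
    filter_upwards [hi 0, hi 1] with x h0 h1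
    simp only [hf]; linarith
  have hy0 : ∀ x ∈ Icc 0 ℓ, y x ≤ 0 * Real.exp (2 * M * x) := by
    refine le_mul_exp_of_le_add_integral hyc (by positivity) fun x hx => ?_
    rw [zero_add, ← intervalIntegral.integral_const_mul]
    have hyi : IntervalIntegrable y volume 0 x := by
      refine (hyc.mono ?_).intervalIntegrable
      rw [uIcc_of_le hx.1]; exact Icc_subset_Icc_right hx.2
    refine intervalIntegral.integral_mono_ae_restrict hx.1 (hsub hx) (hyi.const_mul _) ?_
    rw [← restrict_Ioo_eq_restrict_Icc]
    exact ae_mono (Measure.restrict_mono (Ioo_subset_Ioo_right hx.2) le_rfl) hbound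
  have hwz : ∀ i, w i = 0 := by
    intro i
    refine Lp.ext ?_
    filter_upwards [hbound, Lp.coeFn_zero ℝ 2 (volume.restrict (Ioo (0 : ℝ) ℓ)),
      ae_restrict_mem measurableSet_Ioo] with x h1 h2 hx
    rw [h2, Pi.zero_apply]
    have h3 := hy0 x ⟨hx.1.le, hx.2.le⟩
    rw [zero_mul] at h3
    have h4 : f x ≤ 0 := h1.trans (mul_nonpos_of_nonneg_of_nonpos (by positivity) h3)
    have a0 := abs_nonneg (w 0 x)
    have a1 := abs_nonneg (w 1 x)
    simp only [hf] at h4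
    fin_cases i
    · show (w 0 x : ℝ) = 0
      exact abs_eq_zero.1 (le_antisymm (by linarith) a0)
    · show (w 1 x : ℝ) = 0
      exact abs_eq_zero.1 (le_antisymm (by linarith) a1)
  exact funext hwz

/-- Injectivity makes the right inverse two-sided, so the composite kernel has to be computed in one
order only. -/
lemma onePlus_onePlus_symm {ℓ : ℝ} (hℓ : 0 ≤ ℓ) {k l : Fin 2 → Fin 2 → ℝ → ℝ → ℝ}
    (hk : ∀ i j, ContinuousOn (Function.uncurry (k i j)) (triangle ℓ))
    (hl : ∀ i j, ContinuousOn (Function.uncurry (l i j)) (triangle ℓ))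
    (h : ∀ i j x ξ, (x, ξ) ∈ triangle ℓ → compKernel k l i j x ξ = 0) (w : Fin 2 → L2 ℓ) :
    onePlus ℓ l (onePlus ℓ k w) = w := by
  refine sub_eq_zero.1 (onePlus_injective hℓ hk ?_)
  rw [map_sub, onePlus_onePlus hℓ hk hl h, sub_self]

/-! ### Transport of weak solutions by Volterra transformations -/

lemma continuousOn_fun_mul {f g : ℝ → ℝ} {s : Set ℝ} (hf : ContinuousOn f s)
    (hg : ContinuousOn g s) : ContinuousOn (fun x => f x * g x) s := hf.mul hg

lemma continuousOn_fun_add {f g : ℝ → ℝ} {s : Set ℝ} (hf : ContinuousOn f s)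
    (hg : ContinuousOn g s) : ContinuousOn (fun x => f x + g x) s := hf.add hg

lemma integrable_fun_add {f g : ℝ → ℝ} {μ : Measure ℝ} (hf : Integrable f μ)
    (hg : Integrable g μ) : Integrable (fun x => f x + g x) μ := hf.add hg

lemma intervalIntegrable_fun_add {f g : ℝ → ℝ} {a b : ℝ} (hf : IntervalIntegrable f volume a b)
    (hg : IntervalIntegrable g volume a b) :
    IntervalIntegrable (fun x => f x + g x) volume a b := hf.add hg

lemma intervalIntegrable_fun_sub {f g : ℝ → ℝ} {a b : ℝ} (hf : IntervalIntegrable f volume a b)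
    (hg : IntervalIntegrable g volume a b) :
    IntervalIntegrable (fun x => f x - g x) volume a b := hf.sub hg

/-- The pairing of `u ∈ L²(0,ℓ)` with a function. -/
def pair {ℓ : ℝ} (u : L2 ℓ) (f : ℝ → ℝ) : ℝ := ∫ x in Ioo (0 : ℝ) ℓ, u x * f x

lemma L2.integrable_mul {ℓ : ℝ} (u : L2 ℓ) {f : ℝ → ℝ} (hf : ContinuousOn f (Icc 0 ℓ)) :
    Integrable (fun x => u x * f x) (volume.restrict (Ioo (0 : ℝ) ℓ)) :=
  (Lp.memLp u).integrable_mul (memLp_two_of_continuousOn hf)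

lemma pair_add {ℓ : ℝ} (u : L2 ℓ) {f g : ℝ → ℝ} (hf : ContinuousOn f (Icc 0 ℓ))
    (hg : ContinuousOn g (Icc 0 ℓ)) : pair u (fun x => f x + g x) = pair u f + pair u g := by
  unfold pair
  rw [← integral_add (L2.integrable_mul u hf) (L2.integrable_mul u hg)]
  simp only [mul_add]

lemma pair_const_mul {ℓ : ℝ} (u : L2 ℓ) (c : ℝ) (f : ℝ → ℝ) :
    pair u (fun x => c * f x) = c * pair u f := by
  unfold pair
  rw [← integral_const_mul]
  congr 1; funext x; ring

lemma pair_congr {ℓ : ℝ} (u : L2 ℓ) {f g : ℝ → ℝ} (h : ∀ x ∈ Ioo 0 ℓ, f x = g x) :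
    pair u f = pair u g :=
  setIntegral_congr_fun measurableSet_Ioo fun x hx => by simp only [h x hx]

lemma pair_add_left {ℓ : ℝ} (u v : L2 ℓ) {f : ℝ → ℝ} (hf : ContinuousOn f (Icc 0 ℓ)) :
    pair (u + v) f = pair u f + pair v f := by
  unfold pair
  rw [← integral_add (L2.integrable_mul u hf) (L2.integrable_mul v hf)]
  refine integral_congr_ae ?_
  filter_upwards [Lp.coeFn_add u v] with x hx
  rw [hx, Pi.add_apply, add_mul]

lemma continuousOn_pair {ℓ : ℝ} {w : ℝ → L2 ℓ} {s : Set ℝ} (hw : ContinuousOn w s) {f : ℝ → ℝ}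
    (hf : ContinuousOn f (Icc 0 ℓ)) : ContinuousOn (fun t => pair (w t) f) s := by
  unfold pair
  simp only [L2.integral_mul_eq_inner (memLp_two_of_continuousOn hf)]
  fun_prop

/-- The formal adjoint of a Volterra operator. -/
def adj (ℓ : ℝ) (k : ℝ → ℝ → ℝ) (f : ℝ → ℝ) (ξ : ℝ) : ℝ := ∫ s in ξ..ℓ, k s ξ * f s

lemma continuousOn_adj {ℓ : ℝ} (hℓ : 0 ≤ ℓ) {k : ℝ → ℝ → ℝ}
    (hk : ContinuousOn (Function.uncurry k) (triangle ℓ)) {f : ℝ → ℝ}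
    (hf : ContinuousOn f (Icc 0 ℓ)) : ContinuousOn (adj ℓ k f) (Icc 0 ℓ) := by
  have h1 : ContinuousOn (Function.uncurry fun _ s : ℝ => f s) (triangle ℓ) :=
    hf.comp (f := fun p : ℝ × ℝ => p.2) (by fun_prop) fun p hp => ⟨hp.1, hp.2.1.trans hp.2.2⟩
  have h2 := (continuousOn_comp_kernel hℓ h1 hk).comp (f := fun ξ : ℝ => (ℓ, ξ)) (by fun_prop)
    (s := Icc 0 ℓ) fun ξ hξ => ⟨hξ.1, hξ.2, le_rfl⟩
  refine h2.congr fun ξ _ => ?_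
  simp only [adj, Function.comp, Function.uncurry, mul_comm (f _)]

lemma pair_volterra {ℓ : ℝ} (hℓ : 0 ≤ ℓ) {k : ℝ → ℝ → ℝ}
    (hk : ContinuousOn (Function.uncurry k) (triangle ℓ)) {f : ℝ → ℝ}
    (hf : ContinuousOn f (Icc 0 ℓ)) (u : L2 ℓ) : pair (volterra ℓ k u) f = pair u (adj ℓ k f) := by
  unfold pair adj
  rw [← integral_volterra_mul hℓ hk (L2.integrable u)
    ((memLp_two_of_continuousOn hf).integrable one_le_two)]
  refine integral_congr_ae ?_
  filter_upwards [volterra_ae hℓ hk u] with x hx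
  rw [hx]

lemma pair_onePlus {ℓ : ℝ} (hℓ : 0 ≤ ℓ) {k : Fin 2 → Fin 2 → ℝ → ℝ → ℝ}
    (hk : ∀ i j, ContinuousOn (Function.uncurry (k i j)) (triangle ℓ)) {f : ℝ → ℝ}
    (hf : ContinuousOn f (Icc 0 ℓ)) (w : Fin 2 → L2 ℓ) (i : Fin 2) :
    pair (onePlus ℓ k w i) f = pair (w i) f + (pair (w 0) (adj ℓ (k i 0) f) +
      pair (w 1) (adj ℓ (k i 1) f)) := by
  rw [onePlus_apply, Fin.sum_univ_two, pair_add_left _ _ hf, pair_add_left _ _ hf,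
    pair_volterra hℓ (hk i 0) hf, pair_volterra hℓ (hk i 1) hf]

lemma L2loc.intervalIntegrable {f : ℝ → ℝ} (h : L2loc f) {a b : ℝ} (ha : 0 ≤ a) (hab : a ≤ b) :
    IntervalIntegrable f volume a b := by
  rw [intervalIntegrable_iff_integrableOn_Ioo_of_le hab]
  exact ((h b).integrable one_le_two).mono_measure
    (Measure.restrict_mono (Ioo_subset_Ioo_left ha) le_rfl)

lemma integral_source {ℓ : ℝ} (w : Fin 2 → L2 ℓ) (u : L2 ℓ) (c y : ℝ) {σ : Fin 2 → ℝ → ℝ}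
    (hσ : ∀ m, ContinuousOn (σ m) (Icc 0 ℓ)) {s ψ ψ' : ℝ → ℝ} (hψ : ContinuousOn ψ (Icc 0 ℓ))
    (hψ' : ContinuousOn ψ' (Icc 0 ℓ))
    (hs : IntegrableOn (fun x => s x * ψ x) (Ioo 0 ℓ)) :
    ∫ x in Ioo (0 : ℝ) ℓ, (c * u x * ψ' x + (∑ m, σ m x * w m x + y * s x) * ψ x) =
      c * pair u ψ' + (pair (w 0) (fun x => σ 0 x * ψ x) + pair (w 1) (fun x => σ 1 x * ψ x)) +
        y * ∫ x in Ioo (0 : ℝ) ℓ, s x * ψ x := by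
  unfold pair
  have i0 := L2.integrable_mul (w 0) (continuousOn_fun_mul (hσ 0) hψ)
  have i1 := L2.integrable_mul (w 1) (continuousOn_fun_mul (hσ 1) hψ)
  have i2 := (L2.integrable_mul u hψ').const_mul c
  rw [← integral_const_mul, ← integral_const_mul, ← integral_add i0 i1,
    ← integral_add i2 (integrable_fun_add i0 i1),
    ← integral_add (integrable_fun_add i2 (integrable_fun_add i0 i1)) (hs.const_mul y)]
  congr 1; funext x
  rw [Fin.sum_univ_two]; ring

/-- A Volterra transformation maps weak solutions with sources `σ₁` to weak solutions with
sources `σ₂`. -/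
theorem KerEq.weakTransport {ℓ : ℝ} {Λ : Fin 2 → ℝ} {σ₁ σ₂ : Fin 2 → Fin 2 → ℝ → ℝ}
    {k : Fin 2 → Fin 2 → ℝ → ℝ → ℝ} (hk : KerEq ℓ Λ σ₁ σ₂ k) (hℓ : 0 < ℓ) (hΛ : ∀ i, Λ i ≠ 0)
    (hσ₁ : ∀ i j, ContinuousOn (σ₁ i j) (Icc 0 ℓ)) (hσ₂ : ∀ i j, ContinuousOn (σ₂ i j) (Icc 0 ℓ))
    {w : ℝ → Fin 2 → L2 ℓ} {w0 wL s : Fin 2 → ℝ → ℝ} {y : ℝ → ℝ} {r : Fin 2 → ℝ → ℝ → ℝ}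
    (hw : ∀ i, ContinuousOn (fun t => w t i) (Ici 0)) (hw0 : ∀ i, L2loc (w0 i))
    (hwL : ∀ i, L2loc (wL i)) (hy : L2loc y) (hs : ∀ i, ContinuousOn (s i) (Icc 0 ℓ))
    (heq : ∀ i, WeakTransport (Λ i) (fun t => w t i)
      (fun t x => ∑ m, σ₁ i m x * w t m x + y t * s i x) (w0 i) (wL i))
    (hr : ∀ i, ∀ᵐ t ∂(volume.restrict (Ioi (0 : ℝ))), ∀ x ∈ Ioo 0 ℓ,
      ∑ j, k i j x 0 * (Λ j * w0 j t) +
        y t * (s i x + ∑ j, ∫ ξ in (0 : ℝ)..x, k i j x ξ * s j ξ) = r i t x) (i : Fin 2) :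
    WeakTransport (Λ i) (fun t => onePlus ℓ k (w t) i)
      (fun t x => ∑ m, σ₂ i m x * onePlus ℓ k (w t) m x + r i t x) (w0 i)
      (fun t => wL i t + ∑ j, pair (w t j) (fun ξ => k i j ℓ ξ)) := by
  intro φ hφ t ht
  have kc : ∀ i j, ContinuousOn (Function.uncurry (k i j)) (triangle ℓ) :=
    fun i j => (hk.ext i j).continuousOn
  have hφ' : Continuous (deriv φ) := hφ.continuous_deriv le_rfl
  have cφ : ContinuousOn φ (Icc 0 ℓ) := hφ.continuous.continuousOn
  have cφ' : ContinuousOn (deriv φ) (Icc 0 ℓ) := hφ'.continuousOn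
  -- Testing the transformed state with φ amounts to testing component i with φ and every component
  -- j with Ψ j. These adjoints are C¹ although the kernels are merely continuous, hence admissible
  -- in the weak formulation.
  choose Ψ hΨ eΨ dΨ using fun j => (hk.ext i j).exists_adjoint (hΛ j) hφ
  have cΨ : ∀ j, ContinuousOn (Ψ j) (Icc 0 ℓ) := fun j => (hΨ j).continuous.continuousOn
  have cΨ' : ∀ j, ContinuousOn (deriv (Ψ j)) (Icc 0 ℓ) :=
    fun j => ((hΨ j).continuous_deriv le_rfl).continuousOn
  have eA : ∀ j, ∀ ξ ∈ Ioo 0 ℓ, adj ℓ (k i j) φ ξ = Ψ j ξ :=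
    fun j ξ hξ => (eΨ j ξ (Ioo_subset_Icc_self hξ)).symm
  have ckL : ∀ j, ContinuousOn (fun ξ => k i j ℓ ξ) (Icc 0 ℓ) :=
    fun j => continuousOn_slice_left (kc i j) le_rfl
  have ck0 : ∀ j, ContinuousOn (fun x => k i j x 0) (Icc 0 ℓ) :=
    fun j => continuousOn_slice_right (kc i j) le_rfl
  -- the weak formulations of the components
  have bz : ∀ t, pair (onePlus ℓ k (w t) i) φ = pair (w t i) φ +
      (pair (w t 0) (Ψ 0) + pair (w t 1) (Ψ 1)) := by
    intro t
    rw [pair_onePlus hℓ.le kc cφ, pair_congr _ (eA 0), pair_congr _ (eA 1)]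
  set J : Fin 2 → (ℝ → ℝ) → ℝ → ℝ := fun j ψ τ => Λ j * (w0 j τ * ψ 0 - wL j τ * ψ ℓ) +
    ∫ x in Ioo (0 : ℝ) ℓ, (Λ j * w τ j x * deriv ψ x +
      (∑ m, σ₁ j m x * w τ m x + y τ * s j x) * ψ x) with hJ
  have is : ∀ j {ψ : ℝ → ℝ}, ContinuousOn ψ (Icc 0 ℓ) →
      IntegrableOn (fun x => s j x * ψ x) (Ioo 0 ℓ) := fun j ψ hψ =>
    (memLp_two_of_continuousOn ((hs j).mul hψ)).integrable one_le_two
  have eJ : ∀ j {ψ : ℝ → ℝ}, ContDiff ℝ 1 ψ → ∀ τ, J j ψ τ =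
      Λ j * (w0 j τ * ψ 0 - wL j τ * ψ ℓ) + (Λ j * pair (w τ j) (deriv ψ) +
      (pair (w τ 0) (fun x => σ₁ j 0 x * ψ x) + pair (w τ 1) (fun x => σ₁ j 1 x * ψ x)) +
      y τ * ∫ x in Ioo (0 : ℝ) ℓ, s j x * ψ x) := by
    intro j ψ hψ τ
    have c1 : ContinuousOn ψ (Icc 0 ℓ) := hψ.continuous.continuousOn
    have c2 : ContinuousOn (deriv ψ) (Icc 0 ℓ) := (hψ.continuous_deriv le_rfl).continuousOn
    rw [hJ]
    simp only
    rw [integral_source (w τ) (w τ j) (Λ j) (y τ) (hσ₁ j) c1 c2 (is j c1)]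
  have iJ : ∀ j {ψ : ℝ → ℝ}, ContDiff ℝ 1 ψ → IntervalIntegrable (J j ψ) volume 0 t := by
    intro j ψ hψ
    have c1 : ContinuousOn ψ (Icc 0 ℓ) := hψ.continuous.continuousOn
    have c2 : ContinuousOn (deriv ψ) (Icc 0 ℓ) := (hψ.continuous_deriv le_rfl).continuousOn
    have hsub : uIcc 0 t ⊆ Ici (0 : ℝ) := by
      rw [uIcc_of_le ht]; exact fun x hx => hx.1
    have ip : ∀ m {f : ℝ → ℝ}, ContinuousOn f (Icc 0 ℓ) →
        IntervalIntegrable (fun τ => pair (w τ m) f) volume 0 t := fun m f hf =>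
      ((continuousOn_pair (hw m) hf).mono hsub).intervalIntegrable
    have e : J j ψ = _ := funext (eJ j hψ)
    rw [e]
    exact ((((hw0 j).intervalIntegrable le_rfl ht).mul_const _).sub
      (((hwL j).intervalIntegrable le_rfl ht).mul_const _) |>.const_mul _).add
      ((((ip j c2).const_mul _).add ((ip 0 ((hσ₁ j 0).mul c1)).add
        (ip 1 ((hσ₁ j 1).mul c1)))).add ((hy.intervalIntegrable le_rfl ht).mul_const _))
  have hweak : ∀ j {ψ : ℝ → ℝ}, ContDiff ℝ 1 ψ → pair (w t j) ψ = pair (w 0 j) ψ +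
      ∫ τ in (0 : ℝ)..t, J j ψ τ := fun j ψ hψ => heq j ψ hψ t ht
  -- Since Ψ vanishes at ℓ, the boundary values there enter only through φ. At 0 the value of Ψ is
  -- the pairing of k(·,0) with φ, which turns the boundary values at 0 into part of the source `r`.
  have hΨℓ : ∀ j, Ψ j ℓ = 0 := fun j => by
    rw [eΨ j ℓ ⟨hℓ.le, le_rfl⟩, intervalIntegral.integral_same]
  have hΨ0 : ∀ j, Ψ j 0 = ∫ x in Ioo (0 : ℝ) ℓ, k i j x 0 * φ x := fun j => by
    rw [eΨ j 0 ⟨le_rfl, hℓ.le⟩, intervalIntegral.integral_of_le hℓ.le,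
      integral_Ioc_eq_integral_Ioo]
  -- the derivative of the adjoint test functions
  have cad : ∀ m j, ContinuousOn (adj ℓ (k m j) fun x => σ₂ i m x * φ x) (Icc 0 ℓ) := fun m j =>
    continuousOn_adj hℓ.le (kc m j) ((hσ₂ i m).mul cφ)
  -- The term with φ(ℓ) becomes the correction to the boundary value at ℓ. The last two terms come
  -- from the diagonal condition and exchange the local sources σ₁ for σ₂.
  have pd : ∀ j (u : L2 ℓ), Λ j * pair u (deriv (Ψ j)) =
      pair u (adj ℓ (k 0 j) fun x => σ₂ i 0 x * φ x) +
      pair u (adj ℓ (k 1 j) fun x => σ₂ i 1 x * φ x)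
      - pair u (fun x => σ₁ 0 j x * Ψ 0 x) - pair u (fun x => σ₁ 1 j x * Ψ 1 x)
      + Λ i * pair u (adj ℓ (k i j) (deriv φ)) - Λ i * φ ℓ * pair u (fun ξ => k i j ℓ ξ)
      + pair u (fun x => σ₂ i j x * φ x) - pair u (fun x => σ₁ i j x * φ x) := by
    intro j u
    have cm : ∀ (c : ℝ) {f : ℝ → ℝ}, ContinuousOn f (Icc 0 ℓ) →
        ContinuousOn (fun x => c * f x) (Icc 0 ℓ) := fun c f hf => continuousOn_const.mul hf
    have c0 := cm (-1) (continuousOn_fun_mul (hσ₁ 0 j) (cΨ 0))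
    have c1 := cm (-1) (continuousOn_fun_mul (hσ₁ 1 j) (cΨ 1))
    have c2 := cm (Λ i) (continuousOn_adj hℓ.le (kc i j) cφ')
    have c3 := continuousOn_fun_mul (hσ₂ i j) cφ
    have c4 := cm (-1) (continuousOn_fun_mul (hσ₁ i j) cφ)
    have c5 := cm (-(Λ i * φ ℓ)) (ckL j)
    have e : ∀ ξ ∈ Ioo 0 ℓ, Λ j * deriv (Ψ j) ξ =
        adj ℓ (k 0 j) (fun x => σ₂ i 0 x * φ x) ξ + (adj ℓ (k 1 j) (fun x => σ₂ i 1 x * φ x) ξ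
        + ((-1) * (σ₁ 0 j ξ * Ψ 0 ξ) + ((-1) * (σ₁ 1 j ξ * Ψ 1 ξ) +
        (Λ i * adj ℓ (k i j) (deriv φ) ξ + ((-(Λ i * φ ℓ)) * k i j ℓ ξ +
        (σ₂ i j ξ * φ ξ + (-1) * (σ₁ i j ξ * φ ξ))))))) := by
      intro ξ hξ
      have hξ' := Ioo_subset_Icc_self hξ
      have hd := hk.diag i j ξ hξ'
      rw [dΨ j ξ hξ', eΨ 0 ξ hξ', eΨ 1 ξ hξ']
      have ii : ∀ m n {f : ℝ → ℝ}, ContinuousOn f (Icc 0 ℓ) →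
          IntervalIntegrable (fun x => k m n x ξ * f x) volume ξ ℓ := by
        intro m n f hf
        refine ContinuousOn.intervalIntegrable ?_
        rw [uIcc_of_le hξ.2.le]
        exact (continuousOn_slice_right (kc m n) hξ.1.le).mul (hf.mono (Icc_subset_Icc_left hξ.1.le))
      have e1 : ∫ x in ξ..ℓ, ((∑ m, (σ₂ i m x * k m j x ξ - k i m x ξ * σ₁ m j ξ)) * φ x +
          Λ i * (k i j x ξ * deriv φ x)) =
          adj ℓ (k 0 j) (fun x => σ₂ i 0 x * φ x) ξ + adj ℓ (k 1 j) (fun x => σ₂ i 1 x * φ x) ξ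
          - σ₁ 0 j ξ * (∫ x in ξ..ℓ, k i 0 x ξ * φ x) - σ₁ 1 j ξ * (∫ x in ξ..ℓ, k i 1 x ξ * φ x)
          + Λ i * adj ℓ (k i j) (deriv φ) ξ := by
        unfold adj
        simp only [← intervalIntegral.integral_const_mul]
        have i1 := ii 0 j (continuousOn_fun_mul (hσ₂ i 0) cφ)
        have i2 := ii 1 j (continuousOn_fun_mul (hσ₂ i 1) cφ)
        have i3 := (ii i 0 cφ).const_mul (σ₁ 0 j ξ)
        have i4 := (ii i 1 cφ).const_mul (σ₁ 1 j ξ)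
        have i5 := (ii i j cφ').const_mul (Λ i)
        have i12 := intervalIntegrable_fun_add i1 i2
        have i123 := intervalIntegrable_fun_sub i12 i3
        rw [← intervalIntegral.integral_add i1 i2, ← intervalIntegral.integral_sub i12 i3,
          ← intervalIntegral.integral_sub i123 i4,
          ← intervalIntegral.integral_add (intervalIntegrable_fun_sub i123 i4) i5]
        congr 1; funext x
        rw [Fin.sum_univ_two]; ring
      rw [e1]
      linear_combination φ ξ * hd
    rw [← pair_const_mul, pair_congr u e]
    have d5 := continuousOn_fun_add c3 c4
    have d4 := continuousOn_fun_add c5 d5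
    have d3 := continuousOn_fun_add c2 d4
    have d2 := continuousOn_fun_add c1 d3
    have d1 := continuousOn_fun_add c0 d2
    rw [pair_add u (cad 0 j) (continuousOn_fun_add (cad 1 j) d1), pair_add u (cad 1 j) d1,
      pair_add u c0 d2, pair_add u c1 d3, pair_add u c2 d4, pair_add u c5 d5, pair_add u c3 c4]
    simp only [pair_const_mul]
    ring
  -- assembling
  show pair (onePlus ℓ k (w t) i) φ = pair (onePlus ℓ k (w 0) i) φ + _
  rw [bz t, bz 0, hweak i hφ, hweak 0 (hΨ 0), hweak 1 (hΨ 1)]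
  have : ∀ a b c A B C : ℝ, a + A + (b + B + (c + C)) = a + (b + c) + (A + (B + C)) := by
    intros; ring
  rw [this]
  congr 1
  rw [← intervalIntegral.integral_add (iJ 0 (hΨ 0)) (iJ 1 (hΨ 1)),
    ← intervalIntegral.integral_add (iJ i hφ) ((iJ 0 (hΨ 0)).add (iJ 1 (hΨ 1)))]
  refine intervalIntegral.integral_congr_ae_restrict ?_
  rw [uIoc_of_le ht]
  refine ae_mono (Measure.restrict_mono (fun s hs => hs.1 : Ioc 0 t ⊆ Ioi 0) le_rfl) ?_
  filter_upwards [hr i] with τ hτ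
  set R : ℝ → ℝ := fun x => ∑ j, k i j x 0 * (Λ j * w0 j τ) +
        y τ * (s i x + ∑ j, ∫ ξ in (0 : ℝ)..x, k i j x ξ * s j ξ) with hR
  have cV : ∀ j, ContinuousOn (fun x => ∫ ξ in (0 : ℝ)..x, k i j x ξ * s j ξ) (Icc 0 ℓ) := by
    intro j
    have h1 : ContinuousOn (Function.uncurry fun x _ : ℝ => s j x) (triangle ℓ) :=
      (hs j).comp (f := fun p : ℝ × ℝ => p.1) (by fun_prop)
        fun p hp => ⟨hp.1.trans hp.2.1, hp.2.2⟩
    exact (continuousOn_comp_kernel hℓ.le (kc i j) h1).comp (f := fun x : ℝ => (x, (0 : ℝ)))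
      (by fun_prop) (s := Icc 0 ℓ) fun x hx => ⟨le_rfl, hx.1, hx.2⟩
  have ir : ∀ {f : ℝ → ℝ}, ContinuousOn f (Icc 0 ℓ) → IntegrableOn (fun x => f x * φ x) (Ioo 0 ℓ) :=
    fun hf => (memLp_two_of_continuousOn (hf.mul cφ)).integrable one_le_two
  -- The source hypothesis in weak form: Fubini moves the Volterra integrals of s onto the adjoint
  -- test functions.
  have eR : ∫ x in Ioo (0 : ℝ) ℓ, r i τ x * φ x =
      Λ 0 * w0 0 τ * Ψ 0 0 + Λ 1 * w0 1 τ * Ψ 1 0 + y τ * ((∫ x in Ioo (0 : ℝ) ℓ, s i x * φ x) +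
      ((∫ x in Ioo (0 : ℝ) ℓ, s 0 x * Ψ 0 x) + ∫ x in Ioo (0 : ℝ) ℓ, s 1 x * Ψ 1 x)) := by
    have ev : ∀ j, ∫ x in Ioo (0 : ℝ) ℓ, s j x * Ψ j x =
        ∫ x in Ioo (0 : ℝ) ℓ, (∫ ξ in (0 : ℝ)..x, k i j x ξ * s j ξ) * φ x := by
      intro j
      rw [integral_volterra_mul hℓ.le (kc i j)
        ((memLp_two_of_continuousOn (hs j)).integrable one_le_two)
        ((memLp_two_of_continuousOn cφ).integrable one_le_two)]
      refine setIntegral_congr_fun measurableSet_Ioo fun x hx => ?_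
      simp only [eΨ j x (Ioo_subset_Icc_self hx)]
    rw [ev 0, ev 1, hΨ0 0, hΨ0 1]
    simp only [← integral_const_mul]
    have j1 := integrable_fun_add (ir (cV 0)) (ir (cV 1))
    have j2 := integrable_fun_add (ir (hs i)) j1
    have j3 := (ir (ck0 0)).const_mul (Λ 0 * w0 0 τ)
    have j4 := (ir (ck0 1)).const_mul (Λ 1 * w0 1 τ)
    rw [← integral_add (ir (cV 0)) (ir (cV 1)), ← integral_add (ir (hs i)) j1,
      ← integral_const_mul, ← integral_add j3 j4,
      ← integral_add (integrable_fun_add j3 j4) (j2.const_mul (y τ))]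
    refine setIntegral_congr_fun measurableSet_Ioo fun x hx => ?_
    simp only [← hτ x hx, Fin.sum_univ_two]
    ring
  have irr : IntegrableOn (fun x => r i τ x * φ x) (Ioo 0 ℓ) := by
    have cR : ContinuousOn R (Icc 0 ℓ) := by
      simp only [hR, Fin.sum_univ_two]
      exact (((ck0 0).mul continuousOn_const).add ((ck0 1).mul continuousOn_const)).add
        (continuousOn_const.mul ((hs i).add ((cV 0).add (cV 1))))
    refine (ir cR).congr_fun (fun x hx => ?_) measurableSet_Ioo
    simp only [hR, hτ x hx]
  have e2 := integral_source (onePlus ℓ k (w τ)) (onePlus ℓ k (w τ) i) (Λ i) 1 (hσ₂ i) cφ cφ' irr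
  simp only [one_mul] at e2
  rw [e2, eR, pair_onePlus hℓ.le kc cφ', pair_onePlus hℓ.le kc (continuousOn_fun_mul (hσ₂ i 0) cφ),
    pair_onePlus hℓ.le kc (continuousOn_fun_mul (hσ₂ i 1) cφ), eJ i hφ, eJ 0 (hΨ 0), eJ 1 (hΨ 1), pd 0, pd 1,
    hΨℓ 0, hΨℓ 1, Fin.sum_univ_two]
  rcases (by fin_cases i <;> simp : i = 0 ∨ i = 1) with rfl | rfl <;> ring

/-! ### Primitives and the delay balance -/

lemma absolutelyContinuous_prim {f : ℝ → ℝ} {a b : ℝ} (c : ℝ)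
    (hf : IntervalIntegrable f volume a b) :
    AbsolutelyContinuousOnInterval (fun x => c + ∫ s in a..x, f s) a b :=
  ((contDiff_const (c := c)).contDiffOn.absolutelyContinuousOnInterval).fun_add
    (hf.absolutelyContinuousOnInterval_intervalIntegral (c := a) left_mem_uIcc)

lemma continuousOn_prim {F f : ℝ → ℝ} {a b : ℝ} (hab : a ≤ b) (hf : IntervalIntegrable f volume a b)
    (hF : ∀ x ∈ Icc a b, F x = F a + ∫ s in a..x, f s) : ContinuousOn F (Icc a b) := by
  have := (absolutelyContinuous_prim (F a) hf).continuousOn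
  rw [uIcc_of_le hab] at this
  exact this.congr hF

lemma ae_hasDerivAt_prim {F f : ℝ → ℝ} {a b : ℝ} (hab : a ≤ b)
    (hf : IntervalIntegrable f volume a b)
    (hF : ∀ x ∈ Icc a b, F x = F a + ∫ s in a..x, f s) :
    ∀ᵐ x, x ∈ Ioo a b → HasDerivAt F (f x) x := by
  filter_upwards [hf.ae_hasDerivAt_integral] with x hx hm
  have h := (hx (by rw [uIcc_of_le hab]; exact Ioo_subset_Icc_self hm) a left_mem_uIcc).const_add (F a)
  refine h.congr_of_eventuallyEq ?_
  filter_upwards [Ioo_mem_nhds hm.1 hm.2] with y hy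
  exact hF y (Ioo_subset_Icc_self hy)

/-- Integration by parts for primitives of integrable functions. -/
lemma integral_prim_mul {F f G g : ℝ → ℝ} {a b : ℝ} (hab : a ≤ b)
    (hf : IntervalIntegrable f volume a b) (hg : IntervalIntegrable g volume a b)
    (hF : ∀ x ∈ Icc a b, F x = F a + ∫ s in a..x, f s)
    (hG : ∀ x ∈ Icc a b, G x = G a + ∫ s in a..x, g s) :
    ∫ x in a..b, (f x * G x + F x * g x) = F b * G b - F a * G a := by
  have h := (absolutelyContinuous_prim (F a) hf).integral_deriv_mul_eq_sub
    (absolutelyContinuous_prim (G a) hg)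
  simp only [intervalIntegral.integral_same, add_zero] at h
  rw [← hF b ⟨hab, le_rfl⟩, ← hG b ⟨hab, le_rfl⟩] at h
  rw [← h]
  refine intervalIntegral.integral_congr_ae ?_
  have hb : ∀ᵐ x : ℝ, x ≠ b := by simp [ae_iff, measure_singleton]
  filter_upwards [ae_hasDerivAt_prim (F := fun x => F a + ∫ s in a..x, f s) hab hf (by simp),
    ae_hasDerivAt_prim (F := fun x => G a + ∫ s in a..x, g s) hab hg (by simp), hb] with x h1 h2 h3 hx
  rw [uIoc_of_le hab] at hx
  have hm : x ∈ Ioo a b := ⟨hx.1, lt_of_le_of_ne hx.2 h3⟩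
  rw [(h1 hm).deriv, (h2 hm).deriv, hF x (Ioo_subset_Icc_self hm), hG x (Ioo_subset_Icc_self hm)]

/-- Local integrability on the line. -/
def LocInt (A : ℝ → ℝ) : Prop := ∀ a b : ℝ, IntervalIntegrable A volume a b

/-- Local square-integrability on the line. -/
def LocSq (A : ℝ → ℝ) : Prop := LocInt A ∧ LocInt fun s => A s ^ 2

lemma LocInt.comp_sub_left {A : ℝ → ℝ} (h : LocInt A) (t : ℝ) : LocInt fun s => A (t - s) := by
  intro a b
  have := (h (t - a) (t - b)).comp_sub_left t
  simpa using this

lemma LocInt.comp_sub_right {A : ℝ → ℝ} (h : LocInt A) (t : ℝ) : LocInt fun s => A (s - t) := by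
  intro a b
  have := (h (a - t) (b - t)).comp_sub_right t
  simpa using this

lemma LocInt.comp_div {A : ℝ → ℝ} (h : LocInt A) {c : ℝ} (hc : c ≠ 0) :
    LocInt fun s => A (s / c) := by
  intro a b
  have := (h (c⁻¹ * a) (c⁻¹ * b)).comp_mul_left (c := c⁻¹)
  simp only [ne_eq, inv_eq_zero, hc, not_false_eq_true, mul_div_cancel_left₀] at this
  simpa only [div_eq_inv_mul] using this

lemma LocInt.sub_eq {A : ℝ → ℝ} (h : LocInt A) (a b : ℝ) :
    (∫ s in (0 : ℝ)..b, A s) - ∫ s in (0 : ℝ)..a, A s = ∫ s in a..b, A s :=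
  intervalIntegral.integral_interval_sub_left (h _ _) (h _ _)

/-- For 0 < s ≤ t and 0 < σ ≤ τ the difference s - σ lies in (-τ, t]. The integrand therefore agrees
with the convolution integrand of two truncated, globally integrable functions. -/
lemma integrableOn_convolution {A g : ℝ → ℝ} (hA : LocInt A) {τ t : ℝ} (hτ : 0 ≤ τ) (ht : 0 ≤ t)
    (hg : IntervalIntegrable g volume 0 τ) :
    IntegrableOn (Function.uncurry fun s σ => g σ * A (s - σ)) (Ioc 0 t ×ˢ Ioc 0 τ) := by
  have h1 : Integrable ((Ioc 0 τ).indicator g) volume :=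
    ((intervalIntegrable_iff_integrableOn_Ioc_of_le hτ).1 hg).integrable_indicator
      measurableSet_Ioc
  have h2 : Integrable ((Ioc (-τ) t).indicator A) volume :=
    ((intervalIntegrable_iff_integrableOn_Ioc_of_le (by linarith)).1
      (hA (-τ) t)).integrable_indicator measurableSet_Ioc
  have h3 := h1.convolution_integrand (ContinuousLinearMap.mul ℝ ℝ) h2
  refine (h3.integrableOn (s := Ioc 0 t ×ˢ Ioc 0 τ)).congr_fun_ae ?_
  have hne : ∀ᵐ p : ℝ × ℝ ∂(volume.restrict (Ioc 0 t ×ˢ Ioc 0 τ)), p ∈ Ioc 0 t ×ˢ Ioc 0 τ :=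
    ae_restrict_mem (measurableSet_Ioc.prod measurableSet_Ioc)
  filter_upwards [hne] with p hp
  have m1 : p.2 ∈ Ioc 0 τ := hp.2
  have m2 : p.1 - p.2 ∈ Ioc (-τ) t :=
    ⟨by linarith [hp.1.1, hp.2.2], by linarith [hp.1.2, hp.2.1]⟩
  simp [Function.uncurry, indicator_of_mem m1, indicator_of_mem m2]

lemma intervalIntegrable_conv {A g : ℝ → ℝ} (hA : LocInt A) {τ t : ℝ} (hτ : 0 ≤ τ) (ht : 0 ≤ t)
    (hg : IntervalIntegrable g volume 0 τ) :
    IntervalIntegrable (fun s => ∫ σ in (0 : ℝ)..τ, g σ * A (s - σ)) volume 0 t := by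
  have h := integrableOn_convolution hA hτ ht hg
  rw [IntegrableOn, Measure.volume_eq_prod, ← Measure.prod_restrict] at h
  rw [intervalIntegrable_iff_integrableOn_Ioc_of_le ht]
  simp only [intervalIntegral.integral_of_le hτ]
  exact h.integral_prod_left

/-- Time derivative, in integrated form, of a weighted integral over a moving window. -/
theorem delay_balance {A χ g : ℝ → ℝ} (hA : LocInt A) {τ t : ℝ} (hτ : 0 ≤ τ) (ht : 0 ≤ t)
    (hg : IntervalIntegrable g volume 0 τ)
    (hχ : ∀ σ ∈ Icc 0 τ, χ σ = χ 0 + ∫ s in (0 : ℝ)..σ, g s) :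
    ∫ σ in (0 : ℝ)..τ, χ σ * A (t - σ) = (∫ σ in (0 : ℝ)..τ, χ σ * A (0 - σ)) +
      ∫ s in (0 : ℝ)..t, (χ 0 * A s - χ τ * A (s - τ) + ∫ σ in (0 : ℝ)..τ, g σ * A (s - σ)) := by
  set G : ℝ → ℝ := fun t => ∫ s in (0 : ℝ)..t, A s with hG
  have Gc : Continuous G := intervalIntegral.continuous_primitive hA 0
  have χc : ContinuousOn χ (uIcc 0 τ) := by
    rw [uIcc_of_le hτ]; exact continuousOn_prim hτ hg hχ
  -- The signal A is only integrable, so the window is first integrated by parts against the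
  -- primitive G of A, which is continuous.
  have h1 : ∀ t, ∫ σ in (0 : ℝ)..τ, χ σ * A (t - σ) =
      χ 0 * G t - χ τ * G (t - τ) + ∫ σ in (0 : ℝ)..τ, g σ * G (t - σ) := by
    intro t
    have hb := integral_prim_mul hτ hg ((hA.comp_sub_left t 0 τ).neg) hχ
      (G := fun σ => G (t - σ)) (fun σ _ => ?_)
    · have i1 : IntervalIntegrable (fun σ => g σ * G (t - σ)) volume 0 τ :=
        hg.mul_continuousOn (Gc.comp (f := fun σ : ℝ => t - σ) (by fun_prop)).continuousOn
      have i2 : IntervalIntegrable (fun σ => χ σ * A (t - σ)) volume 0 τ :=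
        (hA.comp_sub_left t 0 τ).continuousOn_mul χc
      have e : ∀ σ, g σ * G (t - σ) + χ σ * (-fun s => A (t - s)) σ =
          g σ * G (t - σ) - χ σ * A (t - σ) := fun σ => by simp [sub_eq_add_neg]
      simp only [e] at hb
      rw [intervalIntegral.integral_sub i1 i2, sub_zero] at hb
      linarith
    · simp only [sub_zero, Pi.neg_apply, intervalIntegral.integral_neg,
        intervalIntegral.integral_comp_sub_left, ← hA.sub_eq (t - σ) t, hG]
      ring
  have h2 : ∀ σ, G (t - σ) - G (0 - σ) = ∫ s in (0 : ℝ)..t, A (s - σ) := by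
    intro σ
    rw [intervalIntegral.integral_comp_sub_right, ← hA.sub_eq]
  have ig : ∀ t, IntervalIntegrable (fun σ => g σ * G (t - σ)) volume 0 τ := fun t =>
    hg.mul_continuousOn (Gc.comp (f := fun σ : ℝ => t - σ) (by fun_prop)).continuousOn
  -- Increments of G are integrals of A; exchanging the two integrations gives the distributed term.
  have h3 : (∫ σ in (0 : ℝ)..τ, g σ * G (t - σ)) - (∫ σ in (0 : ℝ)..τ, g σ * G (0 - σ)) =
      ∫ s in (0 : ℝ)..t, ∫ σ in (0 : ℝ)..τ, g σ * A (s - σ) := by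
    rw [← intervalIntegral.integral_sub (ig t) (ig 0), intervalIntegral_intervalIntegral_swap]
    · refine intervalIntegral.integral_congr fun σ _ => ?_
      simp only [intervalIntegral.integral_const_mul]
      rw [← h2]; ring
    · rw [uIoc_of_le hτ, uIoc_of_le ht]
      exact integrableOn_convolution hA hτ ht hg
  have i1 : IntervalIntegrable (fun s => χ 0 * A s) volume 0 t := (hA 0 t).const_mul _
  have i2 : IntervalIntegrable (fun s => χ τ * A (s - τ)) volume 0 t :=
    (hA.comp_sub_right τ 0 t).const_mul _
  rw [intervalIntegral.integral_add (intervalIntegrable_fun_sub i1 i2)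
    (intervalIntegrable_conv hA hτ ht hg), intervalIntegral.integral_sub i1 i2,
    intervalIntegral.integral_const_mul, intervalIntegral.integral_const_mul, ← h2 τ, ← h3,
    h1 t, h1 0]
  simp only [hG, intervalIntegral.integral_same]
  ring

/-! ### Travelling profiles -/

/-- `x₀` is the inflow boundary of `(0,ℓ)` for the transport speed `c`. -/
def IsInflow (ℓ c x₀ : ℝ) : Prop := (0 < c ∧ x₀ = 0) ∨ (c < 0 ∧ x₀ = ℓ)

lemma IsInflow.ne {ℓ c x₀ : ℝ} (h : IsInflow ℓ c x₀) : c ≠ 0 := by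
  rcases h with h | h
  · exact h.1.ne'
  · exact h.1.ne

lemma IsInflow.mem {ℓ c x₀ x : ℝ} (h : IsInflow ℓ c x₀) (hx : x ∈ Icc 0 ℓ) :
    x / c - x₀ / c ∈ Icc 0 (ℓ / |c|) := by
  rcases h with ⟨hc, rfl⟩ | ⟨hc, rfl⟩
  · rw [abs_of_pos hc, zero_div, sub_zero]
    exact ⟨div_nonneg hx.1 hc.le, div_le_div_of_nonneg_right hx.2 hc.le⟩
  · rw [abs_of_neg hc, ← sub_div, ← neg_div_neg_eq (x - x₀) c]
    have : 0 ≤ -c := by linarith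
    exact ⟨div_nonneg (by linarith [hx.2]) this,
      div_le_div_of_nonneg_right (by linarith [hx.1]) this⟩

lemma IsInflow.integral_comp {ℓ c x₀ : ℝ} (h : IsInflow ℓ c x₀) (hℓ : 0 ≤ ℓ) (G : ℝ → ℝ) :
    ∫ x in Ioo (0 : ℝ) ℓ, G (x / c - x₀ / c) = |c| * ∫ σ in (0 : ℝ)..(ℓ / |c|), G σ := by
  rw [← integral_Ioc_eq_integral_Ioo, ← intervalIntegral.integral_of_le hℓ,
    intervalIntegral.integral_comp_div_sub _ h.ne, smul_eq_mul]
  rcases h with ⟨hc, rfl⟩ | ⟨hc, rfl⟩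
  · rw [abs_of_pos hc]; simp
  · rw [abs_of_neg hc, intervalIntegral.integral_symm]; simp [div_neg]

/-- The profile at time `t` of the signal `A` travelling with speed `c` from the boundary `x₀`. -/
def profFun (c x₀ : ℝ) (A : ℝ → ℝ) (t x : ℝ) : ℝ := A (t - (x / c - x₀ / c))

lemma LocInt.profFun {A : ℝ → ℝ} (hA : LocInt A) {c : ℝ} (hc : c ≠ 0) (x₀ t : ℝ) :
    LocInt (profFun c x₀ A t) := by
  have := ((hA.comp_sub_left t).comp_sub_right (x₀ / c)).comp_div hc
  exact this

lemma memLp_two_of_intervalIntegrable {f : ℝ → ℝ} {ℓ : ℝ} (hℓ : 0 ≤ ℓ)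
    (h1 : IntervalIntegrable f volume 0 ℓ) (h2 : IntervalIntegrable (fun x => f x ^ 2) volume 0 ℓ) :
    MemLp f 2 (volume.restrict (Ioo (0 : ℝ) ℓ)) := by
  rw [intervalIntegrable_iff_integrableOn_Ioo_of_le hℓ] at h1 h2
  exact (memLp_two_iff_integrable_sq h1.aestronglyMeasurable).2 h2

lemma LocSq.memLp_profFun {A : ℝ → ℝ} (hA : LocSq A) {c ℓ : ℝ} (hc : c ≠ 0) (hℓ : 0 ≤ ℓ)
    (x₀ t : ℝ) : MemLp (profFun c x₀ A t) 2 (volume.restrict (Ioo (0 : ℝ) ℓ)) :=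
  memLp_two_of_intervalIntegrable hℓ (hA.1.profFun hc x₀ t _ _) (hA.2.profFun hc x₀ t _ _)

open Classical in
/-- The travelling profile as an element of `L²(0,ℓ)`. -/
def prof (ℓ c x₀ : ℝ) (A : ℝ → ℝ) (t : ℝ) : L2 ℓ :=
  if h : MemLp (profFun c x₀ A t) 2 (volume.restrict (Ioo (0 : ℝ) ℓ)) then h.toLp _ else 0

lemma prof_ae {A : ℝ → ℝ} (hA : LocSq A) {c ℓ : ℝ} (hc : c ≠ 0) (hℓ : 0 ≤ ℓ) (x₀ t : ℝ) :
    prof ℓ c x₀ A t =ᵐ[volume.restrict (Ioo (0 : ℝ) ℓ)] profFun c x₀ A t := by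
  unfold prof
  rw [dif_pos (hA.memLp_profFun hc hℓ x₀ t)]
  exact MemLp.coeFn_toLp _

lemma integral_prof_mul {A : ℝ → ℝ} (hA : LocSq A) {c ℓ x₀ : ℝ} (h : IsInflow ℓ c x₀) (hℓ : 0 ≤ ℓ)
    (t : ℝ) (ψ : ℝ → ℝ) : ∫ x in Ioo (0 : ℝ) ℓ, prof ℓ c x₀ A t x * ψ x =
      |c| * ∫ σ in (0 : ℝ)..(ℓ / |c|), ψ (x₀ + c * σ) * A (t - σ) := by
  rw [← h.integral_comp hℓ fun σ => ψ (x₀ + c * σ) * A (t - σ)]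
  refine integral_congr_ae ?_
  filter_upwards [prof_ae hA h.ne hℓ x₀ t] with x hx
  rw [hx, profFun, mul_comm]
  have : x₀ + c * (x / c - x₀ / c) = x := by have := h.ne; field_simp; ring
  rw [this]

lemma norm_prof_sq {A : ℝ → ℝ} (hA : LocSq A) {c ℓ x₀ : ℝ} (h : IsInflow ℓ c x₀) (hℓ : 0 ≤ ℓ)
    (t : ℝ) : ‖prof ℓ c x₀ A t‖ ^ 2 = |c| * ∫ σ in (0 : ℝ)..(ℓ / |c|), A (t - σ) ^ 2 := by
  rw [L2.norm_sq, ← h.integral_comp hℓ fun σ => A (t - σ) ^ 2]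
  refine integral_congr_ae ?_
  filter_upwards [prof_ae hA h.ne hℓ x₀ t] with x hx
  rw [hx, profFun]

lemma LocInt.indicator {A : ℝ → ℝ} (hA : LocInt A) {s : Set ℝ} (hs : MeasurableSet s) :
    LocInt (s.indicator A) := fun a b =>
  ⟨(hA a b).1.indicator hs, (hA a b).2.indicator hs⟩

/-- This is continuity of translations in L²: for t near t₀ the profile is the restriction to (0, ℓ)
of one fixed function of L²(ℝ) evaluated at c t + x₀ - x. -/
lemma continuous_prof {A : ℝ → ℝ} (hA : LocSq A) {c ℓ x₀ : ℝ} (h : IsInflow ℓ c x₀)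
    (hℓ : 0 ≤ ℓ) : Continuous (prof ℓ c x₀ A) := by
  rw [continuous_iff_continuousAt]
  intro t₀
  have hc := h.ne
  -- Large enough that, for |t - t₀| < 1, the truncation of A to (-R, R] is invisible on (0, ℓ),
  -- while the truncated signal is square integrable on the line.
  set R : ℝ := |t₀| + 2 + ℓ / |c| with hR
  have hτ : 0 ≤ ℓ / |c| := div_nonneg hℓ (abs_nonneg _)
  set A' : ℝ → ℝ := fun y => (Ioc (-R) R).indicator A (y / c) with hA'
  have hcomp : ∀ {f : ℝ → ℝ}, Integrable f → Integrable fun y => f (y / c) := fun hf => by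
    simpa only [div_eq_mul_inv] using hf.comp_mul_right' (inv_ne_zero hc)
  have hRR : -R ≤ R := by
    have := abs_nonneg t₀
    linarith
  have hm : MemLp A' 2 volume := by
    have i1 : Integrable ((Ioc (-R) R).indicator A) :=
      ((intervalIntegrable_iff_integrableOn_Ioc_of_le hRR).1 (hA.1 (-R) R)).integrable_indicator
        measurableSet_Ioc
    have i2 : Integrable ((Ioc (-R) R).indicator fun s => A s ^ 2) :=
      ((intervalIntegrable_iff_integrableOn_Ioc_of_le hRR).1 (hA.2 (-R) R)).integrable_indicator
        measurableSet_Ioc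
    rw [memLp_two_iff_integrable_sq (hcomp i1).aestronglyMeasurable]
    refine (hcomp i2).congr (Filter.Eventually.of_forall fun y => ?_)
    by_cases hy : y / c ∈ Ioc (-R) R
    · simp [indicator_of_mem hy]
    · simp [indicator_of_notMem hy]
  let g : ℝ → C(ℝ, ℝ) := fun t => ⟨fun x => c * t + x₀ - x, by fun_prop⟩
  have hg : ∀ t, MeasurePreserving (g t) volume volume := fun t =>
    Measure.measurePreserving_sub_left volume (c * t + x₀)
  have hgc : Continuous g := by
    refine ContinuousMap.continuous_of_continuous_uncurry _ ?_
    show Continuous fun p : ℝ × ℝ => c * p.1 + x₀ - p.2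
    fun_prop
  let f : ℝ → Lp ℝ 2 (volume : Measure ℝ) := fun t =>
    Lp.compMeasurePreserving (g t) (hg t) (hm.toLp A')
  have hf : Filter.Tendsto f (nhds t₀) (nhds (f t₀)) :=
    Filter.Tendsto.compMeasurePreservingLp (f := fun _ => hm.toLp A') tendsto_const_nhds
      (hgc.tendsto t₀) hg (hg t₀) (by norm_num)
  have hfae : ∀ t, f t =ᵐ[volume] fun x => A' (c * t + x₀ - x) := by
    intro t
    refine (Lp.coeFn_compMeasurePreserving _ (hg t)).trans ?_
    exact (hg t).quasiMeasurePreserving.ae_eq_comp hm.coeFn_toLp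
  have hpae : ∀ t, |t - t₀| < 1 →
      prof ℓ c x₀ A t =ᵐ[volume.restrict (Ioo (0 : ℝ) ℓ)] f t := by
    intro t ht
    filter_upwards [prof_ae hA hc hℓ x₀ t, ae_restrict_of_ae (hfae t),
      ae_restrict_mem measurableSet_Ioo] with x h1 h2 hx
    rw [h1, h2]
    have e : (c * t + x₀ - x) / c = t - (x / c - x₀ / c) := by field_simp; ring
    have hmem := h.mem (Ioo_subset_Icc_self hx)
    rw [abs_lt] at ht
    have a1 := neg_abs_le t₀
    have a2 := le_abs_self t₀
    have hI : t - (x / c - x₀ / c) ∈ Ioc (-R) R :=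
      ⟨by linarith [hmem.2], by linarith [hmem.1]⟩
    simp only [hA', e, indicator_of_mem hI, profFun]
  have hbound : ∀ t, |t - t₀| < 1 → dist (prof ℓ c x₀ A t) (prof ℓ c x₀ A t₀) ≤ dist (f t) (f t₀) := by
    intro t ht
    rw [Lp.dist_def, Lp.dist_def]
    have e : eLpNorm (⇑(prof ℓ c x₀ A t) - ⇑(prof ℓ c x₀ A t₀)) 2 (volume.restrict (Ioo (0 : ℝ) ℓ)) =
        eLpNorm (⇑(f t) - ⇑(f t₀)) 2 (volume.restrict (Ioo (0 : ℝ) ℓ)) :=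
      eLpNorm_congr_ae ((hpae t ht).sub (hpae t₀ (by simp)))
    rw [e]
    refine ENNReal.toReal_mono ?_ (eLpNorm_mono_measure _ Measure.restrict_le_self)
    exact ((Lp.memLp (f t)).sub (Lp.memLp (f t₀))).2.ne
  rw [ContinuousAt, tendsto_iff_dist_tendsto_zero]
  rw [tendsto_iff_dist_tendsto_zero] at hf
  refine squeeze_zero' (Filter.Eventually.of_forall fun _ => dist_nonneg) ?_ hf
  filter_upwards [Metric.ball_mem_nhds t₀ one_pos] with t ht
  exact hbound t (by rwa [Metric.mem_ball, Real.dist_eq] at ht)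

/-- The weak formulation of the transport of a profile. -/
lemma integral_prof_balance {A : ℝ → ℝ} (hA : LocSq A) {c ℓ x₀ : ℝ} (h : IsInflow ℓ c x₀)
    (hℓ : 0 ≤ ℓ) {ψ : ℝ → ℝ} (hψ : ContDiff ℝ 1 ψ) {t : ℝ} (ht : 0 ≤ t) :
    ∫ x in Ioo (0 : ℝ) ℓ, prof ℓ c x₀ A t x * ψ x =
      (∫ x in Ioo (0 : ℝ) ℓ, prof ℓ c x₀ A 0 x * ψ x) + ∫ s in (0 : ℝ)..t,
        (|c| * (A s * ψ x₀ - A (s - ℓ / |c|) * ψ (ℓ - x₀)) +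
          ∫ x in Ioo (0 : ℝ) ℓ, (c * prof ℓ c x₀ A s x * deriv ψ x + 0 * ψ x)) := by
  have hτ : 0 ≤ ℓ / |c| := div_nonneg hℓ (abs_nonneg _)
  have hψ' : Continuous (deriv ψ) := hψ.continuous_deriv le_rfl
  have gc : Continuous fun σ => deriv ψ (x₀ + c * σ) * c :=
    (hψ'.comp (f := fun σ : ℝ => x₀ + c * σ) (by fun_prop)).mul continuous_const
  have hd : ∀ σ, HasDerivAt (fun σ => ψ (x₀ + c * σ)) (deriv ψ (x₀ + c * σ) * c) σ := by
    intro σ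
    have h1 := ((hψ.differentiable one_ne_zero).differentiableAt (x := x₀ + c * σ)).hasDerivAt
    have h2 : HasDerivAt (fun σ : ℝ => x₀ + c * σ) c σ := by
      simpa using ((hasDerivAt_id σ).const_mul c).const_add x₀
    exact HasDerivAt.comp (h := fun σ : ℝ => x₀ + c * σ) σ h1 h2
  have hb := delay_balance (A := A) (χ := fun σ => ψ (x₀ + c * σ)) hA.1 hτ ht
    (g := fun σ => deriv ψ (x₀ + c * σ) * c) (gc.intervalIntegrable 0 _) (fun σ _ => by
      rw [intervalIntegral.integral_eq_sub_of_hasDerivAt (fun s _ => hd s)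
        (gc.intervalIntegrable _ _)]; ring)
  rw [integral_prof_mul hA h hℓ, integral_prof_mul hA h hℓ, hb, mul_add]
  congr 1
  rw [← intervalIntegral.integral_const_mul]
  refine intervalIntegral.integral_congr fun s _ => ?_
  have e1 : x₀ + c * (ℓ / |c|) = ℓ - x₀ := by
    rcases h with ⟨hc, rfl⟩ | ⟨hc, rfl⟩
    · rw [abs_of_pos hc]; field_simp; ring
    · rw [abs_of_neg hc]; have := hc.ne; field_simp; ring
  have e2 : ∫ x in Ioo (0 : ℝ) ℓ, (c * prof ℓ c x₀ A s x * deriv ψ x + 0 * ψ x) =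
      |c| * ∫ σ in (0 : ℝ)..(ℓ / |c|), deriv ψ (x₀ + c * σ) * c * A (s - σ) := by
    have e3 := integral_prof_mul hA h hℓ s fun x => deriv ψ x * c
    rw [← e3]
    congr 1; funext x; ring
  simp only [e1, e2, mul_zero, add_zero]
  ring

lemma weakTransport_prof_pos {A : ℝ → ℝ} (hA : LocSq A) {c ℓ : ℝ} (hc : 0 < c) (hℓ : 0 ≤ ℓ) :
    WeakTransport c (prof ℓ c 0 A) (fun _ _ => 0) A (fun s => A (s - ℓ / c)) := by
  intro ψ hψ t ht
  rw [integral_prof_balance hA (Or.inl ⟨hc, rfl⟩) hℓ hψ ht, abs_of_pos hc, sub_zero]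

lemma weakTransport_prof_neg {A : ℝ → ℝ} (hA : LocSq A) {c ℓ : ℝ} (hc : 0 < c) (hℓ : 0 ≤ ℓ) :
    WeakTransport (-c) (prof ℓ (-c) ℓ A) (fun _ _ => 0) (fun s => A (s - ℓ / c)) A := by
  intro ψ hψ t ht
  rw [integral_prof_balance hA (Or.inr ⟨by linarith, rfl⟩) hℓ hψ ht, abs_neg, abs_of_pos hc, sub_self]
  congr 1
  refine intervalIntegral.integral_congr fun s _ => ?_
  ring

/-! ### Uniqueness and representation of sourceless weak solutions -/

/-- In the variable y = e^x the exponentials e^{kx} become powers, so by Weierstrass their span is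
uniformly dense on a compact interval containing both [0, ℓ] and the values of p on [0, t]. -/
lemma integral_eq_zero_of_moments {ℓ t : ℝ} {f g p : ℝ → ℝ} (hf : IntegrableOn f (Icc 0 ℓ))
    (hg : IntegrableOn g (Icc 0 t)) (hp : Continuous p)
    (h : ∀ k : ℕ, (∫ x in Icc (0 : ℝ) ℓ, f x * Real.exp x ^ k) +
      ∫ s in Icc (0 : ℝ) t, g s * Real.exp (p s) ^ k = 0) {φ : ℝ → ℝ} (hφ : Continuous φ) :
    (∫ x in Icc (0 : ℝ) ℓ, f x * φ x) + ∫ s in Icc (0 : ℝ) t, g s * φ (p s) = 0 := by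
  obtain ⟨M₁, hM₁⟩ := (isCompact_Icc (a := (0 : ℝ)) (b := t)).exists_bound_of_continuousOn
    hp.continuousOn
  set M := max M₁ ℓ
  have mf : ∀ {φ : ℝ → ℝ}, Continuous φ → IntegrableOn (fun x => f x * φ x) (Icc 0 ℓ) :=
    fun hφ => hf.mul_continuousOn hφ.continuousOn isCompact_Icc
  have mg : ∀ {φ : ℝ → ℝ}, Continuous φ → IntegrableOn (fun x => g x * φ (p x)) (Icc 0 t) :=
    fun hφ => hg.mul_continuousOn (hφ.comp hp).continuousOn isCompact_Icc
  set C := (∫ x in Icc (0 : ℝ) ℓ, |f x|) + ∫ s in Icc (0 : ℝ) t, |g s| with hC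
  have hC0 : 0 ≤ C := add_nonneg (integral_nonneg fun _ => abs_nonneg _)
    (integral_nonneg fun _ => abs_nonneg _)
  have key : ∀ ε > 0, |(∫ x in Icc (0 : ℝ) ℓ, f x * φ x) + ∫ s in Icc (0 : ℝ) t, g s * φ (p s)| ≤
      ε * C := by
    intro ε hε
    have hc : ContinuousOn (fun y => φ (Real.log y)) (Icc (Real.exp (-M)) (Real.exp M)) := by
      refine hφ.comp_continuousOn (Real.continuousOn_log.mono fun y hy => ?_)
      exact (lt_of_lt_of_le (Real.exp_pos _) hy.1).ne'
    obtain ⟨P, hP⟩ := exists_polynomial_near_of_continuousOn _ _ _ hc ε hε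
    have hP' : ∀ x, |x| ≤ M → |φ x - P.eval (Real.exp x)| ≤ ε := by
      intro x hx
      rw [abs_le] at hx
      have := hP (Real.exp x) ⟨Real.exp_le_exp.2 hx.1, Real.exp_le_exp.2 hx.2⟩
      rw [Real.log_exp] at this
      rw [abs_sub_comm]; exact this.le
    have cP : Continuous fun x => P.eval (Real.exp x) := P.continuous.comp Real.continuous_exp
    have hz : (∫ x in Icc (0 : ℝ) ℓ, f x * P.eval (Real.exp x)) +
        ∫ s in Icc (0 : ℝ) t, g s * P.eval (Real.exp (p s)) = 0 := by
      simp only [Polynomial.eval_eq_sum_range, Finset.mul_sum]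
      have ck : ∀ k : ℕ, Continuous fun x => P.coeff k * Real.exp x ^ k := fun k => by fun_prop
      rw [integral_finsetSum _ fun k _ => mf (ck k), integral_finsetSum _ fun k _ => mg (ck k),
        ← Finset.sum_add_distrib]
      refine Finset.sum_eq_zero fun k _ => ?_
      simp only [mul_left_comm _ (P.coeff k), integral_const_mul]
      rw [← mul_add, h k, mul_zero]
    have e1 : (∫ x in Icc (0 : ℝ) ℓ, f x * φ x) + ∫ s in Icc (0 : ℝ) t, g s * φ (p s) =
        (∫ x in Icc (0 : ℝ) ℓ, f x * (φ x - P.eval (Real.exp x))) +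
          ∫ s in Icc (0 : ℝ) t, g s * (φ (p s) - P.eval (Real.exp (p s))) := by
      simp only [mul_sub]
      rw [integral_sub (mf hφ) (mf cP), integral_sub (mg hφ) (mg cP)]
      linear_combination hz
    rw [e1, hC, mul_add]
    refine (abs_add_le _ _).trans (add_le_add ?_ ?_)
    · rw [← integral_const_mul]
      refine (abs_integral_le_integral_abs).trans ?_
      refine setIntegral_mono_on (mf (hφ.sub cP)).abs (hf.abs.const_mul ε) measurableSet_Icc ?_
      intro x hx
      rw [abs_mul, mul_comm]
      refine mul_le_mul_of_nonneg_right (hP' x ?_) (abs_nonneg _)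
      rw [abs_of_nonneg hx.1]; exact hx.2.trans (le_max_right _ _)
    · rw [← integral_const_mul]
      refine (abs_integral_le_integral_abs).trans ?_
      refine setIntegral_mono_on (mg (hφ.sub cP)).abs (hg.abs.const_mul ε) measurableSet_Icc ?_
      intro x hx
      rw [abs_mul, mul_comm]
      exact mul_le_mul_of_nonneg_right (hP' _ ((hM₁ x hx).trans (le_max_left _ _))) (abs_nonneg _)
  by_contra hne
  have hpos : 0 < |(∫ x in Icc (0 : ℝ) ℓ, f x * φ x) + ∫ s in Icc (0 : ℝ) t, g s * φ (p s)| :=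
    abs_pos.2 hne
  have h1 := key (|(∫ x in Icc (0 : ℝ) ℓ, f x * φ x) + ∫ s in Icc (0 : ℝ) t, g s * φ (p s)| /
    (2 * (C + 1))) (by positivity)
  rw [div_mul_eq_mul_div, le_div_iff₀ (by positivity)] at h1
  nlinarith

/-- The weak formulation of sourceless transport from the inflow boundary `x₀` with inflow `i` and
outflow `o`. -/
def TransportBalance {ℓ : ℝ} (c x₀ : ℝ) (w : ℝ → L2 ℓ) (i o : ℝ → ℝ) : Prop :=
  ∀ ψ : ℝ → ℝ, ContDiff ℝ 1 ψ → ∀ t : ℝ, 0 ≤ t → pair (w t) ψ = pair (w 0) ψ +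
    ∫ s in (0 : ℝ)..t, (|c| * (i s * ψ x₀ - o s * ψ (ℓ - x₀)) + c * pair (w s) (deriv ψ))

lemma integral_sourceless {ℓ : ℝ} (c : ℝ) (u : L2 ℓ) (ψ ψ' : ℝ → ℝ) :
    ∫ x in Ioo (0 : ℝ) ℓ, (c * u x * ψ' x + 0 * ψ x) = c * pair u ψ' := by
  unfold pair
  rw [← integral_const_mul]
  congr 1; funext x; ring

lemma weakTransport_iff_balance_pos {ℓ c : ℝ} (hc : 0 < c) {w : ℝ → L2 ℓ} {w0 wL : ℝ → ℝ} :
    WeakTransport c w (fun _ _ => 0) w0 wL ↔ TransportBalance c 0 w w0 wL := by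
  unfold WeakTransport TransportBalance
  simp only [integral_sourceless, abs_of_pos hc, sub_zero]
  rfl

lemma weakTransport_iff_balance_neg {ℓ c : ℝ} (hc : 0 < c) {w : ℝ → L2 ℓ} {w0 wL : ℝ → ℝ} :
    WeakTransport (-c) w (fun _ _ => 0) w0 wL ↔ TransportBalance (-c) ℓ w wL w0 := by
  unfold WeakTransport TransportBalance
  have : ∀ a b : ℝ, -c * (a - b) = c * (b - a) := fun a b => by ring
  simp only [integral_sourceless, abs_neg, abs_of_pos hc, sub_self, this]
  rfl

lemma transportBalance_prof {A : ℝ → ℝ} (hA : LocSq A) {c ℓ x₀ : ℝ} (h : IsInflow ℓ c x₀)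
    (hℓ : 0 ≤ ℓ) : TransportBalance c x₀ (prof ℓ c x₀ A) A (fun s => A (s - ℓ / |c|)) := by
  intro ψ hψ t ht
  have := integral_prof_balance hA h hℓ hψ ht
  simp only [integral_sourceless] at this
  exact this

/-- A sourceless weak solution with zero initial data and zero inflow vanishes. -/
theorem TransportBalance.eq_zero {ℓ c x₀ : ℝ} {w : ℝ → L2 ℓ} {o : ℝ → ℝ} (h : IsInflow ℓ c x₀)
    (hb : TransportBalance c x₀ w (fun _ => 0) o) (hw : ContinuousOn w (Ici 0)) (hw0 : w 0 = 0)
    (ho : L2loc o) {t : ℝ} (ht : 0 ≤ t) : w t = 0 ∧ ∀ᵐ s, s ∈ Ioo 0 t → o s = 0 := by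
  have hc := h.ne
  have hc' : |c| ≠ 0 := abs_ne_zero.2 hc
  -- The point p(s) is where the signal that left at time s would be found at time t if the domain
  -- were prolonged beyond the outflow boundary.
  set p : ℝ → ℝ := fun s => ℓ - x₀ + c * (t - s) with hp
  have hpc : Continuous p := by fun_prop
  have iw : IntegrableOn (w t) (Icc 0 ℓ) := by
    rw [integrableOn_Icc_iff_integrableOn_Ioo]; exact L2.integrable (w t)
  have io : IntegrableOn (fun s => |c| * o s) (Icc 0 t) := by
    rw [integrableOn_Icc_iff_integrableOn_Ioo]; exact ((ho t).integrable one_le_two).const_mul _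
  have hmom : ∀ k : ℕ, (∫ x in Icc (0 : ℝ) ℓ, w t x * Real.exp x ^ k) +
      ∫ s in Icc (0 : ℝ) t, |c| * o s * Real.exp (p s) ^ k = 0 := by
    intro k
    -- Exponentials are eigenfunctions of the derivative, so the pairing with ψ satisfies a scalar
    -- linear equation driven by the outflow. An integrating factor then gives the moment identity.
    set ψ : ℝ → ℝ := fun x => Real.exp x ^ k with hψ
    have dψ : ∀ x, HasDerivAt ψ (k * ψ x) x := by
      intro x
      have h1 : HasDerivAt (fun x => Real.exp (k * x)) (Real.exp (k * x) * (k * 1)) x :=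
        ((hasDerivAt_id x).const_mul (k : ℝ)).exp
      have e : ψ = fun x => Real.exp (k * x) := by
        funext x; rw [hψ]; simp only [Real.exp_nat_mul]
      rw [e]
      exact h1.congr_deriv (by ring)
    have hψd : deriv ψ = fun x => k * ψ x := funext fun x => (dψ x).deriv
    have cψ : ContDiff ℝ 1 ψ := by rw [hψ]; fun_prop
    set y : ℝ → ℝ := fun s => pair (w s) ψ with hy
    have yc : ContinuousOn y (Icc 0 t) :=
      (continuousOn_pair hw cψ.continuous.continuousOn).mono fun s hs => hs.1
    have hbal : ∀ s ∈ Icc 0 t, y s = y 0 + ∫ r in (0 : ℝ)..s,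
        (-(|c| * ψ (ℓ - x₀)) * o r + c * k * y r) := by
      intro s hs
      have := hb ψ cψ s hs.1
      rw [hψd] at this
      simp only [pair_const_mul] at this
      rw [hy]; simp only
      rw [this]
      congr 1
      refine intervalIntegral.integral_congr fun r _ => ?_
      ring
    have io' : IntervalIntegrable o volume 0 t := ho.intervalIntegrable le_rfl ht
    have iy : IntervalIntegrable y volume 0 t := by
      refine ContinuousOn.intervalIntegrable ?_
      rwa [uIcc_of_le ht]
    have dE : ∀ s : ℝ, HasDerivAt (fun s => Real.exp (-(c * k) * s))
        (-(c * k) * Real.exp (-(c * k) * s)) s := by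
      intro s
      have := ((hasDerivAt_id s).const_mul (-(c * k))).exp
      exact this.congr_deriv (by simp; ring)
    have cE : Continuous fun s => -(c * k) * Real.exp (-(c * k) * s) := by fun_prop
    have hI := integral_prim_mul ht (cE.intervalIntegrable 0 t)
      ((io'.const_mul (-(|c| * ψ (ℓ - x₀)))).add (iy.const_mul (c * k)))
      (F := fun s => Real.exp (-(c * k) * s)) (fun s _ => by
        rw [intervalIntegral.integral_eq_sub_of_hasDerivAt (fun r _ => dE r)
          (cE.intervalIntegrable _ _)]; ring) hbal
    have hy0 : y 0 = 0 := by
      rw [hy]; simp only; rw [hw0]; unfold pair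
      refine integral_eq_zero_of_ae ?_
      filter_upwards [Lp.coeFn_zero ℝ 2 (volume.restrict (Ioo (0 : ℝ) ℓ))] with x hx
      rw [hx]; simp
    rw [hy0, mul_zero, sub_zero] at hI
    have e1 : y t = ∫ x in Icc (0 : ℝ) ℓ, w t x * Real.exp x ^ k := by
      rw [integral_Icc_eq_integral_Ioo]; rfl
    have e2 : ∫ s in Icc (0 : ℝ) t, |c| * o s * Real.exp (p s) ^ k =
        -(Real.exp (c * k * t) * (Real.exp (-(c * k) * t) * y t)) := by
      rw [← hI, integral_Icc_eq_integral_Ioc, ← intervalIntegral.integral_of_le ht,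
        ← intervalIntegral.integral_const_mul, ← intervalIntegral.integral_neg]
      refine intervalIntegral.integral_congr fun s _ => ?_
      have e3 : Real.exp (p s) ^ k = Real.exp (c * k * t) * (Real.exp (-(c * k) * s) *
          ψ (ℓ - x₀)) := by
        rw [hψ]
        simp only [← Real.exp_nat_mul, ← Real.exp_add, hp]
        congr 1; ring
      simp only [e3]
      ring
    rw [← e1, e2, ← mul_assoc, ← Real.exp_add]
    simp
  have hφ : ∀ {φ : ℝ → ℝ}, Continuous φ → (∫ x in Icc (0 : ℝ) ℓ, w t x * φ x) +
      ∫ s in Icc (0 : ℝ) t, |c| * o s * φ (p s) = 0 := fun hφ =>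
    integral_eq_zero_of_moments iw io hpc hmom hφ
  -- Test functions supported in (0, ℓ) do not see the outflow term, since p(s) lies on or beyond
  -- the outflow boundary. Once w(t) = 0 is known, arbitrary functions of p(s) determine the
  -- outflow.
  have hwz : ∀ᵐ x, x ∈ Ioo 0 ℓ → w t x = 0 := by
    refine isOpen_Ioo.ae_eq_zero_of_integral_contDiff_smul_eq_zero
      ((iw.mono_set Ioo_subset_Icc_self).locallyIntegrableOn) fun φ h1 h2 h3 => ?_
    have hz : ∀ x, x ∉ Ioo 0 ℓ → φ x = 0 := fun x hx =>
      image_eq_zero_of_notMem_tsupport fun hm => hx (h3 hm)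
    have e1 := hφ h1.continuous
    have e2 : ∫ s in Icc (0 : ℝ) t, |c| * o s * φ (p s) = 0 := by
      refine setIntegral_eq_zero_of_forall_eq_zero fun s hs => ?_
      rw [hz (p s), mul_zero]
      rcases h with ⟨hc, rfl⟩ | ⟨hc, rfl⟩
      · intro hm
        have := hm.2
        have h5 : 0 ≤ c * (t - s) := mul_nonneg hc.le (by linarith [hs.2])
        simp only [hp] at this
        linarith
      · intro hm
        have := hm.1
        have h5 : c * (t - s) ≤ 0 := mul_nonpos_of_nonpos_of_nonneg hc.le (by linarith [hs.2])
        simp only [hp] at this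
        linarith
    rw [e2, add_zero] at e1
    refine Eq.trans ?_ e1
    rw [setIntegral_eq_integral_of_forall_compl_eq_zero]
    · congr 1; funext x; rw [smul_eq_mul, mul_comm]
    · intro x hx
      rw [hz x fun hm => hx (Ioo_subset_Icc_self hm), mul_zero]
  constructor
  · refine Lp.ext ?_
    filter_upwards [ae_restrict_of_ae hwz, ae_restrict_mem measurableSet_Ioo,
      Lp.coeFn_zero ℝ 2 (volume.restrict (Ioo (0 : ℝ) ℓ))] with x h1 h2 h3
    rw [h1 h2, h3]; rfl
  · have hoz : ∀ᵐ s, s ∈ Ioo 0 t → |c| * o s = 0 := by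
      refine isOpen_Ioo.ae_eq_zero_of_integral_contDiff_smul_eq_zero
        ((io.mono_set Ioo_subset_Icc_self).locallyIntegrableOn) fun θ h1 h2 h3 => ?_
      have hz : ∀ x, x ∉ Ioo 0 t → θ x = 0 := fun x hx =>
        image_eq_zero_of_notMem_tsupport fun hm => hx (h3 hm)
      have e1 := hφ (φ := fun x => θ (t - (x - (ℓ - x₀)) / c))
        (h1.continuous.comp (by fun_prop))
      have e2 : ∫ x in Icc (0 : ℝ) ℓ, w t x * θ (t - (x - (ℓ - x₀)) / c) = 0 := by
        rw [integral_Icc_eq_integral_Ioo]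
        refine integral_eq_zero_of_ae ?_
        filter_upwards [ae_restrict_of_ae hwz, ae_restrict_mem measurableSet_Ioo] with x h1 h2
        rw [h1 h2, zero_mul]; rfl
      have e3 : ∀ s, t - (p s - (ℓ - x₀)) / c = s := fun s => by
        simp only [hp]; field_simp; ring
      rw [e2, zero_add] at e1
      simp only [e3] at e1
      refine Eq.trans ?_ e1
      rw [setIntegral_eq_integral_of_forall_compl_eq_zero]
      · congr 1; funext x; rw [smul_eq_mul, mul_comm]
      · intro x hx
        rw [hz x fun hm => hx (Ioo_subset_Icc_self hm), mul_zero]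
    filter_upwards [hoz] with s h1 h2
    exact (mul_eq_zero.1 (h1 h2)).resolve_left hc'

/-! ### Initial data as the past of a boundary signal. -/

/-- The signal whose travelling profile has initial value `w₀` and inflow `i`. -/
def hist {ℓ : ℝ} (c x₀ : ℝ) (w₀ : L2 ℓ) (i : ℝ → ℝ) (s : ℝ) : ℝ :=
  if 0 < s then i s else (Ioo 0 ℓ).indicator w₀ (x₀ - c * s)

lemma locInt_glue {i G : ℝ → ℝ} (hi : ∀ T, IntegrableOn i (Ioo 0 T)) (hG : LocInt G) :
    LocInt fun s => if 0 < s then i s else G s := by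
  have h1 : LocInt ((Ioi 0).indicator i) := by
    have : ∀ a b : ℝ, IntegrableOn ((Ioi 0).indicator i) (Ioc a b) := by
      intro a b
      rw [IntegrableOn, integrable_indicator_iff measurableSet_Ioi, IntegrableOn,
        Measure.restrict_restrict measurableSet_Ioi]
      refine (hi (b + 1)).mono_set fun x hx => ⟨hx.1, by linarith [hx.2.2]⟩
    exact fun a b => ⟨this a b, this b a⟩
  have h2 : LocInt ((Iic 0).indicator G) := hG.indicator measurableSet_Iic
  intro a b
  refine ((h1 a b).add (h2 a b)).congr (fun s _ => ?_)
  by_cases hs : 0 < s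
  · simp [hs]
  · simp [hs, not_lt.1 hs]

lemma locSq_hist {ℓ c x₀ : ℝ} (hc : c ≠ 0) (w₀ : L2 ℓ) {i : ℝ → ℝ} (hi : L2loc i) :
    LocSq (hist c x₀ w₀ i) := by
  have hG : ∀ {f : ℝ → ℝ}, IntegrableOn f (Ioo 0 ℓ) →
      LocInt fun s => (Ioo 0 ℓ).indicator f (x₀ - c * s) := by
    intro f hf
    have h1 : LocInt ((Ioo 0 ℓ).indicator f) := fun a b =>
      (hf.integrable_indicator measurableSet_Ioo).intervalIntegrable
    have h2 := (h1.comp_sub_left x₀).comp_div (inv_ne_zero hc)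
    simpa [mul_comm c] using h2
  refine ⟨locInt_glue (fun T => (hi T).integrable one_le_two) (hG (L2.integrable w₀)), ?_⟩
  have h := locInt_glue (i := fun s => i s ^ 2) (fun T => (hi T).integrable_sq)
    (hG (f := fun x => w₀ x ^ 2) (Lp.memLp w₀).integrable_sq)
  intro a b
  refine (h a b).congr fun s _ => ?_
  unfold hist
  split_ifs with hs
  · rfl
  · by_cases hx : x₀ - c * s ∈ Ioo 0 ℓ
    · simp only [indicator_of_mem hx]
    · simp only [indicator_of_notMem hx]; norm_num

lemma prof_hist_zero {ℓ c x₀ : ℝ} (h : IsInflow ℓ c x₀) (hℓ : 0 ≤ ℓ) (w₀ : L2 ℓ) {i : ℝ → ℝ}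
    (hi : L2loc i) : prof ℓ c x₀ (hist c x₀ w₀ i) 0 = w₀ := by
  refine Lp.ext ?_
  filter_upwards [prof_ae (locSq_hist (x₀ := x₀) h.ne w₀ hi) h.ne hℓ x₀ 0,
    ae_restrict_mem measurableSet_Ioo] with x h1 hx
  have h2 := (h.mem (Ioo_subset_Icc_self hx)).1
  have e : x₀ - c * (0 - (x / c - x₀ / c)) = x := by have := h.ne; field_simp; ring
  rw [h1, profFun, hist, if_neg (by linarith), e, indicator_of_mem hx]

lemma TransportBalance.sub {ℓ c x₀ : ℝ} {w w' : ℝ → L2 ℓ} {i i' o o' : ℝ → ℝ}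
    (h : TransportBalance c x₀ w i o) (h' : TransportBalance c x₀ w' i' o')
    (hw : ContinuousOn w (Ici 0)) (hw' : ContinuousOn w' (Ici 0)) (hi : L2loc i) (hi' : L2loc i')
    (ho : L2loc o) (ho' : L2loc o') :
    TransportBalance c x₀ (fun t => w t - w' t) (fun t => i t - i' t) (fun t => o t - o' t) := by
  intro ψ hψ t ht
  have ps : ∀ (u v : L2 ℓ) {f : ℝ → ℝ}, ContinuousOn f (Icc 0 ℓ) →
      pair (u - v) f = pair u f - pair v f := by
    intro u v f hf
    have := pair_add_left (u - v) v hf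
    rw [sub_add_cancel] at this
    linarith
  have c1 : ContinuousOn ψ (Icc 0 ℓ) := hψ.continuous.continuousOn
  have c2 : ContinuousOn (deriv ψ) (Icc 0 ℓ) := (hψ.continuous_deriv le_rfl).continuousOn
  have hsub : uIcc 0 t ⊆ Ici (0 : ℝ) := by rw [uIcc_of_le ht]; exact fun x hx => hx.1
  have ii : ∀ {w : ℝ → L2 ℓ} {i o : ℝ → ℝ}, ContinuousOn w (Ici 0) → L2loc i → L2loc o →
      IntervalIntegrable (fun s => |c| * (i s * ψ x₀ - o s * ψ (ℓ - x₀)) +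
        c * pair (w s) (deriv ψ)) volume 0 t := fun hw hi ho =>
    ((((hi.intervalIntegrable le_rfl ht).mul_const _).sub
      ((ho.intervalIntegrable le_rfl ht).mul_const _)).const_mul _).add
      ((((continuousOn_pair hw c2).mono hsub).intervalIntegrable).const_mul c)
  rw [ps _ _ c1, ps _ _ c1, h ψ hψ t ht, h' ψ hψ t ht, add_sub_add_comm,
    ← intervalIntegral.integral_sub (ii hw hi ho) (ii hw' hi' ho')]
  congr 1
  refine intervalIntegral.integral_congr fun s _ => ?_
  simp only [ps _ _ c2]
  ring

lemma TransportBalance.congr {ℓ c x₀ : ℝ} {w : ℝ → L2 ℓ} {i i' o : ℝ → ℝ}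
    (h : TransportBalance c x₀ w i o)
    (hi : ∀ᵐ s ∂(volume.restrict (Ioi (0 : ℝ))), i s = i' s) : TransportBalance c x₀ w i' o := by
  intro ψ hψ t ht
  rw [h ψ hψ t ht]
  congr 1
  refine intervalIntegral.integral_congr_ae_restrict ?_
  rw [uIoc_of_le ht]
  filter_upwards [ae_mono (Measure.restrict_mono (fun s hs => hs.1 : Ioc 0 t ⊆ Ioi 0) le_rfl) hi]
    with s hs
  rw [hs]

lemma LocSq.l2loc {A : ℝ → ℝ} (h : LocSq A) : L2loc A := by
  intro T
  rcases le_total 0 T with hT | hT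
  · exact memLp_two_of_intervalIntegrable hT (h.1 0 T) (h.2 0 T)
  · rw [Ioo_eq_empty (not_lt.2 hT), Measure.restrict_empty]
    exact ⟨aestronglyMeasurable_zero_measure _, by simp⟩

lemma LocSq.comp_sub_right {A : ℝ → ℝ} (h : LocSq A) (t : ℝ) : LocSq fun s => A (s - t) :=
  ⟨h.1.comp_sub_right t, h.2.comp_sub_right t⟩

lemma L2loc.sub {f g : ℝ → ℝ} (hf : L2loc f) (hg : L2loc g) : L2loc fun t => f t - g t :=
  fun T => (hf T).sub (hg T)

/-- Sourceless weak solutions are travelling profiles. -/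
theorem TransportBalance.eq_prof {ℓ c x₀ : ℝ} {w : ℝ → L2 ℓ} {i o : ℝ → ℝ}
    (hb : TransportBalance c x₀ w i o) (h : IsInflow ℓ c x₀) (hℓ : 0 ≤ ℓ)
    (hw : ContinuousOn w (Ici 0)) (hi : L2loc i) (ho : L2loc o) :
    (∀ t, 0 ≤ t → w t = prof ℓ c x₀ (hist c x₀ (w 0) i) t) ∧
      ∀ᵐ t ∂(volume.restrict (Ioi (0 : ℝ))), o t = hist c x₀ (w 0) i (t - ℓ / |c|) := by
  set A := hist c x₀ (w 0) i with hA
  have hAs : LocSq A := locSq_hist h.ne (w 0) hi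
  -- Subtracting the profile with the same past and the same inflow leaves zero initial data and
  -- zero inflow.
  have hd := hb.sub (transportBalance_prof hAs h hℓ) hw (continuous_prof hAs h hℓ).continuousOn hi
    hAs.l2loc ho (hAs.comp_sub_right _).l2loc
  have hd' := hd.congr (i' := fun _ => 0) (by
    filter_upwards [ae_restrict_mem measurableSet_Ioi] with s hs
    have hs' : 0 < s := hs
    simp [hA, hist, hs'])
  have hz := fun t (ht : 0 ≤ t) => hd'.eq_zero h (hw.sub (continuous_prof hAs h hℓ).continuousOn)
    (by rw [hA, prof_hist_zero h hℓ (w 0) hi, sub_self]) (ho.sub (hAs.comp_sub_right _).l2loc) ht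
  refine ⟨fun t ht => sub_eq_zero.1 (hz t ht).1, ?_⟩
  rw [ae_restrict_iff' measurableSet_Ioi]
  -- The exceptional null set depends on the horizon; integer horizons make it a countable union.
  have hn : ∀ᵐ s, ∀ n : ℕ, s ∈ Ioo (0 : ℝ) n → o s - A (s - ℓ / |c|) = 0 :=
    ae_all_iff.2 fun n => (hz n (Nat.cast_nonneg n)).2
  filter_upwards [hn] with s hs hs0
  obtain ⟨n, hn⟩ := exists_nat_gt s
  exact sub_eq_zero.1 (hs n ⟨hs0, hn⟩)

/-! ### Representation of the plant and of the observer error -/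

/-- The two equations of the plant for the state `w`, with the additional source `y(t) s(x)`. -/
def HypEq (S : Plant) (s : Fin 2 → ℝ → ℝ) (y : ℝ → ℝ) (w : ℝ → Fin 2 → L2 S.ℓ)
    (w0 wL : Fin 2 → ℝ → ℝ) : Prop :=
  ∀ i, WeakTransport (S.spd i) (fun t => w t i)
    (fun t x => ∑ m, S.src i m x * w t m x + y t * s i x) (w0 i) (wL i)

lemma Plant.Admissible.spd_ne {S : Plant} (hS : S.Admissible) (i : Fin 2) : S.spd i ≠ 0 := by
  have h1 := hS.lam1_pos
  have h2 := hS.lam2_pos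
  fin_cases i
  · exact h1.ne'
  · exact (neg_lt_zero.2 h2).ne

lemma Plant.Admissible.continuousOn_src {S : Plant} (hS : S.Admissible) (i j : Fin 2) :
    ContinuousOn (S.src i j) (Icc 0 S.ℓ) := by
  fin_cases i <;> fin_cases j
  · exact continuousOn_const
  · exact hS.c1_cont
  · exact hS.c2_cont
  · exact continuousOn_const

lemma HypEq.sub {S : Plant} (hS : S.Admissible) {s : Fin 2 → ℝ → ℝ} {y y' : ℝ → ℝ}
    {w w' : ℝ → Fin 2 → L2 S.ℓ} {w0 wL w0' wL' : Fin 2 → ℝ → ℝ} (h : HypEq S s y w w0 wL)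
    (h' : HypEq S s y' w' w0' wL') (hs : ∀ i, ContinuousOn (s i) (Icc 0 S.ℓ))
    (hw : ∀ i, ContinuousOn (fun t => w t i) (Ici 0))
    (hw' : ∀ i, ContinuousOn (fun t => w' t i) (Ici 0)) (hy : L2loc y) (hy' : L2loc y')
    (h0 : ∀ i, L2loc (w0 i)) (hL : ∀ i, L2loc (wL i)) (h0' : ∀ i, L2loc (w0' i))
    (hL' : ∀ i, L2loc (wL' i)) :
    HypEq S s (fun t => y t - y' t) (fun t => w t - w' t) (fun i t => w0 i t - w0' i t)
      (fun i t => wL i t - wL' i t) := by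
  intro i ψ hψ t ht
  have ps : ∀ (u v : L2 S.ℓ) {f : ℝ → ℝ}, ContinuousOn f (Icc 0 S.ℓ) →
      pair (u - v) f = pair u f - pair v f := by
    intro u v f hf
    have := pair_add_left (u - v) v hf
    rw [sub_add_cancel] at this
    linarith
  have c1 : ContinuousOn ψ (Icc 0 S.ℓ) := hψ.continuous.continuousOn
  have c2 : ContinuousOn (deriv ψ) (Icc 0 S.ℓ) := (hψ.continuous_deriv le_rfl).continuousOn
  have cσ : ∀ m, ContinuousOn (fun x => S.src i m x * ψ x) (Icc 0 S.ℓ) :=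
    fun m => continuousOn_fun_mul (hS.continuousOn_src i m) c1
  have is : IntegrableOn (fun x => s i x * ψ x) (Ioo 0 S.ℓ) :=
    (memLp_two_of_continuousOn ((hs i).mul c1)).integrable one_le_two
  have hsub : uIcc 0 t ⊆ Ici (0 : ℝ) := by rw [uIcc_of_le ht]; exact fun x hx => hx.1
  have ii : ∀ {w : ℝ → Fin 2 → L2 S.ℓ} {w0 wL : Fin 2 → ℝ → ℝ} {y : ℝ → ℝ},
      (∀ i, ContinuousOn (fun t => w t i) (Ici 0)) → (∀ i, L2loc (w0 i)) → (∀ i, L2loc (wL i)) →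
      L2loc y → IntervalIntegrable (fun τ => S.spd i * (w0 i τ * ψ 0 - wL i τ * ψ S.ℓ) +
        (S.spd i * pair (w τ i) (deriv ψ) + (pair (w τ 0) (fun x => S.src i 0 x * ψ x) +
        pair (w τ 1) (fun x => S.src i 1 x * ψ x)) +
        y τ * ∫ x in Ioo (0 : ℝ) S.ℓ, s i x * ψ x)) volume 0 t := by
    intro w w0 wL y hw h0 hL hy
    have ip : ∀ m {f : ℝ → ℝ}, ContinuousOn f (Icc 0 S.ℓ) →
        IntervalIntegrable (fun τ => pair (w τ m) f) volume 0 t := fun m f hf =>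
      ((continuousOn_pair (hw m) hf).mono hsub).intervalIntegrable
    exact ((((h0 i).intervalIntegrable le_rfl ht).mul_const _).sub
      (((hL i).intervalIntegrable le_rfl ht).mul_const _) |>.const_mul _).add
      ((((ip i c2).const_mul _).add ((ip 0 (cσ 0)).add (ip 1 (cσ 1)))).add
        ((hy.intervalIntegrable le_rfl ht).mul_const _))
  have e := h i ψ hψ t ht
  have e' := h' i ψ hψ t ht
  simp only [integral_source _ _ (S.spd i) _ (hS.continuousOn_src i) c1 c2 is] at e e' ⊢
  change pair (w t i - w' t i) ψ = pair (w 0 i - w' 0 i) ψ + _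
  change pair (w t i) ψ = pair (w 0 i) ψ + _ at e
  change pair (w' t i) ψ = pair (w' 0 i) ψ + _ at e'
  rw [ps _ _ c1, ps _ _ c1, e, e', add_sub_add_comm,
    ← intervalIntegral.integral_sub (ii hw h0 hL hy) (ii hw' h0' hL' hy')]
  congr 1
  refine intervalIntegral.integral_congr fun τ _ => ?_
  simp only [Pi.sub_apply, ps _ _ c2, ps _ _ (cσ _)]
  ring

/-- Both trajectories as vectors. -/
def Trajectory.plant {ℓ : ℝ} (z : Trajectory ℓ) (t : ℝ) : Fin 2 → L2 ℓ := ![z.u t, z.v t]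

def Trajectory.obs {ℓ : ℝ} (z : Trajectory ℓ) (t : ℝ) : Fin 2 → L2 ℓ := ![z.uh t, z.vh t]

def injection (S : Plant) (P : Kernels) : Fin 2 → ℝ → ℝ := ![p1 S P, p2 S P]

lemma continuousOn_injection {S : Plant} {P : Kernels} (hP : P.Cont S.ℓ)
    (i : Fin 2) : ContinuousOn (injection S P i) (Icc 0 S.ℓ) := by
  fin_cases i
  · exact continuousOn_const.mul (continuousOn_slice_right hP.c12 le_rfl)
  · exact continuousOn_const.mul (continuousOn_slice_right hP.c22 le_rfl)

lemma forall_fin_two {p : Fin 2 → Prop} (h0 : p 0) (h1 : p 1) : ∀ i, p i := by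
  intro i
  fin_cases i
  · exact h0
  · exact h1

lemma WeakTransport.congr_source {ℓ c : ℝ} {w : ℝ → L2 ℓ} {f g : ℝ → ℝ → ℝ} {w0 wL : ℝ → ℝ}
    (h : WeakTransport c w f w0 wL) (hf : ∀ s x, f s x = g s x) : WeakTransport c w g w0 wL := by
  have : f = g := by funext s x; exact hf s x
  rwa [← this]

lemma L2loc.zero : L2loc fun _ => 0 := fun _ => MemLp.zero

namespace PlantObserver

variable {S : Plant} {P : Kernels} {inp : ℝ → ℝ} {z : Trajectory S.ℓ} {b : Traces}

/-- The source profile is free because its amplitude is zero. Taking it equal to the output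
injection makes the plant and the observer equations subtractable. -/
lemma hypEq_plant (h : PlantObserver S P inp z b) (s : Fin 2 → ℝ → ℝ) :
    HypEq S s (fun _ => 0) z.plant ![b.u0, b.v0] ![b.uL, b.vL] :=
  forall_fin_two
    (h.eq_u.congr_source fun t x => by simp [Plant.src, Trajectory.plant])
    (h.eq_v.congr_source fun t x => by simp [Plant.src, Trajectory.plant])

lemma hypEq_obs (h : PlantObserver S P inp z b) :
    HypEq S (injection S P) (fun t => b.v0 t - b.vh0 t) z.obs ![b.uh0, b.vh0] ![b.uhL, b.vhL] :=
  forall_fin_two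
    (h.eq_uh.congr_source fun t x => by simp [Plant.src, Trajectory.obs, injection, mul_comm])
    (h.eq_vh.congr_source fun t x => by simp [Plant.src, Trajectory.obs, injection, mul_comm])

lemma continuousOn_plant (h : PlantObserver S P inp z b) (i : Fin 2) :
    ContinuousOn (fun t => z.plant t i) (Ici 0) :=
  forall_fin_two (p := fun i => ContinuousOn (fun t => z.plant t i) (Ici 0)) h.cont.u h.cont.v i

lemma continuousOn_obs (h : PlantObserver S P inp z b) (i : Fin 2) :
    ContinuousOn (fun t => z.obs t i) (Ici 0) :=
  forall_fin_two (p := fun i => ContinuousOn (fun t => z.obs t i) (Ici 0)) h.cont.uh h.cont.vh i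

lemma hypEq_error (hS : S.Admissible) (hP : P.Cont S.ℓ) (h : PlantObserver S P inp z b) :
    HypEq S (injection S P) (fun t => 0 - (b.v0 t - b.vh0 t)) (fun t => z.plant t - z.obs t)
      (fun i t => (![b.u0, b.v0] : Fin 2 → ℝ → ℝ) i t - (![b.uh0, b.vh0] : Fin 2 → ℝ → ℝ) i t)
      (fun i t => (![b.uL, b.vL] : Fin 2 → ℝ → ℝ) i t - (![b.uhL, b.vhL] : Fin 2 → ℝ → ℝ) i t) :=
  (h.hypEq_plant _).sub hS h.hypEq_obs (continuousOn_injection hP) h.continuousOn_plant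
    h.continuousOn_obs L2loc.zero (h.traces.v0.sub h.traces.vh0)
    (forall_fin_two h.traces.u0 h.traces.v0) (forall_fin_two h.traces.uL h.traces.vL)
    (forall_fin_two h.traces.uh0 h.traces.vh0) (forall_fin_two h.traces.uhL h.traces.vhL)

end PlantObserver

/-! ### Delay representations of the plant and of the observer error. -/

/-- `γ` consists of the travelling profiles of the signals `A` and `B`. -/
structure DelayState (S : Plant) (γ : ℝ → Fin 2 → L2 S.ℓ) (A B : ℝ → ℝ) : Prop where
  sqA : LocSq A
  sqB : LocSq B
  eqA : ∀ t, 0 ≤ t → γ t 0 = prof S.ℓ S.lam1 0 A t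
  eqB : ∀ t, 0 ≤ t → γ t 1 = prof S.ℓ (-S.lam2) S.ℓ B t

lemma Plant.Admissible.inflow_left {S : Plant} (hS : S.Admissible) : IsInflow S.ℓ S.lam1 0 :=
  Or.inl ⟨hS.lam1_pos, rfl⟩

lemma Plant.Admissible.inflow_right {S : Plant} (hS : S.Admissible) :
    IsInflow S.ℓ (-S.lam2) S.ℓ :=
  Or.inr ⟨neg_lt_zero.2 hS.lam2_pos, rfl⟩

lemma exists_delayState {S : Plant} (hS : S.Admissible) {γ : ℝ → Fin 2 → L2 S.ℓ}
    {w0 wL : Fin 2 → ℝ → ℝ} (hγ : ∀ i, ContinuousOn (fun t => γ t i) (Ici 0))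
    (h : ∀ i, WeakTransport (S.spd i) (fun t => γ t i) (fun _ _ => 0) (w0 i) (wL i))
    (h0 : ∀ i, L2loc (w0 i)) (hL : ∀ i, L2loc (wL i)) :
    ∃ A B, DelayState S γ A B ∧ (∀ᵐ t ∂(volume.restrict (Ioi (0 : ℝ))), w0 0 t = A t) ∧
      (∀ᵐ t ∂(volume.restrict (Ioi (0 : ℝ))), wL 1 t = B t) ∧
      (∀ᵐ t ∂(volume.restrict (Ioi (0 : ℝ))), wL 0 t = A (t - S.ℓ / S.lam1)) ∧
      ∀ᵐ t ∂(volume.restrict (Ioi (0 : ℝ))), w0 1 t = B (t - S.ℓ / S.lam2) := by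
  have hℓ := hS.ℓ_pos.le
  have b1 := ((weakTransport_iff_balance_pos hS.lam1_pos).1 (h 0)).eq_prof hS.inflow_left hℓ (hγ 0)
    (h0 0) (hL 0)
  have b2 := ((weakTransport_iff_balance_neg hS.lam2_pos).1 (h 1)).eq_prof hS.inflow_right hℓ (hγ 1)
    (hL 1) (h0 1)
  rw [abs_of_pos hS.lam1_pos] at b1
  rw [abs_neg, abs_of_pos hS.lam2_pos] at b2
  refine ⟨_, _, ⟨locSq_hist hS.inflow_left.ne _ (h0 0), locSq_hist hS.inflow_right.ne _ (hL 1),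
    b1.1, b2.1⟩, ?_, ?_, b1.2, b2.2⟩
  · filter_upwards [ae_restrict_mem measurableSet_Ioi] with t ht
    rw [hist, if_pos (mem_Ioi.1 ht)]
  · filter_upwards [ae_restrict_mem measurableSet_Ioi] with t ht
    rw [hist, if_pos (mem_Ioi.1 ht)]

lemma KerEq.continuousOn {ℓ : ℝ} {Λ : Fin 2 → ℝ} {σ₁ σ₂ : Fin 2 → Fin 2 → ℝ → ℝ}
    {k : Fin 2 → Fin 2 → ℝ → ℝ → ℝ} (hk : KerEq ℓ Λ σ₁ σ₂ k) (i j : Fin 2) :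
    ContinuousOn (Function.uncurry (k i j)) (triangle ℓ) := (hk.ext i j).continuousOn

lemma continuousOn_onePlus {ℓ : ℝ} (k : Fin 2 → Fin 2 → ℝ → ℝ → ℝ) {w : ℝ → Fin 2 → L2 ℓ}
    {s : Set ℝ} (hw : ∀ i, ContinuousOn (fun t => w t i) s) (i : Fin 2) :
    ContinuousOn (fun t => onePlus ℓ k (w t) i) s :=
  continuousOn_pi.1 ((onePlus ℓ k).continuous.comp_continuousOn (continuousOn_pi.2 hw)) i

lemma ContinuousOn.l2loc {f : ℝ → ℝ} (h : ContinuousOn f (Ici 0)) : L2loc f := fun _ =>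
  memLp_two_of_continuousOn (h.mono fun _ hx => hx.1)

lemma L2loc.add {f g : ℝ → ℝ} (hf : L2loc f) (hg : L2loc g) : L2loc fun t => f t + g t :=
  fun T => (hf T).add (hg T)

lemma L2loc.const_mul {f : ℝ → ℝ} (hf : L2loc f) (c : ℝ) : L2loc fun t => c * f t :=
  fun T => (hf T).const_mul c

/-- The representation obtained from a kernel that removes the sources. -/
lemma HypEq.exists_delayState {S : Plant} (hS : S.Admissible) {s : Fin 2 → ℝ → ℝ} {y : ℝ → ℝ}
    {w : ℝ → Fin 2 → L2 S.ℓ} {w0 wL : Fin 2 → ℝ → ℝ} (h : HypEq S s y w w0 wL)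
    {k : Fin 2 → Fin 2 → ℝ → ℝ → ℝ} (hk : KerEq S.ℓ S.spd S.src 0 k)
    (hs : ∀ i, ContinuousOn (s i) (Icc 0 S.ℓ))
    (hw : ∀ i, ContinuousOn (fun t => w t i) (Ici 0)) (hy : L2loc y)
    (h0 : ∀ i, L2loc (w0 i)) (hL : ∀ i, L2loc (wL i))
    (hr : ∀ i, ∀ᵐ t ∂(volume.restrict (Ioi (0 : ℝ))), ∀ x ∈ Ioo 0 S.ℓ,
      ∑ j, k i j x 0 * (S.spd j * w0 j t) +
        y t * (s i x + ∑ j, ∫ ξ in (0 : ℝ)..x, k i j x ξ * s j ξ) = 0) :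
    ∃ A B, DelayState S (fun t => onePlus S.ℓ k (w t)) A B ∧
      (∀ᵐ t ∂(volume.restrict (Ioi (0 : ℝ))), w0 0 t = A t) ∧
      (∀ᵐ t ∂(volume.restrict (Ioi (0 : ℝ))),
        wL 1 t + ∑ j, pair (w t j) (fun ξ => k 1 j S.ℓ ξ) = B t) ∧
      (∀ᵐ t ∂(volume.restrict (Ioi (0 : ℝ))),
        wL 0 t + ∑ j, pair (w t j) (fun ξ => k 0 j S.ℓ ξ) = A (t - S.ℓ / S.lam1)) ∧
      ∀ᵐ t ∂(volume.restrict (Ioi (0 : ℝ))), w0 1 t = B (t - S.ℓ / S.lam2) := by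
  have hp := hk.weakTransport hS.ℓ_pos hS.spd_ne hS.continuousOn_src (fun _ _ => continuousOn_const)
    hw h0 hL hy hs h (r := fun _ _ _ => 0) hr
  refine PETC.exists_delayState hS (continuousOn_onePlus k hw)
    (w0 := w0) (wL := fun i t => wL i t + ∑ j, pair (w t j) (fun ξ => k i j S.ℓ ξ))
    (fun i => (hp i).congr_source fun t x => by simp) h0 fun i => ?_
  simp only [Fin.sum_univ_two]
  have hc : ∀ j, L2loc fun t => pair (w t j) (fun ξ => k i j S.ℓ ξ) := fun j =>
    ContinuousOn.l2loc (continuousOn_pair (hw j) (continuousOn_slice_left (hk.continuousOn i j) le_rfl))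
  exact (hL i).add ((hc 0).add (hc 1))

lemma pair_neg {ℓ : ℝ} (u : L2 ℓ) (f : ℝ → ℝ) : pair u (fun x => -f x) = -pair u f := by
  have := pair_const_mul u (-1) f
  simpa using this

namespace PlantObserver

variable {S : Plant} {P : Kernels} {inp : ℝ → ℝ} {z : Trajectory S.ℓ} {b : Traces}

/-- Delay representation of the plant. -/
theorem exists_plant_rep (hS : S.Admissible) {K : Kernels} (hK : IsControlKernel S K)
    (h : PlantObserver S P inp z b) :
    ∃ A B, DelayState S (fun t => onePlus S.ℓ K.opp.mat (z.plant t)) A B ∧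
      (∀ᵐ t ∂(volume.restrict (Ioi (0 : ℝ))), A t = S.q * B (t - S.ℓ / S.lam2)) ∧
      (∀ᵐ t ∂(volume.restrict (Ioi (0 : ℝ))), B t = S.rho * A (t - S.ℓ / S.lam1) +
        (inp t - (pair (z.u t) (Nu S K) + pair (z.v t) (Nv S K)))) ∧
      (∀ᵐ t ∂(volume.restrict (Ioi (0 : ℝ))),
        b.uL t - pair (z.u t) (K.k11 S.ℓ) - pair (z.v t) (K.k12 S.ℓ) = A (t - S.ℓ / S.lam1)) := by
  have hk := hK.ctrlEq.kerEq hS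
  have h1 := hS.lam1_pos
  have h2 := hS.lam2_pos
  have hq := hS.q_ne
  obtain ⟨A, B, hd, e1, e2, e3, e4⟩ := (h.hypEq_plant 0).exists_delayState hS hk
    (fun _ => continuousOn_const) h.continuousOn_plant L2loc.zero
    (forall_fin_two h.traces.u0 h.traces.v0) (forall_fin_two h.traces.uL h.traces.vL) (by
      -- The conditions of K on ξ = 0 are what cancels the boundary terms at x = 0 under u(0) = q
      -- v(0).
      refine forall_fin_two ?_ ?_
      · filter_upwards [h.bc_u] with t ht x hx
        have := hK.bc11 x (Ioo_subset_Icc_self hx)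
        simp only [Fin.sum_univ_two, Plant.spd, Kernels.mat, Kernels.opp, Matrix.cons_val_zero,
          Matrix.cons_val_one, Matrix.cons_val_fin_one, zero_mul, add_zero]
        rw [ht, this]
        field_simp; ring
      · filter_upwards [h.bc_u] with t ht x hx
        have := hK.bc22 x (Ioo_subset_Icc_self hx)
        simp only [Fin.sum_univ_two, Plant.spd, Kernels.mat, Kernels.opp, Matrix.cons_val_zero,
          Matrix.cons_val_one, Matrix.cons_val_fin_one, zero_mul, add_zero]
        rw [ht, this]
        field_simp; ring)
  have e3' : ∀ᵐ t ∂(volume.restrict (Ioi (0 : ℝ))),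
      b.uL t - pair (z.u t) (K.k11 S.ℓ) - pair (z.v t) (K.k12 S.ℓ) = A (t - S.ℓ / S.lam1) := by
    filter_upwards [e3] with t ht
    rw [← ht]
    simp only [Fin.sum_univ_two, Kernels.mat, Kernels.opp, Matrix.cons_val_zero,
      Matrix.cons_val_one, Matrix.cons_val_fin_one, pair_neg, Trajectory.plant]
    ring
  have c11 : ContinuousOn (K.k11 S.ℓ) (Icc 0 S.ℓ) := continuousOn_slice_left hK.cont.c11 le_rfl
  have c12 : ContinuousOn (K.k12 S.ℓ) (Icc 0 S.ℓ) := continuousOn_slice_left hK.cont.c12 le_rfl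
  have c21 : ContinuousOn (K.k21 S.ℓ) (Icc 0 S.ℓ) := continuousOn_slice_left hK.cont.c21 le_rfl
  have c22 : ContinuousOn (K.k22 S.ℓ) (Icc 0 S.ℓ) := continuousOn_slice_left hK.cont.c22 le_rfl
  have pN : ∀ (u : L2 S.ℓ) {f g : ℝ → ℝ}, ContinuousOn f (Icc 0 S.ℓ) → ContinuousOn g (Icc 0 S.ℓ) →
      pair u (fun ξ => f ξ - S.rho * g ξ) = pair u f - S.rho * pair u g := by
    intro u f g hf hg
    have hm : ContinuousOn (fun x => -S.rho * g x) (Icc 0 S.ℓ) := continuousOn_const.mul hg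
    have e : (fun ξ => f ξ - S.rho * g ξ) = fun ξ => f ξ + -S.rho * g ξ := by funext ξ; ring
    rw [e, pair_add u hf hm, pair_const_mul]; ring
  refine ⟨A, B, hd, ?_, ?_, e3'⟩
  · filter_upwards [e1, e4, h.bc_u] with t a1 a2 a3
    rw [← a1, ← a2]
    exact a3
  · filter_upwards [e2, e3', h.bc_v] with t a1 a2 a3
    rw [← a1, ← a2]
    -- The kernels N^u and N^v are the defect between the second row and ρ times the first row of K
    -- at x = ℓ. The boundary condition at ℓ therefore leaves the input minus the feedback
    -- functional of the plant state.
    have n1 : pair (z.u t) (Nu S K) = pair (z.u t) (K.k21 S.ℓ) - S.rho * pair (z.u t) (K.k11 S.ℓ) :=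
      pN _ c21 c11
    have n2 : pair (z.v t) (Nv S K) = pair (z.v t) (K.k22 S.ℓ) - S.rho * pair (z.v t) (K.k12 S.ℓ) :=
      pN _ c22 c12
    rw [n1, n2]
    simp only [Fin.sum_univ_two, Kernels.mat, Kernels.opp, Matrix.cons_val_zero,
      Matrix.cons_val_one, Matrix.cons_val_fin_one, pair_neg, Trajectory.plant, a3]
    ring

/-- Delay representation of the observer error. -/
theorem exists_error_rep (hS : S.Admissible) (hP : IsObserverKernel S P) {Q : Kernels}
    (hQ : CtrlEq S Q) (hQ1 : ∀ ξ ∈ Icc 0 S.ℓ, Q.k21 S.ℓ ξ = S.rho * Q.k11 S.ℓ ξ)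
    (hQ2 : ∀ ξ ∈ Icc 0 S.ℓ, Q.k22 S.ℓ ξ = S.rho * Q.k12 S.ℓ ξ) (h : PlantObserver S P inp z b) :
    ∃ A B, DelayState S (fun t => onePlus S.ℓ Q.opp.mat (z.plant t - z.obs t)) A B ∧
      (∀ᵐ t ∂(volume.restrict (Ioi (0 : ℝ))), A t = 0) ∧
      (∀ᵐ t ∂(volume.restrict (Ioi (0 : ℝ))), B t = S.rho * A (t - S.ℓ / S.lam1)) ∧
      (∀ᵐ t ∂(volume.restrict (Ioi (0 : ℝ))), b.uL t - b.uhL t - pair (z.u t - z.uh t) (Q.k11 S.ℓ)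
        - pair (z.v t - z.vh t) (Q.k12 S.ℓ) = A (t - S.ℓ / S.lam1)) ∧
      ∀ᵐ t ∂(volume.restrict (Ioi (0 : ℝ))), betaTilde0 b t = B (t - S.ℓ / S.lam2) := by
  have hk := hQ.kerEq hS
  obtain ⟨A, B, hd, e1, e2, e3, e4⟩ := (h.hypEq_error hS hP.cont).exists_delayState hS hk
    (continuousOn_injection hP.cont) (fun i => (h.continuousOn_plant i).sub (h.continuousOn_obs i))
    (L2loc.zero.sub (h.traces.v0.sub h.traces.vh0))
    (forall_fin_two (h.traces.u0.sub h.traces.uh0) (h.traces.v0.sub h.traces.vh0))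
    (forall_fin_two (h.traces.uL.sub h.traces.uhL) (h.traces.vL.sub h.traces.vhL)) (by
      intro i
      filter_upwards [h.bc_u, h.bc_uh] with t a1 a2 x hx
      -- Since ũ(0) = 0, the source to be cancelled is λ₂ ṽ(0,t) times the second column of (1 -
      -- Q)(1 - P) - 1 at ξ = 0. The gains p₁, p₂ are the corresponding column of P, which is why
      -- the injection removes it.
      have hc := observerInverse_comp hS hQ hQ1 hQ2 hP i 1 (x := x) (ξ := 0)
        ⟨le_rfl, hx.1.le, hx.2.le⟩
      have hi : ∀ j y, injection S P j y = S.lam2 * P.opp.mat j 1 y 0 := by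
        intro j y
        fin_cases j
        · show -S.lam2 * P.k12 y 0 = S.lam2 * (-P.k12 y 0); ring
        · show -S.lam2 * P.k22 y 0 = S.lam2 * (-P.k22 y 0); ring
      simp only [compKernel, Fin.sum_univ_two] at hc
      simp only [hi, mul_left_comm _ S.lam2, intervalIntegral.integral_const_mul]
      simp only [Fin.sum_univ_two, Plant.spd, Matrix.cons_val_zero,
        Matrix.cons_val_one, Matrix.cons_val_fin_one]
      rw [a1, a2]
      linear_combination (-(S.lam2 * (b.v0 t - b.vh0 t))) * hc)
  have e3' : ∀ᵐ t ∂(volume.restrict (Ioi (0 : ℝ))), b.uL t - b.uhL t -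
      pair (z.u t - z.uh t) (Q.k11 S.ℓ) - pair (z.v t - z.vh t) (Q.k12 S.ℓ) =
      A (t - S.ℓ / S.lam1) := by
    filter_upwards [e3] with t ht
    rw [← ht]
    simp only [Fin.sum_univ_two, Kernels.mat, Kernels.opp, Matrix.cons_val_zero,
      Matrix.cons_val_one, Matrix.cons_val_fin_one, pair_neg, Trajectory.plant, Trajectory.obs,
      Pi.sub_apply]
    ring
  refine ⟨A, B, hd, ?_, ?_, e3', ?_⟩
  · filter_upwards [e1, h.bc_u, h.bc_uh] with t a1 a2 a3
    rw [← a1]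
    show b.u0 t - b.uh0 t = 0
    rw [a2, a3, sub_self]
  · filter_upwards [e2, e3', h.bc_v, h.bc_vh] with t a1 a2 a3 a4
    rw [← a1, ← a2]
    have q1 : ∀ u : L2 S.ℓ, pair u (Q.k21 S.ℓ) = S.rho * pair u (Q.k11 S.ℓ) := fun u => by
      rw [← pair_const_mul]
      exact pair_congr u fun x hx => hQ1 x (Ioo_subset_Icc_self hx)
    have q2 : ∀ u : L2 S.ℓ, pair u (Q.k22 S.ℓ) = S.rho * pair u (Q.k12 S.ℓ) := fun u => by
      rw [← pair_const_mul]
      exact pair_congr u fun x hx => hQ2 x (Ioo_subset_Icc_self hx)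
    simp only [Fin.sum_univ_two, Kernels.mat, Kernels.opp, Matrix.cons_val_zero,
      Matrix.cons_val_one, Matrix.cons_val_fin_one, pair_neg, Trajectory.plant, Trajectory.obs,
      Pi.sub_apply, q1, q2, a3, a4]
    ring
  · exact e4

end PlantObserver

/-! ### Energy estimates -/

/-- Squared norm of a pair of `L²` functions. -/
def nsq {ℓ : ℝ} (w : Fin 2 → L2 ℓ) : ℝ := ‖w 0‖ ^ 2 + ‖w 1‖ ^ 2

lemma nsq_nonneg {ℓ : ℝ} (w : Fin 2 → L2 ℓ) : 0 ≤ nsq w := by unfold nsq; positivity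

lemma exists_nsq_le {ℓ : ℝ} (T : (Fin 2 → L2 ℓ) →L[ℝ] (Fin 2 → L2 ℓ)) :
    ∃ C : ℝ, 0 < C ∧ ∀ w, nsq (T w) ≤ C * nsq w := by
  refine ⟨2 * ‖T‖ ^ 2 + 1, by positivity, fun w => ?_⟩
  have h1 : ∀ i, ‖T w i‖ ≤ ‖T‖ * ‖w‖ := fun i => (norm_le_pi_norm _ i).trans (T.le_opNorm w)
  have h2 : ‖w‖ ≤ Real.sqrt (nsq w) := by
    refine (pi_norm_le_iff_of_nonneg (Real.sqrt_nonneg _)).2 (forall_fin_two ?_ ?_)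
    · exact Real.le_sqrt_of_sq_le (by unfold nsq; nlinarith [sq_nonneg ‖w 1‖])
    · exact Real.le_sqrt_of_sq_le (by unfold nsq; nlinarith [sq_nonneg ‖w 0‖])
  have h3 : ‖w‖ ^ 2 ≤ nsq w := by
    rw [← Real.sq_sqrt (nsq_nonneg w)]
    exact pow_le_pow_left₀ (norm_nonneg _) h2 2
  have h4 : ∀ i, ‖T w i‖ ^ 2 ≤ ‖T‖ ^ 2 * nsq w := fun i =>
    (pow_le_pow_left₀ (norm_nonneg _) (h1 i) 2).trans (by rw [mul_pow]; gcongr)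
  have h5 := nsq_nonneg w
  have := h4 0
  have := h4 1
  unfold nsq at *
  linarith

lemma Trajectory.norm_sq {ℓ : ℝ} (z : Trajectory ℓ) (t : ℝ) :
    z.norm t ^ 2 = nsq (z.plant t) + nsq (z.obs t) := by
  unfold Trajectory.norm
  rw [Real.sq_sqrt (by positivity)]
  simp only [nsq, Trajectory.plant, Trajectory.obs, Matrix.cons_val_zero, Matrix.cons_val_one,
    Matrix.cons_val_fin_one]
  ring

lemma nsq_sub_le {ℓ : ℝ} (v w : Fin 2 → L2 ℓ) : nsq (v - w) ≤ 2 * (nsq v + nsq w) := by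
  have h : ∀ i, ‖(v - w) i‖ ^ 2 ≤ 2 * (‖v i‖ ^ 2 + ‖w i‖ ^ 2) := fun i => by
    have h1 := norm_sub_le (v i) (w i)
    have h2 := norm_nonneg (v i - w i)
    rw [Pi.sub_apply]
    nlinarith [sq_nonneg (‖v i‖ - ‖w i‖)]
  have := h 0
  have := h 1
  unfold nsq
  linarith

lemma exists_pair_sq_le {ℓ : ℝ} {f : ℝ → ℝ} (hf : ContinuousOn f (Icc 0 ℓ)) :
    ∃ C : ℝ, 0 ≤ C ∧ ∀ u : L2 ℓ, pair u f ^ 2 ≤ C * ‖u‖ ^ 2 := by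
  refine ⟨∫ x in Ioo (0 : ℝ) ℓ, f x ^ 2, integral_nonneg fun _ => sq_nonneg _, fun u => ?_⟩
  have := integral_mul_sq_le (Lp.memLp u) (memLp_two_of_continuousOn hf)
  rw [L2.norm_sq, mul_comm]
  exact this

lemma exists_pair_add_sq_le {ℓ : ℝ} {f g : ℝ → ℝ} (hf : ContinuousOn f (Icc 0 ℓ))
    (hg : ContinuousOn g (Icc 0 ℓ)) :
    ∃ C : ℝ, 0 < C ∧ ∀ w : Fin 2 → L2 ℓ, (pair (w 0) f + pair (w 1) g) ^ 2 ≤ C * nsq w := by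
  obtain ⟨C1, h1, H1⟩ := exists_pair_sq_le hf
  obtain ⟨C2, h2, H2⟩ := exists_pair_sq_le hg
  refine ⟨2 * (C1 + C2) + 1, by positivity, fun w => ?_⟩
  have a1 := H1 (w 0)
  have a2 := H2 (w 1)
  unfold nsq
  have b1 := mul_nonneg h1 (sq_nonneg ‖w 1‖)
  have b2 := mul_nonneg h2 (sq_nonneg ‖w 0‖)
  nlinarith [sq_nonneg (pair (w 0) f - pair (w 1) g), sq_nonneg ‖w 1‖, sq_nonneg ‖w 0‖]

lemma window_balance {A : ℝ → ℝ} (hA : LocInt A) {τ t : ℝ} (hτ : 0 ≤ τ) (ht : 0 ≤ t) :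
    ∫ σ in (0 : ℝ)..τ, A (t - σ) = (∫ σ in (0 : ℝ)..τ, A (0 - σ)) +
      ∫ s in (0 : ℝ)..t, (A s - A (s - τ)) := by
  have := delay_balance hA hτ ht (χ := fun _ => 1) (g := fun _ => 0) (by simp) (by simp)
  simpa using this

/-- The basic energy of a delay state. -/
def energy (S : Plant) (ω : ℝ) (γ : Fin 2 → L2 S.ℓ) : ℝ :=
  ‖γ 0‖ ^ 2 / S.lam1 + ω * (‖γ 1‖ ^ 2 / S.lam2)

lemma L2loc.intervalIntegrable_sq {f : ℝ → ℝ} (h : L2loc f) {a b : ℝ} (ha : 0 ≤ a) (hab : a ≤ b) :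
    IntervalIntegrable (fun s => f s ^ 2) volume a b := by
  rw [intervalIntegrable_iff_integrableOn_Ioo_of_le hab]
  exact ((h b).integrable_sq).mono_measure
    (Measure.restrict_mono (Ioo_subset_Ioo_left ha) le_rfl)

lemma integral_mono_ae_Ioi {f g : ℝ → ℝ} {a b : ℝ} (ha : 0 ≤ a) (hab : a ≤ b)
    (hf : IntervalIntegrable f volume a b) (hg : IntervalIntegrable g volume a b)
    (h : ∀ᵐ t ∂(volume.restrict (Ioi (0 : ℝ))), f t ≤ g t) :
    ∫ t in a..b, f t ≤ ∫ t in a..b, g t := by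
  refine intervalIntegral.integral_mono_ae_restrict hab hf hg ?_
  rw [← restrict_Ioo_eq_restrict_Icc]
  exact ae_mono (Measure.restrict_mono (fun s hs => lt_of_le_of_lt ha hs.1) le_rfl) h

/-- The energy is a window of A² plus ω times a window of B², so its rate is inflow minus outflow.
The relation A² = q² B(· - ℓ/λ₂)² leaves ω - q² of the outflow of B. The bounds B² ≤ 2ρ² A(· -
ℓ/λ₁)² + 2d² and 2ωρ² ≤ 1/2 leave half of the outflow of A. The plant uses ω = q², and the error
uses q = 0. -/
theorem DelayState.energy_le {S : Plant} (hS : S.Admissible) {γ : ℝ → Fin 2 → L2 S.ℓ}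
    {A B d : ℝ → ℝ} (h : DelayState S γ A B) {q ω : ℝ} (hd : L2loc d) (hω : q ^ 2 ≤ ω)
    (hω' : 2 * ω * S.rho ^ 2 ≤ 1 / 2)
    (hA : ∀ᵐ t ∂(volume.restrict (Ioi (0 : ℝ))), A t = q * B (t - S.ℓ / S.lam2))
    (hB : ∀ᵐ t ∂(volume.restrict (Ioi (0 : ℝ))), B t = S.rho * A (t - S.ℓ / S.lam1) + d t)
    {t : ℝ} (ht : 0 ≤ t) :
    energy S ω (γ t) + 1 / 2 * (∫ s in (0 : ℝ)..t, A (s - S.ℓ / S.lam1) ^ 2) +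
      (ω - q ^ 2) * (∫ s in (0 : ℝ)..t, B (s - S.ℓ / S.lam2) ^ 2) ≤
      energy S ω (γ 0) + 2 * ω * ∫ s in (0 : ℝ)..t, d s ^ 2 := by
  have hℓ := hS.ℓ_pos
  have h1 := hS.lam1_pos
  have h2 := hS.lam2_pos
  have τ1 : 0 ≤ S.ℓ / S.lam1 := (div_pos hℓ h1).le
  have τ2 : 0 ≤ S.ℓ / S.lam2 := (div_pos hℓ h2).le
  have eE : ∀ t, 0 ≤ t → energy S ω (γ t) = (∫ σ in (0 : ℝ)..(S.ℓ / S.lam1), A (t - σ) ^ 2) +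
      ω * ∫ σ in (0 : ℝ)..(S.ℓ / S.lam2), B (t - σ) ^ 2 := by
    intro t ht
    unfold energy
    rw [h.eqA t ht, h.eqB t ht, norm_prof_sq h.sqA hS.inflow_left hℓ.le,
      norm_prof_sq h.sqB hS.inflow_right hℓ.le, abs_neg, abs_of_pos h1, abs_of_pos h2]
    field_simp
  have i1 := h.sqA.2 0 t
  have i2 := h.sqA.2.comp_sub_right (S.ℓ / S.lam1) 0 t
  have i3 := h.sqB.2 0 t
  have i4 := h.sqB.2.comp_sub_right (S.ℓ / S.lam2) 0 t
  have i5 := hd.intervalIntegrable_sq le_rfl ht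
  have w1 := window_balance h.sqA.2 τ1 ht
  have w2 := window_balance h.sqB.2 τ2 ht
  rw [eE t ht, eE 0 le_rfl, w1, w2]
  have key : (∫ s in (0 : ℝ)..t, (A s ^ 2 - A (s - S.ℓ / S.lam1) ^ 2)) +
      ω * (∫ s in (0 : ℝ)..t, (B s ^ 2 - B (s - S.ℓ / S.lam2) ^ 2)) +
      1 / 2 * (∫ s in (0 : ℝ)..t, A (s - S.ℓ / S.lam1) ^ 2) +
      (ω - q ^ 2) * (∫ s in (0 : ℝ)..t, B (s - S.ℓ / S.lam2) ^ 2) ≤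
      2 * ω * ∫ s in (0 : ℝ)..t, d s ^ 2 := by
    simp only [← intervalIntegral.integral_const_mul]
    have j1 := i1.sub i2
    have j2 := (i3.sub i4).const_mul ω
    have j3 := i2.const_mul (1 / 2)
    have j4 := i4.const_mul (ω - q ^ 2)
    rw [← intervalIntegral.integral_add (intervalIntegrable_fun_sub i1 i2)
        ((intervalIntegrable_fun_sub i3 i4).const_mul ω),
      ← intervalIntegral.integral_add (intervalIntegrable_fun_add (intervalIntegrable_fun_sub i1 i2)
        ((intervalIntegrable_fun_sub i3 i4).const_mul ω)) j3,
      ← intervalIntegral.integral_add (intervalIntegrable_fun_add (intervalIntegrable_fun_add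
        (intervalIntegrable_fun_sub i1 i2) ((intervalIntegrable_fun_sub i3 i4).const_mul ω)) j3) j4]
    refine integral_mono_ae_Ioi le_rfl ht (((j1.add j2).add j3).add j4) (i5.const_mul _) ?_
    filter_upwards [hA, hB] with s a1 a2
    rw [a1, a2]
    have hω0 : 0 ≤ ω := (sq_nonneg q).trans hω
    have p1 := mul_nonneg hω0 (sq_nonneg (S.rho * A (s - S.ℓ / S.lam1) - d s))
    have p2 := mul_nonneg (sub_nonneg.2 hω') (sq_nonneg (A (s - S.ℓ / S.lam1)))
    nlinarith
  linarith

lemma exists_energy_bounds {S : Plant} (hS : S.Admissible) {ω : ℝ} (hω : 0 < ω) :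
    ∃ C : ℝ, 0 < C ∧ ∀ γ : Fin 2 → L2 S.ℓ, nsq γ ≤ C * energy S ω γ ∧ energy S ω γ ≤ C * nsq γ := by
  have h1 := hS.lam1_pos
  have h2 := hS.lam2_pos
  refine ⟨S.lam1 + S.lam2 / ω + (1 / S.lam1 + ω / S.lam2), by positivity, fun γ => ?_⟩
  have n0 := sq_nonneg ‖γ 0‖
  have n1 := sq_nonneg ‖γ 1‖
  unfold nsq energy
  constructor
  · have e : (S.lam1 + S.lam2 / ω + (1 / S.lam1 + ω / S.lam2)) *
        (‖γ 0‖ ^ 2 / S.lam1 + ω * (‖γ 1‖ ^ 2 / S.lam2)) = ‖γ 0‖ ^ 2 + ‖γ 1‖ ^ 2 +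
        (S.lam1 * (ω * (‖γ 1‖ ^ 2 / S.lam2)) + S.lam2 / ω * (‖γ 0‖ ^ 2 / S.lam1) +
        (1 / S.lam1 + ω / S.lam2) * (‖γ 0‖ ^ 2 / S.lam1 + ω * (‖γ 1‖ ^ 2 / S.lam2))) := by
      field_simp; ring
    rw [e]
    have : 0 ≤ S.lam1 * (ω * (‖γ 1‖ ^ 2 / S.lam2)) + S.lam2 / ω * (‖γ 0‖ ^ 2 / S.lam1) +
        (1 / S.lam1 + ω / S.lam2) * (‖γ 0‖ ^ 2 / S.lam1 + ω * (‖γ 1‖ ^ 2 / S.lam2)) := by positivity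
    linarith
  · have e : (S.lam1 + S.lam2 / ω + (1 / S.lam1 + ω / S.lam2)) * (‖γ 0‖ ^ 2 + ‖γ 1‖ ^ 2) =
        ‖γ 0‖ ^ 2 / S.lam1 + ω * (‖γ 1‖ ^ 2 / S.lam2) + ((S.lam1 + S.lam2 / ω) *
        (‖γ 0‖ ^ 2 + ‖γ 1‖ ^ 2) + 1 / S.lam1 * ‖γ 1‖ ^ 2 + ω / S.lam2 * ‖γ 0‖ ^ 2) := by
      field_simp; ring
    rw [e]
    have : 0 ≤ (S.lam1 + S.lam2 / ω) * (‖γ 0‖ ^ 2 + ‖γ 1‖ ^ 2) + 1 / S.lam1 * ‖γ 1‖ ^ 2 +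
        ω / S.lam2 * ‖γ 0‖ ^ 2 := by positivity
    linarith

lemma L2loc.congr {f g : ℝ → ℝ} (hf : L2loc f)
    (h : ∀ᵐ t ∂(volume.restrict (Ioi (0 : ℝ))), f t = g t) : L2loc g := fun T =>
  (hf T).ae_eq (ae_mono (Measure.restrict_mono (fun _ hs => hs.1) le_rfl) h)

lemma PlantObserver.l2loc_inp {S : Plant} {P : Kernels} {inp : ℝ → ℝ} {z : Trajectory S.ℓ}
    {b : Traces} (h : PlantObserver S P inp z b) : L2loc inp := by
  refine (h.traces.vL.sub (h.traces.uL.const_mul S.rho)).congr ?_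
  filter_upwards [h.bc_v] with t ht
  rw [ht]; ring

lemma kernels_continuous_row {S : Plant} {K : Kernels} (hK : K.Cont S.ℓ) :
    ContinuousOn (K.k11 S.ℓ) (Icc 0 S.ℓ) ∧ ContinuousOn (K.k12 S.ℓ) (Icc 0 S.ℓ) ∧
    ContinuousOn (K.k21 S.ℓ) (Icc 0 S.ℓ) ∧ ContinuousOn (K.k22 S.ℓ) (Icc 0 S.ℓ) :=
  ⟨continuousOn_slice_left hK.c11 le_rfl, continuousOn_slice_left hK.c12 le_rfl,
    continuousOn_slice_left hK.c21 le_rfl, continuousOn_slice_left hK.c22 le_rfl⟩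

lemma continuousOn_Nu {S : Plant} {K : Kernels} (hK : K.Cont S.ℓ) :
    ContinuousOn (Nu S K) (Icc 0 S.ℓ) :=
  (kernels_continuous_row hK).2.2.1.sub (continuousOn_const.mul (kernels_continuous_row hK).1)

lemma continuousOn_Nv {S : Plant} {K : Kernels} (hK : K.Cont S.ℓ) :
    ContinuousOn (Nv S K) (Icc 0 S.ℓ) :=
  (kernels_continuous_row hK).2.2.2.sub (continuousOn_const.mul (kernels_continuous_row hK).2.1)

lemma kerEq_pair_continuous {S : Plant} (hS : S.Admissible) {K L : Kernels}
    (hK : IsControlKernel S K) (hL : IsInverseKernel S L) (w : Fin 2 → L2 S.ℓ) :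
    onePlus S.ℓ L.mat (onePlus S.ℓ K.opp.mat w) = w ∧
      onePlus S.ℓ K.opp.mat (onePlus S.ℓ L.mat w) = w :=
  ⟨onePlus_onePlus_symm hS.ℓ_pos.le (hK.ctrlEq.kerEq hS).continuousOn
    (hL.invEq.kerEq hS).continuousOn (fun i j _ _ hp => control_comp_inverse hS hK hL i j hp) w,
    onePlus_onePlus hS.ℓ_pos.le (hK.ctrlEq.kerEq hS).continuousOn
    (hL.invEq.kerEq hS).continuousOn (fun i j _ _ hp => control_comp_inverse hS hK hL i j hp) w⟩

/-- Estimate of the plant on a bounded time interval. -/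
theorem exists_plant_estimate {S : Plant} (hS : S.Admissible) (hrefl : |S.rho * S.q| ≤ 1 / 2)
    {K L : Kernels} (hK : IsControlKernel S K) (hL : IsInverseKernel S L) {T : ℝ} (hT : 0 ≤ T) :
    ∃ C : ℝ, 0 < C ∧ ∀ (P : Kernels) (inp : ℝ → ℝ) (z : Trajectory S.ℓ) (b : Traces),
      PlantObserver S P inp z b → ∀ t ∈ Icc 0 T,
        nsq (z.plant t) ≤ C * (nsq (z.plant 0) + ∫ s in (0 : ℝ)..t, inp s ^ 2) ∧
        ∫ s in (0 : ℝ)..t, (b.uL s - pair (z.u s) (K.k11 S.ℓ) - pair (z.v s) (K.k12 S.ℓ)) ^ 2 ≤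
          C * (nsq (z.plant 0) + ∫ s in (0 : ℝ)..t, inp s ^ 2) := by
  have hq : 0 < S.q ^ 2 := by have := hS.q_ne; positivity
  -- The bound |ρq| ≤ 1/2 is what allows the weight ω = q².
  have hω' : 2 * S.q ^ 2 * S.rho ^ 2 ≤ 1 / 2 := by
    have h1 : (S.rho * S.q) ^ 2 ≤ (1 / 2) ^ 2 := sq_le_sq' (by linarith [neg_abs_le (S.rho * S.q)])
      ((le_abs_self _).trans hrefl)
    nlinarith
  obtain ⟨C1, p1, H1⟩ := exists_energy_bounds hS hq
  obtain ⟨C2, p2, H2⟩ := exists_nsq_le (onePlus S.ℓ K.opp.mat)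
  obtain ⟨C3, p3, H3⟩ := exists_nsq_le (onePlus S.ℓ L.mat)
  obtain ⟨C4, p4, H4⟩ := exists_pair_add_sq_le (continuousOn_Nu hK.cont) (continuousOn_Nv hK.cont)
  -- The Grönwall constant: the perturbation is the input minus a feedback functional whose square
  -- is at most C₄C₃C₁ times the energy, and (x - y)² ≤ 2x² + 2y² doubles the factor 2q².
  set κ : ℝ := 4 * S.q ^ 2 * (C4 * (C3 * C1)) with hκ
  have hκ0 : 0 ≤ κ := by positivity
  set D : ℝ := C1 * C2 + 4 * S.q ^ 2 with hD
  have hD0 : 0 < D := by positivity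
  set e := Real.exp (κ * T) with he
  have he0 : 0 < e := Real.exp_pos _
  refine ⟨C3 * C1 * (D * e) + 2 * (D + κ * (T * (D * e))), by positivity, ?_⟩
  intro P inp z b h
  obtain ⟨A, B, hd, eA, eB, eL⟩ := h.exists_plant_rep hS hK
  have hN : ContinuousOn (fun t => pair (z.u t) (Nu S K) + pair (z.v t) (Nv S K)) (Ici 0) :=
    (continuousOn_pair h.cont.u (continuousOn_Nu hK.cont)).add
      (continuousOn_pair h.cont.v (continuousOn_Nv hK.cont))
  have hinp := h.l2loc_inp
  have hdl : L2loc fun t => inp t - (pair (z.u t) (Nu S K) + pair (z.v t) (Nv S K)) :=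
    hinp.sub (ContinuousOn.l2loc hN)
  set E : ℝ → ℝ := fun t => energy S (S.q ^ 2) (onePlus S.ℓ K.opp.mat (z.plant t)) with hE
  have hEc : ContinuousOn E (Ici 0) := by
    have hc := continuousOn_onePlus K.opp.mat h.continuousOn_plant
    exact (((hc 0).norm.pow 2).div_const _).add
      (continuousOn_const.mul (((hc 1).norm.pow 2).div_const _))
  have hE0 : ∀ t, 0 ≤ E t := fun t => by
    have := H1 (onePlus S.ℓ K.opp.mat (z.plant t))
    have h5 := nsq_nonneg (onePlus S.ℓ K.opp.mat (z.plant t))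
    by_contra hn
    nlinarith [this.1, not_le.1 hn]
  have hw : ∀ t, nsq (z.plant t) ≤ C3 * C1 * E t := fun t => by
    have h1 := H3 (onePlus S.ℓ K.opp.mat (z.plant t))
    rw [(kerEq_pair_continuous hS hK hL (z.plant t)).1] at h1
    calc _ ≤ _ := h1
      _ ≤ C3 * (C1 * E t) := mul_le_mul_of_nonneg_left (H1 _).1 p3.le
      _ = _ := by ring
  have main : ∀ t, 0 ≤ t → E t + 1 / 2 * ∫ s in (0 : ℝ)..t, A (s - S.ℓ / S.lam1) ^ 2 ≤
      (E 0 + 4 * S.q ^ 2 * ∫ s in (0 : ℝ)..t, inp s ^ 2) + κ * ∫ s in (0 : ℝ)..t, E s := by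
    intro t ht
    have h1 := hd.energy_le hS hdl le_rfl hω' eA eB ht
    rw [sub_self, zero_mul, add_zero] at h1
    have iE : IntervalIntegrable E volume 0 t := by
      refine (hEc.mono ?_).intervalIntegrable
      rw [uIcc_of_le ht]; exact fun x hx => hx.1
    have ii := hinp.intervalIntegrable_sq le_rfl ht
    have h2 : 2 * S.q ^ 2 * ∫ s in (0 : ℝ)..t,
        (inp s - (pair (z.u s) (Nu S K) + pair (z.v s) (Nv S K))) ^ 2 ≤
        4 * S.q ^ 2 * (∫ s in (0 : ℝ)..t, inp s ^ 2) + κ * ∫ s in (0 : ℝ)..t, E s := by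
      simp only [← intervalIntegral.integral_const_mul]
      rw [← intervalIntegral.integral_add (ii.const_mul _) (iE.const_mul _)]
      refine intervalIntegral.integral_mono_on ht ((hdl.intervalIntegrable_sq le_rfl ht).const_mul _)
        ((ii.const_mul _).add (iE.const_mul _)) fun s hs => ?_
      have h3 := H4 (z.plant s)
      change (pair (z.u s) (Nu S K) + pair (z.v s) (Nv S K)) ^ 2 ≤ _ at h3
      have h4 := mul_le_mul_of_nonneg_left (hw s) p4.le
      have h5 : (pair (z.u s) (Nu S K) + pair (z.v s) (Nv S K)) ^ 2 ≤ C4 * (C3 * C1) * E s := by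
        linarith
      have h6 := mul_le_mul_of_nonneg_left h5 (by positivity : (0 : ℝ) ≤ 4 * S.q ^ 2)
      have h7 := mul_nonneg hq.le
        (sq_nonneg (inp s + (pair (z.u s) (Nu S K) + pair (z.v s) (Nv S K))))
      simp only [hκ]
      nlinarith
    linarith
  intro t ht
  have ii := hinp.intervalIntegrable_sq le_rfl ht.1
  have hi0 : 0 ≤ ∫ s in (0 : ℝ)..t, inp s ^ 2 :=
    intervalIntegral.integral_nonneg ht.1 fun _ _ => sq_nonneg _
  set I := ∫ s in (0 : ℝ)..t, inp s ^ 2 with hI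
  set a := E 0 + 4 * S.q ^ 2 * I with ha
  have hE00 : E 0 ≤ C1 * C2 * nsq (z.plant 0) := by
    calc _ ≤ _ := (H1 _).2
      _ ≤ C1 * (C2 * nsq (z.plant 0)) := mul_le_mul_of_nonneg_left (H2 _) p1.le
      _ = _ := by ring
  have haD : a ≤ D * (nsq (z.plant 0) + I) := by
    have n0 := nsq_nonneg (z.plant 0)
    have m1 : 0 ≤ C1 * C2 * I := by positivity
    have m2 : 0 ≤ 4 * S.q ^ 2 * nsq (z.plant 0) := by positivity
    simp only [ha, hD]; nlinarith
  have ha0 : 0 ≤ a := by have := hE0 0; positivity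
  have hA0 : ∀ r, 0 ≤ r → 0 ≤ ∫ s in (0 : ℝ)..r, A (s - S.ℓ / S.lam1) ^ 2 := fun r hr =>
    intervalIntegral.integral_nonneg hr fun _ _ => sq_nonneg _
  have hg : ∀ r ∈ Icc 0 t, E r ≤ a * Real.exp (κ * r) := by
    refine le_mul_exp_of_le_add_integral (hEc.mono fun x hx => hx.1) hκ0 fun r hr => ?_
    have h1 := main r hr.1
    have h2 : ∫ s in (0 : ℝ)..r, inp s ^ 2 ≤ I :=
      intervalIntegral.integral_mono_interval le_rfl hr.1 hr.2
        (Filter.Eventually.of_forall fun _ => sq_nonneg _) ii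
    have h3 := mul_le_mul_of_nonneg_left h2 (by positivity : (0 : ℝ) ≤ 4 * S.q ^ 2)
    have h4 := hA0 r hr.1
    linarith
  have hg' : ∀ r ∈ Icc 0 t, E r ≤ a * e := fun r hr => (hg r hr).trans
    (mul_le_mul_of_nonneg_left (Real.exp_le_exp.2
      (mul_le_mul_of_nonneg_left (hr.2.trans ht.2) hκ0)) ha0)
  have n0 := nsq_nonneg (z.plant 0)
  have q0 : 0 ≤ D * (nsq (z.plant 0) + I) := by positivity
  constructor
  · calc nsq (z.plant t) ≤ C3 * C1 * E t := hw t
      _ ≤ C3 * C1 * (D * (nsq (z.plant 0) + I) * e) := by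
          refine mul_le_mul_of_nonneg_left ((hg' t ⟨ht.1, le_rfl⟩).trans ?_) (by positivity)
          exact mul_le_mul_of_nonneg_right haD he0.le
      _ ≤ _ := by
          have : 0 ≤ 2 * (D + κ * (T * (D * e))) * (nsq (z.plant 0) + I) := by positivity
          linarith
  · have e1 : ∫ s in (0 : ℝ)..t, (b.uL s - pair (z.u s) (K.k11 S.ℓ) - pair (z.v s) (K.k12 S.ℓ)) ^ 2 =
        ∫ s in (0 : ℝ)..t, A (s - S.ℓ / S.lam1) ^ 2 := by
      refine intervalIntegral.integral_congr_ae_restrict ?_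
      rw [uIoc_of_le ht.1]
      filter_upwards [ae_mono (Measure.restrict_mono (fun s hs => hs.1 : Ioc 0 t ⊆ Ioi 0) le_rfl) eL]
        with s hs
      rw [hs]
    rw [e1]
    have h1 := main t ht.1
    have h2 : ∫ s in (0 : ℝ)..t, E s ≤ t * (a * e) := by
      have iE : IntervalIntegrable E volume 0 t := by
        refine (hEc.mono ?_).intervalIntegrable
        rw [uIcc_of_le ht.1]; exact fun x hx => hx.1
      have := intervalIntegral.integral_mono_on ht.1 iE (intervalIntegrable_const (c := a * e)) hg'
      rw [intervalIntegral.integral_const, sub_zero, smul_eq_mul] at this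
      exact this
    have h3 : t * (a * e) ≤ T * (D * (nsq (z.plant 0) + I) * e) :=
      mul_le_mul ht.2 (mul_le_mul_of_nonneg_right haD he0.le) (by positivity) hT
    have h4 := mul_le_mul_of_nonneg_left (h2.trans h3) hκ0
    have h5 := hE0 t
    have h6 : 0 ≤ C3 * C1 * (D * e) * (nsq (z.plant 0) + I) := by positivity
    nlinarith

/-! ### The observer error -/

lemma ae_shift {p : ℝ → Prop} (h : ∀ᵐ t ∂(volume.restrict (Ioi (0 : ℝ))), p t) (τ : ℝ) :
    ∀ᵐ t, τ < t → p (t - τ) := by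
  have h' := (ae_restrict_iff' measurableSet_Ioi).1 h
  filter_upwards [(measurePreserving_sub_right volume τ).quasiMeasurePreserving.ae h'] with t ht hτ
  exact ht (mem_Ioi.2 (by linarith))

lemma ae_back {p : ℝ → Prop} (h : ∀ᵐ t ∂(volume.restrict (Ioi (0 : ℝ))), p t) (t : ℝ) :
    ∀ᵐ σ, σ < t → p (t - σ) := by
  have h' := (ae_restrict_iff' measurableSet_Ioi).1 h
  filter_upwards [(Measure.measurePreserving_sub_left volume t).quasiMeasurePreserving.ae h']
    with σ hσ hτ
  exact hσ (mem_Ioi.2 (by linarith))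

lemma prof_eq_zero {A : ℝ → ℝ} (hA : LocSq A) {c ℓ x₀ : ℝ} (h : IsInflow ℓ c x₀) (hℓ : 0 ≤ ℓ)
    {s t : ℝ} (hs : 0 ≤ s) (ht : s + ℓ / |c| ≤ t)
    (h0 : ∀ᵐ r ∂(volume.restrict (Ioi (0 : ℝ))), s < r → A r = 0) : prof ℓ c x₀ A t = 0 := by
  have : ‖prof ℓ c x₀ A t‖ ^ 2 = 0 := by
    rw [norm_prof_sq hA h hℓ]
    refine mul_eq_zero_of_right _ (intervalIntegral.integral_zero_ae ?_)
    have hc : (0 : ℝ) ≤ ℓ / |c| := div_nonneg hℓ (abs_nonneg _)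
    filter_upwards [ae_back h0 t, Measure.ae_ne volume (ℓ / |c|)] with σ hσ hne hm
    rw [uIoc_of_le hc] at hm
    have := lt_of_le_of_ne hm.2 hne
    rw [hσ (by linarith) (by linarith)]
    ring
  simpa using this

lemma continuousOn_nsq {ℓ : ℝ} {w : ℝ → Fin 2 → L2 ℓ} {s : Set ℝ}
    (hw : ∀ i, ContinuousOn (fun t => w t i) s) : ContinuousOn (fun t => nsq (w t)) s :=
  ((hw 0).norm.pow 2).add ((hw 1).norm.pow 2)

/-- The time after which the observer has converged. -/
def Plant.horizon (S : Plant) : ℝ := S.ℓ / S.lam1 + S.ℓ / S.lam2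

lemma Plant.Admissible.horizon_pos {S : Plant} (hS : S.Admissible) : 0 < S.horizon :=
  add_pos (div_pos hS.ℓ_pos hS.lam1_pos) (div_pos hS.ℓ_pos hS.lam2_pos)

theorem error_inverse {S : Plant} (hS : S.Admissible) {P Q : Kernels} (hP : IsObserverKernel S P)
    (hQ : CtrlEq S Q) (hQ1 : ∀ ξ ∈ Icc 0 S.ℓ, Q.k21 S.ℓ ξ = S.rho * Q.k11 S.ℓ ξ)
    (hQ2 : ∀ ξ ∈ Icc 0 S.ℓ, Q.k22 S.ℓ ξ = S.rho * Q.k12 S.ℓ ξ) (w : Fin 2 → L2 S.ℓ) :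
    onePlus S.ℓ P.opp.mat (onePlus S.ℓ Q.opp.mat w) = w :=
  onePlus_onePlus_symm hS.ℓ_pos.le (hQ.kerEq hS).continuousOn (hP.invEq.kerEq hS).continuousOn
    (fun i j _ _ hp => observerInverse_comp hS hQ hQ1 hQ2 hP i j hp) w

/-- Nothing enters at x = 0 in the transformed error, so the signal A is zero for positive times and
B dies out ℓ/λ₁ later; after one more crossing time the profiles are empty. Until then the energy
without input does not grow. As q plays no role, the weight 1/(4ρ²) is available. The trace of u - û
at ℓ is A delayed plus a pairing with the error, whence the factor 1 + t. -/
theorem exists_error_estimate {S : Plant} (hS : S.Admissible) {P : Kernels}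
    (hP : IsObserverKernel S P) : ∃ C : ℝ, 0 < C ∧
    ∀ (inp : ℝ → ℝ) (z : Trajectory S.ℓ) (b : Traces), PlantObserver S P inp z b →
      (∀ t, 0 ≤ t → nsq (z.plant t - z.obs t) ≤ C * nsq (z.plant 0 - z.obs 0) ∧
        ∫ s in (0 : ℝ)..t, betaTilde0 b s ^ 2 ≤ C * nsq (z.plant 0 - z.obs 0) ∧
        ∫ s in (0 : ℝ)..t, (b.uL s - b.uhL s) ^ 2 ≤ C * (1 + t) * nsq (z.plant 0 - z.obs 0)) ∧
      (∀ t, S.horizon ≤ t → z.plant t = z.obs t) ∧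
      ∀ᵐ t ∂(volume.restrict (Ioi (0 : ℝ))), S.horizon < t →
        betaTilde0 b t = 0 ∧ b.uL t = b.uhL t := by
  obtain ⟨Q, hQ, hQ1, hQ2⟩ := exists_observerInverse hS
  have hρ : 0 < S.rho ^ 2 := by have := hS.rho_ne; positivity
  set ω : ℝ := 1 / (4 * S.rho ^ 2) with hω
  have hω0 : 0 < ω := by positivity
  have hωρ : 2 * ω * S.rho ^ 2 ≤ 1 / 2 := by rw [hω]; have := hS.rho_ne; apply le_of_eq; field_simp; norm_num
  obtain ⟨C1, p1, H1⟩ := exists_energy_bounds hS hω0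
  obtain ⟨C2, p2, H2⟩ := exists_nsq_le (onePlus S.ℓ Q.opp.mat)
  obtain ⟨C3, p3, H3⟩ := exists_nsq_le (onePlus S.ℓ P.opp.mat)
  obtain ⟨C4, p4, H4⟩ := exists_pair_add_sq_le (kernels_continuous_row (S := S) hQ.cont).1
    (kernels_continuous_row (S := S) hQ.cont).2.1
  set C5 := C3 * C1 * (C1 * C2) with hC5
  have p5 : 0 < C5 := by positivity
  have p6 : 0 < C1 * C2 / ω := by positivity
  refine ⟨C5 + C1 * C2 / ω + (4 * (C1 * C2) + 2 * (C4 * C5)), by positivity, ?_⟩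
  intro inp z b h
  obtain ⟨A, B, hd, eA, eB, eL, e0⟩ := h.exists_error_rep hS hP hQ hQ1 hQ2
  have hℓ := hS.ℓ_pos
  have τ1 : 0 < S.ℓ / S.lam1 := div_pos hℓ hS.lam1_pos
  have τ2 : 0 < S.ℓ / S.lam2 := div_pos hℓ hS.lam2_pos
  set e : ℝ → Fin 2 → L2 S.ℓ := fun t => z.plant t - z.obs t with he
  have hec : ∀ i, ContinuousOn (fun t => e t i) (Ici 0) := fun i =>
    (h.continuousOn_plant i).sub (h.continuousOn_obs i)
  set X := nsq (e 0) with hX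
  have hX0 : 0 ≤ X := nsq_nonneg _
  have hE : ∀ t, 0 ≤ energy S ω (onePlus S.ℓ Q.opp.mat (e t)) := fun t => by
    have := H1 (onePlus S.ℓ Q.opp.mat (e t))
    have h5 := nsq_nonneg (onePlus S.ℓ Q.opp.mat (e t))
    by_contra hn
    nlinarith [this.1, not_le.1 hn]
  have hE0 : energy S ω (onePlus S.ℓ Q.opp.mat (e 0)) ≤ C1 * C2 * X := by
    calc _ ≤ _ := (H1 _).2
      _ ≤ C1 * (C2 * X) := mul_le_mul_of_nonneg_left (H2 _) p1.le
      _ = _ := by ring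
  have main : ∀ t, 0 ≤ t → energy S ω (onePlus S.ℓ Q.opp.mat (e t)) +
      1 / 2 * (∫ s in (0 : ℝ)..t, A (s - S.ℓ / S.lam1) ^ 2) +
      ω * (∫ s in (0 : ℝ)..t, B (s - S.ℓ / S.lam2) ^ 2) ≤ C1 * C2 * X := by
    intro t ht
    have := hd.energy_le hS (q := 0) (d := fun _ => 0) L2loc.zero (by simpa using hω0.le) hωρ
      (by filter_upwards [eA] with t ht; rw [ht]; ring)
      (by filter_upwards [eB] with t ht; rw [ht]; ring) ht
    simp only [ne_eq, OfNat.ofNat_ne_zero, not_false_eq_true, zero_pow, sub_zero,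
      intervalIntegral.integral_zero, mul_zero, add_zero] at this
    exact this.trans hE0
  have iA : ∀ t, 0 ≤ t → 0 ≤ ∫ s in (0 : ℝ)..t, A (s - S.ℓ / S.lam1) ^ 2 := fun t ht =>
    intervalIntegral.integral_nonneg ht fun _ _ => sq_nonneg _
  have iB : ∀ t, 0 ≤ t → 0 ≤ ω * ∫ s in (0 : ℝ)..t, B (s - S.ℓ / S.lam2) ^ 2 := fun t ht =>
    mul_nonneg hω0.le (intervalIntegral.integral_nonneg ht fun _ _ => sq_nonneg _)
  have hn : ∀ t, 0 ≤ t → nsq (e t) ≤ C5 * X := fun t ht => by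
    have h1 := H3 (onePlus S.ℓ Q.opp.mat (e t))
    rw [error_inverse hS hP hQ hQ1 hQ2] at h1
    calc _ ≤ _ := h1
      _ ≤ C3 * (C1 * energy S ω (onePlus S.ℓ Q.opp.mat (e t))) :=
          mul_le_mul_of_nonneg_left (H1 _).1 p3.le
      _ ≤ C3 * (C1 * (C1 * C2 * X)) := by
          have := main t ht; have := iA t ht; have := iB t ht
          gcongr; linarith
      _ = _ := by rw [hC5]; ring
  have eB0 : ∀ᵐ r ∂(volume.restrict (Ioi (0 : ℝ))), S.ℓ / S.lam1 < r → B r = 0 := by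
    filter_upwards [eB, ae_restrict_of_ae (ae_shift eA (S.ℓ / S.lam1))] with r h1 h2 h3
    rw [h1, h2 h3, mul_zero]
  have hz : ∀ t, S.horizon ≤ t → z.plant t - z.obs t = 0 := by
    intro t ht
    have ht0 : 0 ≤ t := hS.horizon_pos.le.trans ht
    unfold Plant.horizon at ht
    have g : onePlus S.ℓ Q.opp.mat (e t) = 0 := by
      funext i
      revert i
      refine forall_fin_two ?_ ?_
      · refine (hd.eqA t ht0).trans (prof_eq_zero hd.sqA hS.inflow_left hℓ.le le_rfl ?_ ?_)
        · rw [abs_of_pos hS.lam1_pos]; linarith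
        · filter_upwards [eA] with r hr _ using hr
      · refine (hd.eqB t ht0).trans (prof_eq_zero hd.sqB hS.inflow_right hℓ.le τ1.le ?_ eB0)
        rw [abs_neg, abs_of_pos hS.lam2_pos]; linarith
    have := error_inverse hS hP hQ hQ1 hQ2 (e t)
    rw [g, map_zero] at this
    exact this.symm
  refine ⟨fun t ht => ⟨?_, ?_, ?_⟩, fun t ht => sub_eq_zero.1 (hz t ht), ?_⟩
  · refine (hn t ht).trans ?_
    have : 0 ≤ (C1 * C2 / ω + (4 * (C1 * C2) + 2 * (C4 * C5))) * X := by positivity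
    linarith
  · have e1 : ∫ s in (0 : ℝ)..t, betaTilde0 b s ^ 2 =
        ∫ s in (0 : ℝ)..t, B (s - S.ℓ / S.lam2) ^ 2 := by
      refine intervalIntegral.integral_congr_ae_restrict ?_
      rw [uIoc_of_le ht]
      filter_upwards [ae_mono (Measure.restrict_mono (fun s hs => hs.1 : Ioc 0 t ⊆ Ioi 0) le_rfl) e0]
        with s hs
      rw [hs]
    rw [e1]
    have h1 : ω * (∫ s in (0 : ℝ)..t, B (s - S.ℓ / S.lam2) ^ 2) ≤ C1 * C2 * X := by
      have := main t ht; have := iA t ht; have := hE t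
      linarith
    have h2 : (∫ s in (0 : ℝ)..t, B (s - S.ℓ / S.lam2) ^ 2) ≤ C1 * C2 / ω * X := by
      rw [div_mul_eq_mul_div, le_div_iff₀ hω0]; linarith
    have : 0 ≤ (C5 + (4 * (C1 * C2) + 2 * (C4 * C5))) * X := by positivity
    linarith
  · have h1 : ∫ s in (0 : ℝ)..t, A (s - S.ℓ / S.lam1) ^ 2 ≤ 2 * (C1 * C2 * X) := by
      have := main t ht; have := iB t ht; have := hE t
      linarith
    have i1 := hd.sqA.2.comp_sub_right (S.ℓ / S.lam1) 0 t
    have h2 : ∫ s in (0 : ℝ)..t, (b.uL s - b.uhL s) ^ 2 ≤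
        ∫ s in (0 : ℝ)..t, (2 * A (s - S.ℓ / S.lam1) ^ 2 + 2 * (C4 * (C5 * X))) := by
      refine integral_mono_ae_Ioi le_rfl ht
        ((h.traces.uL.sub h.traces.uhL).intervalIntegrable_sq le_rfl ht)
        ((i1.const_mul 2).add intervalIntegrable_const) ?_
      filter_upwards [eL, ae_restrict_mem measurableSet_Ioi] with s hs hs0
      have h3 := H4 (e s)
      have h4 := mul_le_mul_of_nonneg_left (hn s (le_of_lt hs0)) p4.le
      have h5 : b.uL s - b.uhL s = A (s - S.ℓ / S.lam1) +
          (pair (e s 0) (Q.k11 S.ℓ) + pair (e s 1) (Q.k12 S.ℓ)) := by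
        rw [← hs]
        simp only [he, Pi.sub_apply, Trajectory.plant, Trajectory.obs, Matrix.cons_val_zero,
          Matrix.cons_val_one, Matrix.cons_val_fin_one]
        ring
      rw [h5]
      nlinarith [sq_nonneg (A (s - S.ℓ / S.lam1) -
        (pair (e s 0) (Q.k11 S.ℓ) + pair (e s 1) (Q.k12 S.ℓ)))]
    rw [intervalIntegral.integral_add (i1.const_mul 2) intervalIntegrable_const,
      intervalIntegral.integral_const_mul, intervalIntegral.integral_const, sub_zero,
      smul_eq_mul] at h2
    have e1 : C5 + C1 * C2 / ω + (4 * (C1 * C2) + 2 * (C4 * C5)) =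
      (C5 + C1 * C2 / ω) + 4 * (C1 * C2) + 2 * (C4 * C5) := by ring
    have h3 : 0 ≤ (C5 + C1 * C2 / ω) * (1 + t) * X + 4 * (C1 * C2) * t * X +
      2 * (C4 * C5) * X := by positivity
    rw [e1]
    nlinarith
  · filter_upwards [eL, e0, ae_restrict_of_ae (ae_shift eA (S.ℓ / S.lam1)),
      ae_restrict_of_ae (ae_shift eB0 (S.ℓ / S.lam2))] with t h1 h2 h3 h4 ht
    have hh := hz t ht.le
    have q0 : z.u t - z.uh t = 0 := congrFun hh 0
    have q1 : z.v t - z.vh t = 0 := congrFun hh 1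
    unfold Plant.horizon at ht
    refine ⟨?_, ?_⟩
    · rw [h2, h4 (by linarith) (by linarith)]
    · rw [h3 (by linarith), q0, q1] at h1
      have p0 : ∀ f, pair (0 : L2 S.ℓ) f = 0 := fun f => by
        unfold pair
        refine integral_eq_zero_of_ae ?_
        filter_upwards [Lp.coeFn_zero ℝ 2 (volume.restrict (Ioo (0 : ℝ) S.ℓ))] with x hx
        rw [hx]; simp
      rw [p0, p0] at h1
      linarith

/-! ### Bounds on the solution and on the outputs -/

lemma feedback_eq {S : Plant} (K : Kernels) (z : Trajectory S.ℓ) (t : ℝ) :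
    feedback S K z t = pair (z.obs t 0) (Nu S K) + pair (z.obs t 1) (Nv S K) := by
  unfold feedback pair
  simp only [mul_comm (Nu S K _), mul_comm (Nv S K _)]
  rfl

lemma alphaHatL_eq {S : Plant} (K : Kernels) (z : Trajectory S.ℓ) (b : Traces) (t : ℝ) :
    alphaHatL K z b t = b.uhL t - pair (z.obs t 0) (K.k11 S.ℓ) - pair (z.obs t 1) (K.k12 S.ℓ) := by
  unfold alphaHatL pair
  simp only [mul_comm (K.k11 S.ℓ _), mul_comm (K.k12 S.ℓ _)]
  rfl

lemma hatNormSq_eq {S : Plant} (hS : S.Admissible) {K : Kernels} (hK : IsControlKernel S K)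
    (z : Trajectory S.ℓ) (t : ℝ) : hatNormSq K z t = nsq (onePlus S.ℓ K.opp.mat (z.obs t)) := by
  have hc := (hK.ctrlEq.kerEq hS).continuousOn
  unfold hatNormSq nsq
  rw [L2.norm_sq, L2.norm_sq]
  congr 1
  · refine integral_congr_ae ?_
    filter_upwards [onePlus_ae hS.ℓ_pos.le hc (z.obs t) 0] with x hx
    rw [hx]
    simp only [Fin.sum_univ_two, Kernels.mat, Kernels.opp, Matrix.cons_val_zero,
      Matrix.cons_val_one, Matrix.cons_val_fin_one, Trajectory.obs, neg_mul,
      intervalIntegral.integral_neg, alphaHat]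
    ring
  · refine integral_congr_ae ?_
    filter_upwards [onePlus_ae hS.ℓ_pos.le hc (z.obs t) 1] with x hx
    rw [hx]
    simp only [Fin.sum_univ_two, Kernels.mat, Kernels.opp, Matrix.cons_val_zero,
      Matrix.cons_val_one, Matrix.cons_val_fin_one, Trajectory.obs, neg_mul,
      intervalIntegral.integral_neg, betaHat]
    ring

lemma pair_sub_left {ℓ : ℝ} (u v : L2 ℓ) {f : ℝ → ℝ} (hf : ContinuousOn f (Icc 0 ℓ)) :
    pair (u - v) f = pair u f - pair v f := by
  have := pair_add_left (u - v) v hf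
  rw [sub_add_cancel] at this
  linarith

lemma continuousOn_feedback {S : Plant} {P K : Kernels} {inp : ℝ → ℝ} {z : Trajectory S.ℓ}
    {b : Traces} (hK : K.Cont S.ℓ) (h : PlantObserver S P inp z b) :
    ContinuousOn (feedback S K z) (Ici 0) := by
  have : feedback S K z = fun t => pair (z.obs t 0) (Nu S K) + pair (z.obs t 1) (Nv S K) :=
    funext fun t => feedback_eq K z t
  rw [this]
  exact (continuousOn_pair (h.continuousOn_obs 0) (continuousOn_Nu hK)).add
    (continuousOn_pair (h.continuousOn_obs 1) (continuousOn_Nv hK))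

lemma continuousOn_hatNormSq {S : Plant} (hS : S.Admissible) {P K : Kernels} {inp : ℝ → ℝ}
    {z : Trajectory S.ℓ} {b : Traces} (hK : IsControlKernel S K) (h : PlantObserver S P inp z b) :
    ContinuousOn (hatNormSq K z) (Ici 0) := by
  have : hatNormSq K z = fun t => nsq (onePlus S.ℓ K.opp.mat (z.obs t)) :=
    funext fun t => hatNormSq_eq hS hK z t
  rw [this]
  exact continuousOn_nsq (continuousOn_onePlus _ h.continuousOn_obs)

lemma l2loc_alphaHatL {S : Plant} {P K : Kernels} {inp : ℝ → ℝ} {z : Trajectory S.ℓ}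
    {b : Traces} (hK : K.Cont S.ℓ) (h : PlantObserver S P inp z b) : L2loc (alphaHatL K z b) := by
  have : alphaHatL K z b = fun t => b.uhL t - pair (z.obs t 0) (K.k11 S.ℓ) -
      pair (z.obs t 1) (K.k12 S.ℓ) := funext fun t => alphaHatL_eq K z b t
  rw [this]
  exact (h.traces.uhL.sub (ContinuousOn.l2loc
    (continuousOn_pair (h.continuousOn_obs 0) (kernels_continuous_row hK).1))).sub
    (ContinuousOn.l2loc (continuousOn_pair (h.continuousOn_obs 1) (kernels_continuous_row hK).2.1))

lemma l2loc_betaTilde0 {S : Plant} {P : Kernels} {inp : ℝ → ℝ} {z : Trajectory S.ℓ}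
    {b : Traces} (h : PlantObserver S P inp z b) : L2loc (betaTilde0 b) :=
  h.traces.v0.sub h.traces.vh0

lemma exists_output_bounds {S : Plant} (hS : S.Admissible) {K : Kernels}
    (hK : IsControlKernel S K) : ∃ C : ℝ, 0 < C ∧ ∀ (z : Trajectory S.ℓ) (t : ℝ),
      feedback S K z t ^ 2 ≤ C * z.norm t ^ 2 ∧ hatNormSq K z t ≤ C * z.norm t ^ 2 := by
  obtain ⟨C1, p1, H1⟩ := exists_nsq_le (onePlus S.ℓ K.opp.mat)
  obtain ⟨C2, p2, H2⟩ := exists_pair_add_sq_le (continuousOn_Nu hK.cont) (continuousOn_Nv hK.cont)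
  refine ⟨C1 + C2, by positivity, fun z t => ?_⟩
  have n1 := nsq_nonneg (z.plant t)
  have n2 := nsq_nonneg (z.obs t)
  have h1 := H1 (z.obs t)
  have h2 := H2 (z.obs t)
  rw [feedback_eq, hatNormSq_eq hS hK, Trajectory.norm_sq]
  constructor
  · have : 0 ≤ C1 * (nsq (z.plant t) + nsq (z.obs t)) + C2 * nsq (z.plant t) := by positivity
    linarith
  · have : 0 ≤ C2 * (nsq (z.plant t) + nsq (z.obs t)) + C1 * nsq (z.plant t) := by positivity
    linarith

/-- Growth on bounded time intervals. -/
theorem exists_growth {S : Plant} (hS : S.Admissible) (hrefl : |S.rho * S.q| ≤ 1 / 2)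
    {K L P : Kernels} (hK : IsControlKernel S K) (hL : IsInverseKernel S L)
    (hP : IsObserverKernel S P) {T : ℝ} (hT : 0 ≤ T) :
    ∃ C : ℝ, 0 < C ∧ ∀ (inp : ℝ → ℝ) (z : Trajectory S.ℓ) (b : Traces),
      PlantObserver S P inp z b → ∀ t ∈ Icc 0 T,
        z.norm t ^ 2 ≤ C * (z.norm 0 ^ 2 + ∫ s in (0 : ℝ)..t, inp s ^ 2) ∧
        ∫ s in (0 : ℝ)..t, betaTilde0 b s ^ 2 ≤
          C * (z.norm 0 ^ 2 + ∫ s in (0 : ℝ)..t, inp s ^ 2) ∧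
        ∫ s in (0 : ℝ)..t, alphaHatL K z b s ^ 2 ≤
          C * (z.norm 0 ^ 2 + ∫ s in (0 : ℝ)..t, inp s ^ 2) := by
  obtain ⟨C1, p1, H1⟩ := exists_plant_estimate hS hrefl hK hL hT
  obtain ⟨C2, p2, H2⟩ := exists_error_estimate hS hP
  have r1 := (kernels_continuous_row (S := S) hK.cont).1
  have r2 := (kernels_continuous_row (S := S) hK.cont).2.1
  obtain ⟨C3, p3, H3⟩ := exists_pair_add_sq_le r1 r2
  refine ⟨3 * C1 + 4 * C2 + (3 * C1 + 6 * (C2 * (1 + T)) + 6 * (C3 * C2) * T), by positivity, ?_⟩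
  intro inp z b h t ht
  have hI : 0 ≤ ∫ s in (0 : ℝ)..t, inp s ^ 2 :=
    intervalIntegral.integral_nonneg ht.1 fun _ _ => sq_nonneg _
  set I := ∫ s in (0 : ℝ)..t, inp s ^ 2
  obtain ⟨a1, a2⟩ := H1 P inp z b h t ht
  obtain ⟨E, -, -⟩ := H2 inp z b h
  obtain ⟨b1, b2, b3⟩ := E t ht.1
  have n0 := nsq_nonneg (z.plant 0)
  have m0 := nsq_nonneg (z.obs 0)
  have nt := nsq_nonneg (z.plant t)
  have hX : nsq (z.plant 0 - z.obs 0) ≤ 2 * z.norm 0 ^ 2 := by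
    rw [Trajectory.norm_sq]; exact nsq_sub_le _ _
  have hN : nsq (z.plant 0) ≤ z.norm 0 ^ 2 := by rw [Trajectory.norm_sq]; linarith
  set N := z.norm 0 ^ 2 with hNd
  have hN0 : 0 ≤ N := sq_nonneg _
  set Y := N + I with hY
  have hYN : N ≤ Y := by linarith
  have hY0 : 0 ≤ Y := by linarith
  have c1 : C1 * (nsq (z.plant 0) + I) ≤ C1 * Y :=
    mul_le_mul_of_nonneg_left (by linarith) p1.le
  have c2 : C2 * nsq (z.plant 0 - z.obs 0) ≤ C2 * (2 * Y) :=
    mul_le_mul_of_nonneg_left (by linarith) p2.le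
  have hTt : 0 ≤ T := hT
  have s1 : 0 ≤ C1 * Y := by positivity
  have s2 : 0 ≤ C2 * Y := by positivity
  have s3 : 0 ≤ C2 * (1 + T) * Y := by positivity
  have s4 : 0 ≤ C3 * C2 * T * Y := by positivity
  refine ⟨?_, ?_, ?_⟩
  · have d : nsq (z.obs t) ≤ 2 * (nsq (z.plant t) + nsq (z.plant t - z.obs t)) := by
      have := nsq_sub_le (z.plant t) (z.plant t - z.obs t)
      rwa [sub_sub_cancel] at this
    rw [Trajectory.norm_sq]
    linarith
  · linarith
  · have ix := L2loc.intervalIntegrable_sq ((h.traces.uL.sub (ContinuousOn.l2loc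
      (continuousOn_pair h.cont.u r1))).sub (ContinuousOn.l2loc (continuousOn_pair h.cont.v r2)))
      le_rfl ht.1
    have iy := (h.traces.uL.sub h.traces.uhL).intervalIntegrable_sq le_rfl ht.1
    have hle : ∫ s in (0 : ℝ)..t, alphaHatL K z b s ^ 2 ≤ ∫ s in (0 : ℝ)..t,
        (3 * (b.uL s - pair (z.u s) (K.k11 S.ℓ) - pair (z.v s) (K.k12 S.ℓ)) ^ 2 +
          3 * (b.uL s - b.uhL s) ^ 2 + 3 * (C3 * (C2 * (2 * Y)))) := by
      refine intervalIntegral.integral_mono_on ht.1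
        ((l2loc_alphaHatL hK.cont h).intervalIntegrable_sq le_rfl ht.1)
        (((ix.const_mul 3).add (iy.const_mul 3)).add intervalIntegrable_const) fun s hs => ?_
      have h3 := H3 (z.plant s - z.obs s)
      have h4 := mul_le_mul_of_nonneg_left ((E s hs.1).1.trans c2) p3.le
      -- The observer output is the plant output minus the trace of the error plus its pairing with
      -- row ℓ of K, each of which is already controlled.
      have h5 : alphaHatL K z b s = (b.uL s - pair (z.u s) (K.k11 S.ℓ) -
          pair (z.v s) (K.k12 S.ℓ)) - (b.uL s - b.uhL s) +
          (pair ((z.plant s - z.obs s) 0) (K.k11 S.ℓ) +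
            pair ((z.plant s - z.obs s) 1) (K.k12 S.ℓ)) := by
        rw [alphaHatL_eq, Pi.sub_apply, Pi.sub_apply, pair_sub_left _ _ r1, pair_sub_left _ _ r2]
        simp only [Trajectory.plant, Trajectory.obs, Matrix.cons_val_zero,
          Matrix.cons_val_one, Matrix.cons_val_fin_one]
        ring
      rw [h5]
      set x := b.uL s - pair (z.u s) (K.k11 S.ℓ) - pair (z.v s) (K.k12 S.ℓ)
      set y := b.uL s - b.uhL s
      set w := pair ((z.plant s - z.obs s) 0) (K.k11 S.ℓ) +
            pair ((z.plant s - z.obs s) 1) (K.k12 S.ℓ)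
      nlinarith [sq_nonneg (x + y), sq_nonneg (x - w), sq_nonneg (y + w)]
    rw [intervalIntegral.integral_add
        (intervalIntegrable_fun_add (ix.const_mul 3) (iy.const_mul 3)) intervalIntegrable_const,
      intervalIntegral.integral_add (ix.const_mul 3) (iy.const_mul 3),
      intervalIntegral.integral_const_mul, intervalIntegral.integral_const_mul,
      intervalIntegral.integral_const, sub_zero, smul_eq_mul] at hle
    have d1 : t * (3 * (C3 * (C2 * (2 * Y)))) ≤ T * (3 * (C3 * (C2 * (2 * Y)))) :=
      mul_le_mul_of_nonneg_right ht.2 (by positivity)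
    have d2 : C2 * (1 + t) * nsq (z.plant 0 - z.obs 0) ≤ C2 * (1 + T) * (2 * Y) :=
      mul_le_mul (mul_le_mul_of_nonneg_left (by linarith [ht.2]) p2.le) (by linarith)
        (nsq_nonneg _) (by positivity)
    linarith

/-- Linearity of the plant and observer equations. -/
theorem PlantObserver.sub {S : Plant} (hS : S.Admissible) {P : Kernels} (hP : P.Cont S.ℓ)
    {inp inp' : ℝ → ℝ} {z z' : Trajectory S.ℓ} {b b' : Traces} (h : PlantObserver S P inp z b)
    (h' : PlantObserver S P inp' z' b') :
    PlantObserver S P (fun t => inp t - inp' t)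
      ⟨fun t => z.u t - z'.u t, fun t => z.v t - z'.v t, fun t => z.uh t - z'.uh t,
        fun t => z.vh t - z'.vh t⟩
      ⟨fun t => b.u0 t - b'.u0 t, fun t => b.uL t - b'.uL t, fun t => b.v0 t - b'.v0 t,
        fun t => b.vL t - b'.vL t, fun t => b.uh0 t - b'.uh0 t, fun t => b.uhL t - b'.uhL t,
        fun t => b.vh0 t - b'.vh0 t, fun t => b.vhL t - b'.vhL t⟩ := by
  have e1 := (h.hypEq_plant (injection S P)).sub hS (h'.hypEq_plant (injection S P))
    (continuousOn_injection hP)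
    h.continuousOn_plant h'.continuousOn_plant L2loc.zero L2loc.zero
    (forall_fin_two h.traces.u0 h.traces.v0) (forall_fin_two h.traces.uL h.traces.vL)
    (forall_fin_two h'.traces.u0 h'.traces.v0) (forall_fin_two h'.traces.uL h'.traces.vL)
  have e2 := h.hypEq_obs.sub hS h'.hypEq_obs (continuousOn_injection hP)
    h.continuousOn_obs h'.continuousOn_obs
    (h.traces.v0.sub h.traces.vh0) (h'.traces.v0.sub h'.traces.vh0)
    (forall_fin_two h.traces.uh0 h.traces.vh0) (forall_fin_two h.traces.uhL h.traces.vhL)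
    (forall_fin_two h'.traces.uh0 h'.traces.vh0) (forall_fin_two h'.traces.uhL h'.traces.vhL)
  exact
  { cont := ⟨h.cont.u.sub h'.cont.u, h.cont.v.sub h'.cont.v, h.cont.uh.sub h'.cont.uh,
      h.cont.vh.sub h'.cont.vh⟩
    traces := ⟨h.traces.u0.sub h'.traces.u0, h.traces.uL.sub h'.traces.uL,
      h.traces.v0.sub h'.traces.v0, h.traces.vL.sub h'.traces.vL, h.traces.uh0.sub h'.traces.uh0,
      h.traces.uhL.sub h'.traces.uhL, h.traces.vh0.sub h'.traces.vh0,
      h.traces.vhL.sub h'.traces.vhL⟩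
    eq_u := (e1 0).congr_source fun t x => by simp [Plant.src, Trajectory.plant]
    eq_v := (e1 1).congr_source fun t x => by simp [Plant.src, Trajectory.plant]
    eq_uh := (e2 0).congr_source fun t x => by
      simp [Plant.src, Trajectory.obs, injection]; ring
    eq_vh := (e2 1).congr_source fun t x => by
      simp [Plant.src, Trajectory.obs, injection]; ring
    bc_u := by filter_upwards [h.bc_u, h'.bc_u] with t a a'; rw [a, a']; ring
    bc_v := by filter_upwards [h.bc_v, h'.bc_v] with t a a'; rw [a, a']; ring
    bc_uh := by filter_upwards [h.bc_uh, h'.bc_uh] with t a a'; rw [a, a']; ring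
    bc_vh := by filter_upwards [h.bc_vh, h'.bc_vh] with t a a'; rw [a, a']; ring }

/-! ### Periodic events -/

/-- The values held on the successive sampling intervals. -/
def holdSeq (U m : ℝ → ℝ) (gamma : ℝ → ℝ → ℝ) (h : ℝ) : ℕ → ℝ
  | 0 => U 0
  | n + 1 => open Classical in
      if 0 < gamma (holdSeq U m gamma h n - U ((n + 1 : ℕ) * h)) (m ((n + 1 : ℕ) * h)) then
        U ((n + 1 : ℕ) * h) else holdSeq U m gamma h n

lemma holdSeq_congr {U m U' m' : ℝ → ℝ} {gamma : ℝ → ℝ → ℝ} {h : ℝ} {n : ℕ}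
    (hU : ∀ i ≤ n, U (i * h) = U' (i * h)) (hm : ∀ i ≤ n, m (i * h) = m' (i * h)) :
    holdSeq U m gamma h n = holdSeq U' m' gamma h n := by
  induction n with
  | zero => simpa [holdSeq] using hU 0 le_rfl
  | succ n ih =>
    have := ih (fun i hi => hU i (hi.trans n.le_succ)) (fun i hi => hm i (hi.trans n.le_succ))
    simp only [holdSeq, this, hU _ le_rfl, hm _ le_rfl]

lemma ofReal_mul_lt {h : ℝ} (hh : 0 < h) {i j : ℕ} :
    ENNReal.ofReal (i * h) < ENNReal.ofReal (j * h) ↔ i < j := by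
  rw [ENNReal.ofReal_lt_ofReal_iff']
  constructor
  · rintro ⟨h1, -⟩
    exact_mod_cast lt_of_mul_lt_mul_right h1 hh.le
  · intro hij
    have h1 : (i : ℝ) < j := by exact_mod_cast hij
    have h2 : (0 : ℝ) ≤ i := Nat.cast_nonneg i
    exact ⟨mul_lt_mul_of_pos_right h1 hh, mul_pos (by linarith) hh⟩

lemma ofReal_mul_le {h : ℝ} (hh : 0 < h) {i j : ℕ} (hij : i ≤ j) :
    ENNReal.ofReal (i * h) ≤ ENNReal.ofReal (j * h) := by
  rcases hij.lt_or_eq with h1 | rfl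
  · exact ((ofReal_mul_lt hh).2 h1).le
  · exact le_rfl

/-- By induction on n, where k is the last event up to time nh, located at jh. Either the sample (n
+ 1)h triggers and is event k + 1, or it does not and the next event is no earlier than (n + 2)h. An
event time equal to ∞ needs no separate treatment. -/
theorem EventTimes.exists_index {U m : ℝ → ℝ} {gamma : ℝ → ℝ → ℝ} {h : ℝ} {tk : ℕ → ℝ≥0∞}
    (E : EventTimes U m gamma h tk) (hh : 0 < h) (n : ℕ) :
    ∃ k j : ℕ, tk k = ENNReal.ofReal (j * h) ∧ j ≤ n ∧
      ENNReal.ofReal ((n + 1 : ℕ) * h) ≤ tk (k + 1) ∧ holdSeq U m gamma h n = U (j * h) := by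
  have step : ∀ k j : ℕ, tk k = ENNReal.ofReal (j * h) →
      ENNReal.ofReal ((j + 1 : ℕ) * h) ≤ tk (k + 1) := by
    intro k j hk
    rw [E.succ k]
    refine le_sInf ?_
    rintro _ ⟨i, rfl, hi, -⟩
    rw [hk, ofReal_mul_lt hh] at hi
    exact ofReal_mul_le hh hi
  induction n with
  | zero =>
    have h0 : tk 0 = ENNReal.ofReal ((0 : ℕ) * h) := by rw [E.zero]; simp
    exact ⟨0, 0, h0, le_rfl, step 0 0 h0, by simp [holdSeq]⟩
  | succ n ih =>
    obtain ⟨k, j, hk, hj, hn, hc⟩ := ih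
    have htoR : (tk k).toReal = j * h := by
      rw [hk, ENNReal.toReal_ofReal (by positivity)]
    by_cases hg : 0 < gamma (holdSeq U m gamma h n - U ((n + 1 : ℕ) * h)) (m ((n + 1 : ℕ) * h))
    · have e : tk (k + 1) = ENNReal.ofReal ((n + 1 : ℕ) * h) := by
        refine le_antisymm ?_ hn
        rw [E.succ k]
        refine sInf_le ⟨n + 1, rfl, ?_, ?_⟩
        · rw [hk, ofReal_mul_lt hh]; omega
        · rw [htoR, ← hc]; exact hg
      exact ⟨k + 1, n + 1, e, le_rfl, step _ _ e, if_pos hg⟩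
    · refine ⟨k, j, hk, by omega, ?_, (if_neg hg).trans hc⟩
      have hn' := hn
      rw [E.succ k] at hn' ⊢
      refine le_sInf ?_
      rintro _ ⟨i, rfl, hi, hgi⟩
      have h1 : ¬ i ≤ n := fun hin => by
        have h3 : ENNReal.ofReal ((n + 1 : ℕ) * h) ≤ ENNReal.ofReal (i * h) :=
          hn'.trans (sInf_le ⟨i, rfl, hi, hgi⟩)
        exact absurd ((ofReal_mul_lt hh).2 (show i < n + 1 by omega)) (not_lt.2 h3)
      have h2 : i ≠ n + 1 := by
        rintro rfl
        rw [htoR, ← hc] at hgi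
        exact hg hgi
      exact ofReal_mul_le hh (by omega)

lemma EventTimes.monotone {U m : ℝ → ℝ} {gamma : ℝ → ℝ → ℝ} {h : ℝ} {tk : ℕ → ℝ≥0∞}
    (E : EventTimes U m gamma h tk) : Monotone tk := by
  refine monotone_nat_of_le_succ fun k => ?_
  rw [E.succ k]
  refine le_sInf ?_
  rintro _ ⟨i, rfl, hi, -⟩
  exact hi.le

theorem EventTimes.hold_eq {U m : ℝ → ℝ} {gamma : ℝ → ℝ → ℝ} {h : ℝ} {tk : ℕ → ℝ≥0∞}
    (E : EventTimes U m gamma h tk) (hh : 0 < h) {inp : ℝ → ℝ} (Z : ZeroOrderHold U tk inp) (n : ℕ)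
    {t : ℝ} (ht : t ∈ Ico (n * h) ((n + 1 : ℕ) * h)) : inp t = holdSeq U m gamma h n := by
  obtain ⟨k, j, hk, hj, hn, hc⟩ := E.exists_index hh n
  have h0 : (0 : ℝ) ≤ n * h := by positivity
  have htoR : (tk k).toReal = j * h := by rw [hk, ENNReal.toReal_ofReal (by positivity)]
  rw [hc, ← htoR]
  refine Z k t (h0.trans ht.1) ?_ ?_
  · rw [hk]
    exact (ofReal_mul_le hh hj).trans (ENNReal.ofReal_le_ofReal ht.1)
  · refine lt_of_lt_of_le ?_ hn
    exact (ENNReal.ofReal_lt_ofReal_iff (by positivity)).2 ht.2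

/-- The piecewise constant signal with the values `c n`. -/
def stepSignal (h : ℝ) (c : ℕ → ℝ) (t : ℝ) : ℝ := c ⌊t / h⌋₊

lemma stepSignal_eq {h : ℝ} (hh : 0 < h) (c : ℕ → ℝ) {n : ℕ} {t : ℝ}
    (ht : t ∈ Ico (n * h) ((n + 1 : ℕ) * h)) : stepSignal h c t = c n := by
  unfold stepSignal
  congr 1
  have h0 : (0 : ℝ) ≤ n * h := by positivity
  rw [Nat.floor_eq_iff (div_nonneg (h0.trans ht.1) hh.le)]
  refine ⟨(le_div_iff₀ hh).2 ht.1, (div_lt_iff₀ hh).2 ?_⟩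
  have := ht.2
  push_cast at this
  exact this

lemma mem_step {h : ℝ} (hh : 0 < h) {t : ℝ} (ht : 0 ≤ t) :
    t ∈ Ico ((⌊t / h⌋₊ : ℝ) * h) ((⌊t / h⌋₊ + 1 : ℕ) * h) := by
  have h1 := Nat.floor_le (div_nonneg ht hh.le)
  have h2 := Nat.lt_floor_add_one (t / h)
  refine ⟨(le_div_iff₀ hh).1 h1, ?_⟩
  push_cast
  exact (div_lt_iff₀ hh).1 h2

/-- The event times are defined by recursion. Monotonicity makes the half-open intervals between
them disjoint, so the interval containing t is the one found by `EventTimes.exists_index`. -/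
theorem exists_eventTimes (U m : ℝ → ℝ) (gamma : ℝ → ℝ → ℝ) {h : ℝ} (hh : 0 < h) :
    ∃ tk, EventTimes U m gamma h tk ∧
      ZeroOrderHold U tk (stepSignal h (holdSeq U m gamma h)) := by
  set tk : ℕ → ℝ≥0∞ := fun k => Nat.rec (motive := fun _ => ℝ≥0∞) 0 (fun _ T =>
    sInf {s : ℝ≥0∞ | ∃ n : ℕ, s = ENNReal.ofReal (n * h) ∧ T < s ∧
      0 < gamma (U T.toReal - U (n * h)) (m (n * h))}) k
  have E : EventTimes U m gamma h tk := ⟨rfl, fun _ => rfl⟩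
  refine ⟨tk, E, fun k t ht h1 h2 => ?_⟩
  have hm := mem_step hh ht
  rw [stepSignal_eq hh _ hm]
  obtain ⟨k', j, hk, hj, hn, hc⟩ := E.exists_index hh ⌊t / h⌋₊
  have g1 : tk k' ≤ ENNReal.ofReal t := by
    rw [hk]
    exact (ofReal_mul_le hh hj).trans (ENNReal.ofReal_le_ofReal hm.1)
  have g2 : ENNReal.ofReal t < tk (k' + 1) :=
    lt_of_lt_of_le ((ENNReal.ofReal_lt_ofReal_iff (by positivity)).2 hm.2) hn
  have e : k = k' := by
    rcases lt_trichotomy k k' with hlt | rfl | hlt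
    · exact absurd ((E.monotone hlt).trans g1) (not_le.2 h2)
    · rfl
    · exact absurd ((E.monotone hlt).trans h1) (not_le.2 g2)
  rw [hc, e, hk, ENNReal.toReal_ofReal (by positivity)]

/-- Entry n of an iterate depends only on earlier entries of the previous one, so it no longer
changes from the (n + 1)-st iterate on. The sequence of stabilised entries is the fixed point. -/
lemma exists_fixedPoint_of_causal {α : Type*} [Inhabited α] {F : (ℕ → α) → ℕ → α}
    (hF : ∀ c c' n, (∀ i < n, c i = c' i) → F c n = F c' n) : ∃ c, F c = c := by
  have key : ∀ n k k', n < k → n < k' → F^[k] default n = F^[k'] default n := by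
    intro n
    induction n using Nat.strong_induction_on with
    | _ n ih =>
      intro k k' hk hk'
      obtain ⟨k, rfl⟩ := Nat.exists_eq_add_of_lt hk
      obtain ⟨k', rfl⟩ := Nat.exists_eq_add_of_lt hk'
      rw [Function.iterate_succ_apply', Function.iterate_succ_apply']
      exact hF _ _ n fun i hi => ih i hi _ _ (by omega) (by omega)
  refine ⟨fun n => F^[n + 1] default n, funext fun n => ?_⟩
  rw [Function.iterate_succ_apply']
  exact hF _ _ n fun i hi => key i _ _ (by omega) (by omega)

/-! ### The dynamic variable -/

/-- The source of the dynamic variable. -/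
def dynSource (S : Plant) (K L P : Kernels) (G : Design) (z : Trajectory S.ℓ) (b : Traces)
    (inp : ℝ → ℝ) (s : ℝ) : ℝ :=
  G.thetam S * (inp s - feedback S K z s) ^ 2 - G.kappa (eps0 S L) * hatNormSq K z s
    - G.kappa (eps1 S L) * alphaHatL K z b s ^ 2 - G.kappa (eps2 S K L P) * betaTilde0 b s ^ 2

lemma PlantObserver.intervalIntegrable_dynSource {S : Plant} (hS : S.Admissible) {K L P : Kernels}
    {G : Design} {inp : ℝ → ℝ} {z : Trajectory S.ℓ} {b : Traces} (hK : IsControlKernel S K)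
    (h : PlantObserver S P inp z b) {t t' : ℝ} (ht : 0 ≤ t) (ht' : t ≤ t') :
    IntervalIntegrable (dynSource S K L P G z b inp) volume t t' := by
  have hU := ContinuousOn.l2loc (continuousOn_feedback hK.cont h)
  have hN : IntervalIntegrable (hatNormSq K z) volume t t' := by
    refine ((continuousOn_hatNormSq hS hK h).mono ?_).intervalIntegrable
    rw [uIcc_of_le ht']; exact fun x hx => ht.trans hx.1
  exact ((((h.l2loc_inp.sub hU).intervalIntegrable_sq ht ht').const_mul _).sub
    (hN.const_mul _) |>.sub (((l2loc_alphaHatL hK.cont h).intervalIntegrable_sq ht ht').const_mul _)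
    |>.sub (((l2loc_betaTilde0 h).intervalIntegrable_sq ht ht').const_mul _))

lemma dynamicVariable_iff {S : Plant} {K L P : Kernels} {G : Design} {m₀ : ℝ} {z : Trajectory S.ℓ}
    {b : Traces} {inp m : ℝ → ℝ} : DynamicVariable S K L P G m₀ z b inp m ↔
    ContinuousOn m (Ici 0) ∧ ∀ t, 0 ≤ t → m t = m₀ + ∫ s in (0 : ℝ)..t,
      (-G.eta * m s + dynSource S K L P G z b inp s) := by
  have e : ∀ s, -G.eta * m s + G.thetam S * (inp s - feedback S K z s) ^ 2
      - G.kappa (eps0 S L) * hatNormSq K z s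
      - G.kappa (eps1 S L) * alphaHatL K z b s ^ 2
      - G.kappa (eps2 S K L P) * betaTilde0 b s ^ 2 =
      -G.eta * m s + dynSource S K L P G z b inp s := fun s => by unfold dynSource; ring
  constructor
  · intro h
    exact ⟨h.cont, fun t ht => by rw [h.eq t ht]; simp only [e]⟩
  · rintro ⟨h1, h2⟩
    exact ⟨h1, fun t ht => by rw [h2 t ht]; simp only [e]⟩

/-- Variation of constants. The source is only integrable, so the product rule takes the form of
integration by parts for primitives. -/
lemma exists_linear_ode {η m₀ : ℝ} {g : ℝ → ℝ}
    (hg : ∀ t, 0 ≤ t → IntervalIntegrable g volume 0 t) :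
    ∃ m : ℝ → ℝ, ContinuousOn m (Ici 0) ∧
      ∀ t, 0 ≤ t → m t = m₀ + ∫ s in (0 : ℝ)..t, (-η * m s + g s) := by
  have hexp : Continuous fun s => Real.exp (η * s) := by fun_prop
  set H : ℝ → ℝ := fun t => m₀ + ∫ s in (0 : ℝ)..t, Real.exp (η * s) * g s with hH
  have hi : ∀ t, 0 ≤ t → IntervalIntegrable (fun s => Real.exp (η * s) * g s) volume 0 t :=
    fun t ht => (hg t ht).continuousOn_mul hexp.continuousOn
  have H0 : H 0 = m₀ := by simp [hH]
  have eH : ∀ t, H t = H 0 + ∫ s in (0 : ℝ)..t, Real.exp (η * s) * g s := fun t => by rw [H0]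
  have hc : ContinuousOn H (Ici 0) := by
    intro t ht
    have h1 := continuousOn_prim (b := t + 1) (by linarith [mem_Ici.1 ht] : (0 : ℝ) ≤ t + 1)
      (hi _ (by linarith [mem_Ici.1 ht])) (F := H) fun x _ => eH x
    have h2 := h1 t ⟨ht, by linarith⟩
    refine h2.mono_of_mem_nhdsWithin ?_
    filter_upwards [self_mem_nhdsWithin, mem_nhdsWithin_of_mem_nhds (Iio_mem_nhds (lt_add_one t))]
      with x h1 h2 using ⟨h1, (mem_Iio.1 h2).le⟩
  refine ⟨fun t => Real.exp (-η * t) * H t, ContinuousOn.mul (by fun_prop) hc, fun t ht => ?_⟩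
  have hd : ∀ x : ℝ, HasDerivAt (fun s => Real.exp (-η * s)) (-η * Real.exp (-η * x)) x := fun x => by
    have := ((hasDerivAt_id x).const_mul (-η)).exp
    simpa [mul_comm] using this
  have hcd : Continuous fun s => -η * Real.exp (-η * s) := by fun_prop
  have e := integral_prim_mul ht (hcd.intervalIntegrable 0 t) (hi t ht)
    (F := fun s => Real.exp (-η * s)) (G := H)
    (fun x _ => by
      rw [intervalIntegral.integral_eq_sub_of_hasDerivAt (fun y _ => hd y)
        (hcd.intervalIntegrable 0 x)]; ring)
    (fun x _ => eH x)
  rw [H0, mul_zero, Real.exp_zero, one_mul] at e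
  refine (sub_eq_iff_eq_add'.1 e.symm).trans ?_
  congr 1
  refine intervalIntegral.integral_congr fun s _ => ?_
  have : Real.exp (-η * s) * Real.exp (η * s) = 1 := by rw [← Real.exp_add]; simp
  linear_combination (g s) * this

lemma linear_ode_unique {η m₀ T : ℝ} (hη : 0 ≤ η) {g g' m m' : ℝ → ℝ}
    (hg : ∀ t, 0 ≤ t → IntervalIntegrable g volume 0 t)
    (hg' : ∀ t, 0 ≤ t → IntervalIntegrable g' volume 0 t)
    (hgg : ∀ᵐ s, s ∈ Ioo 0 T → g s = g' s)
    (hc : ContinuousOn m (Ici 0)) (hc' : ContinuousOn m' (Ici 0))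
    (h : ∀ t, 0 ≤ t → m t = m₀ + ∫ s in (0 : ℝ)..t, (-η * m s + g s))
    (h' : ∀ t, 0 ≤ t → m' t = m₀ + ∫ s in (0 : ℝ)..t, (-η * m' s + g' s)) :
    ∀ t ∈ Icc 0 T, m t = m' t := by
  intro t ht
  have hi : ∀ {f : ℝ → ℝ}, ContinuousOn f (Ici 0) → ∀ r, 0 ≤ r → IntervalIntegrable f volume 0 r :=
    fun hf r hr => by
      refine (hf.mono ?_).intervalIntegrable
      rw [uIcc_of_le hr]; exact fun x hx => hx.1
  have key := le_mul_exp_of_le_add_integral (T := T) (y := fun s => |m s - m' s|) (a := 0) (K := η)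
    ((hc.sub hc').abs.mono fun x hx => hx.1) hη (fun r hr => ?_) t ht
  · have h0 : |m t - m' t| ≤ 0 := by simpa using key
    exact sub_eq_zero.1 (abs_nonpos_iff.1 h0)
  · have e : m r - m' r = ∫ s in (0 : ℝ)..r, -η * (m s - m' s) := by
      rw [h r hr.1, h' r hr.1, add_sub_add_left_eq_sub, ← intervalIntegral.integral_sub
        (((hi hc r hr.1).const_mul _).add (hg r hr.1))
        (((hi hc' r hr.1).const_mul _).add (hg' r hr.1))]
      refine intervalIntegral.integral_congr_ae ?_
      filter_upwards [hgg, Measure.ae_ne volume r] with s h1 h2 hs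
      rw [uIoc_of_le hr.1] at hs
      rw [h1 ⟨hs.1, (lt_of_le_of_ne hs.2 h2).trans_le hr.2⟩]
      ring
    rw [zero_add, e, ← intervalIntegral.integral_const_mul]
    refine (intervalIntegral.abs_integral_le_integral_abs hr.1).trans (le_of_eq ?_)
    refine intervalIntegral.integral_congr fun s _ => ?_
    simp only [abs_mul, abs_neg, abs_of_nonneg hη]

/-! ### Uniqueness and causality -/

lemma ae_eq_zero_of_integral_sq {f : ℝ → ℝ} (hf : L2loc f) {T : ℝ} (hT : 0 ≤ T)
    (h : ∫ s in (0 : ℝ)..T, f s ^ 2 ≤ 0) : ∀ᵐ s, s ∈ Ioo 0 T → f s = 0 := by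
  rw [intervalIntegral.integral_of_le hT, integral_Ioc_eq_integral_Ioo] at h
  have h0 := le_antisymm h (integral_nonneg fun _ => sq_nonneg _)
  have := (integral_eq_zero_iff_of_nonneg (fun _ => sq_nonneg _) (hf T).integrable_sq).1 h0
  filter_upwards [(ae_restrict_iff' measurableSet_Ioo).1 this] with s hs hm
  have := hs hm
  simpa using this

/-- The solution up to time `T` is determined by the initial data and the input up to time `T`. -/
theorem PlantObserver.causal {S : Plant} (hS : S.Admissible) (hrefl : |S.rho * S.q| ≤ 1 / 2)
    {K L P : Kernels} (hK : IsControlKernel S K) (hL : IsInverseKernel S L)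
    (hP : IsObserverKernel S P) {inp inp' : ℝ → ℝ} {z z' : Trajectory S.ℓ} {b b' : Traces}
    (h : PlantObserver S P inp z b) (h' : PlantObserver S P inp' z' b')
    (h0 : z.plant 0 = z'.plant 0 ∧ z.obs 0 = z'.obs 0) {T : ℝ} (hT : 0 ≤ T)
    (hi : ∀ s ∈ Ioo 0 T, inp s = inp' s) :
    (∀ t ∈ Icc 0 T, z.plant t = z'.plant t ∧ z.obs t = z'.obs t) ∧
    ∀ᵐ s, s ∈ Ioo 0 T → betaTilde0 b s = betaTilde0 b' s ∧
      alphaHatL K z b s = alphaHatL K z' b' s := by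
  obtain ⟨C, hC, H⟩ := exists_growth hS hrefl hK hL hP hT
  -- By linearity the difference of the two solutions has zero data and an input vanishing on (0,
  -- T), and the growth bound then makes it zero.
  have hd := h.sub hS hP.cont h'
  set zd : Trajectory S.ℓ := ⟨fun t => z.u t - z'.u t, fun t => z.v t - z'.v t,
    fun t => z.uh t - z'.uh t, fun t => z.vh t - z'.vh t⟩ with hzd
  have r1 := (kernels_continuous_row (S := S) hK.cont).1
  have r2 := (kernels_continuous_row (S := S) hK.cont).2.1
  have ep : ∀ t, zd.plant t = z.plant t - z'.plant t := fun t => by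
    funext i; fin_cases i <;> rfl
  have eo : ∀ t, zd.obs t = z.obs t - z'.obs t := fun t => by
    funext i; fin_cases i <;> rfl
  have hn0 : zd.norm 0 ^ 2 = 0 := by
    rw [Trajectory.norm_sq, ep, eo, h0.1, h0.2]; simp [nsq]
  have hI : ∀ t ∈ Icc 0 T, ∫ s in (0 : ℝ)..t, (inp s - inp' s) ^ 2 = 0 := fun t ht => by
    refine intervalIntegral.integral_zero_ae ?_
    filter_upwards [Measure.ae_ne volume t] with s h2 hs
    rw [uIoc_of_le ht.1] at hs
    rw [hi s ⟨hs.1, (lt_of_le_of_ne hs.2 h2).trans_le ht.2⟩]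
    ring
  refine ⟨fun t ht => ?_, ?_⟩
  · have := (H _ _ _ hd t ht).1
    rw [hn0, hI t ht, Trajectory.norm_sq, ep, eo] at this
    have n1 := nsq_nonneg (z.plant t - z'.plant t)
    have n2 := nsq_nonneg (z.obs t - z'.obs t)
    have hz : ∀ w : Fin 2 → L2 S.ℓ, nsq w = 0 → w = 0 := by
      intro w hw
      unfold nsq at hw
      have a := sq_nonneg ‖w 0‖
      have b := sq_nonneg ‖w 1‖
      funext i
      fin_cases i
      · exact norm_eq_zero.1 (pow_eq_zero_iff two_ne_zero |>.1 (by linarith : ‖w 0‖ ^ 2 = 0))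
      · exact norm_eq_zero.1 (pow_eq_zero_iff two_ne_zero |>.1 (by linarith : ‖w 1‖ ^ 2 = 0))
    exact ⟨sub_eq_zero.1 (hz _ (by linarith)), sub_eq_zero.1 (hz _ (by linarith))⟩
  · have hh := H _ _ _ hd T ⟨hT, le_rfl⟩
    rw [hn0, hI T ⟨hT, le_rfl⟩, add_zero, mul_zero] at hh
    filter_upwards [ae_eq_zero_of_integral_sq (l2loc_betaTilde0 hd) hT hh.2.1,
      ae_eq_zero_of_integral_sq (l2loc_alphaHatL hK.cont hd) hT hh.2.2] with s h1 h2 hs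
    constructor
    · have := h1 hs
      unfold betaTilde0 at this ⊢
      linarith
    · have := h2 hs
      rw [alphaHatL_eq, eo, Pi.sub_apply, Pi.sub_apply, pair_sub_left _ _ r1,
        pair_sub_left _ _ r2] at this
      rw [alphaHatL_eq, alphaHatL_eq]
      linarith

/-- Causality of the outputs used by the event-triggering mechanism. -/
theorem PlantObserver.causal_outputs {S : Plant} (hS : S.Admissible)
    (hrefl : |S.rho * S.q| ≤ 1 / 2) {K L P : Kernels} (hK : IsControlKernel S K)
    (hL : IsInverseKernel S L) (hP : IsObserverKernel S P) {G : Design} (hG : 0 ≤ G.eta)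
    {inp inp' : ℝ → ℝ} {z z' : Trajectory S.ℓ} {b b' : Traces}
    (h : PlantObserver S P inp z b) (h' : PlantObserver S P inp' z' b')
    (h0 : z.plant 0 = z'.plant 0 ∧ z.obs 0 = z'.obs 0) {m₀ : ℝ} {m m' : ℝ → ℝ}
    (hm : DynamicVariable S K L P G m₀ z b inp m) (hm' : DynamicVariable S K L P G m₀ z' b' inp' m')
    {T : ℝ} (hT : 0 ≤ T) (hi : ∀ s ∈ Ioo 0 T, inp s = inp' s) :
    ∀ t ∈ Icc 0 T, feedback S K z t = feedback S K z' t ∧ m t = m' t := by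
  obtain ⟨c1, c2⟩ := h.causal hS hrefl hK hL hP h' h0 hT hi
  have hf : ∀ t ∈ Icc 0 T, feedback S K z t = feedback S K z' t := fun t ht => by
    rw [feedback_eq, feedback_eq, (c1 t ht).2]
  obtain ⟨k1, k2⟩ := dynamicVariable_iff.1 hm
  obtain ⟨k1', k2'⟩ := dynamicVariable_iff.1 hm'
  refine fun t ht => ⟨hf t ht, linear_ode_unique hG
    (fun t ht => h.intervalIntegrable_dynSource hS hK le_rfl ht)
    (fun t ht => h'.intervalIntegrable_dynSource hS hK le_rfl ht) ?_ k1 k1' k2 k2' t ht⟩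
  filter_upwards [c2] with s hs hsm
  unfold dynSource
  rw [(hs hsm).1, (hs hsm).2, hi s hsm, hf s (Ioo_subset_Icc_self hsm), hatNormSq_eq hS hK,
    hatNormSq_eq hS hK, (c1 s (Ioo_subset_Icc_self hsm)).2]

/-! ### Existence of solutions for a given input -/

/-- Method of steps: `hstep` prolongs a signal by the fixed length T₀ without changing its past, and
causality preserves the equation already satisfied there. -/
lemma exists_causal_fixedPoint {R : (ℝ → ℝ) → ℝ → ℝ} {T₀ : ℝ} (hT : 0 < T₀)
    (hcausal : ∀ i i' t, (∀ s ≤ t, i s = i' s) → R i t = R i' t)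
    (hstep : ∀ a, 0 ≤ a → ∀ i, L2loc i → ∃ i', L2loc i' ∧ (∀ s ≤ a, i' s = i s) ∧
      ∀ᵐ s, s ∈ Ioo a (a + T₀) → i' s = R i' s) :
    ∃ i, L2loc i ∧ ∀ᵐ t ∂(volume.restrict (Ioi (0 : ℝ))), i t = R i t := by
  choose! F hF using hstep
  set q : ℕ → ℝ → ℝ := fun k => Nat.rec (motive := fun _ => ℝ → ℝ) (fun _ => 0)
    (fun k i => F (k * T₀) i) k with hq
  have q1 : ∀ k, q (k + 1) = F (k * T₀) (q k) := fun k => rfl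
  have k0 : ∀ k : ℕ, 0 ≤ k * T₀ := fun k => by positivity
  have qL : ∀ k, L2loc (q k) := by
    intro k
    induction k with
    | zero => exact L2loc.zero
    | succ k ih => rw [q1]; exact (hF _ (k0 k) _ ih).1
  have agree : ∀ k n : ℕ, ∀ s ≤ k * T₀, q (k + n) s = q k s := by
    intro k n
    induction n with
    | zero => exact fun s _ => rfl
    | succ n ih =>
      intro s hs
      rw [← add_assoc, q1, (hF _ (k0 _) _ (qL _)).2.1 s, ih s hs]
      refine hs.trans (mul_le_mul_of_nonneg_right ?_ hT.le)
      push_cast; linarith [(Nat.cast_nonneg n : (0 : ℝ) ≤ n)]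
  have agree' : ∀ k n : ℕ, ∀ s, s ≤ k * T₀ → s ≤ n * T₀ → q k s = q n s := by
    intro k n s h1 h2
    rcases le_total k n with h | h
    · obtain ⟨d, rfl⟩ := Nat.exists_eq_add_of_le h
      exact (agree k d s h1).symm
    · obtain ⟨d, rfl⟩ := Nat.exists_eq_add_of_le h
      exact agree n d s h2
  -- The index ⌊t/T₀⌋ + 1 is chosen so that t lies before its end point, where the value is final.
  set i : ℝ → ℝ := fun t => q (⌊t / T₀⌋₊ + 1) t with hi
  have ei : ∀ (k : ℕ) s, s ≤ k * T₀ → i s = q k s := fun k s hs => by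
    refine agree' (⌊s / T₀⌋₊ + 1) k s ?_ hs
    have := Nat.lt_floor_add_one (s / T₀)
    push_cast
    exact ((div_lt_iff₀ hT).1 this).le
  refine ⟨i, fun T => ?_, ?_⟩
  · obtain ⟨k, hk⟩ := exists_nat_gt (T / T₀)
    refine (qL k T).ae_eq ?_
    filter_upwards [ae_restrict_mem measurableSet_Ioo] with s hs
    exact (ei k s (hs.2.le.trans ((div_lt_iff₀ hT).1 hk).le)).symm
  · rw [ae_restrict_iff' measurableSet_Ioi]
    have h1 : ∀ᵐ s : ℝ, ∀ k : ℕ, s ≠ k * T₀ := ae_all_iff.2 fun k => Measure.ae_ne volume _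
    have h2 : ∀ᵐ s, ∀ k : ℕ, s ∈ Ioo (k * T₀) (k * T₀ + T₀) → q (k + 1) s = R (q (k + 1)) s :=
      ae_all_iff.2 fun k => (hF _ (k0 k) _ (qL k)).2.2
    filter_upwards [h1, h2] with t h1 h2 ht
    have hm := mem_step hT (le_of_lt ht)
    set k := ⌊t / T₀⌋₊
    have e : ((k + 1 : ℕ) : ℝ) * T₀ = k * T₀ + T₀ := by push_cast; ring
    have h3 := h2 k ⟨lt_of_le_of_ne hm.1 (h1 k).symm, by rw [← e]; exact hm.2⟩
    rw [ei (k + 1) t hm.2.le, h3]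
    exact hcausal _ _ t fun s hs => (ei (k + 1) s (hs.trans hm.2.le)).symm

/-- Neumann series. -/
lemma exists_add_eq_of_norm_lt_one {E : Type*} [NormedAddCommGroup E] [NormedSpace ℝ E]
    [CompleteSpace E] (V : E →L[ℝ] E) (hV : ‖V‖ < 1) (f : E) : ∃ b, b + V b = f := by
  have hV' : ‖-V‖ < 1 := by rwa [norm_neg]
  set u := Units.oneSub (-V) hV' with hu
  refine ⟨(↑u⁻¹ : E →L[ℝ] E) f, ?_⟩
  have h : (u : E →L[ℝ] E) * (↑u⁻¹ : E →L[ℝ] E) = 1 := u.mul_inv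
  have h2 : (u : E →L[ℝ] E) = 1 + V := by rw [hu, Units.val_oneSub, sub_neg_eq_add]
  have h3 := congrArg (fun W : E →L[ℝ] E => W f) h
  rw [h2] at h3
  simpa using h3

lemma locSq_indicator {ℓ : ℝ} (w : L2 ℓ) : LocSq ((Ioo 0 ℓ).indicator w) := by
  have hG : ∀ {f : ℝ → ℝ}, IntegrableOn f (Ioo 0 ℓ) → LocInt ((Ioo 0 ℓ).indicator f) :=
    fun hf a b => (hf.integrable_indicator measurableSet_Ioo).intervalIntegrable
  refine ⟨hG (L2.integrable w), fun a b => (hG (f := fun x => w x ^ 2)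
    (Lp.memLp w).integrable_sq a b).congr fun s _ => ?_⟩
  by_cases hx : s ∈ Ioo 0 ℓ
  · simp only [indicator_of_mem hx]
  · simp only [indicator_of_notMem hx]; norm_num

lemma hist_add {ℓ c x₀ : ℝ} (w₀ : L2 ℓ) {i i' g : ℝ → ℝ} (hg : ∀ s ≤ 0, g s = 0)
    (h : ∀ s, i' s = i s + g s) (s : ℝ) : hist c x₀ w₀ i' s = hist c x₀ w₀ i s + g s := by
  unfold hist
  split_ifs with hs
  · exact h s
  · rw [hg s (not_lt.1 hs), add_zero]

lemma hist_congr {ℓ c x₀ : ℝ} (w₀ : L2 ℓ) {i i' : ℝ → ℝ} {s : ℝ} (h : i s = i' s) :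
    hist c x₀ w₀ i s = hist c x₀ w₀ i' s := by
  unfold hist
  rw [h]

/-! ### The boundary equation at x = ℓ. -/

/-- The signal entering at `x = 0` when `i` enters at `x = ℓ`. -/
def reflected (S : Plant) (γ₀ : Fin 2 → L2 S.ℓ) (i : ℝ → ℝ) : ℝ → ℝ :=
  hist S.lam1 0 (γ₀ 0) fun s => S.q * hist (-S.lam2) S.ℓ (γ₀ 1) i (s - S.ℓ / S.lam2)

lemma l2loc_reflected_inflow {S : Plant} (hS : S.Admissible) (γ₀ : Fin 2 → L2 S.ℓ) {i : ℝ → ℝ}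
    (hi : L2loc i) :
    L2loc fun s => S.q * hist (-S.lam2) S.ℓ (γ₀ 1) i (s - S.ℓ / S.lam2) :=
  ((locSq_hist hS.inflow_right.ne (γ₀ 1) hi).comp_sub_right _).l2loc.const_mul _

lemma locSq_reflected {S : Plant} (hS : S.Admissible) (γ₀ : Fin 2 → L2 S.ℓ) {i : ℝ → ℝ}
    (hi : L2loc i) : LocSq (reflected S γ₀ i) :=
  locSq_hist hS.inflow_left.ne _ (l2loc_reflected_inflow hS γ₀ hi)

/-- The value at `x = ℓ` prescribed by the boundary condition when `i` has entered so far. -/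
def rightInflow (S : Plant) (Na Nb : ℝ → ℝ) (inp : ℝ → ℝ) (γ₀ : Fin 2 → L2 S.ℓ) (i : ℝ → ℝ)
    (t : ℝ) : ℝ :=
  inp t + S.rho * reflected S γ₀ i (t - S.ℓ / S.lam1) -
    ((S.lam1 * ∫ σ in (0 : ℝ)..(S.ℓ / S.lam1), Na (S.lam1 * σ) * reflected S γ₀ i (t - σ)) +
      S.lam2 * ∫ σ in (0 : ℝ)..(S.ℓ / S.lam2),
        Nb (S.ℓ - S.lam2 * σ) * hist (-S.lam2) S.ℓ (γ₀ 1) i (t - σ))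

lemma pair_prof_left {S : Plant} (hS : S.Admissible) {A : ℝ → ℝ} (hA : LocSq A) (t : ℝ)
    (f : ℝ → ℝ) : pair (prof S.ℓ S.lam1 0 A t) f =
      S.lam1 * ∫ σ in (0 : ℝ)..(S.ℓ / S.lam1), f (S.lam1 * σ) * A (t - σ) := by
  have := integral_prof_mul hA hS.inflow_left hS.ℓ_pos.le t f
  rw [abs_of_pos hS.lam1_pos] at this
  simp only [zero_add] at this
  exact this

lemma pair_prof_right {S : Plant} (hS : S.Admissible) {B : ℝ → ℝ} (hB : LocSq B) (t : ℝ)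
    (f : ℝ → ℝ) : pair (prof S.ℓ (-S.lam2) S.ℓ B t) f =
      S.lam2 * ∫ σ in (0 : ℝ)..(S.ℓ / S.lam2), f (S.ℓ - S.lam2 * σ) * B (t - σ) := by
  have := integral_prof_mul hB hS.inflow_right hS.ℓ_pos.le t f
  rw [abs_neg, abs_of_pos hS.lam2_pos] at this
  simp only [neg_mul, ← sub_eq_add_neg] at this
  exact this

lemma rightInflow_eq_pair {S : Plant} (hS : S.Admissible) (Na Nb inp : ℝ → ℝ)
    (γ₀ : Fin 2 → L2 S.ℓ) {i : ℝ → ℝ} (hi : L2loc i) (t : ℝ) :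
    rightInflow S Na Nb inp γ₀ i t = inp t + S.rho * reflected S γ₀ i (t - S.ℓ / S.lam1) -
      (pair (prof S.ℓ S.lam1 0 (reflected S γ₀ i) t) Na +
        pair (prof S.ℓ (-S.lam2) S.ℓ (hist (-S.lam2) S.ℓ (γ₀ 1) i) t) Nb) := by
  rw [pair_prof_left hS (locSq_reflected hS γ₀ hi),
    pair_prof_right hS (locSq_hist hS.inflow_right.ne _ hi), rightInflow]

lemma l2loc_rightInflow {S : Plant} (hS : S.Admissible) {Na Nb inp : ℝ → ℝ}
    (hNa : ContinuousOn Na (Icc 0 S.ℓ)) (hNb : ContinuousOn Nb (Icc 0 S.ℓ)) (hinp : L2loc inp)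
    (γ₀ : Fin 2 → L2 S.ℓ) {i : ℝ → ℝ} (hi : L2loc i) :
    L2loc (rightInflow S Na Nb inp γ₀ i) := by
  rw [funext (rightInflow_eq_pair hS Na Nb inp γ₀ hi)]
  refine (hinp.add (((locSq_reflected hS γ₀ hi).comp_sub_right _).l2loc.const_mul _)).sub
    (ContinuousOn.l2loc ?_)
  exact (continuousOn_pair (continuous_prof (locSq_reflected hS γ₀ hi) hS.inflow_left
    hS.ℓ_pos.le).continuousOn hNa).add (continuousOn_pair (continuous_prof
    (locSq_hist hS.inflow_right.ne _ hi) hS.inflow_right hS.ℓ_pos.le).continuousOn hNb)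

lemma rightInflow_causal {S : Plant} (hS : S.Admissible) (Na Nb inp : ℝ → ℝ)
    (γ₀ : Fin 2 → L2 S.ℓ) {i i' : ℝ → ℝ} {t : ℝ} (h : ∀ s ≤ t, i s = i' s) :
    rightInflow S Na Nb inp γ₀ i t = rightInflow S Na Nb inp γ₀ i' t := by
  have τ1 : 0 < S.ℓ / S.lam1 := div_pos hS.ℓ_pos hS.lam1_pos
  have τ2 : 0 < S.ℓ / S.lam2 := div_pos hS.ℓ_pos hS.lam2_pos
  have hr : ∀ s ≤ t, reflected S γ₀ i s = reflected S γ₀ i' s := fun s hs =>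
    hist_congr _ (by rw [hist_congr _ (h (s - S.ℓ / S.lam2) (by linarith))])
  unfold rightInflow
  rw [hr _ (by linarith)]
  congr 2
  · congr 1
    refine intervalIntegral.integral_congr fun σ hσ => ?_
    rw [uIcc_of_le τ1.le] at hσ
    simp only [hr (t - σ) (by linarith [hσ.1])]
  · congr 1
    refine intervalIntegral.integral_congr fun σ hσ => ?_
    rw [uIcc_of_le τ2.le] at hσ
    simp only [hist_congr (ℓ := S.ℓ) (c := -S.lam2) (x₀ := S.ℓ) (γ₀ 1)
      (h (t - σ) (by linarith [hσ.1]))]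

/-- A correction that starts at time 0 has filled only the first r of the window, so the delay
integral becomes a Volterra integral. -/
lemma integral_causal_shift {f g : ℝ → ℝ} {τ r : ℝ} (hr : r ∈ Icc 0 τ)
    (hi : IntervalIntegrable (fun σ => f σ * g (r - σ)) volume 0 τ) (hg : ∀ s ≤ 0, g s = 0) :
    ∫ σ in (0 : ℝ)..τ, f σ * g (r - σ) = ∫ s in (0 : ℝ)..r, f (r - s) * g s := by
  have h1 := intervalIntegral.integral_comp_sub_left (a := 0) (b := r)
    (fun s => f (r - s) * g s) r
  simp only [sub_sub_cancel, sub_self, sub_zero] at h1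
  rw [← h1, ← intervalIntegral.integral_add_adjacent_intervals (b := r)
    (hi.mono_set (by rw [uIcc_of_le hr.1, uIcc_of_le (hr.1.trans hr.2)]
                     exact Icc_subset_Icc_right hr.2))
    (hi.mono_set (by rw [uIcc_of_le hr.2, uIcc_of_le (hr.1.trans hr.2)]
                     exact Icc_subset_Icc_left hr.1))]
  have h2 : ∫ σ in r..τ, f σ * g (r - σ) = 0 := by
    refine intervalIntegral.integral_zero_ae (Filter.Eventually.of_forall fun σ hσ => ?_)
    rw [uIoc_of_le hr.2] at hσ
    rw [hg _ (by linarith [hσ.1]), mul_zero]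
  rw [h2, add_zero]

/-- Existence of the signal entering at `x = ℓ`. -/
theorem exists_rightInflow {S : Plant} (hS : S.Admissible) {Na Nb inp : ℝ → ℝ}
    (hNa : ContinuousOn Na (Icc 0 S.ℓ)) (hNb : ContinuousOn Nb (Icc 0 S.ℓ)) (hinp : L2loc inp)
    (γ₀ : Fin 2 → L2 S.ℓ) :
    ∃ i, L2loc i ∧
      ∀ᵐ t ∂(volume.restrict (Ioi (0 : ℝ))), i t = rightInflow S Na Nb inp γ₀ i t := by
  have hℓ := hS.ℓ_pos
  have h1 := hS.lam1_pos
  have h2 := hS.lam2_pos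
  have τ1 : 0 < S.ℓ / S.lam1 := div_pos hℓ h1
  have τ2 : 0 < S.ℓ / S.lam2 := div_pos hℓ h2
  obtain ⟨M, hM⟩ := (isCompact_Icc (a := (0 : ℝ)) (b := S.ℓ)).exists_bound_of_continuousOn hNb
  have hM0 : 0 ≤ M := (norm_nonneg _).trans (hM 0 ⟨le_rfl, hℓ.le⟩)
  -- Within a crossing time ℓ/λ₂ a change of the inflow at ℓ has not yet come back from x = 0. The
  -- second bound makes the norm of the remaining Volterra operator, at most λ₂ M T₀, smaller than
  -- 1.
  set T₀ : ℝ := min (S.ℓ / S.lam2) (1 / (S.lam2 * M + 1)) with hT₀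
  have pM : 0 < S.lam2 * M + 1 := by positivity
  have hT : 0 < T₀ := lt_min τ2 (by positivity)
  have hT2 : T₀ ≤ S.ℓ / S.lam2 := min_le_left _ _
  set k : ℝ → ℝ → ℝ := fun r s => S.lam2 * Nb (S.ℓ - S.lam2 * (r - s)) with hk
  have kmem : ∀ p ∈ triangle T₀, S.ℓ - S.lam2 * (p.1 - p.2) ∈ Icc 0 S.ℓ := by
    rintro p ⟨a1, a2, a3⟩
    have h3 : S.lam2 * (p.1 - p.2) ≤ S.lam2 * (S.ℓ / S.lam2) :=
      mul_le_mul_of_nonneg_left (by linarith) h2.le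
    rw [mul_div_cancel₀ _ h2.ne'] at h3
    have h4 : 0 ≤ S.lam2 * (p.1 - p.2) := mul_nonneg h2.le (by linarith)
    exact ⟨by linarith, by linarith⟩
  have kc : ContinuousOn (Function.uncurry k) (triangle T₀) := by
    refine continuousOn_const.mul (hNb.comp (f := fun p : ℝ × ℝ => S.ℓ - S.lam2 * (p.1 - p.2))
      (by fun_prop) kmem)
  have kn : ‖volterra T₀ k‖ < 1 := by
    refine (norm_volterra_le hT.le kc (M := S.lam2 * M) (by positivity) fun p hp => ?_).trans_lt ?_
    · rw [hk, abs_mul, abs_of_pos h2]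
      exact mul_le_mul_of_nonneg_left (hM _ (kmem p hp)) h2.le
    · have h3 : S.lam2 * M * T₀ ≤ S.lam2 * M * (1 / (S.lam2 * M + 1)) :=
        mul_le_mul_of_nonneg_left (min_le_right _ _) (by positivity)
      refine h3.trans_lt ?_
      rw [mul_one_div, div_lt_one pM]
      linarith
  refine exists_causal_fixedPoint hT (fun i i' t h => rightInflow_causal hS Na Nb inp γ₀ h) ?_
  intro a ha i hi
  -- The known past is continued by zero after a. The prolongation is then sought as j + g with g
  -- supported in (a, a + T₀).
  set j : ℝ → ℝ := (Iic a).indicator i with hj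
  have jL : L2loc j := fun T => (hi T).indicator measurableSet_Iic
  have fL : MemLp (fun r => rightInflow S Na Nb inp γ₀ j (r + a)) 2
      (volume.restrict (Ioo (0 : ℝ) T₀)) := by
    have h3 := l2loc_rightInflow hS hNa hNb hinp γ₀ jL (a + T₀)
    have mp := (measurePreserving_add_right (volume : Measure ℝ) a).restrict_preimage
      (measurableSet_Ioo (a := a) (b := a + T₀))
    have h4 := (h3.mono_measure (Measure.restrict_mono (Ioo_subset_Ioo_left ha) le_rfl)
      ).comp_measurePreserving mp
    have e : (fun x => x + a) ⁻¹' Ioo a (a + T₀) = Ioo 0 T₀ := by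
      ext x; simp only [mem_preimage, mem_Ioo]; constructor <;> rintro ⟨u, v⟩ <;>
        exact ⟨by linarith, by linarith⟩
    rw [e] at h4
    exact h4
  obtain ⟨β, hβ⟩ := exists_add_eq_of_norm_lt_one (volterra T₀ k) kn (fL.toLp _)
  set g : ℝ → ℝ := fun s => (Ioo 0 T₀).indicator β (s - a) with hg
  have gS : LocSq g := (locSq_indicator β).comp_sub_right a
  have g0 : ∀ s ≤ a, g s = 0 := fun s hs =>
    indicator_of_notMem (fun hm => by linarith [hm.1]) _
  set i' : ℝ → ℝ := fun s => j s + g s with hi'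
  have iL : L2loc i' := jL.add gS.l2loc
  refine ⟨i', iL, fun s hs => ?_, ?_⟩
  · rw [hi']
    simp only [g0 s hs, add_zero, hj]
    rw [indicator_of_mem (mem_Iic.2 hs)]
  · have hB : ∀ s, hist (-S.lam2) S.ℓ (γ₀ 1) i' s = hist (-S.lam2) S.ℓ (γ₀ 1) j s + g s :=
      hist_add _ (fun s hs => g0 s (hs.trans ha)) fun s => rfl
    -- The reflected signal is unaffected by the correction on this step, so only the integral
    -- against N^β contributes to the equation for β.
    have hA : ∀ s ≤ a + S.ℓ / S.lam2, reflected S γ₀ i' s = reflected S γ₀ j s := fun s hs =>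
      hist_congr _ (by rw [hB, g0 _ (by linarith), add_zero])
    have key : ∀ r ∈ Ioo 0 T₀, rightInflow S Na Nb inp γ₀ i' (r + a) =
        rightInflow S Na Nb inp γ₀ j (r + a) - ∫ s in (0 : ℝ)..r, k r s * β s := by
      intro r hr
      have e1 : reflected S γ₀ i' (r + a - S.ℓ / S.lam1) =
          reflected S γ₀ j (r + a - S.ℓ / S.lam1) := hA _ (by linarith [hr.2])
      have e2 : ∫ σ in (0 : ℝ)..(S.ℓ / S.lam1), Na (S.lam1 * σ) * reflected S γ₀ i' (r + a - σ) =
          ∫ σ in (0 : ℝ)..(S.ℓ / S.lam1), Na (S.lam1 * σ) * reflected S γ₀ j (r + a - σ) := by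
        refine intervalIntegral.integral_congr fun σ hσ => ?_
        rw [uIcc_of_le τ1.le] at hσ
        simp only [hA (r + a - σ) (by linarith [hσ.1, hr.2])]
      have cb : ContinuousOn (fun σ => Nb (S.ℓ - S.lam2 * σ)) (uIcc 0 (S.ℓ / S.lam2)) := by
        rw [uIcc_of_le τ2.le]
        refine hNb.comp (f := fun σ : ℝ => S.ℓ - S.lam2 * σ) (by fun_prop) fun σ hσ => ?_
        have h3 : S.lam2 * σ ≤ S.lam2 * (S.ℓ / S.lam2) := mul_le_mul_of_nonneg_left hσ.2 h2.le
        rw [mul_div_cancel₀ _ h2.ne'] at h3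
        exact ⟨by linarith, by linarith [mul_nonneg h2.le hσ.1]⟩
      have i1 : IntervalIntegrable (fun σ => Nb (S.ℓ - S.lam2 * σ) *
          hist (-S.lam2) S.ℓ (γ₀ 1) j (r + a - σ)) volume 0 (S.ℓ / S.lam2) :=
        ((locSq_hist hS.inflow_right.ne (γ₀ 1) jL).1.comp_sub_left (r + a) _ _).continuousOn_mul cb
      have i2 : IntervalIntegrable (fun σ => Nb (S.ℓ - S.lam2 * σ) * g (r + a - σ)) volume
          0 (S.ℓ / S.lam2) := (gS.1.comp_sub_left (r + a) _ _).continuousOn_mul cb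
      have e3 : S.lam2 * ∫ σ in (0 : ℝ)..(S.ℓ / S.lam2), Nb (S.ℓ - S.lam2 * σ) * g (r + a - σ) =
          ∫ s in (0 : ℝ)..r, k r s * β s := by
        have e4 : ∀ σ, g (r + a - σ) = (Ioo 0 T₀).indicator β (r - σ) := fun σ => by
          simp only [hg]; congr 1; ring
        simp only [e4] at i2 ⊢
        rw [integral_causal_shift ⟨hr.1.le, hr.2.le.trans hT2⟩ i2
          (fun s hs => indicator_of_notMem (fun hm => by linarith [hm.1]) _),
          ← intervalIntegral.integral_const_mul]
        refine intervalIntegral.integral_congr_ae (Filter.Eventually.of_forall fun s hs => ?_)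
        rw [uIoc_of_le hr.1.le] at hs
        rw [indicator_of_mem (show s ∈ Ioo 0 T₀ from ⟨hs.1, hs.2.trans_lt hr.2⟩)]
        simp only [hk]; ring
      unfold rightInflow
      rw [e1, e2, ← e3]
      simp only [hB, mul_add]
      rw [intervalIntegral.integral_add i1 i2]
      ring
    have h5 : ∀ᵐ r ∂(volume.restrict (Ioo (0 : ℝ) T₀)),
        β r + (∫ s in (0 : ℝ)..r, k r s * β s) = rightInflow S Na Nb inp γ₀ j (r + a) := by
      filter_upwards [Lp.coeFn_add β (volterra T₀ k β), volterra_ae hT.le kc β,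
        MemLp.coeFn_toLp fL] with r a1 a2 a3
      rw [← a3, ← hβ, a1, Pi.add_apply, a2]
    rw [ae_restrict_iff' measurableSet_Ioo] at h5
    filter_upwards [(measurePreserving_sub_right volume a).quasiMeasurePreserving.ae h5] with s hs hm
    have hm' : s - a ∈ Ioo 0 T₀ := ⟨by linarith [hm.1], by linarith [hm.2]⟩
    have h6 := key _ hm'
    have h7 := hs hm'
    rw [sub_add_cancel] at h6 h7
    rw [h6, ← h7, hi']
    simp only [hj, hg]
    rw [indicator_of_notMem (fun hx => by linarith [mem_Iic.1 hx, hm.1]), indicator_of_mem hm']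
    ring

/-! ### Assembling solutions of the plant and the observer. -/

/-- The pair of travelling profiles of `A` (to the right) and `B` (to the left). -/
def profiles (S : Plant) (A B : ℝ → ℝ) (t : ℝ) : Fin 2 → L2 S.ℓ :=
  ![prof S.ℓ S.lam1 0 A t, prof S.ℓ (-S.lam2) S.ℓ B t]

lemma continuousOn_profiles {S : Plant} (hS : S.Admissible) {A B : ℝ → ℝ} (hA : LocSq A)
    (hB : LocSq B) (i : Fin 2) : ContinuousOn (fun t => profiles S A B t i) (Ici 0) :=
  forall_fin_two (p := fun i => ContinuousOn (fun t => profiles S A B t i) (Ici 0))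
    (continuous_prof hA hS.inflow_left hS.ℓ_pos.le).continuousOn
    (continuous_prof hB hS.inflow_right hS.ℓ_pos.le).continuousOn i

/-- The boundary values at `x = 0` of `profiles S A B`. -/
def leftTrace (S : Plant) (A B : ℝ → ℝ) : Fin 2 → ℝ → ℝ := ![A, fun t => B (t - S.ℓ / S.lam2)]

/-- The boundary values at `x = ℓ` of `1 + k` applied to `profiles S A B`. -/
def rightTrace (S : Plant) (k : Fin 2 → Fin 2 → ℝ → ℝ → ℝ) (A B : ℝ → ℝ) (i : Fin 2) (t : ℝ) : ℝ :=
  (![fun t => A (t - S.ℓ / S.lam1), B] : Fin 2 → ℝ → ℝ) i t +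
    ∑ j, pair (profiles S A B t j) (fun ξ => k i j S.ℓ ξ)

lemma l2loc_leftTrace {S : Plant} {A B : ℝ → ℝ} (hA : LocSq A) (hB : LocSq B) :
    ∀ i, L2loc (leftTrace S A B i) :=
  forall_fin_two hA.l2loc (hB.comp_sub_right _).l2loc

lemma l2loc_rightTrace {S : Plant} (hS : S.Admissible) {σ₁ σ₂ : Fin 2 → Fin 2 → ℝ → ℝ}
    {k : Fin 2 → Fin 2 → ℝ → ℝ → ℝ} (hk : KerEq S.ℓ S.spd σ₁ σ₂ k) {A B : ℝ → ℝ} (hA : LocSq A)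
    (hB : LocSq B) (i : Fin 2) : L2loc (rightTrace S k A B i) := by
  have hc : ∀ j, L2loc fun t => pair (profiles S A B t j) (fun ξ => k i j S.ℓ ξ) := fun j =>
    ContinuousOn.l2loc (continuousOn_pair (continuousOn_profiles hS hA hB j)
      (continuousOn_slice_left (hk.continuousOn i j) le_rfl))
  have h1 : ∀ i, L2loc ((![fun t => A (t - S.ℓ / S.lam1), B] : Fin 2 → ℝ → ℝ) i) :=
    forall_fin_two (hA.comp_sub_right _).l2loc hB.l2loc
  unfold rightTrace
  simp only [Fin.sum_univ_two]
  exact (h1 i).add ((hc 0).add (hc 1))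

/-- Travelling profiles are mapped to weak solutions of the coupled equations. -/
theorem weakTransport_onePlus_profiles {S : Plant} (hS : S.Admissible)
    {k : Fin 2 → Fin 2 → ℝ → ℝ → ℝ} (hk : KerEq S.ℓ S.spd 0 S.src k) {A B : ℝ → ℝ} (hA : LocSq A)
    (hB : LocSq B) {r : Fin 2 → ℝ → ℝ → ℝ}
    (hr : ∀ i, ∀ᵐ t ∂(volume.restrict (Ioi (0 : ℝ))), ∀ x ∈ Ioo 0 S.ℓ,
      k i 0 x 0 * (S.lam1 * A t) - k i 1 x 0 * (S.lam2 * B (t - S.ℓ / S.lam2)) = r i t x)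
    (i : Fin 2) :
    WeakTransport (S.spd i) (fun t => onePlus S.ℓ k (profiles S A B t) i)
      (fun t x => ∑ m, S.src i m x * onePlus S.ℓ k (profiles S A B t) m x + r i t x)
      (leftTrace S A B i) (rightTrace S k A B i) := by
  have hw : ∀ i, WeakTransport (S.spd i) (fun t => profiles S A B t i)
      (fun t x => ∑ m, (0 : Fin 2 → Fin 2 → ℝ → ℝ) i m x * profiles S A B t m x +
        (fun _ => (0 : ℝ)) t * (fun _ _ => (0 : ℝ) : Fin 2 → ℝ → ℝ) i x) (leftTrace S A B i)
      ((![fun t => A (t - S.ℓ / S.lam1), B] : Fin 2 → ℝ → ℝ) i) :=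
    forall_fin_two
      ((weakTransport_prof_pos hA hS.lam1_pos hS.ℓ_pos.le).congr_source fun t x => by simp)
      ((weakTransport_prof_neg hB hS.lam2_pos hS.ℓ_pos.le).congr_source fun t x => by simp)
  refine hk.weakTransport hS.ℓ_pos hS.spd_ne (fun _ _ => continuousOn_const) hS.continuousOn_src
    (continuousOn_profiles hS hA hB) (l2loc_leftTrace hA hB)
    (forall_fin_two (hA.comp_sub_right _).l2loc hB.l2loc) L2loc.zero
    (fun _ => continuousOn_const) hw (fun i => ?_) i
  filter_upwards [hr i] with t ht x hx
  rw [← ht x hx]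
  simp only [Fin.sum_univ_two, leftTrace, Plant.spd, Matrix.cons_val_zero, Matrix.cons_val_one,
    Matrix.cons_val_fin_one, zero_mul, add_zero]
  ring

lemma pair_sub_const_mul {ℓ : ℝ} (u : L2 ℓ) {f g : ℝ → ℝ} (hf : ContinuousOn f (Icc 0 ℓ))
    (hg : ContinuousOn g (Icc 0 ℓ)) (c : ℝ) :
    pair u (fun ξ => f ξ - c * g ξ) = pair u f - c * pair u g := by
  have hm : ContinuousOn (fun x => -c * g x) (Icc 0 ℓ) := continuousOn_const.mul hg
  have e : (fun ξ => f ξ - c * g ξ) = fun ξ => f ξ + -c * g ξ := by funext ξ; ring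
  rw [e, pair_add u hf hm, pair_const_mul]; ring

lemma profiles_hist_zero {S : Plant} (hS : S.Admissible) (γ₀ : Fin 2 → L2 S.ℓ) {i i' : ℝ → ℝ}
    (hi : L2loc i) (hi' : L2loc i') :
    profiles S (hist S.lam1 0 (γ₀ 0) i) (hist (-S.lam2) S.ℓ (γ₀ 1) i') 0 = γ₀ := by
  funext j
  fin_cases j
  · exact prof_hist_zero hS.inflow_left hS.ℓ_pos.le _ hi
  · exact prof_hist_zero hS.inflow_right hS.ℓ_pos.le _ hi'

lemma hist_of_pos {ℓ c x₀ : ℝ} (w₀ : L2 ℓ) (i : ℝ → ℝ) :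
    ∀ᵐ t ∂(volume.restrict (Ioi (0 : ℝ))), hist c x₀ w₀ i t = i t := by
  filter_upwards [ae_restrict_mem measurableSet_Ioi] with t ht
  rw [hist, if_pos (mem_Ioi.1 ht)]

/-- In the profile variables the condition v(ℓ) = ρ u(ℓ) + input becomes the fixed-point equation
for the inflow at ℓ, with N^α and N^β as integral weights. The condition at x = 0 is built into the
reflected signal. -/
lemma exists_plant_solution {S : Plant} (hS : S.Admissible) {L : Kernels}
    (hL : IsInverseKernel S L) {inp : ℝ → ℝ} (hinp : L2loc inp) (γ₀ : Fin 2 → L2 S.ℓ) :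
    ∃ A B, LocSq A ∧ LocSq B ∧ profiles S A B 0 = γ₀ ∧
      (∀ᵐ t ∂(volume.restrict (Ioi (0 : ℝ))), A t = S.q * B (t - S.ℓ / S.lam2)) ∧
      ∀ᵐ t ∂(volume.restrict (Ioi (0 : ℝ))),
        rightTrace S L.mat A B 1 t = S.rho * rightTrace S L.mat A B 0 t + inp t := by
  have hL' : L.Cont S.ℓ := hL.cont
  obtain ⟨c11, c12, c21, c22⟩ := kernels_continuous_row (S := S) hL'
  have cNa : ContinuousOn (Nalpha S L) (Icc 0 S.ℓ) := c21.sub (continuousOn_const.mul c11)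
  have cNb : ContinuousOn (Nbeta S L) (Icc 0 S.ℓ) := c22.sub (continuousOn_const.mul c12)
  obtain ⟨i, hi, e⟩ := exists_rightInflow hS cNa cNb hinp γ₀
  refine ⟨reflected S γ₀ i, hist (-S.lam2) S.ℓ (γ₀ 1) i, locSq_reflected hS γ₀ hi,
    locSq_hist hS.inflow_right.ne _ hi,
    profiles_hist_zero hS γ₀ (l2loc_reflected_inflow hS γ₀ hi) hi, hist_of_pos _ _, ?_⟩
  filter_upwards [e, hist_of_pos (c := -S.lam2) (x₀ := S.ℓ) (γ₀ 1) i] with t h1 h2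
  rw [rightInflow_eq_pair hS _ _ _ _ hi] at h1
  have n1 := fun u : L2 S.ℓ => pair_sub_const_mul u c21 c11 S.rho
  have n2 := fun u : L2 S.ℓ => pair_sub_const_mul u c22 c12 S.rho
  change ∀ u : L2 S.ℓ, pair u (Nalpha S L) = _ at n1
  change ∀ u : L2 S.ℓ, pair u (Nbeta S L) = _ at n2
  rw [n1, n2] at h1
  simp only [rightTrace, Fin.sum_univ_two, profiles, Kernels.mat, Matrix.cons_val_zero,
    Matrix.cons_val_one, Matrix.cons_val_fin_one]
  rw [h2, h1]
  ring

/-- No equation has to be solved here: A is the initial profile followed by zero, and B is fed by ρ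
times A delayed, because the conditions of P on x = ℓ cancel the integral terms. -/
lemma exists_error_solution {S : Plant} (hS : S.Admissible) {P : Kernels}
    (hP : IsObserverKernel S P) (γ₀ : Fin 2 → L2 S.ℓ) :
    ∃ A B, LocSq A ∧ LocSq B ∧ profiles S A B 0 = γ₀ ∧
      (∀ᵐ t ∂(volume.restrict (Ioi (0 : ℝ))), A t = 0) ∧
      ∀ᵐ t ∂(volume.restrict (Ioi (0 : ℝ))),
        rightTrace S P.opp.mat A B 1 t = S.rho * rightTrace S P.opp.mat A B 0 t := by
  set A : ℝ → ℝ := hist S.lam1 0 (γ₀ 0) fun _ => 0 with hA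
  have sA : LocSq A := locSq_hist hS.inflow_left.ne _ L2loc.zero
  have iB : L2loc fun t => S.rho * A (t - S.ℓ / S.lam1) := (sA.comp_sub_right _).l2loc.const_mul _
  refine ⟨A, hist (-S.lam2) S.ℓ (γ₀ 1) fun t => S.rho * A (t - S.ℓ / S.lam1), sA,
    locSq_hist hS.inflow_right.ne _ iB, profiles_hist_zero hS γ₀ L2loc.zero iB,
    hist_of_pos _ _, ?_⟩
  filter_upwards [hist_of_pos (c := -S.lam2) (x₀ := S.ℓ) (γ₀ 1)
    fun t => S.rho * A (t - S.ℓ / S.lam1)] with t h2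
  have hρ := hS.rho_ne
  have q1 : ∀ u : L2 S.ℓ, pair u (P.k21 S.ℓ) = S.rho * pair u (P.k11 S.ℓ) := fun u => by
    rw [← pair_const_mul]
    refine pair_congr u fun x hx => ?_
    rw [hP.bc11 x (Ioo_subset_Icc_self hx)]
    field_simp
  have q2 : ∀ u : L2 S.ℓ, pair u (P.k22 S.ℓ) = S.rho * pair u (P.k12 S.ℓ) := fun u => by
    rw [← pair_const_mul]
    exact pair_congr u fun x hx => hP.bc22 x (Ioo_subset_Icc_self hx)
  simp only [rightTrace, Fin.sum_univ_two, Kernels.mat, Kernels.opp, Matrix.cons_val_zero,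
    Matrix.cons_val_one, Matrix.cons_val_fin_one, pair_neg, q1, q2]
  rw [h2]
  ring

/-- Existence of a solution of the plant and the observer for a given input. -/
theorem exists_plantObserver {S : Plant} (hS : S.Admissible) {K L P : Kernels}
    (hK : IsControlKernel S K) (hL : IsInverseKernel S L) (hP : IsObserverKernel S P)
    {inp : ℝ → ℝ} (hinp : L2loc inp) (u₀ v₀ uh₀ vh₀ : L2 S.ℓ) :
    ∃ (z : Trajectory S.ℓ) (b : Traces), PlantObserver S P inp z b ∧
      z.u 0 = u₀ ∧ z.v 0 = v₀ ∧ z.uh 0 = uh₀ ∧ z.vh 0 = vh₀ := by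
  obtain ⟨Q, hQ, hQ1, hQ2⟩ := exists_observerInverse hS
  have kL := hL.invEq.kerEq hS
  have kP := hP.invEq.kerEq hS
  obtain ⟨A, B, hA, hB, h0, hAB, hL1⟩ := exists_plant_solution hS hL hinp
    (onePlus S.ℓ K.opp.mat ![u₀, v₀])
  obtain ⟨A', B', hA', hB', h0', hAB', hL1'⟩ := exists_error_solution hS hP
    (onePlus S.ℓ Q.opp.mat ![u₀ - uh₀, v₀ - vh₀])
  -- The plant is w and the observer is w - e. The transformed initial data were chosen so that the
  -- inverse transformations return the prescribed ones at time 0.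
  set w : ℝ → Fin 2 → L2 S.ℓ := fun t => onePlus S.ℓ L.mat (profiles S A B t) with hw
  set e : ℝ → Fin 2 → L2 S.ℓ := fun t => onePlus S.ℓ P.opp.mat (profiles S A' B' t) with he
  have w0 : w 0 = ![u₀, v₀] := by rw [hw]; simp only [h0]; exact (kerEq_pair_continuous hS hK hL _).1
  have e0 : e 0 = ![u₀ - uh₀, v₀ - vh₀] := by
    rw [he]; simp only [h0']; exact error_inverse hS hP hQ hQ1 hQ2 _
  have cw := continuousOn_onePlus L.mat (continuousOn_profiles hS hA hB)
  have ce := continuousOn_onePlus P.opp.mat (continuousOn_profiles hS hA' hB')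
  have l0 := l2loc_leftTrace (S := S) hA hB
  have lL := l2loc_rightTrace hS kL hA hB
  have l0' := l2loc_leftTrace (S := S) hA' hB'
  have lL' := l2loc_rightTrace hS kP hA' hB'
  have hq := hS.q_ne
  have h1 := hS.lam1_pos
  have h2 := hS.lam2_pos
  have Hw : HypEq S (injection S P) (fun _ => 0) w (leftTrace S A B) (rightTrace S L.mat A B) := by
    intro i
    refine (weakTransport_onePlus_profiles hS kL hA hB (r := fun _ _ _ => 0) ?_ i).congr_source
      fun t x => by simp [hw]
    refine forall_fin_two ?_ ?_
    · filter_upwards [hAB] with t ht x hx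
      rw [ht]
      simp only [Kernels.mat, Matrix.cons_val_zero, Matrix.cons_val_one, Matrix.cons_val_fin_one]
      rw [hL.bc11 x (Ioo_subset_Icc_self hx)]
      field_simp; ring
    · filter_upwards [hAB] with t ht x hx
      rw [ht]
      simp only [Kernels.mat, Matrix.cons_val_zero, Matrix.cons_val_one, Matrix.cons_val_fin_one]
      rw [hL.bc22 x (Ioo_subset_Icc_self hx)]
      field_simp; ring
  -- With A' = 0 the only source created by 1 - P at x = 0 is -B'(t - ℓ/λ₂) times the gains, that
  -- is, minus the injection with ṽ(0,t) equal to that trace.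
  have He : HypEq S (injection S P) (fun t => -B' (t - S.ℓ / S.lam2)) e (leftTrace S A' B')
      (rightTrace S P.opp.mat A' B') := by
    intro i
    refine weakTransport_onePlus_profiles hS kP hA' hB'
      (r := fun i t x => -B' (t - S.ℓ / S.lam2) * injection S P i x) ?_ i
    refine forall_fin_two ?_ ?_
    · filter_upwards [hAB'] with t ht x hx
      rw [ht]
      simp only [Kernels.mat, Kernels.opp, injection, p1, Matrix.cons_val_zero,
        Matrix.cons_val_one, Matrix.cons_val_fin_one]
      ring
    · filter_upwards [hAB'] with t ht x hx
      rw [ht]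
      simp only [Kernels.mat, Kernels.opp, injection, p2, Matrix.cons_val_zero,
        Matrix.cons_val_one, Matrix.cons_val_fin_one]
      ring
  have hB2 : L2loc fun t => -B' (t - S.ℓ / S.lam2) := by
    have := L2loc.zero.sub (hB'.comp_sub_right (S.ℓ / S.lam2)).l2loc
    simpa using this
  have Ho := Hw.sub hS He (continuousOn_injection hP.cont) cw ce L2loc.zero hB2 l0 lL l0' lL'
  refine ⟨⟨fun t => w t 0, fun t => w t 1, fun t => w t 0 - e t 0, fun t => w t 1 - e t 1⟩,
    ⟨leftTrace S A B 0, rightTrace S L.mat A B 0, leftTrace S A B 1, rightTrace S L.mat A B 1,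
      fun t => leftTrace S A B 0 t - leftTrace S A' B' 0 t,
      fun t => rightTrace S L.mat A B 0 t - rightTrace S P.opp.mat A' B' 0 t,
      fun t => leftTrace S A B 1 t - leftTrace S A' B' 1 t,
      fun t => rightTrace S L.mat A B 1 t - rightTrace S P.opp.mat A' B' 1 t⟩, ?_, ?_, ?_, ?_, ?_⟩
  · exact
    { cont := ⟨cw 0, cw 1, (cw 0).sub (ce 0), (cw 1).sub (ce 1)⟩
      traces := ⟨l0 0, lL 0, l0 1, lL 1, (l0 0).sub (l0' 0), (lL 0).sub (lL' 0),
        (l0 1).sub (l0' 1), (lL 1).sub (lL' 1)⟩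
      eq_u := (Hw 0).congr_source fun t x => by simp [Plant.src]
      eq_v := (Hw 1).congr_source fun t x => by simp [Plant.src]
      eq_uh := (Ho 0).congr_source fun t x => by
        simp [Plant.src, leftTrace, injection]; ring
      eq_vh := (Ho 1).congr_source fun t x => by
        simp [Plant.src, leftTrace, injection]; ring
      bc_u := hAB
      bc_v := hL1
      bc_uh := by
        filter_upwards [hAB, hAB'] with t a1 a2
        show A t - A' t = S.q * B (t - S.ℓ / S.lam2)
        rw [a1, a2, sub_zero]
      bc_vh := by
        filter_upwards [hL1, hL1'] with t a1 a2
        rw [a1, a2]; ring }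
  · exact congrFun w0 0
  · exact congrFun w0 1
  · show w 0 0 - e 0 0 = uh₀
    rw [w0, e0]; simp
  · show w 0 1 - e 0 1 = vh₀
    rw [w0, e0]; simp

/-! ### Well-posedness of the closed loop -/

lemma l2loc_stepSignal {h : ℝ} (hh : 0 < h) (c : ℕ → ℝ) : L2loc (stepSignal h c) := by
  intro T
  have hm : Measurable (stepSignal h c) :=
    (measurable_of_countable c).comp (Nat.measurable_floor.comp (measurable_id.div_const h))
  refine MemLp.of_bound hm.aestronglyMeasurable (∑ i ∈ Finset.range (⌊T / h⌋₊ + 1), |c i|) ?_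
  filter_upwards [ae_restrict_mem measurableSet_Ioo] with t ht
  refine Finset.single_le_sum (f := fun i => |c i|) (fun _ _ => abs_nonneg _)
    (Finset.mem_range.2 (Nat.lt_succ_of_le (Nat.floor_le_floor ?_)))
  exact div_le_div_of_nonneg_right ht.2.le hh.le

lemma IsSolution.exists_hold {S : Plant} {K L P : Kernels} {G : Design} {h m₀ : ℝ} (hh : 0 < h)
    {u₀ v₀ uh₀ vh₀ : L2 S.ℓ} {z : Trajectory S.ℓ}
    (H : IsSolution S K L P G h m₀ u₀ v₀ uh₀ vh₀ z) :
    ∃ (b : Traces) (m inp : ℝ → ℝ), PlantObserver S P inp z b ∧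
      DynamicVariable S K L P G m₀ z b inp m ∧
      ∀ (n : ℕ), ∀ t ∈ Ico (n * h) ((n + 1 : ℕ) * h),
        inp t = holdSeq (feedback S K z) m (G.gammaP S L h) h n := by
  obtain ⟨-, -, -, -, b, m, inp, tk, h1, h2, h3, h4⟩ := H
  exact ⟨b, m, inp, h1, h2, fun n t ht => h3.hold_eq hh h4 n ht⟩

/-- Every sequence of held values defines an open-loop solution, and the trigger produces a new
sequence from it. By causality entry n of the new sequence depends only on the held values before n,
so a fixed point exists, and it is the closed loop. -/
theorem exists_solution {S : Plant} (hS : S.Admissible) (hrefl : |S.rho * S.q| ≤ 1 / 2)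
    {K L P : Kernels} (hK : IsControlKernel S K) (hL : IsInverseKernel S L)
    (hP : IsObserverKernel S P) {G : Design} (hG : 0 ≤ G.eta) {h : ℝ} (hh : 0 < h)
    (u₀ v₀ uh₀ vh₀ : L2 S.ℓ) (m₀ : ℝ) :
    ∃ z, IsSolution S K L P G h m₀ u₀ v₀ uh₀ vh₀ z := by
  have ex : ∀ c : ℕ → ℝ, ∃ (z : Trajectory S.ℓ) (b : Traces) (m : ℝ → ℝ),
      PlantObserver S P (stepSignal h c) z b ∧
      (z.u 0 = u₀ ∧ z.v 0 = v₀ ∧ z.uh 0 = uh₀ ∧ z.vh 0 = vh₀) ∧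
      DynamicVariable S K L P G m₀ z b (stepSignal h c) m := by
    intro c
    obtain ⟨z, b, h1, h2⟩ :=
      exists_plantObserver hS hK hL hP (l2loc_stepSignal hh c) u₀ v₀ uh₀ vh₀
    obtain ⟨m, h3, h4⟩ := exists_linear_ode (η := G.eta) (m₀ := m₀)
      (g := dynSource S K L P G z b (stepSignal h c))
      fun t ht => h1.intervalIntegrable_dynSource hS hK le_rfl ht
    exact ⟨z, b, m, h1, h2, dynamicVariable_iff.2 ⟨h3, h4⟩⟩
  choose z b m hz h0 hm using ex
  obtain ⟨c, hc⟩ := exists_fixedPoint_of_causal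
    (F := fun c => holdSeq (feedback S K (z c)) (m c) (G.gammaP S L h) h) (by
      intro c c' n hcc
      have h1 := (hz c).causal_outputs hS hrefl hK hL hP hG (hz c')
        ⟨by simp only [Trajectory.plant, (h0 c).1, (h0 c).2.1, (h0 c').1, (h0 c').2.1],
          by simp only [Trajectory.obs, (h0 c).2.2.1, (h0 c).2.2.2, (h0 c').2.2.1, (h0 c').2.2.2]⟩
        (hm c) (hm c') (T := n * h) (by positivity) (fun s hs => by
          have hf := mem_step hh hs.1.le
          rw [stepSignal_eq hh c hf, stepSignal_eq hh c' hf]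
          refine hcc _ ?_
          have h3 := hf.1.trans_lt hs.2
          exact_mod_cast lt_of_mul_lt_mul_right h3 hh.le)
      have h2 : ∀ i ≤ n, (i : ℝ) * h ∈ Icc 0 ((n : ℝ) * h) := fun i hi =>
        ⟨by positivity, mul_le_mul_of_nonneg_right (by exact_mod_cast hi) hh.le⟩
      exact holdSeq_congr (fun i hi => (h1 _ (h2 i hi)).1) fun i hi => (h1 _ (h2 i hi)).2)
  obtain ⟨tk, e1, e2⟩ := exists_eventTimes (feedback S K (z c)) (m c) (G.gammaP S L h) hh
  rw [hc] at e2
  exact ⟨z c, (h0 c).1, (h0 c).2.1, (h0 c).2.2.1, (h0 c).2.2.2, b c, m c, stepSignal h c, tk,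
    hz c, hm c, e1, e2⟩

/-- Induction over sampling intervals: if the inputs agree before nh, the feedback and m agree at
the samples up to nh, hence so does the value held on the next interval. -/
theorem IsSolution.unique {S : Plant} (hS : S.Admissible) (hrefl : |S.rho * S.q| ≤ 1 / 2)
    {K L P : Kernels} (hK : IsControlKernel S K) (hL : IsInverseKernel S L)
    (hP : IsObserverKernel S P) {G : Design} (hG : 0 ≤ G.eta) {h : ℝ} (hh : 0 < h)
    {u₀ v₀ uh₀ vh₀ : L2 S.ℓ} {m₀ : ℝ} {z z' : Trajectory S.ℓ}
    (H : IsSolution S K L P G h m₀ u₀ v₀ uh₀ vh₀ z)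
    (H' : IsSolution S K L P G h m₀ u₀ v₀ uh₀ vh₀ z') {t : ℝ} (ht : 0 ≤ t) :
    z'.u t = z.u t ∧ z'.v t = z.v t ∧ z'.uh t = z.uh t ∧ z'.vh t = z.vh t := by
  obtain ⟨b, m, inp, h1, h2, h3⟩ := H.exists_hold hh
  obtain ⟨b', m', inp', h1', h2', h3'⟩ := H'.exists_hold hh
  have h0 : z'.plant 0 = z.plant 0 ∧ z'.obs 0 = z.obs 0 := by
    obtain ⟨a1, a2, a3, a4, -⟩ := H
    obtain ⟨b1, b2, b3, b4, -⟩ := H'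
    exact ⟨by simp only [Trajectory.plant, a1, a2, b1, b2],
      by simp only [Trajectory.obs, a3, a4, b3, b4]⟩
  have hi : ∀ n : ℕ, ∀ s ∈ Ioo 0 ((n : ℝ) * h), inp' s = inp s := by
    intro n
    induction n with
    | zero => intro s hs; simp only [Nat.cast_zero, zero_mul] at hs; exact absurd hs.2 hs.1.not_gt
    | succ n ih =>
      intro s hs
      by_cases hs' : s < n * h
      · exact ih s ⟨hs.1, hs'⟩
      · have h4 := h1'.causal_outputs hS hrefl hK hL hP hG h1 h0 h2' h2 (T := n * h)
          (by positivity) ih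
        have h5 : ∀ i ≤ n, (i : ℝ) * h ∈ Icc 0 ((n : ℝ) * h) := fun i hi =>
          ⟨by positivity, mul_le_mul_of_nonneg_right (by exact_mod_cast hi) hh.le⟩
        rw [h3' n s ⟨not_lt.1 hs', hs.2⟩, h3 n s ⟨not_lt.1 hs', hs.2⟩]
        exact holdSeq_congr (fun i hi => (h4 _ (h5 i hi)).1) fun i hi => (h4 _ (h5 i hi)).2
  have hm := mem_step hh ht
  obtain ⟨c1, -⟩ := h1'.causal hS hrefl hK hL hP h1 h0 ht fun s hs =>
    hi _ s ⟨hs.1, hs.2.trans hm.2⟩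
  obtain ⟨e1, e2⟩ := c1 t ⟨ht, le_rfl⟩
  exact ⟨congrFun e1 0, congrFun e1 1, congrFun e2 0, congrFun e2 1⟩

/-! ### Functions that are primitives of their derivatives -/

/-- `F` is on `[a,b]` a primitive of the integrable function `f`. -/
structure Prim (F f : ℝ → ℝ) (a b : ℝ) : Prop where
  le : a ≤ b
  int : IntervalIntegrable f volume a b
  eq : ∀ x ∈ Icc a b, F x = F a + ∫ s in a..x, f s

namespace Prim

variable {F f G g : ℝ → ℝ} {a b : ℝ}

lemma continuousOn (h : Prim F f a b) : ContinuousOn F (uIcc a b) := by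
  rw [uIcc_of_le h.le]; exact continuousOn_prim h.le h.int h.eq

lemma int' (h : Prim F f a b) {x y : ℝ} (hx : a ≤ x) (hxy : x ≤ y) (hy : y ≤ b) :
    IntervalIntegrable f volume x y :=
  h.int.mono_set (by rw [uIcc_of_le hxy, uIcc_of_le h.le]; exact Icc_subset_Icc hx hy)

lemma sub_eq (h : Prim F f a b) {x y : ℝ} (hx : a ≤ x) (hxy : x ≤ y) (hy : y ≤ b) :
    F y = F x + ∫ s in x..y, f s := by
  rw [h.eq y ⟨hx.trans hxy, hy⟩, h.eq x ⟨hx, hxy.trans hy⟩, add_assoc,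
    intervalIntegral.integral_add_adjacent_intervals (h.int' le_rfl hx (hxy.trans hy))
      (h.int' hx hxy hy)]

lemma mono (h : Prim F f a b) {x y : ℝ} (hx : a ≤ x) (hxy : x ≤ y) (hy : y ≤ b) :
    Prim F f x y :=
  ⟨hxy, h.int' hx hxy hy, fun _ ht => h.sub_eq hx ht.1 (ht.2.trans hy)⟩

lemma add (h : Prim F f a b) (h' : Prim G g a b) :
    Prim (fun x => F x + G x) (fun x => f x + g x) a b := by
  refine ⟨h.le, h.int.add h'.int, fun x hx => ?_⟩
  rw [intervalIntegral.integral_add (h.int' le_rfl hx.1 hx.2) (h'.int' le_rfl hx.1 hx.2), h.eq x hx,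
    h'.eq x hx]
  ring

lemma const_mul (h : Prim F f a b) (c : ℝ) : Prim (fun x => c * F x) (fun x => c * f x) a b := by
  refine ⟨h.le, h.int.const_mul c, fun x hx => ?_⟩
  rw [intervalIntegral.integral_const_mul, h.eq x hx]
  ring

lemma const_sub (h : Prim F f a b) (c : ℝ) : Prim (fun x => c - F x) (fun x => -f x) a b := by
  refine ⟨h.le, h.int.neg, fun x hx => ?_⟩
  rw [intervalIntegral.integral_neg, h.eq x hx]
  ring

lemma mul (h : Prim F f a b) (h' : Prim G g a b) :
    Prim (fun x => F x * G x) (fun x => f x * G x + F x * g x) a b := by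
  refine ⟨h.le, (h.int.mul_continuousOn h'.continuousOn).add
    (h'.int.continuousOn_mul h.continuousOn), fun x hx => ?_⟩
  have := integral_prim_mul hx.1 (h.int' le_rfl hx.1 hx.2) (h'.int' le_rfl hx.1 hx.2)
    (fun y hy => h.eq y ⟨hy.1, hy.2.trans hx.2⟩) (fun y hy => h'.eq y ⟨hy.1, hy.2.trans hx.2⟩)
  rw [this]
  ring

lemma of_hasDerivAt (hab : a ≤ b) (hF : ∀ x, HasDerivAt F (f x) x) (hf : Continuous f) :
    Prim F f a b :=
  ⟨hab, hf.intervalIntegrable _ _, fun x _ => by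
    rw [intervalIntegral.integral_eq_sub_of_hasDerivAt (fun y _ => hF y)
      (hf.intervalIntegrable _ _)]; ring⟩

lemma congr_deriv (h : Prim F f a b) (hg : ∀ᵐ s, s ∈ Ioo a b → f s = g s) : Prim F g a b := by
  have e : ∀ᵐ s, s ∈ Ioc a b → f s = g s := by
    filter_upwards [hg, Measure.ae_ne volume b] with s h1 h2 hs
    exact h1 ⟨hs.1, lt_of_le_of_ne hs.2 h2⟩
  refine ⟨h.le, h.int.congr_ae ?_, fun x hx => ?_⟩
  · rw [uIoc_of_le h.le]
    exact (ae_restrict_iff' measurableSet_Ioc).2 e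
  · rw [h.eq x hx]
    congr 1
    refine intervalIntegral.integral_congr_ae ?_
    filter_upwards [e] with s hs hm
    rw [uIoc_of_le hx.1] at hm
    exact hs ⟨hm.1, hm.2.trans hx.2⟩

/-- The product e^{ks}F is a primitive of a function that is nonpositive almost everywhere. -/
lemma exp_decay (h : Prim F f a b) {k : ℝ} (hf : ∀ᵐ s, s ∈ Ioo a b → f s ≤ -k * F s) :
    F b ≤ Real.exp (-k * (b - a)) * F a := by
  have hd : ∀ x : ℝ, HasDerivAt (fun s => Real.exp (k * s)) (k * Real.exp (k * x)) x := fun x => by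
    have := ((hasDerivAt_id x).const_mul k).exp
    simpa [mul_comm] using this
  have hp := (of_hasDerivAt h.le hd (by fun_prop)).mul h
  have e := hp.eq b ⟨h.le, le_rfl⟩
  have hneg : ∫ s in a..b, (k * Real.exp (k * s) * F s + Real.exp (k * s) * f s) ≤
      ∫ s in a..b, (0 : ℝ) := by
    refine intervalIntegral.integral_mono_ae_restrict h.le hp.int intervalIntegrable_const ?_
    rw [← restrict_Ioo_eq_restrict_Icc]
    refine (ae_restrict_iff' measurableSet_Ioo).2 ?_
    filter_upwards [hf] with s hs hm
    have := mul_le_mul_of_nonneg_left (hs hm) (Real.exp_pos (k * s)).le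
    linarith
  rw [intervalIntegral.integral_zero] at hneg
  have h1 : Real.exp (k * b) * F b ≤ Real.exp (k * a) * F a := by linarith
  have h2 : Real.exp (-k * (b - a)) * Real.exp (k * b) = Real.exp (k * a) := by
    rw [← Real.exp_add]; congr 1; ring
  have h3 := Real.exp_pos (k * b)
  refine le_of_mul_le_mul_left ?_ h3
  calc _ ≤ _ := h1
    _ = _ := by rw [← h2]; ring

end Prim

/-- Distributed delays of locally integrable signals are primitives. -/
lemma prim_delay {A χ g : ℝ → ℝ} (hA : LocInt A) {τ a b : ℝ} (hτ : 0 ≤ τ) (ha : 0 ≤ a)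
    (hab : a ≤ b) (hχ : Prim χ g 0 τ) :
    Prim (fun t => ∫ σ in (0 : ℝ)..τ, χ σ * A (t - σ))
      (fun s => χ 0 * A s - χ τ * A (s - τ) + ∫ σ in (0 : ℝ)..τ, g σ * A (s - σ)) a b := by
  refine Prim.mono (a := 0) (b := b) ⟨ha.trans hab, ?_, fun t ht => ?_⟩ ha hab le_rfl
  · exact (((hA 0 b).const_mul _).sub ((hA.comp_sub_right τ 0 b).const_mul _)).add
      (intervalIntegrable_conv hA hτ (ha.trans hab) hχ.int)
  · exact delay_balance hA hτ ht.1 hχ.int hχ.eq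

/-! ### Decay of the dynamic variable -/

/-- Between two samples the positive part of the dynamic variable decays exponentially. -/
lemma hold_decay {a η ε0 ε1 ε3 κ0 κ1 θm θ h c α : ℝ} {m fm U u N y : ℝ → ℝ}
    (ha : a = 1 + ε3 + η) (ha0 : 0 < a) (hθ : 0 ≤ θ) (hθm : 0 ≤ θm)
    (hε0 : 0 ≤ ε0) (hε1 : 0 ≤ ε1)
    (hκ0 : θm * ((Real.exp (a * h) - 1) / a) * ε0 ≤ κ0)
    (hκ1 : θm * ((Real.exp (a * h) - 1) / a) * ε1 ≤ κ1)
    (hm : Prim m fm α (α + h)) (hU : Prim U u α (α + h)) (hN : ∀ s, 0 ≤ N s)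
    (hfm : ∀ᵐ s, s ∈ Ioo α (α + h) → fm s =
      -η * m s + θm * (c - U s) ^ 2 - κ0 * N s - κ1 * y s ^ 2)
    (hu : ∀ᵐ s, s ∈ Ioo α (α + h) → u s ^ 2 ≤ ε0 * N s + ε1 * y s ^ 2 + ε3 * (c - U s) ^ 2)
    (hstart : c - U α = 0 ∨
      (Real.exp (a * h) * (θm + a * θ) - θm) * (c - U α) ^ 2 + a * m α ≤ 0)
    {t : ℝ} (ht : t ∈ Icc α (α + h)) :
    m t ≤ Real.exp (-η * (t - α)) * max (m α) 0 := by
  -- This is the solution of g' = -(1 + a g) that vanishes at the next sampling instant.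
  set g : ℝ → ℝ := fun t => (Real.exp (a * (α + h - t)) - 1) / a with hg
  have hgd : ∀ x, HasDerivAt g (-Real.exp (a * (α + h - x))) x := fun x => by
    have := ((((hasDerivAt_id x).const_sub (α + h)).const_mul a).exp.sub_const 1).div_const a
    refine HasDerivAt.congr_deriv (f := g) this ?_
    simp only [id]
    field_simp
  have hE : ∀ x, Real.exp (a * (α + h - x)) = a * g x + 1 := fun x => by
    simp only [hg]; field_simp; ring
  have hg0 : ∀ x ≤ α + h, 0 ≤ g x := fun x hx => by
    refine div_nonneg (sub_nonneg.2 (Real.one_le_exp ?_)) ha0.le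
    exact mul_nonneg ha0.le (by linarith)
  have hg1 : ∀ x, α ≤ x → g x ≤ (Real.exp (a * h) - 1) / a := fun x hx => by
    refine div_le_div_of_nonneg_right (sub_le_sub_right (Real.exp_le_exp.2 ?_) 1) ha0.le
    exact mul_le_mul_of_nonneg_left (by linarith) ha0.le
  have hd := hU.const_sub c
  -- The quantity that decays is Z = m + θ_m g d² with d = c - U. The -1 in g' cancels the
  -- destabilising θ_m d² in the rate of m.
  have hZ := hm.add (((Prim.of_hasDerivAt hm.le hgd (by fun_prop)).mul (hd.mul hd)).const_mul θm)
  have key := (hZ.mono le_rfl ht.1 ht.2).exp_decay (k := η) (by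
    filter_upwards [hfm, hu] with s h1 h2 hs
    have hs' : s ∈ Ioo α (α + h) := ⟨hs.1, hs.2.trans_le ht.2⟩
    have h1 := h1 hs'
    have h2 := h2 hs'
    have p0 := hg0 s hs'.2.le
    have p1 := hg1 s hs'.1.le
    have q0 : θm * g s * ε0 * N s ≤ κ0 * N s :=
      mul_le_mul_of_nonneg_right ((mul_le_mul_of_nonneg_right
        (mul_le_mul_of_nonneg_left p1 hθm) hε0).trans hκ0) (hN s)
    have q1 : θm * g s * ε1 * y s ^ 2 ≤ κ1 * y s ^ 2 :=
      mul_le_mul_of_nonneg_right ((mul_le_mul_of_nonneg_right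
        (mul_le_mul_of_nonneg_left p1 hθm) hε1).trans hκ1) (sq_nonneg _)
    -- This square gives -2 d u ≤ d² + u². The bound on u² then adds ε₃ d² and terms absorbed by κ₀
    -- and κ₁, so a = 1 + ε₃ + η leaves exactly -η θ_m g d².
    have q2 : 0 ≤ θm * g s * (c - U s + u s) ^ 2 := by positivity
    have q3 := mul_le_mul_of_nonneg_left h2 (mul_nonneg hθm p0)
    have q4 : θm * g s * (c - U s) ^ 2 * (a - (1 + ε3 + η)) = 0 := by rw [ha]; ring
    rw [h1, hE]
    linarith)
  have p0 := hg0 t ht.2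
  have q0 : 0 ≤ θm * (g t * ((c - U t) * (c - U t))) := by
    have := mul_self_nonneg (c - U t)
    positivity
  -- At a sample either the input was just updated and d = 0, or no event occurred. In the second
  -- case the trigger inequality says a Z ≤ -aθ e^{ah} d² ≤ 0.
  have q1 : m α + θm * (g α * ((c - U α) * (c - U α))) ≤ max (m α) 0 := by
    rcases hstart with h0 | h0
    · rw [h0]; simp
    · refine le_max_of_le_right ?_
      have e : g α = (Real.exp (a * h) - 1) / a := by simp only [hg]; congr 4; ring
      have h1 : 0 ≤ Real.exp (a * h) * θ * (c - U α) ^ 2 := by positivity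
      have h2 : a * (m α + θm * (g α * ((c - U α) * (c - U α)))) ≤ 0 := by
        rw [e]
        have : a * (m α + θm * ((Real.exp (a * h) - 1) / a * ((c - U α) * (c - U α)))) =
          a * m α + θm * (Real.exp (a * h) - 1) * (c - U α) ^ 2 := by field_simp
        rw [this]
        nlinarith [mul_nonneg ha0.le h1]
      by_contra hn
      exact absurd h2 (not_le.2 (mul_pos ha0 (not_le.1 hn)))
  have q2 := mul_le_mul_of_nonneg_left q1 (Real.exp_pos (-η * (t - α))).le
  linarith

/-- Decay of the Lyapunov functional once the dynamic variable decays. -/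
lemma lyapunov_decay {η ε κ0 e cV M₁ τ T : ℝ} {m fm V v N w : ℝ → ℝ}
    (hε : 0 ≤ ε) (hεη : ε ≤ η) (hεe : ε * cV ≤ e - κ0) (hM : 0 ≤ M₁)
    (hm : Prim m fm τ T) (hV : Prim V v τ T) (hN : ∀ s, 0 ≤ N s)
    (hfm : ∀ᵐ s, s ∈ Ioo τ T → fm s = -η * m s + w s - κ0 * N s)
    (hv : ∀ᵐ s, s ∈ Ioo τ T → v s ≤ -e * N s + w s)
    (hVN : ∀ s ∈ Ioo τ T, V s ≤ cV * N s)
    (hmd : ∀ s ∈ Icc τ T, m s ≤ Real.exp (-η * (s - τ)) * M₁) :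
    V T ≤ Real.exp (-ε * (T - τ)) * (V τ - m τ + 2 * M₁) := by
  have hTτ := hm.le
  have hd : ∀ x, HasDerivAt (fun s => Real.exp (-η * (s - τ)) * M₁)
      (-η * (Real.exp (-η * (x - τ)) * M₁)) x := fun x => by
    have := ((((hasDerivAt_id x).sub_const τ).const_mul (-η)).exp).mul_const M₁
    refine HasDerivAt.congr_deriv (f := fun s => Real.exp (-η * (s - τ)) * M₁) this ?_
    simp only [id]
    ring
  -- The functional V - m + e^{-η(s-τ)}M₁ bounds V from below through m ≤ e^{-η(s-τ)}M₁. In it the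
  -- common term w cancels, and what remains is -(e - κ₀)N - η(e^{-η(s-τ)}M₁ - m).
  have hY := (hV.add (hm.const_mul (-1))).add (Prim.of_hasDerivAt hTτ hd (by fun_prop))
  have key := hY.exp_decay (k := ε) (by
    filter_upwards [hfm, hv] with s h1 h2 hs
    have h3 := hmd s (Ioo_subset_Icc_self hs)
    have h4 := mul_le_mul_of_nonneg_left (hVN s hs) hε
    have h5 := mul_le_mul_of_nonneg_right hεe (hN s)
    have h6 := mul_le_mul_of_nonneg_left h3 (sub_nonneg.2 hεη)
    rw [h1 hs]
    have := h2 hs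
    linarith)
  simp only [sub_self, mul_zero, Real.exp_zero, one_mul] at key
  have h1 := hmd T ⟨hTτ, le_rfl⟩
  have h2 : Real.exp (-η * (T - τ)) ≤ Real.exp (-ε * (T - τ)) := by
    refine Real.exp_le_exp.2 ?_
    have := mul_le_mul_of_nonneg_right hεη (sub_nonneg.2 hTτ)
    linarith
  have h3 := mul_le_mul_of_nonneg_right h2 hM
  have h4 := mul_nonneg (Real.exp_pos (-η * (T - τ))).le hM
  linarith

/-! ### Consequences of the choice of the parameters -/

namespace Design.Admissible

variable {G : Design} {S : Plant} {L : Kernels}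

/-- The decay rate available in the Lyapunov functional. -/
def rate (G : Design) (S : Plant) : ℝ := G.mu * G.r S * G.C

lemma r_pos (hS : S.Admissible) : 0 < G.r S := by
  have h1 := hS.lam1_pos
  have h2 := hS.lam2_pos
  have hq := hS.q_ne
  exact lt_min (by positivity) (by positivity)

lemma kappa_nonneg (hG : G.Admissible S L) {ε : ℝ} (hε : 0 ≤ ε) : 0 ≤ G.kappa ε :=
  div_nonneg (mul_nonneg hG.theta_pos.le hε) (by linarith [hG.sigma_mem.2])

lemma eps0_nonneg : 0 ≤ eps0 S L :=
  mul_nonneg (by norm_num) (le_max_of_le_left (mul_nonneg (sq_nonneg _)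
    (integral_nonneg fun _ => sq_nonneg _)))

lemma eps1_nonneg : 0 ≤ eps1 S L := mul_nonneg (by norm_num) (sq_nonneg _)

lemma eps3_nonneg : 0 ≤ eps3 S L := mul_nonneg (by norm_num) (sq_nonneg _)

lemma a_pos (hG : G.Admissible S L) : 0 < G.a S L := by
  have := eps3_nonneg (S := S) (L := L)
  have := hG.eta_pos
  unfold Design.a
  linarith

/-- The choice of C gives κ₀ < (μ - δ) r C, and δ > 0 makes the inequality with μ r C strict. -/
lemma kappa_eps0_lt_rate (hS : S.Admissible) (hG : G.Admissible S L) :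
    0 < G.C ∧ G.kappa (eps0 S L) < rate G S := by
  have hr := r_pos (G := G) hS
  have hμ : 0 < G.mu - G.delta := sub_pos.2 hG.delta_mem.2
  have hκ := hG.kappa_nonneg (eps0_nonneg (S := S) (L := L))
  have h1 := (le_max_left _ _).trans_lt hG.C_gt
  have hC : 0 < G.C := lt_of_le_of_lt (div_nonneg hκ (mul_pos hμ hr).le) h1
  rw [div_lt_iff₀ (mul_pos hμ hr)] at h1
  have h2 : 0 < G.C * (G.delta * G.r S) := mul_pos hC (mul_pos hG.delta_mem.1 hr)
  refine ⟨hC, ?_⟩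
  unfold rate
  linarith

/-- The left side is twice the largest weight of the second signal in the affine Lyapunov
functional. With x = μℓ/λ₁ and y = μℓ/λ₂, the first bound on r and x e^{-x} ≤ 1 give eℓ ≤ C, and the
second gives eℓ ≤ 2Cq²y. The sum is at most 4Cq²(1 + y) ≤ 4Cq²e^y. -/
lemma weight_le_thetam (hS : S.Admissible) (hG : G.Admissible S L) :
    2 * (S.q ^ 2 * (G.C + rate G S * S.ℓ) + rate G S * S.ℓ) ≤ G.thetam S := by
  have hℓ := hS.ℓ_pos
  have h1 := hS.lam1_pos
  have h2 := hS.lam2_pos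
  have hμ := hG.mu_pos
  have hC := (hG.kappa_eps0_lt_rate hS).1
  set x := G.mu * (S.ℓ / S.lam1) with hx
  set y := G.mu * (S.ℓ / S.lam2) with hy
  have r1 : G.r S ≤ 1 / S.lam1 * Real.exp (-x) := min_le_left _ _
  have r2 : G.r S ≤ 2 * S.q ^ 2 / S.lam2 := min_le_right _ _
  have hk : 0 ≤ G.mu * G.C * S.ℓ := by positivity
  have e1 : rate G S * S.ℓ ≤ G.C := by
    have h3 : rate G S * S.ℓ ≤ G.C * (x * Real.exp (-x)) := by
      calc rate G S * S.ℓ = G.mu * G.C * S.ℓ * G.r S := by unfold rate; ring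
        _ ≤ G.mu * G.C * S.ℓ * (1 / S.lam1 * Real.exp (-x)) := mul_le_mul_of_nonneg_left r1 hk
        _ = _ := by rw [hx]; ring
    have h4 : x * Real.exp (-x) ≤ 1 := by
      rw [Real.exp_neg, ← div_eq_mul_inv, div_le_one (Real.exp_pos _)]
      linarith [Real.add_one_le_exp x]
    have := mul_le_mul_of_nonneg_left h4 hC.le
    linarith
  have e2 : rate G S * S.ℓ ≤ 2 * G.C * S.q ^ 2 * y := by
    calc rate G S * S.ℓ = G.mu * G.C * S.ℓ * G.r S := by unfold rate; ring
      _ ≤ G.mu * G.C * S.ℓ * (2 * S.q ^ 2 / S.lam2) := mul_le_mul_of_nonneg_left r2 hk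
      _ = _ := by rw [hy]; ring
  have e3 := mul_le_mul_of_nonneg_left (Real.add_one_le_exp y)
    (by positivity : 0 ≤ 4 * G.C * S.q ^ 2)
  have e4 := mul_le_mul_of_nonneg_left e1 (sq_nonneg S.q)
  have e5 : G.thetam S = 4 * G.C * S.q ^ 2 * Real.exp y := by unfold Design.thetam; ring
  rw [e5]
  linarith

lemma thetam_nonneg (hS : S.Admissible) (hG : G.Admissible S L) : 0 ≤ G.thetam S := by
  have hC := (hG.kappa_eps0_lt_rate hS).1
  unfold Design.thetam
  positivity

/-- The bound on μ says 4ρ²q² e^{μ(ℓ/λ₁+ℓ/λ₂)} < 1, so the second lower bound on C reads κ₁ < C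
minus that multiple of C, while ρ²θ_m is at most the same multiple. -/
lemma kappa_eps1_le (hS : S.Admissible) (hG : G.Admissible S L) :
    S.rho ^ 2 * G.thetam S + G.kappa (eps1 S L) ≤ G.C := by
  have hℓ := hS.ℓ_pos
  have h1 := hS.lam1_pos
  have h2 := hS.lam2_pos
  have hC := (hG.kappa_eps0_lt_rate hS).1
  set E := Real.exp (G.mu * (S.ℓ / S.lam1 + S.ℓ / S.lam2)) with hE
  have hX : 0 < |S.q * S.rho| := abs_pos.2 (mul_ne_zero hS.q_ne hS.rho_ne)
  have hlt : 4 * S.rho ^ 2 * S.q ^ 2 * E < 1 := by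
    have m1 : G.mu * (S.ℓ / S.lam1 + S.ℓ / S.lam2) < 2 * Real.log (1 / (2 * |S.q * S.rho|)) := by
      have h3 : 0 < S.ℓ / S.lam1 + S.ℓ / S.lam2 := by positivity
      have h4 := mul_lt_mul_of_pos_right hG.mu_lt h3
      refine h4.trans_eq ?_
      field_simp
      ring
    have m2 : E < (1 / (2 * |S.q * S.rho|)) ^ 2 := by
      refine (Real.exp_lt_exp.2 m1).trans_eq ?_
      rw [mul_comm, Real.exp_mul, Real.exp_log (by positivity)]
      norm_cast
    have m3 : 4 * S.rho ^ 2 * S.q ^ 2 = (2 * |S.q * S.rho|) ^ 2 := by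
      rw [mul_pow, sq_abs]; ring
    rw [m3]
    have m4 := mul_lt_mul_of_pos_left m2 (by positivity : 0 < (2 * |S.q * S.rho|) ^ 2)
    refine m4.trans_eq ?_
    field_simp
  have h3 := (le_max_right _ _).trans_lt hG.C_gt
  rw [div_lt_iff₀ (sub_pos.2 hlt)] at h3
  have h4 : Real.exp (G.mu * (S.ℓ / S.lam2)) ≤ E := by
    refine Real.exp_le_exp.2 (mul_le_mul_of_nonneg_left ?_ hG.mu_pos.le)
    have : 0 ≤ S.ℓ / S.lam1 := by positivity
    linarith
  have h5 := mul_le_mul_of_nonneg_left h4 (by positivity : 0 ≤ 4 * S.rho ^ 2 * S.q ^ 2 * G.C)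
  have e5 : S.rho ^ 2 * G.thetam S =
      4 * S.rho ^ 2 * S.q ^ 2 * G.C * Real.exp (G.mu * (S.ℓ / S.lam2)) := by
    unfold Design.thetam; ring
  rw [e5]
  linarith

/-- The condition h ≤ τ bounds e^{ah} - 1 by aθσ/((aθ + θ_m)(1 - σ)). After multiplication by θ_m/a
this is θ/(1 - σ) times a factor below 1, which leaves κ. -/
lemma gap_le_kappa (hS : S.Admissible) (hG : G.Admissible S L) {h : ℝ} (hh : h ≤ G.tau S L)
    {ε : ℝ} (hε : 0 ≤ ε) :
    G.thetam S * ((Real.exp (G.a S L * h) - 1) / G.a S L) * ε ≤ G.kappa ε := by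
  have ha := hG.a_pos
  have hθ := hG.theta_pos
  have hm := hG.thetam_nonneg hS
  have hσ0 := hG.sigma_mem.1
  have hσ := sub_pos.2 hG.sigma_mem.2
  set a := G.a S L with had
  have hD : 0 < (a * G.theta + G.thetam S) * (1 - G.sigma) := by positivity
  set X := a * G.theta * G.sigma / ((a * G.theta + G.thetam S) * (1 - G.sigma)) with hX
  have hX0 : 0 ≤ X := by positivity
  have h1 : Real.exp (a * h) ≤ 1 + X := by
    have h2 : a * h ≤ Real.log (1 + X) := by
      have h3 := mul_le_mul_of_nonneg_left hh ha.le
      refine h3.trans_eq ?_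
      rw [Design.tau, ← had, ← hX]
      field_simp
    rwa [Real.le_log_iff_exp_le (by linarith)] at h2
  have h4 : G.thetam S * ((Real.exp (a * h) - 1) / a) ≤ G.theta / (1 - G.sigma) := by
    have h5 : (Real.exp (a * h) - 1) / a ≤ X / a := div_le_div_of_nonneg_right (by linarith) ha.le
    refine (mul_le_mul_of_nonneg_left h5 hm).trans ?_
    have h6 : G.thetam S * (X / a) = G.theta / (1 - G.sigma) *
        (G.thetam S * G.sigma / (a * G.theta + G.thetam S)) := by rw [hX]; field_simp
    rw [h6]
    refine mul_le_of_le_one_right (by positivity) ?_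
    rw [div_le_one (by positivity)]
    have := mul_le_mul_of_nonneg_left hG.sigma_mem.2.le hm
    have : 0 < a * G.theta := by positivity
    linarith
  refine (mul_le_mul_of_nonneg_right h4 hε).trans_eq ?_
  unfold Design.kappa
  ring

end Design.Admissible

/-! ### The feedback as a functional of the backstepping variables -/

lemma Prim.eq_of_mem {F f : ℝ → ℝ} {a b x y : ℝ} (h : Prim F f a b) (hx : x ∈ Icc a b)
    (hy : y ∈ Icc a b) : F y = F x + ∫ s in x..y, f s := by
  rw [h.eq y hy, h.eq x hx, add_assoc, intervalIntegral.integral_add_adjacent_intervals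
    (h.int' le_rfl hx.1 hx.2)]
  rcases le_total x y with hxy | hxy
  · exact h.int' hx.1 hxy hy.2
  · exact (h.int' hy.1 hxy hx.2).symm

lemma IsInflow.outflow {ℓ c x₀ : ℝ} (h : IsInflow ℓ c x₀) : x₀ + c * (ℓ / |c|) = ℓ - x₀ := by
  rcases h with ⟨hc, rfl⟩ | ⟨hc, rfl⟩
  · rw [abs_of_pos hc]; field_simp; ring
  · have := hc.ne
    rw [abs_of_neg hc, div_neg]; field_simp; ring

lemma IsInflow.mem_Icc {ℓ c x₀ σ : ℝ} (h : IsInflow ℓ c x₀) (hσ : σ ∈ Icc 0 (ℓ / |c|)) :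
    x₀ + c * σ ∈ Icc 0 ℓ := by
  have hc0 : 0 < |c| := abs_pos.2 h.ne
  have h1 : |c| * σ ≤ ℓ := by
    have := mul_le_mul_of_nonneg_left hσ.2 hc0.le
    rwa [mul_div_cancel₀ _ hc0.ne'] at this
  have h2 : 0 ≤ |c| * σ := mul_nonneg hc0.le hσ.1
  rcases h with ⟨hc, rfl⟩ | ⟨hc, rfl⟩
  · rw [abs_of_pos hc] at h1 h2; exact ⟨by linarith, by linarith⟩
  · rw [abs_of_neg hc] at h1 h2; exact ⟨by linarith, by linarith⟩

/-- The pairing of a travelling profile with an `H¹` function is a primitive. -/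
lemma prim_pair_prof {ℓ c x₀ a b : ℝ} (h : IsInflow ℓ c x₀) (hℓ : 0 ≤ ℓ) {A F f : ℝ → ℝ}
    (hA : LocSq A) (hF : Prim F f 0 ℓ) (ha : 0 ≤ a) (hab : a ≤ b) :
    Prim (fun t => pair (prof ℓ c x₀ A t) F) (fun s => |c| * (F x₀ * A s -
      F (ℓ - x₀) * A (s - ℓ / |c|)) + c * pair (prof ℓ c x₀ A s) f) a b := by
  have hτ : 0 ≤ ℓ / |c| := div_nonneg hℓ (abs_nonneg _)
  have m0 : x₀ ∈ Icc 0 ℓ := by simpa using h.mem_Icc (left_mem_Icc.2 hτ)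
  have hχ : Prim (fun σ => F (x₀ + c * σ)) (fun σ => c * f (x₀ + c * σ)) 0 (ℓ / |c|) := by
    refine ⟨hτ, ?_, fun σ hσ => ?_⟩
    · have h1 : IntervalIntegrable f volume x₀ (ℓ - x₀) := by
        rcases h with ⟨-, rfl⟩ | ⟨-, rfl⟩
        · simpa using hF.int
        · simpa using hF.int.symm
      have h2 : IntervalIntegrable f volume (x₀ + c * 0) (x₀ + c * (ℓ / |c|)) := by
        rwa [mul_zero, add_zero, h.outflow]
      have h3 := (h2.comp_add_left x₀).comp_mul_left (c := c)
      simp only [add_sub_cancel_left, mul_div_cancel_left₀ _ h.ne] at h3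
      exact h3.const_mul c
    · rw [mul_zero, add_zero, intervalIntegral.integral_const_mul,
        intervalIntegral.integral_comp_add_mul _ h.ne, mul_zero, add_zero, smul_eq_mul,
        mul_inv_cancel_left₀ h.ne]
      exact hF.eq_of_mem m0 (h.mem_Icc hσ)
  have hp := (prim_delay hA.1 hτ ha hab hχ).const_mul |c|
  have e1 : (fun t => pair (prof ℓ c x₀ A t) F) =
      fun t => |c| * ∫ σ in (0 : ℝ)..(ℓ / |c|), F (x₀ + c * σ) * A (t - σ) :=
    funext fun t => integral_prof_mul hA h hℓ t F
  rw [e1]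
  refine hp.congr_deriv (Filter.Eventually.of_forall fun s _ => ?_)
  have e2 : pair (prof ℓ c x₀ A s) f = |c| * ∫ σ in (0 : ℝ)..(ℓ / |c|), f (x₀ + c * σ) * A (s - σ) :=
    integral_prof_mul hA h hℓ s f
  rw [e2]
  simp only [mul_zero, add_zero, h.outflow, mul_assoc c, intervalIntegral.integral_const_mul]
  ring

/-- This is the second row minus ρ times the first row of (1 - K)(1 + L) = 1, evaluated at x = ℓ. -/
lemma row_identity {S : Plant} (hS : S.Admissible) {K L : Kernels} (hK : IsControlKernel S K)
    (hL : IsInverseKernel S L) (j : Fin 2) {ξ : ℝ} (hξ : ξ ∈ Ioo 0 S.ℓ) :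
    L.mat 1 j S.ℓ ξ - S.rho * L.mat 0 j S.ℓ ξ = (K.mat 1 j S.ℓ ξ - S.rho * K.mat 0 j S.ℓ ξ) +
      (adj S.ℓ (L.mat 0 j) (Nu S K) ξ + adj S.ℓ (L.mat 1 j) (Nv S K) ξ) := by
  have hp : (S.ℓ, ξ) ∈ triangle S.ℓ := ⟨hξ.1.le, hξ.2.le, le_rfl⟩
  have h0 := control_comp_inverse hS hK hL 0 j hp
  have h1 := control_comp_inverse hS hK hL 1 j hp
  have cK := (hK.ctrlEq.kerEq hS).continuousOn
  have cL := (hL.invEq.kerEq hS).continuousOn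
  have hsub : uIcc ξ S.ℓ ⊆ Icc ξ S.ℓ := by rw [uIcc_of_le hξ.2.le]
  have ii : ∀ i m, IntervalIntegrable (fun s => K.opp.mat i m S.ℓ s * L.mat m j s ξ) volume ξ S.ℓ :=
    fun i m => (((continuousOn_slice_left (cK i m) le_rfl).mono fun s hs =>
      ⟨hξ.1.le.trans (hsub hs).1, (hsub hs).2⟩).mul
      ((continuousOn_slice_right (cL m j) hξ.1.le).mono hsub)).intervalIntegrable
  have e : ∀ m, ∫ s in ξ..S.ℓ, L.mat m j s ξ *
      (-K.opp.mat 1 m S.ℓ s + S.rho * K.opp.mat 0 m S.ℓ s) =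
      -(∫ s in ξ..S.ℓ, K.opp.mat 1 m S.ℓ s * L.mat m j s ξ) +
        S.rho * ∫ s in ξ..S.ℓ, K.opp.mat 0 m S.ℓ s * L.mat m j s ξ := by
    intro m
    rw [neg_add_eq_sub, ← intervalIntegral.integral_const_mul,
      ← intervalIntegral.integral_sub ((ii 0 m).const_mul _) (ii 1 m)]
    refine intervalIntegral.integral_congr fun s _ => ?_
    ring
  have a0 : adj S.ℓ (L.mat 0 j) (Nu S K) ξ = ∫ s in ξ..S.ℓ, L.mat 0 j s ξ *
      (-K.opp.mat 1 0 S.ℓ s + S.rho * K.opp.mat 0 0 S.ℓ s) := by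
    unfold adj
    refine intervalIntegral.integral_congr fun s _ => ?_
    simp only [Nu, Kernels.mat, Kernels.opp, Matrix.cons_val_zero, Matrix.cons_val_one,
      Matrix.cons_val_fin_one]
    ring
  have a1 : adj S.ℓ (L.mat 1 j) (Nv S K) ξ = ∫ s in ξ..S.ℓ, L.mat 1 j s ξ *
      (-K.opp.mat 1 1 S.ℓ s + S.rho * K.opp.mat 0 1 S.ℓ s) := by
    unfold adj
    refine intervalIntegral.integral_congr fun s _ => ?_
    simp only [Nv, Kernels.mat, Kernels.opp, Matrix.cons_val_zero, Matrix.cons_val_one,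
      Matrix.cons_val_fin_one]
    ring
  have o : ∀ i, K.opp.mat i j S.ℓ ξ = -K.mat i j S.ℓ ξ := fun i => by
    fin_cases i <;> fin_cases j <;> rfl
  rw [a0, a1, e, e]
  simp only [compKernel, Fin.sum_univ_two, o] at h0 h1
  linear_combination h1 - S.rho * h0

/-- In the transformed variables the feedback is paired with pure transport, so its rate of change
can be read off from the boundary signals and the derivatives of N^α, N^β. -/
lemma pair_feedback {S : Plant} (hS : S.Admissible) {K L : Kernels} (hK : IsControlKernel S K)
    (hL : IsInverseKernel S L) (w : Fin 2 → L2 S.ℓ) :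
    pair (w 0) (Nu S K) + pair (w 1) (Nv S K) =
      pair (onePlus S.ℓ K.opp.mat w 0) (Nalpha S L) +
        pair (onePlus S.ℓ K.opp.mat w 1) (Nbeta S L) := by
  have cL := (hL.invEq.kerEq hS).continuousOn
  have cu := continuousOn_Nu (S := S) hK.cont
  have cv := continuousOn_Nv (S := S) hK.cont
  have hℓ := hS.ℓ_pos.le
  set γ := onePlus S.ℓ K.opp.mat w with hγ
  have hw : w = onePlus S.ℓ L.mat γ := (kerEq_pair_continuous hS hK hL w).1.symm
  have ca := fun i j => continuousOn_adj hℓ (cL i j) cu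
  have cb := fun i j => continuousOn_adj hℓ (cL i j) cv
  have r0 : pair (γ 0) (Nalpha S L) = pair (γ 0) (Nu S K) +
      (pair (γ 0) (adj S.ℓ (L.mat 0 0) (Nu S K)) + pair (γ 0) (adj S.ℓ (L.mat 1 0) (Nv S K))) := by
    rw [← pair_add _ (ca 0 0) (cb 1 0), ← pair_add _ cu (continuousOn_fun_add (ca 0 0) (cb 1 0))]
    exact pair_congr _ fun ξ hξ => row_identity hS hK hL 0 hξ
  have r1 : pair (γ 1) (Nbeta S L) = pair (γ 1) (Nv S K) +
      (pair (γ 1) (adj S.ℓ (L.mat 0 1) (Nu S K)) + pair (γ 1) (adj S.ℓ (L.mat 1 1) (Nv S K))) := by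
    rw [← pair_add _ (ca 0 1) (cb 1 1), ← pair_add _ cv (continuousOn_fun_add (ca 0 1) (cb 1 1))]
    exact pair_congr _ fun ξ hξ => row_identity hS hK hL 1 hξ
  have e0 := pair_onePlus hℓ cL cu γ 0
  have e1 := pair_onePlus hℓ cL cv γ 1
  rw [← hw] at e0 e1
  rw [e0, e1, r0, r1]
  ring

/-! ### Growth of the closed loop on bounded time intervals -/

/-- The closed loop in terms of the values held on the sampling intervals. -/
structure HeldLoop (S : Plant) (K L P : Kernels) (G : Design) (h m₀ : ℝ) (z : Trajectory S.ℓ)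
    (b : Traces) (m inp : ℝ → ℝ) : Prop where
  obs : PlantObserver S P inp z b
  dyn : DynamicVariable S K L P G m₀ z b inp m
  hold : ∀ (n : ℕ), ∀ t ∈ Ico (n * h) ((n + 1 : ℕ) * h),
    inp t = holdSeq (feedback S K z) m (G.gammaP S L h) h n

lemma exists_holdSeq_eq (U m : ℝ → ℝ) (gamma : ℝ → ℝ → ℝ) (h : ℝ) (n : ℕ) :
    ∃ j ≤ n, holdSeq U m gamma h n = U (j * h) := by
  induction n with
  | zero => exact ⟨0, le_rfl, by simp [holdSeq]⟩
  | succ n ih =>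
    obtain ⟨j, hj, e⟩ := ih
    by_cases hg : 0 < gamma (holdSeq U m gamma h n - U ((n + 1 : ℕ) * h)) (m ((n + 1 : ℕ) * h))
    · exact ⟨n + 1, le_rfl, if_pos hg⟩
    · exact ⟨j, hj.trans n.le_succ, (if_neg hg).trans e⟩

/-- The alternative on which `hold_decay` starts; at n = 0 the input is updated, so d = 0. -/
lemma holdSeq_start (U m : ℝ → ℝ) (gamma : ℝ → ℝ → ℝ) (h : ℝ) (n : ℕ) :
    holdSeq U m gamma h n - U (n * h) = 0 ∨
      gamma (holdSeq U m gamma h n - U (n * h)) (m (n * h)) ≤ 0 := by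
  cases n with
  | zero => left; simp [holdSeq]
  | succ n =>
    by_cases hg : 0 < gamma (holdSeq U m gamma h n - U ((n + 1 : ℕ) * h)) (m ((n + 1 : ℕ) * h))
    · left
      rw [show holdSeq U m gamma h (n + 1) = U ((n + 1 : ℕ) * h) from if_pos hg, sub_self]
    · right
      rw [show holdSeq U m gamma h (n + 1) = holdSeq U m gamma h n from if_neg hg]
      exact not_lt.1 hg

lemma hatNormSq_nonneg {S : Plant} (K : Kernels) (z : Trajectory S.ℓ) (t : ℝ) :
    0 ≤ hatNormSq K z t :=
  add_nonneg (integral_nonneg fun _ => sq_nonneg _) (integral_nonneg fun _ => sq_nonneg _)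

lemma integral_sq_le_of_bound {f : ℝ → ℝ} (hf : L2loc f) {t c : ℝ} (ht : 0 ≤ t)
    (h : ∀ s ∈ Ico 0 t, f s ^ 2 ≤ c) : ∫ s in (0 : ℝ)..t, f s ^ 2 ≤ t * c := by
  have := intervalIntegral.integral_mono_on_of_le_Ioo ht (hf.intervalIntegrable_sq le_rfl ht)
    (intervalIntegrable_const (c := c)) fun s hs => h s ⟨hs.1.le, hs.2⟩
  rwa [intervalIntegral.integral_const, sub_zero, smul_eq_mul] at this

section

variable {S : Plant} {K L P : Kernels} {G : Design} {h : ℝ}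

/-- By induction over sampling intervals: the held value is the feedback at some earlier sample jh,
bounded by the state there, which in turn is bounded by the data and the input before jh. -/
lemma exists_input_bound (hS : S.Admissible) (hrefl : |S.rho * S.q| ≤ 1 / 2)
    (hK : IsControlKernel S K) (hL : IsInverseKernel S L) (hP : IsObserverKernel S P)
    (hh : 0 < h) (n : ℕ) : ∃ B : ℝ, 0 ≤ B ∧ ∀ m₀ z b m inp,
      HeldLoop S K L P G h m₀ z b m inp → ∀ s ∈ Ico 0 (n * h), inp s ^ 2 ≤ B * z.norm 0 ^ 2 := by
  obtain ⟨C, hC, H⟩ := exists_growth hS hrefl hK hL hP (T := n * h) (by positivity)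
  obtain ⟨D, hD, HD⟩ := exists_output_bounds hS hK
  have main : ∀ k ≤ n, ∃ B : ℝ, 0 ≤ B ∧ ∀ m₀ z b m inp,
      HeldLoop S K L P G h m₀ z b m inp →
      ∀ s ∈ Ico 0 ((k : ℝ) * h), inp s ^ 2 ≤ B * z.norm 0 ^ 2 := by
    intro k
    induction k with
    | zero =>
      refine fun _ => ⟨0, le_rfl, fun m₀ z b m inp _ s hs => ?_⟩
      rw [Nat.cast_zero, zero_mul] at hs
      exact absurd hs.2 (not_lt.2 hs.1)
    | succ k ih =>
      intro hk
      obtain ⟨B, hB, HB⟩ := ih (by omega)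
      refine ⟨B + D * (C * (1 + k * h * B)), by positivity, fun m₀ z b m inp hl s hs => ?_⟩
      have n0 := sq_nonneg (z.norm 0)
      by_cases hsk : s < k * h
      · have := HB m₀ z b m inp hl s ⟨hs.1, hsk⟩
        have : 0 ≤ D * (C * (1 + k * h * B)) * z.norm 0 ^ 2 := by positivity
        linarith
      · rw [hl.hold k s ⟨not_lt.1 hsk, hs.2⟩]
        obtain ⟨j, hj, e⟩ := exists_holdSeq_eq (feedback S K z) m (G.gammaP S L h) h k
        have hjk : (j : ℝ) * h ≤ k * h := mul_le_mul_of_nonneg_right (by exact_mod_cast hj) hh.le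
        have hkn : (k : ℝ) * h ≤ n * h :=
          mul_le_mul_of_nonneg_right (by exact_mod_cast (by omega : k ≤ n)) hh.le
        have hj0 : (0 : ℝ) ≤ j * h := by positivity
        have h1 := (H inp z b hl.obs (j * h) ⟨hj0, hjk.trans hkn⟩).1
        have h2 := integral_sq_le_of_bound hl.obs.l2loc_inp hj0 fun s hs' =>
          HB m₀ z b m inp hl s ⟨hs'.1, hs'.2.trans_le hjk⟩
        have h3 : (j : ℝ) * h * (B * z.norm 0 ^ 2) ≤ k * h * (B * z.norm 0 ^ 2) :=
          mul_le_mul_of_nonneg_right hjk (by positivity)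
        have h4 := mul_le_mul_of_nonneg_left (h2.trans h3) hC.le
        have h5 := mul_le_mul_of_nonneg_left (h1.trans (by
          linarith : _ ≤ C * (1 + k * h * B) * z.norm 0 ^ 2)) hD.le
        have h6 := (HD z (j * h)).1
        have h7 : 0 ≤ B * z.norm 0 ^ 2 := by positivity
        rw [e]
        linarith
  exact main n le_rfl

/-- Only finitely many sampling intervals precede the convergence of the observer, so crude bounds
linear in the data are enough there and no information on the sign of m is required. -/
theorem exists_loop_growth (hS : S.Admissible) (hrefl : |S.rho * S.q| ≤ 1 / 2)
    (hK : IsControlKernel S K) (hL : IsInverseKernel S L) (hP : IsObserverKernel S P)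
    (hG : G.Admissible S L) (hh : 0 < h) (n : ℕ) : ∃ R : ℝ, 0 < R ∧ ∀ m₀ z b m inp,
      HeldLoop S K L P G h m₀ z b m inp → ∀ t ∈ Icc 0 (n * h),
        z.norm t ^ 2 ≤ R * (z.norm 0 ^ 2 + |m₀|) ∧ |m t| ≤ R * (z.norm 0 ^ 2 + |m₀|) := by
  set T : ℝ := n * h with hT
  have hT0 : 0 ≤ T := by positivity
  obtain ⟨C, hC, H⟩ := exists_growth hS hrefl hK hL hP hT0
  obtain ⟨D, hD, HD⟩ := exists_output_bounds hS hK
  obtain ⟨B, hB, HB⟩ := exists_input_bound (G := G) hS hrefl hK hL hP hh n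
  have hκ0 := hG.kappa_nonneg (Design.Admissible.eps0_nonneg (S := S) (L := L))
  have hκ1 := hG.kappa_nonneg (Design.Admissible.eps1_nonneg (S := S) (L := L))
  have hκ2 : 0 ≤ G.kappa (eps2 S K L P) := hG.kappa_nonneg (mul_nonneg (by norm_num) (sq_nonneg _))
  have hθm := hG.thetam_nonneg hS
  have hη := hG.eta_pos
  set κ0 := G.kappa (eps0 S L)
  set κ1 := G.kappa (eps1 S L)
  set κ2 := G.kappa (eps2 S K L P)
  set R₁ := C * (1 + T * B) with hR₁
  have hR₁0 : 0 < R₁ := by positivity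
  set c := G.thetam S * (2 * B + 2 * (D * R₁)) + κ0 * (D * R₁) with hc
  have hc0 : 0 ≤ c := by positivity
  set E := Real.exp (G.eta * T) with hE
  have hE0 : 0 < E := Real.exp_pos _
  refine ⟨R₁ + (1 + T * c + κ1 * R₁ + κ2 * R₁) * E, by positivity, ?_⟩
  intro m₀ z b m inp hl
  set X := z.norm 0 ^ 2 with hX
  have hX0 : 0 ≤ X := sq_nonneg _
  have hm0 := abs_nonneg m₀
  have hi : ∀ t ∈ Icc 0 T, C * (X + ∫ s in (0 : ℝ)..t, inp s ^ 2) ≤ R₁ * X := fun t ht => by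
    have h1 := integral_sq_le_of_bound hl.obs.l2loc_inp ht.1 fun s hs' =>
      HB m₀ z b m inp hl s ⟨hs'.1, hs'.2.trans_le ht.2⟩
    have h2 : t * (B * X) ≤ T * (B * X) := mul_le_mul_of_nonneg_right ht.2 (by positivity)
    calc _ ≤ C * (X + T * (B * X)) := mul_le_mul_of_nonneg_left (by linarith) hC.le
      _ = _ := by rw [hR₁]; ring
  have hz : ∀ t ∈ Icc 0 T, z.norm t ^ 2 ≤ R₁ * X := fun t ht =>
    (H inp z b hl.obs t ht).1.trans (hi t ht)
  obtain ⟨mc, me⟩ := dynamicVariable_iff.1 hl.dyn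
  have hdyn : ∀ t ∈ Icc 0 T, ∫ s in (0 : ℝ)..t, |dynSource S K L P G z b inp s| ≤
      (T * c + κ1 * R₁ + κ2 * R₁) * X := by
    intro t ht
    have i1 := (l2loc_alphaHatL hK.cont hl.obs).intervalIntegrable_sq le_rfl ht.1
    have i2 := (l2loc_betaTilde0 hl.obs).intervalIntegrable_sq le_rfl ht.1
    have h1 := intervalIntegral.integral_mono_on_of_le_Ioo ht.1
      (hl.obs.intervalIntegrable_dynSource hS hK (L := L) (G := G) le_rfl ht.1).abs
      (((intervalIntegrable_const (c := c * X)).add (i1.const_mul κ1)).add (i2.const_mul κ2))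
      fun s hs => by
        have hs' : s ∈ Icc 0 T := ⟨hs.1.le, hs.2.le.trans ht.2⟩
        have a1 := HB m₀ z b m inp hl s ⟨hs.1.le, hs.2.trans_le ht.2⟩
        have a2 := (HD z s).1.trans (mul_le_mul_of_nonneg_left (hz s hs') hD.le)
        have a3 := (HD z s).2.trans (mul_le_mul_of_nonneg_left (hz s hs') hD.le)
        have a4 : (inp s - feedback S K z s) ^ 2 ≤ 2 * (B * X) + 2 * (D * (R₁ * X)) := by
          nlinarith [sq_nonneg (inp s + feedback S K z s)]
        have a5 := mul_le_mul_of_nonneg_left a4 hθm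
        have a6 := mul_le_mul_of_nonneg_left a3 hκ0
        have a7 := mul_nonneg hθm (sq_nonneg (inp s - feedback S K z s))
        have a8 := mul_nonneg hκ0 (hatNormSq_nonneg K z s)
        have a9 := mul_nonneg hκ1 (sq_nonneg (alphaHatL K z b s))
        have a10 := mul_nonneg hκ2 (sq_nonneg (betaTilde0 b s))
        unfold dynSource
        rw [abs_le]
        constructor <;> simp only [hc] <;> linarith
    rw [intervalIntegral.integral_add
        (intervalIntegrable_fun_add intervalIntegrable_const (i1.const_mul κ1)) (i2.const_mul κ2),
      intervalIntegral.integral_add intervalIntegrable_const (i1.const_mul κ1),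
      intervalIntegral.integral_const_mul κ1, intervalIntegral.integral_const_mul κ2,
      intervalIntegral.integral_const, sub_zero, smul_eq_mul] at h1
    obtain ⟨-, b1, b2⟩ := H inp z b hl.obs t ht
    have b1 := mul_le_mul_of_nonneg_left (b1.trans (hi t ht)) hκ2
    have b2 := mul_le_mul_of_nonneg_left (b2.trans (hi t ht)) hκ1
    have b3 : t * (c * X) ≤ T * (c * X) := mul_le_mul_of_nonneg_right ht.2 (by positivity)
    linarith
  have hm : ∀ t ∈ Icc 0 T, |m t| ≤ (|m₀| + (T * c + κ1 * R₁ + κ2 * R₁) * X) *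
      Real.exp (G.eta * t) := by
    refine le_mul_exp_of_le_add_integral (mc.abs.mono fun x hx => hx.1) hη.le fun t ht => ?_
    have im : IntervalIntegrable m volume 0 t := by
      refine (mc.mono ?_).intervalIntegrable
      rw [uIcc_of_le ht.1]; exact fun x hx => hx.1
    have id := hl.obs.intervalIntegrable_dynSource hS hK (L := L) (G := G) le_rfl ht.1
    rw [me t ht.1, intervalIntegral.integral_add (im.const_mul _) id,
      intervalIntegral.integral_const_mul]
    have h1 := intervalIntegral.abs_integral_le_integral_abs (f := m) (μ := volume) ht.1
    have h2 := intervalIntegral.abs_integral_le_integral_abs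
      (f := dynSource S K L P G z b inp) (μ := volume) ht.1
    have h3 := abs_add_le m₀ (-G.eta * (∫ s in (0 : ℝ)..t, m s) +
      ∫ s in (0 : ℝ)..t, dynSource S K L P G z b inp s)
    have h4 := abs_add_le (-G.eta * (∫ s in (0 : ℝ)..t, m s))
      (∫ s in (0 : ℝ)..t, dynSource S K L P G z b inp s)
    rw [abs_mul, abs_neg, abs_of_pos hη] at h4
    have h5 := mul_le_mul_of_nonneg_left h1 hη.le
    linarith [hdyn t ht]
  intro t ht
  have p1 : 0 ≤ (1 + T * c + κ1 * R₁ + κ2 * R₁) * E * (X + |m₀|) := by positivity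
  have p2 : 0 ≤ R₁ * |m₀| := by positivity
  have p3 : 0 ≤ R₁ * (X + |m₀|) := by positivity
  constructor
  · have := hz t ht
    linarith
  · have h1 : Real.exp (G.eta * t) ≤ E := Real.exp_le_exp.2 (mul_le_mul_of_nonneg_left ht.2 hη.le)
    have p4 : 0 ≤ |m₀| + (T * c + κ1 * R₁ + κ2 * R₁) * X := by positivity
    have h2 := (hm t ht).trans (mul_le_mul_of_nonneg_left h1 p4)
    have p5 : 0 ≤ X * E := by positivity
    have p6 : 0 ≤ (T * c + κ1 * R₁ + κ2 * R₁) * |m₀| * E := by positivity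
    linarith

end

/-! ### The closed loop after the convergence of the observer -/

lemma Prim.congr {F G f : ℝ → ℝ} {a b : ℝ} (h : Prim F f a b) (e : ∀ x ∈ Icc a b, F x = G x) :
    Prim G f a b :=
  ⟨h.le, h.int, fun x hx => by rw [← e x hx, ← e a ⟨le_rfl, h.le⟩, h.eq x hx]⟩

/-! ### The Lyapunov functional and the rate of the feedback. -/

/-- A window with an affine weight. -/
lemma weighted_window {Q : ℝ → ℝ} (hQ : LocInt Q) (hQ0 : ∀ s, 0 ≤ Q s) {c ℓ : ℝ} (hc : 0 < c)
    (hℓ : 0 ≤ ℓ) (p : ℝ) {e : ℝ} (he : 0 ≤ e) :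
    (∀ t, p * (∫ σ in (0 : ℝ)..(ℓ / c), Q (t - σ)) ≤
        ∫ σ in (0 : ℝ)..(ℓ / c), (p + e * (ℓ - c * σ)) * Q (t - σ) ∧
      ∫ σ in (0 : ℝ)..(ℓ / c), (p + e * (ℓ - c * σ)) * Q (t - σ) ≤
        (p + e * ℓ) * ∫ σ in (0 : ℝ)..(ℓ / c), Q (t - σ)) ∧
    ∀ a b, 0 ≤ a → a ≤ b →
      Prim (fun t => ∫ σ in (0 : ℝ)..(ℓ / c), (p + e * (ℓ - c * σ)) * Q (t - σ))
        (fun s => (p + e * ℓ) * Q s - p * Q (s - ℓ / c) -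
          e * (c * ∫ σ in (0 : ℝ)..(ℓ / c), Q (s - σ))) a b := by
  have hτ : 0 ≤ ℓ / c := div_nonneg hℓ hc.le
  have cχ : Continuous fun σ : ℝ => p + e * (ℓ - c * σ) := by fun_prop
  have iq := fun t => hQ.comp_sub_left t 0 (ℓ / c)
  have iχ := fun t => (iq t).continuousOn_mul cχ.continuousOn
  have hb : ∀ σ ∈ Icc 0 (ℓ / c), 0 ≤ e * (ℓ - c * σ) ∧ e * (ℓ - c * σ) ≤ e * ℓ := fun σ hσ => by
    have h1 := mul_le_mul_of_nonneg_left hσ.2 hc.le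
    rw [mul_div_cancel₀ _ hc.ne'] at h1
    exact ⟨mul_nonneg he (by linarith),
      mul_le_mul_of_nonneg_left (by linarith [mul_nonneg hc.le hσ.1]) he⟩
  refine ⟨fun t => ⟨?_, ?_⟩, fun a b ha hab => ?_⟩
  · rw [← intervalIntegral.integral_const_mul]
    exact intervalIntegral.integral_mono_on hτ ((iq t).const_mul _) (iχ t) fun σ hσ =>
      mul_le_mul_of_nonneg_right (by linarith [(hb σ hσ).1]) (hQ0 _)
  · rw [← intervalIntegral.integral_const_mul]
    exact intervalIntegral.integral_mono_on hτ (iχ t) ((iq t).const_mul _) fun σ hσ =>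
      mul_le_mul_of_nonneg_right (by linarith [(hb σ hσ).2]) (hQ0 _)
  · have hd : ∀ x : ℝ, HasDerivAt (fun σ : ℝ => p + e * (ℓ - c * σ)) (-(e * c)) x := fun x => by
      have := (((hasDerivAt_id x).const_mul c).const_sub ℓ).const_mul e |>.const_add p
      refine HasDerivAt.congr_deriv (f := fun σ : ℝ => p + e * (ℓ - c * σ)) this ?_
      ring
    refine (prim_delay hQ hτ ha hab (Prim.of_hasDerivAt hτ hd continuous_const)).congr_deriv
      (Filter.Eventually.of_forall fun s _ => ?_)
    rw [intervalIntegral.integral_const_mul, mul_div_cancel₀ _ hc.ne']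
    ring

/-- The parameter ε₀ is written with `deriv`, whereas the estimates use the density of the
primitive; the two agree almost everywhere. -/
lemma MemH1.exists_prim {ℓ : ℝ} (hℓ : 0 ≤ ℓ) {f : ℝ → ℝ} (h : MemH1 ℓ f) :
    ∃ g, MemLp g 2 (volume.restrict (Ioo (0 : ℝ) ℓ)) ∧ Prim f g 0 ℓ ∧
      ∫ ξ in Ioo (0 : ℝ) ℓ, deriv f ξ ^ 2 = ∫ ξ in Ioo (0 : ℝ) ℓ, g ξ ^ 2 := by
  obtain ⟨g, hg, e⟩ := h
  have hi : IntervalIntegrable g volume 0 ℓ := by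
    rw [intervalIntegrable_iff_integrableOn_Ioo_of_le hℓ]
    exact hg.integrable one_le_two
  refine ⟨g, hg, ⟨hℓ, hi, e⟩, setIntegral_congr_ae measurableSet_Ioo ?_⟩
  filter_upwards [ae_hasDerivAt_prim hℓ hi e] with x hx hm
  rw [(hx hm).deriv]

/-- Four would suffice for four terms; 5 is the factor built into the parameters ε_i. -/
lemma sq_four_le (p q r s : ℝ) : (p - q - r + s) ^ 2 ≤ 5 * (p ^ 2 + q ^ 2 + r ^ 2 + s ^ 2) := by
  have h : 5 * (p ^ 2 + q ^ 2 + r ^ 2 + s ^ 2) - (p - q - r + s) ^ 2 = (p + q) ^ 2 + (p + r) ^ 2 +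
      (p - s) ^ 2 + (q - r) ^ 2 + (q + s) ^ 2 + (r + s) ^ 2 +
      (p ^ 2 + q ^ 2 + r ^ 2 + s ^ 2) := by ring
  have : 0 ≤ (p + q) ^ 2 + (p + r) ^ 2 + (p - s) ^ 2 + (q - r) ^ 2 + (q + s) ^ 2 + (r + s) ^ 2 +
      (p ^ 2 + q ^ 2 + r ^ 2 + s ^ 2) := by positivity
  linarith

lemma output_rate_sq_le {x₁ x₂ y d n₁ n₂ i₁ i₂ l₁ l₂ c₃ c₄ : ℝ} (h₁ : x₁ ^ 2 ≤ n₁ ^ 2 * i₁)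
    (h₂ : x₂ ^ 2 ≤ n₂ ^ 2 * i₂) :
    (l₁ * x₁ - l₂ * x₂ - c₃ * y + c₄ * d) ^ 2 ≤
      5 * max (l₁ ^ 2 * i₁) (l₂ ^ 2 * i₂) * (n₁ ^ 2 + n₂ ^ 2) + 5 * c₃ ^ 2 * y ^ 2 +
        5 * c₄ ^ 2 * d ^ 2 := by
  have m1 := mul_le_mul_of_nonneg_left h₁ (sq_nonneg l₁)
  have m2 := mul_le_mul_of_nonneg_left h₂ (sq_nonneg l₂)
  have k1 := mul_le_mul_of_nonneg_right (le_max_left (l₁ ^ 2 * i₁) (l₂ ^ 2 * i₂)) (sq_nonneg n₁)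
  have k2 := mul_le_mul_of_nonneg_right (le_max_right (l₁ ^ 2 * i₁) (l₂ ^ 2 * i₂)) (sq_nonneg n₂)
  refine (sq_four_le _ _ _ _).trans ?_
  simp only [mul_pow]
  linarith

/-- At x = 0 the inflow of α and the outflow of β cancel exactly, by the choice of the weight q²(C +
g). At x = ℓ the estimate (ρy + d)² ≤ 2ρ²y² + 2d² costs at most θ_m(ρ²y² + d²), and the outflow C y²
pays for ρ²θ_m y² with κ₁ y² to spare. -/
lemma boundary_terms_le {C g q ρ b y d θ κ p₁ p₂ e : ℝ} (hg : 0 ≤ q ^ 2 * (C + g) + g)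
    (hθ : 2 * (q ^ 2 * (C + g) + g) ≤ θ) (hκ : ρ ^ 2 * θ + κ ≤ C) :
    (C + g) * (q * b) ^ 2 - C * y ^ 2 - e * p₁ +
      ((q ^ 2 * (C + g) + g) * (ρ * y + d) ^ 2 - q ^ 2 * (C + g) * b ^ 2 - e * p₂) ≤
      -e * (p₁ + p₂) + (θ * d ^ 2 - κ * y ^ 2) := by
  have k1 := mul_nonneg hg (sq_nonneg (ρ * y - d))
  have k2 := mul_le_mul_of_nonneg_right hθ (sq_nonneg d)
  have k3 := mul_le_mul_of_nonneg_right hκ (sq_nonneg y)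
  have k4 := mul_le_mul_of_nonneg_right hθ (sq_nonneg (ρ * y))
  linarith

section

variable {S : Plant} {K L P : Kernels} {G : Design} {inp : ℝ → ℝ} {z : Trajectory S.ℓ} {b : Traces}

open Design.Admissible in
-- After the horizon the observer variables are the profiles of the plant signals A and B. The rate
-- of U is then that of two pairings with transported profiles, and V is a sum of two weighted
-- windows of A² and B². Since ṽ(0,t) = 0, the injection contributes nothing to either rate.
theorem PlantObserver.exists_lyapunov (hS : S.Admissible) (hK : IsControlKernel S K)
    (hL : IsInverseKernel S L) (hP : IsObserverKernel S P) (hNa : MemH1 S.ℓ (Nalpha S L))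
    (hNb : MemH1 S.ℓ (Nbeta S L)) (hG : G.Admissible S L) (h : PlantObserver S P inp z b) :
    ∃ V v u : ℝ → ℝ,
      (∀ x y, S.horizon ≤ x → x ≤ y → Prim (feedback S K z) u x y ∧ Prim V v x y) ∧
      (∀ᵐ t ∂(volume.restrict (Ioi (0 : ℝ))), S.horizon < t → betaTilde0 b t = 0 ∧
        u t ^ 2 ≤ eps0 S L * hatNormSq K z t + eps1 S L * alphaHatL K z b t ^ 2 +
          eps3 S L * (inp t - feedback S K z t) ^ 2 ∧
        v t ≤ -rate G S * hatNormSq K z t + (G.thetam S * (inp t - feedback S K z t) ^ 2 -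
          G.kappa (eps1 S L) * alphaHatL K z b t ^ 2)) ∧
      ∀ t, S.horizon ≤ t →
        hatNormSq K z t ≤ (S.lam1 / G.C + S.lam2 / (S.q ^ 2 * G.C)) * V t ∧
        V t ≤ ((G.C + rate G S * S.ℓ) / S.lam1 + G.thetam S / S.lam2) * hatNormSq K z t := by
  have hℓ := hS.ℓ_pos
  have h1 := hS.lam1_pos
  have h2 := hS.lam2_pos
  have hq := hS.q_ne
  have hq2 : 0 < S.q ^ 2 := by positivity
  obtain ⟨hC, hκe⟩ := hG.kappa_eps0_lt_rate hS
  have he : 0 ≤ rate G S := (hG.kappa_nonneg eps0_nonneg).trans hκe.le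
  have hw := hG.weight_le_thetam hS
  have hκ1 := hG.kappa_eps1_le hS
  have hT := hS.horizon_pos
  obtain ⟨_, -, HE⟩ := exists_error_estimate hS hP
  obtain ⟨-, hobs, htr⟩ := HE inp z b h
  obtain ⟨A, B, hd, eA, eB, eL⟩ := h.exists_plant_rep hS hK
  obtain ⟨ga, ga2, pa, da⟩ := hNa.exists_prim hℓ.le
  obtain ⟨gb, gb2, pb, db⟩ := hNb.exists_prim hℓ.le
  set C := G.C
  set e := rate G S
  have nA : ∀ t, ‖prof S.ℓ S.lam1 0 A t‖ ^ 2 = S.lam1 * ∫ σ in (0 : ℝ)..(S.ℓ / S.lam1),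
      A (t - σ) ^ 2 := fun t => by
    rw [norm_prof_sq hd.sqA hS.inflow_left hℓ.le, abs_of_pos h1]
  have nB : ∀ t, ‖prof S.ℓ (-S.lam2) S.ℓ B t‖ ^ 2 = S.lam2 * ∫ σ in (0 : ℝ)..(S.ℓ / S.lam2),
      B (t - σ) ^ 2 := fun t => by
    rw [norm_prof_sq hd.sqB hS.inflow_right hℓ.le, abs_neg, abs_of_pos h2]
  have hN : ∀ t, S.horizon ≤ t → hatNormSq K z t =
      ‖prof S.ℓ S.lam1 0 A t‖ ^ 2 + ‖prof S.ℓ (-S.lam2) S.ℓ B t‖ ^ 2 := fun t ht => by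
    rw [hatNormSq_eq hS hK, ← hobs t ht, ← hd.eqA t (hT.le.trans ht), ← hd.eqB t (hT.le.trans ht),
      nsq]
  have hU : ∀ t, S.horizon ≤ t → pair (prof S.ℓ S.lam1 0 A t) (Nalpha S L) +
      pair (prof S.ℓ (-S.lam2) S.ℓ B t) (Nbeta S L) = feedback S K z t := fun t ht => by
    rw [feedback_eq, ← hobs t ht, pair_feedback hS hK hL, ← hd.eqA t (hT.le.trans ht),
      ← hd.eqB t (hT.le.trans ht)]
  -- Both weights decrease affinely with slope e in the direction of travel, which produces -e times
  -- the squared norm. They run from C + eℓ to C for A, and from q²(C + eℓ) + eℓ to q²(C + eℓ) for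
  -- B.
  obtain ⟨b1, P1⟩ := weighted_window hd.sqA.2 (fun s => sq_nonneg (A s)) h1 hℓ.le C he
  obtain ⟨b2, P2⟩ := weighted_window hd.sqB.2 (fun s => sq_nonneg (B s)) h2 hℓ.le
    (S.q ^ 2 * (C + e * S.ℓ)) he
  refine ⟨_, _, _, fun x y hx hxy => ⟨((prim_pair_prof hS.inflow_left hℓ.le hd.sqA pa
    (hT.le.trans hx) hxy).add (prim_pair_prof hS.inflow_right hℓ.le hd.sqB pb
    (hT.le.trans hx) hxy)).congr fun t ht => hU t (hx.trans ht.1),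
    (P1 x y (hT.le.trans hx) hxy).add (P2 x y (hT.le.trans hx) hxy)⟩, ?_, fun t ht => ?_⟩
  · have hcol : S.lam2 * Nbeta S L 0 = S.q * S.lam1 * Nalpha S L 0 := by
      have m : S.ℓ ∈ Icc 0 S.ℓ := ⟨hℓ.le, le_rfl⟩
      simp only [Nbeta, Nalpha, hL.bc11 _ m, hL.bc22 _ m]
      field_simp
    filter_upwards [eA, eB, eL, htr] with t a1 a2 a3 a4 ht
    have hαL : alphaHatL K z b t = A (t - S.ℓ / S.lam1) := by
      rw [alphaHatL_eq, ← (a4 ht).2, ← a3, ← hobs t ht.le]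
      rfl
    have hdt : B t = S.rho * A (t - S.ℓ / S.lam1) + (inp t - feedback S K z t) := by
      rw [a2, feedback_eq, ← hobs t ht.le]
      rfl
    refine ⟨(a4 ht).1, ?_, ?_⟩
    · have c1 := integral_mul_sq_le (Lp.memLp (prof S.ℓ S.lam1 0 A t)) ga2
      have c2 := integral_mul_sq_le (Lp.memLp (prof S.ℓ (-S.lam2) S.ℓ B t)) gb2
      rw [← L2.norm_sq, ← da] at c1
      rw [← L2.norm_sq, ← db] at c2
      change pair _ _ ^ 2 ≤ _ at c1
      change pair _ _ ^ 2 ≤ _ at c2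
      rw [hN t ht.le, hαL, sub_self, sub_zero, abs_neg, abs_of_pos h1, abs_of_pos h2]
      set x1 := pair (prof S.ℓ S.lam1 0 A t) ga
      set x2 := pair (prof S.ℓ (-S.lam2) S.ℓ B t) gb
      set y := A (t - S.ℓ / S.lam1)
      set d := inp t - feedback S K z t
      have hu : S.lam1 * (Nalpha S L 0 * A t - Nalpha S L S.ℓ * y) + S.lam1 * x1 +
          (S.lam2 * (Nbeta S L S.ℓ * B t - Nbeta S L 0 * B (t - S.ℓ / S.lam2)) + -S.lam2 * x2) =
          S.lam1 * x1 - S.lam2 * x2 - (S.lam1 * Nalpha S L S.ℓ - S.rho * S.lam2 * Nbeta S L S.ℓ) * y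
            + S.lam2 * Nbeta S L S.ℓ * d := by
        rw [a1, hdt]
        linear_combination (-B (t - S.ℓ / S.lam2)) * hcol
      rw [hu]
      exact output_rate_sq_le c1 c2
    · rw [hN t ht.le, hαL, nA, nB, a1, hdt]
      exact boundary_terms_le (by positivity) hw hκ1
  · rw [hN t ht, nA, nB]
    have i1 : 0 ≤ ∫ σ in (0 : ℝ)..(S.ℓ / S.lam1), A (t - σ) ^ 2 :=
      intervalIntegral.integral_nonneg (div_pos hℓ h1).le fun _ _ => sq_nonneg _
    have i2 : 0 ≤ ∫ σ in (0 : ℝ)..(S.ℓ / S.lam2), B (t - σ) ^ 2 :=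
      intervalIntegral.integral_nonneg (div_pos hℓ h2).le fun _ _ => sq_nonneg _
    obtain ⟨l1, u1⟩ := b1 t
    obtain ⟨l2, u2⟩ := b2 t
    set I1 := ∫ σ in (0 : ℝ)..(S.ℓ / S.lam1), A (t - σ) ^ 2
    set I2 := ∫ σ in (0 : ℝ)..(S.ℓ / S.lam2), B (t - σ) ^ 2
    set W1 := ∫ σ in (0 : ℝ)..(S.ℓ / S.lam1), (C + e * (S.ℓ - S.lam1 * σ)) * A (t - σ) ^ 2
    set W2 := ∫ σ in (0 : ℝ)..(S.ℓ / S.lam2),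
      (S.q ^ 2 * (C + e * S.ℓ) + e * (S.ℓ - S.lam2 * σ)) * B (t - σ) ^ 2
    have q1 : 0 ≤ W1 := (mul_nonneg hC.le i1).trans l1
    have q2 : 0 ≤ W2 := (mul_nonneg (by positivity) i2).trans l2
    have l3 : S.q ^ 2 * C * I2 ≤ W2 := by
      have : 0 ≤ S.q ^ 2 * (e * S.ℓ) * I2 := by positivity
      linarith
    constructor
    · have r1 : S.lam1 * I1 ≤ S.lam1 / C * W1 := by
        calc _ = S.lam1 / C * (C * I1) := by field_simp
          _ ≤ _ := mul_le_mul_of_nonneg_left l1 (by positivity)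
      have r2 : S.lam2 * I2 ≤ S.lam2 / (S.q ^ 2 * C) * W2 := by
        calc _ = S.lam2 / (S.q ^ 2 * C) * (S.q ^ 2 * C * I2) := by field_simp
          _ ≤ _ := mul_le_mul_of_nonneg_left l3 (by positivity)
      have r3 : 0 ≤ S.lam2 / (S.q ^ 2 * C) * W1 := by positivity
      have r4 : 0 ≤ S.lam1 / C * W2 := by positivity
      linarith
    · have hθ := hG.thetam_nonneg hS
      have r1 : W1 ≤ (C + e * S.ℓ) / S.lam1 * (S.lam1 * I1) := by
        refine u1.trans_eq ?_
        field_simp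
      have r2 : W2 ≤ G.thetam S / S.lam2 * (S.lam2 * I2) := by
        refine (u2.trans (mul_le_mul_of_nonneg_right (?_ : _ ≤ G.thetam S) i2)).trans_eq ?_
        · have : 0 ≤ S.q ^ 2 * (C + e * S.ℓ) + e * S.ℓ := by positivity
          linarith
        · field_simp
      have r3 : 0 ≤ (C + e * S.ℓ) / S.lam1 * (S.lam2 * I2) := by positivity
      have r4 : 0 ≤ G.thetam S / S.lam2 * (S.lam1 * I1) := by positivity
      linarith

end

/-! ### Exponential convergence of the closed loop -/

lemma prim_of_eq_add_integral {m f : ℝ → ℝ} {m₀ a b : ℝ} (h : ∀ t, 0 ≤ t →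
    m t = m₀ + ∫ s in (0 : ℝ)..t, f s) (hf : ∀ x y, 0 ≤ x → x ≤ y →
    IntervalIntegrable f volume x y) (ha : 0 ≤ a) (hab : a ≤ b) : Prim m f a b := by
  refine ⟨hab, hf a b ha hab, fun x hx => ?_⟩
  rw [h x (ha.trans hx.1), h a ha, add_assoc, intervalIntegral.integral_add_adjacent_intervals
    (hf 0 a le_rfl ha) (hf a x ha hx.1)]

/-- Decay on every sampling interval gives decay on a half-line. -/
lemma decay_of_steps {m : ℝ → ℝ} {η h : ℝ} (hh : 0 < h) {n₁ : ℕ}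
    (H : ∀ n, n₁ ≤ n → ∀ t ∈ Icc (n * h) (n * h + h),
      m t ≤ Real.exp (-η * (t - n * h)) * max (m (n * h)) 0) {t : ℝ} (ht : n₁ * h ≤ t) :
    m t ≤ Real.exp (-η * (t - n₁ * h)) * max (m (n₁ * h)) 0 := by
  have ind : ∀ n, n₁ ≤ n →
      max (m (n * h)) 0 ≤ Real.exp (-η * (n * h - n₁ * h)) * max (m (n₁ * h)) 0 := by
    intro n hn
    induction n, hn using Nat.le_induction with
    | base => simp
    | succ n hn ih =>
      refine max_le ?_ (by positivity)
      have e : ((n + 1 : ℕ) : ℝ) * h = n * h + h := by push_cast; ring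
      rw [e]
      refine (H n hn _ ⟨by linarith, le_rfl⟩).trans
        ((mul_le_mul_of_nonneg_left ih (Real.exp_pos _).le).trans_eq ?_)
      rw [← mul_assoc, ← Real.exp_add]
      ring_nf
  have t0 : 0 ≤ t := le_trans (by positivity) ht
  have hf := Nat.floor_le (div_nonneg t0 hh.le)
  have hc := Nat.lt_floor_add_one (t / h)
  rw [le_div_iff₀ hh] at hf
  rw [div_lt_iff₀ hh] at hc
  have hn : n₁ ≤ ⌊t / h⌋₊ := Nat.le_floor ((le_div_iff₀ hh).2 ht)
  refine (H _ hn t ⟨hf, by linarith⟩).trans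
    ((mul_le_mul_of_nonneg_left (ind _ hn) (Real.exp_pos _).le).trans_eq ?_)
  rw [← mul_assoc, ← Real.exp_add]
  ring_nf

section

variable {S : Plant} {K L P : Kernels} {G : Design} {h : ℝ}

open Design.Admissible in
-- From the sampling instant n₁h on, the observer is exact. The positive part of m decays across all
-- sampling intervals, V decays as a consequence, and V is equivalent to the squared norm of the
-- transformed state.
theorem exists_loop_decay (hS : S.Admissible) (hK : IsControlKernel S K)
    (hL : IsInverseKernel S L) (hP : IsObserverKernel S P) (hNa : MemH1 S.ℓ (Nalpha S L))
    (hNb : MemH1 S.ℓ (Nbeta S L)) (hG : G.Admissible S L) (hh : 0 < h) (hτ : h ≤ G.tau S L)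
    {n₁ : ℕ} (hn₁ : S.horizon ≤ n₁ * h) :
    ∃ R ε : ℝ, 0 < R ∧ 0 < ε ∧ ∀ m₀ z b m inp, HeldLoop S K L P G h m₀ z b m inp →
      ∀ t, n₁ * h ≤ t → z.norm t ^ 2 ≤
        R * Real.exp (-ε * (t - n₁ * h)) * (z.norm (n₁ * h) ^ 2 + |m (n₁ * h)|) := by
  have hℓ := hS.ℓ_pos
  have h1 := hS.lam1_pos
  have h2 := hS.lam2_pos
  have hq2 : 0 < S.q ^ 2 := by have := hS.q_ne; positivity
  have hT := hS.horizon_pos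
  have hη := hG.eta_pos
  have hθm := hG.thetam_nonneg hS
  obtain ⟨hC, hκe⟩ := hG.kappa_eps0_lt_rate hS
  have hκ0 := hG.kappa_nonneg (eps0_nonneg (S := S) (L := L))
  have he : 0 < rate G S := hκ0.trans_lt hκe
  obtain ⟨_, -, HE⟩ := exists_error_estimate hS hP
  obtain ⟨D, hD, HD⟩ := exists_output_bounds hS hK
  obtain ⟨C₃, hC₃, H₃⟩ := exists_nsq_le (onePlus S.ℓ L.mat)
  set cV := (G.C + rate G S * S.ℓ) / S.lam1 + G.thetam S / S.lam2 with hcV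
  have hcV0 : 0 < cV := by positivity
  set cN := S.lam1 / G.C + S.lam2 / (S.q ^ 2 * G.C) with hcN
  have hcN0 : 0 < cN := by positivity
  -- The first entry turns the surplus e - κ₀ into a decay rate for V, which is at most cV times the
  -- squared norm; the second is the decay rate of m.
  set ε := min ((rate G S - G.kappa (eps0 S L)) / cV) G.eta with hε
  have hε0 : 0 < ε := lt_min (div_pos (sub_pos.2 hκe) hcV0) hη
  -- The factor 2 appears because plant and observer coincide. The 3 bounds -m + 2 max(m, 0) by
  -- 3|m|, and D compares the transformed norm with the original one.
  refine ⟨2 * C₃ * cN * (cV * D + 3), ε, by positivity, hε0, ?_⟩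
  intro m₀ z b m inp hl t ht
  obtain ⟨-, hobs, -⟩ := HE inp z b hl.obs
  obtain ⟨V, v, u, hVu, hae, hVN⟩ := hl.obs.exists_lyapunov hS hK hL hP hNa hNb hG
  obtain ⟨-, me⟩ := dynamicVariable_iff.1 hl.dyn
  have τ0 : (0 : ℝ) ≤ n₁ * h := by positivity
  have hm : ∀ x y, 0 ≤ x → x ≤ y →
      Prim m (fun s => -G.eta * m s + dynSource S K L P G z b inp s) x y := by
    have mc := hl.dyn.cont
    refine fun x y => prim_of_eq_add_integral me fun x y hx hxy => IntervalIntegrable.add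
      (IntervalIntegrable.const_mul (ContinuousOn.intervalIntegrable (mc.mono ?_)) _)
      (hl.obs.intervalIntegrable_dynSource hS hK hx hxy)
    rw [uIcc_of_le hxy]
    exact fun s hs => hx.trans hs.1
  have hae' := (ae_restrict_iff' measurableSet_Ioi).1 hae
  have hmd : ∀ t, n₁ * h ≤ t →
      m t ≤ Real.exp (-G.eta * (t - n₁ * h)) * max (m (n₁ * h)) 0 := by
    refine fun t => decay_of_steps hh fun n hn t ht => ?_
    have hn' : (n₁ : ℝ) * h ≤ n * h := mul_le_mul_of_nonneg_right (by exact_mod_cast hn) hh.le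
    have n0 : 0 ≤ (n : ℝ) * h := τ0.trans hn'
    have e : ((n + 1 : ℕ) : ℝ) * h = n * h + h := by push_cast; ring
    have hi : ∀ s ∈ Ioo ((n : ℝ) * h) (n * h + h),
        inp s = holdSeq (feedback S K z) m (G.gammaP S L h) h n := fun s hs =>
      hl.hold n s ⟨hs.1.le, by rw [e]; exact hs.2⟩
    refine hold_decay (ε0 := eps0 S L) (ε1 := eps1 S L) (a := G.a S L) (θm := G.thetam S)
      (θ := G.theta) (N := hatNormSq K z)
      (y := alphaHatL K z b) (U := feedback S K z) rfl hG.a_pos hG.theta_pos.le hθm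
      eps0_nonneg eps1_nonneg (hG.gap_le_kappa hS hτ eps0_nonneg)
      (hG.gap_le_kappa hS hτ eps1_nonneg) (hm _ _ n0 (by linarith))
      (hVu _ _ (hn₁.trans hn') (by linarith)).1 (hatNormSq_nonneg K z) ?_ ?_
      (holdSeq_start (feedback S K z) m (G.gammaP S L h) h n) ht
    · filter_upwards [hae'] with s h3 hs
      obtain ⟨h4, -⟩ := h3 (n0.trans_lt hs.1) ((hn₁.trans hn').trans_lt hs.1)
      rw [← hi s hs, dynSource, h4]
      ring
    · filter_upwards [hae'] with s h3 hs
      obtain ⟨-, h4, -⟩ := h3 (n0.trans_lt hs.1) ((hn₁.trans hn').trans_lt hs.1)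
      rwa [hi s hs] at h4
  have key := lyapunov_decay (N := hatNormSq K z) (κ0 := G.kappa (eps0 S L)) (e := rate G S)
    (w := fun s => G.thetam S * (inp s - feedback S K z s) ^ 2 -
      G.kappa (eps1 S L) * alphaHatL K z b s ^ 2) hε0.le (min_le_right _ _)
    ((le_div_iff₀ hcV0).1 (min_le_left _ _)) (le_max_right (m (n₁ * h)) 0) (hm _ _ τ0 ht)
    (hVu _ _ hn₁ ht).2 (hatNormSq_nonneg K z) (by
      filter_upwards [hae'] with s h3 hs
      obtain ⟨h4, -⟩ := h3 (τ0.trans_lt hs.1) (hn₁.trans_lt hs.1)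
      rw [dynSource, h4]
      ring) (by
      filter_upwards [hae'] with s h3 hs
      exact (h3 (τ0.trans_lt hs.1) (hn₁.trans_lt hs.1)).2.2)
    (fun s hs => (hVN s (hn₁.trans hs.1.le)).2) fun s hs => hmd s hs.1
  set X := z.norm (n₁ * h) ^ 2
  have hX : 0 ≤ X := sq_nonneg _
  have a1 := mul_le_mul_of_nonneg_left (HD z (n₁ * h)).2 hcV0.le
  have a2 := (hVN _ hn₁).2
  have a3 : max (m (n₁ * h)) 0 ≤ |m (n₁ * h)| := max_le (le_abs_self _) (abs_nonneg _)
  have a4 := neg_abs_le (m (n₁ * h))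
  have a5 : V (n₁ * h) - m (n₁ * h) + 2 * max (m (n₁ * h)) 0 ≤
      (cV * D + 3) * (X + |m (n₁ * h)|) := by
    have : 0 ≤ cV * D * |m (n₁ * h)| := by positivity
    linarith
  have a6 := mul_le_mul_of_nonneg_left a5 (Real.exp_pos (-ε * (t - n₁ * h))).le
  have a7 := (hVN t (hn₁.trans ht)).1.trans (mul_le_mul_of_nonneg_left (key.trans a6) hcN0.le)
  have a8 := H₃ (onePlus S.ℓ K.opp.mat (z.obs t))
  rw [(kerEq_pair_continuous hS hK hL (z.obs t)).1, ← hatNormSq_eq hS hK] at a8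
  have a9 := a8.trans (mul_le_mul_of_nonneg_left a7 hC₃.le)
  rw [Trajectory.norm_sq, hobs t (hn₁.trans ht)]
  linarith

theorem exists_exponential_decay (hS : S.Admissible) (hrefl : |S.rho * S.q| ≤ 1 / 2)
    (hK : IsControlKernel S K) (hL : IsInverseKernel S L) (hP : IsObserverKernel S P)
    (hNa : MemH1 S.ℓ (Nalpha S L)) (hNb : MemH1 S.ℓ (Nbeta S L)) (hG : G.Admissible S L)
    (hh : 0 < h) (hτ : h ≤ G.tau S L) : ∃ M ν : ℝ, 0 < M ∧ 0 < ν ∧ ∀ m₀ z b m inp,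
      HeldLoop S K L P G h m₀ z b m inp → ∀ t, 0 ≤ t →
        z.norm t ^ 2 ≤ M * Real.exp (-ν * t) * (z.norm 0 ^ 2 + |m₀|) := by
  -- The first sampling instant not before the horizon; the decay estimate for m has to start at a
  -- sample.
  set n₁ := ⌈S.horizon / h⌉₊
  have hn₁ : S.horizon ≤ n₁ * h := (div_le_iff₀ hh).1 (Nat.le_ceil _)
  have τ0 : (0 : ℝ) ≤ n₁ * h := by positivity
  obtain ⟨R, hR, HR⟩ := exists_loop_growth hS hrefl hK hL hP hG hh n₁
  obtain ⟨Q, ε, hQ, hε, HQ⟩ := exists_loop_decay hS hK hL hP hNa hNb hG hh hτ hn₁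
  -- The exponential factor compensates for the initial stretch, where only growth is known. The
  -- factor 2R bounds the squared state norm and |m| together at n₁h.
  refine ⟨(R + 2 * Q * R) * Real.exp (ε * (n₁ * h)), ε, by positivity, hε,
    fun m₀ z b m inp hl t ht => ?_⟩
  set X := z.norm 0 ^ 2 + |m₀|
  have hX : 0 ≤ X := by positivity
  have e : Real.exp (-ε * (t - n₁ * h)) = Real.exp (ε * (n₁ * h)) * Real.exp (-ε * t) := by
    rw [← Real.exp_add]; ring_nf
  rcases le_total t (n₁ * h) with h1 | h1
  · have h2 : 1 ≤ Real.exp (-ε * (t - n₁ * h)) := Real.one_le_exp (by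
      have := mul_nonneg hε.le (sub_nonneg.2 h1)
      linarith)
    have h3 : 0 ≤ 2 * Q * R * X := by positivity
    calc _ ≤ R * X := (HR m₀ z b m inp hl t ⟨ht, h1⟩).1
      _ ≤ (R + 2 * Q * R) * X := by linarith
      _ ≤ Real.exp (-ε * (t - n₁ * h)) * ((R + 2 * Q * R) * X) :=
        le_mul_of_one_le_left (by positivity) h2
      _ = _ := by rw [e]; ring
  · obtain ⟨h2, h3⟩ := HR m₀ z b m inp hl (n₁ * h) ⟨τ0, le_rfl⟩
    have h4 : 0 ≤ R * X := by positivity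
    calc _ ≤ Q * Real.exp (-ε * (t - n₁ * h)) * (z.norm (n₁ * h) ^ 2 + |m (n₁ * h)|) :=
        HQ m₀ z b m inp hl t h1
      _ ≤ Q * Real.exp (-ε * (t - n₁ * h)) * (R * X + R * X) := by gcongr
      _ = Real.exp (-ε * (t - n₁ * h)) * (2 * Q * R * X) := by ring
      _ ≤ Real.exp (-ε * (t - n₁ * h)) * ((R + 2 * Q * R) * X) :=
        mul_le_mul_of_nonneg_left (by linarith) (Real.exp_pos _).le
      _ = _ := by rw [e]; ring

end

end PETC

end

/-! ### The main theorem. -/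

theorem mainTheorem1 (S : PETC.Plant) (hS : S.Admissible) (hrefl : |S.rho * S.q| ≤ 1 / 2) :
    (∃ K L P : PETC.Kernels, PETC.IsControlKernel S K ∧ PETC.IsInverseKernel S L ∧
      PETC.IsObserverKernel S P) ∧
    ∀ K L P : PETC.Kernels, PETC.IsControlKernel S K → PETC.IsInverseKernel S L →
      PETC.IsObserverKernel S P →
      PETC.MemH1 S.ℓ (PETC.Nalpha S L) → PETC.MemH1 S.ℓ (PETC.Nbeta S L) →
      ∀ G : PETC.Design, G.Admissible S L → ∀ h : ℝ, 0 < h → h ≤ G.tau S L →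
        (∀ (u₀ v₀ uh₀ vh₀ : PETC.L2 S.ℓ) (m₀ : ℝ), m₀ < 0 →
          ∃ z : PETC.Trajectory S.ℓ, PETC.IsSolution S K L P G h m₀ u₀ v₀ uh₀ vh₀ z ∧
            ∀ z' : PETC.Trajectory S.ℓ, PETC.IsSolution S K L P G h m₀ u₀ v₀ uh₀ vh₀ z' →
              ∀ t : ℝ, 0 ≤ t →
                z'.u t = z.u t ∧ z'.v t = z.v t ∧ z'.uh t = z.uh t ∧ z'.vh t = z.vh t) ∧
        ∃ M ν : ℝ, 0 < M ∧ 0 < ν ∧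
          ∀ (u₀ v₀ uh₀ vh₀ : PETC.L2 S.ℓ) (m₀ : ℝ), m₀ < 0 →
            ∀ z : PETC.Trajectory S.ℓ, PETC.IsSolution S K L P G h m₀ u₀ v₀ uh₀ vh₀ z →
              ∀ t : ℝ, 0 ≤ t →
                z.norm t ^ 2 ≤ M * Real.exp (-ν * t) * (z.norm 0 ^ 2 + |m₀|) := by
  refine ⟨?_, ?_⟩
  · obtain ⟨K, hK⟩ := PETC.exists_controlKernel hS
    obtain ⟨L, hL⟩ := PETC.exists_inverseKernel hS
    obtain ⟨P, hP⟩ := PETC.exists_observerKernel hS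
    exact ⟨K, L, P, hK, hL, hP⟩
  · intro K L P hK hL hP hNa hNb G hG h hh hτ
    refine ⟨fun u₀ v₀ uh₀ vh₀ m₀ _ => ?_, ?_⟩
    · obtain ⟨z, hz⟩ := PETC.exists_solution hS hrefl hK hL hP hG.eta_pos.le hh u₀ v₀ uh₀ vh₀ m₀
      exact ⟨z, hz, fun z' hz' t ht => hz.unique hS hrefl hK hL hP hG.eta_pos.le hh hz' ht⟩
    · obtain ⟨M, ν, hM, hν, H⟩ :=
        PETC.exists_exponential_decay hS hrefl hK hL hP hNa hNb hG hh hτ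
      refine ⟨M, ν, hM, hν, fun u₀ v₀ uh₀ vh₀ m₀ _ z hz => ?_⟩
      obtain ⟨b, m, inp, h1, h2, h3⟩ := hz.exists_hold hh
      exact H m₀ z b m inp ⟨h1, h2, h3⟩
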